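/- Let $\Bbbk$ be a field; all algebras, modules and comodules below are finite-dimensional over $\Bbbk$. Let $(T,R)$ be a quasitriangular Hopf algebra, $R=R^1\otimes R^2$, so that $\mathrm{Rep}(T)$ is braided by $v\otimes w\mapsto R^2w\otimes R^1v$. Let $H$ be a braided Hopf algebra in $\mathrm{Rep}(T)$, with bosonization $A=H\#T$ (product $(h\#t)(y\#r)=h(t_1\cdot y)\#t_2r$, coproduct $\Delta(h\#t)=h_1\#R^2t_1\otimes R^1\cdot h_2\#t_2$, antipode $\mathcal S$), and let $\pi:A\to T$, $\pi(h\#t)=\varepsilon(h)t$. Let $K$ be a left $A$-comodule algebra and $P\in{}^{A}_K\mathcal M_K$, that is, a $K$-bimodule with a left $A$-coaction $p\mapsto p_{-1}\otimes p_0$ that is a morphism of $K$-bimodules. *The space $S^T(H,K,P)$.* It consists of the left $K$-linear maps $\alpha:A\otimes K\to P$ (where $l\cdot(x\otimes y)=l_{-1}x\otimes l_0y$) such that $\alpha(x\otimes y)=\alpha(x\otimes1)\cdot y$ and $$R^2\pi(y_{-1})\otimes\alpha\big((1\#R^1)x\otimes y_0\big)=\pi\big(\alpha(x\otimes y)_{-1}\big)\otimes\alpha(x\otimes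 y)_0\qquad(x\in A,\ y\in K),$$ with the $A$-action $(h\cdot\alpha)(x\otimes y)=\alpha(xh\otimes y)$. *The relative end.* Let $\mathcal M={}_K\mathcal M$, let $X\triangleright M=X\otimes M$ with $y\cdot(x\otimes m)=y_{-1}x\otimes y_0m$, and let $\underline{\mathrm{Hom}}(M,N)=\mathrm{Hom}_K(A\otimes M,N)$ be the internal Hom, with $(h\cdot\alpha)(g\otimes m)=\alpha(gh\otimes m)$. For $V\in\mathrm{Rep}(T)$ let $V_\pi$ be the $A$-module induced by $\pi$, with half-braiding $\sigma^V_X:V_\pi\otimes X\to X\otimes V_\pi$ inverse to $x\otimes v\mapsto R^2v\otimes(1\#R^1)x$. Let $F:\mathcal M\to\mathcal M$ be a $\mathrm{Rep}(T)$-module functor with structure $d_{V,N}:F(V_\pi\triangleright N)\to V_\pi\triangleright F(N)$. The prebalancing $$\beta^V_{M,N}:\underline{\mathrm{Hom}}(M,F(V_\pi\triangleright N))\to\underline{\mathrm{Hom}}(V^*_\pi\triangleright M,F(N))$$ is the morphism corresponding to $(\mathrm{ev}_V\triangleright\mathrm{id})(\mathrm{id}\triangleright d_{V,N}f)((\sigma^{V^*}_X)^{-1}\triangleright\mathrm{id}_M)$,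 for $X=\underline{\mathrm{Hom}}(M,F(V_\pi\triangleright N))$ and $f:X\triangleright M\to F(V_\pi\triangleright N)$ the evaluation. The relative end $\bar\rho(F)=\oint_{M}\underline{\mathrm{Hom}}(M,F(M))$ is the universal $A$-module $E$ with a dinatural family $\lambda_M:E\to\underline{\mathrm{Hom}}(M,F(M))$ such that $$\underline{\mathrm{Hom}}(\mathrm{ev}_V\triangleright\mathrm{id}_M,\mathrm{id})\,\lambda_M=\underline{\mathrm{Hom}}(m_{V^*,V,M},\mathrm{id})\,\beta^V_{V\triangleright M,M}\,\lambda_{V\triangleright M}\qquad(V\in\mathrm{Rep}(T),\ M\in\mathcal M),$$ where $m_{V^*,V,M}$ is the associativity isomorphism of the action. For $F=P\otimes_K-$ take $d_{V,N}(p\otimes v\otimes n)=\pi(p_{-1})v\otimes p_0\otimes n$. *The object $\mathcal Z(\bar\rho_K)(P)$* is $E=\bar\rho(P\otimes_K-)$ with the half-braiding $\sigma_X=l_X\,\bar\rho(c_X)\,r_X^{-1}:E\otimes X\to X\otimes E$ for $X\in\mathrm{Rep}(A)$. Here $c_{X,M}(p\otimes x\otimes m)=p_{-1}x\otimes p_0\otimes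 m$, and $r_X:\bar\rho(F\triangleleft X)\cong\bar\rho(F)\otimes X$, $l_X:\bar\rho(X\triangleright F)\cong X\otimes\bar\rho(F)$, with $(F\triangleleft X)(M)=F(X\triangleright M)$ and $(X\triangleright F)(M)=X\triangleright F(M)$, are the $\mathrm{Rep}(A)$-bimodule structure of the right adjoint $\bar\rho$ of $X\mapsto X\triangleright-$. **Theorem.** $\mathcal M={}_K\mathcal M$ is a left $\mathrm{Rep}(H\#T)$-module category: it is abelian, and $\triangleright$, with the usual associativity and unit isomorphisms, is an action that is $\Bbbk$-bilinear and exact in each variable. The relative end and $\mathcal Z(\bar\rho_K)(P)$ exist, and: (i) There is an isomorphism of $H\#T$-modules $$S^T(H,K,P)\simeq\oint_{M\in\mathcal M}\mathrm{Hom}_K(H\#T\otimes M,\ P\otimes_KM)$$ under which $\lambda_M$ becomes $\alpha\mapsto(h\otimes m\mapsto\alpha(h\otimes1)\otimes m)$. When $P=K$ it is an isomorphism of algebras in $\mathrm{Rep}(H\#T)$, for the product $(\alpha.\beta)(x\otimes y)=\alpha(x_1\otimes\beta(x_2\otimes y))$ with unit $x\otimes y\mapsto\varepsilon(x)y$ on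 $S^T(H,K,K)$, and for the product on the relative end $\oint_M\underline{\mathrm{Hom}}(M,M)$ that is induced by the composition of the internal Homs. (ii) The formula $$\alpha_{-1}\otimes\alpha_0(x\otimes y)=\mathcal S(x_1)\,\alpha(x_2\otimes1)_{-1}\,x_3\otimes\alpha(x_2\otimes1)_0\cdot y$$ defines a coaction that makes $S^T(H,K,P)$ a Yetter–Drinfeld module in ${}^{H\#T}_{H\#T}\mathcal{YD}$, and the isomorphism of (i) is an isomorphism $S^T(H,K,P)\simeq\mathcal Z(\bar\rho_K)(P)$ in ${}^{H\#T}_{H\#T}\mathcal{YD}$; here half-braidings $\sigma$ and coactions correspond by $\sigma_X(e\otimes x)=e_{-1}x\otimes e_0$. -/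

import Mathlib

open scoped TensorProduct
open TensorProduct Coalgebra CategoryTheory

set_option linter.unusedSectionVars false

universe u

noncomputable section

section Shortcuts

variable {k M N A B : Type u} [Field k] [AddCommMonoid M] [Module k M] [AddCommMonoid N]
  [Module k N] [Semiring A] [Algebra k A] [Semiring B] [Algebra k B]

instance : AddMonoidHomClass (M →ₗ[k] N) M N := inferInstance
instance : AddHomClass (M →ₗ[k] N) M N := inferInstance
instance : ZeroHomClass (M →ₗ[k] N) M N := inferInstance
instance : AddMonoidHomClass (M ≃ₗ[k] N) M N := inferInstance
instance : AddHomClass (M ≃ₗ[k] N) M N := inferInstance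
instance : ZeroHomClass (M ≃ₗ[k] N) M N := inferInstance
instance : AddMonoidHomClass (A →ₐ[k] B) A B := inferInstance
instance : AddHomClass (A →ₐ[k] B) A B := inferInstance
instance : ZeroHomClass (A →ₐ[k] B) A B := inferInstance

instance : MonoidHomClass (A →ₐ[k] B) A B := inferInstance
instance : MulHomClass (A →ₐ[k] B) A B := inferInstance
instance : OneHomClass (A →ₐ[k] B) A B := inferInstance
instance : MulActionSemiHomClass (M →ₗ[k] N) (id : k → k) M N := inferInstance

end Shortcuts

section ActionOnTensors

variable (k : Type u) [Field k] (A B X Y : Type u) [Ring A] [Algebra k A] [Ring B] [Algebra k B]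
  [AddCommGroup X] [Module k X] [Module A X] [IsScalarTower k A X]
  [AddCommGroup Y] [Module k Y] [Module B Y] [IsScalarTower k B Y]

/-- The action of `A ⊗ B` on `X ⊗ Y`: `(a ⊗ b)(x ⊗ y) = a x ⊗ b y`. -/
def act2 : A ⊗[k] B →ₐ[k] Module.End k (X ⊗[k] Y) :=
  (Module.endTensorEndAlgHom (R := k) (S := k) (A := k) (M := X) (N := Y)).comp
    (Algebra.TensorProduct.map (Algebra.lsmul k k X) (Algebra.lsmul k k Y))

variable {k A B X Y}

@[simp]
theorem act2_tmul (a : A) (b : B) (x : X) (y : Y) :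
    act2 k A B X Y (a ⊗ₜ b) (x ⊗ₜ y) = (a • x) ⊗ₜ[k] (b • y) := by
  rfl

variable (k A) in
/-- The linear map `a ↦ a x`. -/
def actOn (x : X) : A →ₗ[k] X := (LinearMap.toSpanSingleton A X x).restrictScalars k

@[simp]
theorem actOn_apply (x : X) (a : A) : actOn k A x a = a • x := rfl

end ActionOnTensors

section Quasitriangular

variable (k : Type u) [Field k] (T : Type u) [Ring T] [HopfAlgebra k T]

/-- An `R`-matrix for the Hopf algebra `T`; the elements `R₁₂`, `R₁₃`, `R₂₃` live in
`T ⊗ (T ⊗ T)`. -/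
structure RMatrix where
  R : (T ⊗[k] T)ˣ
  comul_id :
    TensorProduct.assoc k T T T ((comul (R := k) (A := T)).rTensor T (R : T ⊗[k] T)) =
      Algebra.TensorProduct.map (AlgHom.id k T)
          (Algebra.TensorProduct.includeRight : T →ₐ[k] T ⊗[k] T) (R : T ⊗[k] T) *
        ((1 : T) ⊗ₜ[k] (R : T ⊗[k] T))
  id_comul :
    (comul (R := k) (A := T)).lTensor T (R : T ⊗[k] T) =
      Algebra.TensorProduct.map (AlgHom.id k T)
          (Algebra.TensorProduct.includeRight : T →ₐ[k] T ⊗[k] T) (R : T ⊗[k] T) *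
        Algebra.TensorProduct.map (AlgHom.id k T)
          (Algebra.TensorProduct.includeLeft : T →ₐ[k] T ⊗[k] T) (R : T ⊗[k] T)
  counit_id : (counit (R := k) (A := T)).rTensor T (R : T ⊗[k] T) = (1 : k) ⊗ₜ[k] (1 : T)
  id_counit : (counit (R := k) (A := T)).lTensor T (R : T ⊗[k] T) = (1 : T) ⊗ₜ[k] (1 : k)
  comul_cop : ∀ t : T, TensorProduct.comm k T T (comul (R := k) t) =
    (R : T ⊗[k] T) * comul (R := k) t * ((R⁻¹ : (T ⊗[k] T)ˣ) : T ⊗[k] T)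

variable {k T}

/-- The braiding `V ⊗ W → W ⊗ V`, `v ⊗ w ↦ R² w ⊗ R¹ v`, of `T`-modules. -/
def RMatrix.braiding (R : RMatrix k T) (V W : Type u)
    [AddCommGroup V] [Module k V] [Module T V] [IsScalarTower k T V]
    [AddCommGroup W] [Module k W] [Module T W] [IsScalarTower k T W] :
    V ⊗[k] W →ₗ[k] W ⊗[k] V :=
  (TensorProduct.comm k V W).toLinearMap ∘ₗ act2 k T T V W (R.R : T ⊗[k] T)

variable (R : RMatrix k T) (H : Type u) [Ring H] [Algebra k H] [Coalgebra k H]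
  [Module T H] [IsScalarTower k T H]

/-- The multiplication `(a ⊗ b)(c ⊗ d) = a (R² c) ⊗ (R¹ b) d` of the braided tensor square. -/
def RMatrix.braidedMul : (H ⊗[k] H) ⊗[k] (H ⊗[k] H) →ₗ[k] H ⊗[k] H :=
  TensorProduct.map (LinearMap.mul' k H) (LinearMap.mul' k H) ∘ₗ
    (TensorProduct.assoc k H H (H ⊗[k] H)).symm.toLinearMap ∘ₗ
    (LinearMap.lTensor H
      ((TensorProduct.assoc k H H H).toLinearMap ∘ₗ
        (R.braiding H H).rTensor H ∘ₗ (TensorProduct.assoc k H H H).symm.toLinearMap)) ∘ₗ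
    (TensorProduct.assoc k H H (H ⊗[k] H)).toLinearMap

/-- `H`, an algebra and coalgebra over `k` with an action of `T`, is a Hopf algebra in the
braided category of `T`-modules. -/
structure BraidedHopf where
  smul_mul : ∀ (t : T) (a b : H),
    t • (a * b) = LinearMap.mul' k H (act2 k T T H H (comul (R := k) t) (a ⊗ₜ b))
  smul_one : ∀ t : T, t • (1 : H) = counit (R := k) t • (1 : H)
  comul_smul : ∀ (t : T) (a : H),
    comul (R := k) (t • a) = act2 k T T H H (comul (R := k) t) (comul (R := k) a)
  counit_smul : ∀ (t : T) (a : H),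
    counit (R := k) (t • a) = counit (R := k) t * counit (R := k) a
  comul_mul : ∀ a b : H,
    comul (R := k) (a * b) = R.braidedMul H (comul (R := k) a ⊗ₜ comul (R := k) b)
  comul_one : comul (R := k) (1 : H) = (1 : H) ⊗ₜ[k] (1 : H)
  counit_mul : ∀ a b : H, counit (R := k) (a * b) = counit (R := k) a * counit (R := k) b
  counit_one : counit (R := k) (1 : H) = 1
  antipode : H →ₗ[k] H
  antipode_smul : ∀ (t : T) (a : H), antipode (t • a) = t • antipode a
  antipode_mul : ∀ a : H, LinearMap.mul' k H (antipode.rTensor H (comul (R := k) a)) =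
    counit (R := k) a • (1 : H)
  mul_antipode : ∀ a : H, LinearMap.mul' k H (antipode.lTensor H (comul (R := k) a)) =
    counit (R := k) a • (1 : H)

end Quasitriangular

section Bosonization

variable {k : Type u} [Field k] {T : Type u} [Ring T] [HopfAlgebra k T] {R : RMatrix k T}
  {H : Type u} [Ring H] [Algebra k H] [Coalgebra k H] [Module T H] [IsScalarTower k T H]

/-- The bosonization `H # T`, with underlying space `H ⊗ T`. -/
@[nolint unusedArguments]
def Boson (_hH : BraidedHopf R H) : Type u := H ⊗[k] T

namespace Boson

variable (hH : BraidedHopf R H)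

instance : AddCommGroup (Boson hH) := inferInstanceAs (AddCommGroup (H ⊗[k] T))
instance : Module k (Boson hH) := inferInstanceAs (Module k (H ⊗[k] T))

/-- Left multiplication by `h # 1`. -/
def opH : H →ₐ[k] Module.End k (H ⊗[k] T) :=
  (act2 k H T H T).comp Algebra.TensorProduct.includeLeft

/-- Left multiplication by `1 # t`: `h # r ↦ t₁ h # t₂ r`. -/
def opT : T →ₐ[k] Module.End k (H ⊗[k] T) :=
  (act2 k T T H T).comp (Bialgebra.comulAlgHom k T)

/-- Left multiplication in `H # T`: `(h # t)(y # r) = h (t₁ y) # t₂ r`. -/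
def op : H ⊗[k] T →ₗ[k] Module.End k (H ⊗[k] T) :=
  LinearMap.mul' k _ ∘ₗ TensorProduct.map (opH (k := k) (T := T) (H := H)).toLinearMap
    (opT (k := k) (T := T) (H := H)).toLinearMap

theorem op_tmul (h : H) (t : T) :
    op (k := k) (h ⊗ₜ[k] t) = opH (k := k) (T := T) h * opT (k := k) (H := H) t := rfl

theorem opH_tmul (h y : H) (r : T) :
    opH (k := k) (T := T) h (y ⊗ₜ[k] r) = (h * y) ⊗ₜ[k] r := by
  simp [opH]

theorem op_tmul_one (h : H) :
    op (k := k) (h ⊗ₜ[k] (1 : T)) = opH (k := k) (T := T) h := by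
  rw [op_tmul, map_one, mul_one]

theorem op_one_tmul (t : T) :
    op (k := k) ((1 : H) ⊗ₜ[k] t) = opT (k := k) (H := H) t := by
  rw [op_tmul, map_one, one_mul]

theorem opT_apply (t : T) (z : H ⊗[k] T) :
    opT (k := k) t z = act2 k T T H T (comul t) z := rfl

/-- `w ↦ ∑ (w₁ y) # w₂`. -/
def tmulAct (y : H) : T ⊗[k] T →ₗ[k] H ⊗[k] T := (actOn k T y).rTensor T

theorem opT_opH (hH : BraidedHopf R H) (t : T) (y : H) :
    opT (k := k) t * opH (k := k) (T := T) y = op (tmulAct y (comul (R := k) t)) := by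
  refine TensorProduct.ext' fun z s => ?_
  rw [Module.End.mul_apply, opH_tmul, opT_apply]
  let Φ : T ⊗[k] (T ⊗[k] T) →ₗ[k] H ⊗[k] T :=
    TensorProduct.map (LinearMap.mul' k H) LinearMap.id ∘ₗ
    (TensorProduct.assoc k H H T).symm.toLinearMap ∘ₗ
    TensorProduct.map (actOn k T y) (TensorProduct.map (actOn k T z) (LinearMap.mulRight k s))
  have h1 : ∀ w : T ⊗[k] T, act2 k T T H T w ((y * z) ⊗ₜ s) =
      Φ (TensorProduct.assoc k T T T ((comul (R := k)).rTensor T w)) := by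
    intro w
    induction w with
    | zero => simp
    | add a b ha hb => simp only [map_add, LinearMap.add_apply, ha, hb]
    | tmul a b =>
      simp only [act2_tmul, LinearMap.rTensor_tmul, hH.smul_mul]
      generalize comul (R := k) a = c
      induction c with
      | zero => simp
      | add a b ha hb => simp only [map_add, LinearMap.add_apply, add_tmul, ha, hb]
      | tmul c d => simp [Φ]
  have h2 : ∀ w : T ⊗[k] T, op (tmulAct y w) (z ⊗ₜ s) =
      Φ ((comul (R := k)).lTensor T w) := by
    intro w
    induction w with
    | zero => simp
    | add a b ha hb => simp only [map_add, LinearMap.add_apply, ha, hb]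
    | tmul a b =>
      simp only [tmulAct, op_tmul, LinearMap.rTensor_tmul, LinearMap.lTensor_tmul,
        Module.End.mul_apply, opT_apply]
      generalize comul (R := k) b = c
      induction c with
      | zero => simp
      | add a b ha hb => simp only [map_add, LinearMap.add_apply, tmul_add, ha, hb]
      | tmul c d => simp [Φ, opH_tmul]
  rw [h1, h2, coassoc_apply]

theorem opT_one_tmul (hH : BraidedHopf R H) (t : T) : opT (k := k) t ((1 : H) ⊗ₜ[k] (1 : T)) = 1 ⊗ₜ t := by
  have h1 : ∀ w : T ⊗[k] T, act2 k T T H T w ((1 : H) ⊗ₜ (1 : T)) =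
      TensorProduct.map (Algebra.linearMap k H) LinearMap.id
        ((counit (R := k)).rTensor T w) := by
    intro w
    induction w with
    | zero => simp
    | add a b ha hb => simp only [map_add, LinearMap.add_apply, ha, hb]
    | tmul a b => simp [hH.smul_one, Algebra.smul_def]
  rw [opT_apply, h1, rTensor_counit_comul]
  simp

theorem op_op (hH : BraidedHopf R H) (x y : H ⊗[k] T) : op (op x y) = op x * op y := by
  have hL : ∀ (h : H) (z : H ⊗[k] T), op (opH (k := k) (T := T) h z) = opH h * op z := by
    intro h z
    induction z with
    | zero => simp
    | add a b ha hb => simp only [map_add, mul_add, ha, hb]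
    | tmul a b => rw [opH_tmul, op_tmul, op_tmul, map_mul, mul_assoc]
  have hR : ∀ (t : T) (z : H ⊗[k] T), op (opT (k := k) t z) = opT t * op z := by
    intro t z
    induction z with
    | zero => simp
    | add a b ha hb => simp only [map_add, mul_add, ha, hb]
    | tmul a b =>
      rw [op_tmul, ← mul_assoc, opT_opH hH, opT_apply]
      generalize comul (R := k) t = c
      induction c with
      | zero => simp
      | add c d hc hd => simp only [map_add, LinearMap.add_apply, hc, hd, add_mul]
      | tmul c d => simp [tmulAct, op_tmul, mul_assoc]
  induction x with
  | zero => simp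
  | add a b ha hb => simp only [map_add, LinearMap.add_apply, add_mul, ha, hb]
  | tmul a b => rw [op_tmul, Module.End.mul_apply, hL, hR, mul_assoc]

instance : Ring (Boson hH) :=
  { (inferInstance : AddCommGroup (Boson hH)) with
    mul := fun x y => op (k := k) (T := T) (H := H) x y
    one := ((1 : H) ⊗ₜ[k] (1 : T) : H ⊗[k] T)
    mul_assoc := fun x y z => LinearMap.congr_fun (op_op hH x y) z
    one_mul := fun x => by
      change op (k := k) ((1 : H) ⊗ₜ[k] (1 : T)) x = x
      rw [op_tmul, map_one, map_one]; rfl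
    mul_one := fun x => by
      change op (k := k) (T := T) (H := H) x ((1 : H) ⊗ₜ[k] (1 : T)) = x
      induction x using TensorProduct.induction_on with
      | zero => simp
      | add a b ha hb => rw [map_add, LinearMap.add_apply, ha, hb]
      | tmul a b =>
        rw [op_tmul, Module.End.mul_apply, opT_one_tmul hH, opH_tmul, mul_one]
    left_distrib := fun x y z => map_add (op (k := k) (T := T) (H := H) x) y z
    right_distrib := fun x y z =>
      congrArg (fun f : Module.End k (H ⊗[k] T) => f z) (map_add op x y)
    zero_mul := fun x => by
      exact LinearMap.congr_fun (map_zero (op (k := k) (T := T) (H := H))) x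
    mul_zero := fun x => map_zero (op (k := k) (T := T) (H := H) x) }

instance : Algebra k (Boson hH) :=
  Algebra.ofModule
    (fun r x y => congrArg (fun f : Module.End k (H ⊗[k] T) => f y) (map_smul op r x))
    (fun r x y => map_smul (op (k := k) (T := T) (H := H) x) r y)

/-- The element `h # t`. -/
def mk (h : H) (t : T) : Boson hH := h ⊗ₜ[k] t

theorem mul_def (x y : Boson hH) : x * y = op (k := k) (T := T) (H := H) x y := rfl

theorem one_def : (1 : Boson hH) = mk hH 1 1 := rfl

@[elab_as_elim]
theorem induction_on {p : Boson hH → Prop} (x : Boson hH) (zero : p 0)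
    (tmul : ∀ h t, p (mk hH h t)) (add : ∀ x y, p x → p y → p (x + y)) : p x :=
  TensorProduct.induction_on x zero tmul add

/-- The inclusion `h ↦ h # 1`. -/
def inH : H →ₐ[k] Boson hH :=
  AlgHom.ofLinearMap ((TensorProduct.mk k H T).flip 1) rfl fun x y => by
    change _ = op (k := k) (x ⊗ₜ[k] (1 : T)) (y ⊗ₜ[k] (1 : T))
    rw [op_tmul_one, opH_tmul]; rfl

/-- The inclusion `t ↦ 1 # t`. -/
def inT : T →ₐ[k] Boson hH :=
  AlgHom.ofLinearMap (TensorProduct.mk k H T 1) rfl fun x y => by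
    change _ = op (k := k) ((1 : H) ⊗ₜ[k] x) ((1 : H) ⊗ₜ[k] y)
    have h := opT_one_tmul hH (x * y)
    rw [map_mul, Module.End.mul_apply, opT_one_tmul hH] at h
    rw [op_one_tmul, h]; rfl

theorem inH_mul_inT (h : H) (t : T) : inH hH h * inT hH t = mk hH h t := by
  change op (k := k) (h ⊗ₜ[k] (1 : T)) ((1 : H) ⊗ₜ[k] t) = h ⊗ₜ[k] t
  rw [op_tmul_one, opH_tmul, mul_one]

/-- `w ↦ ∑ (w₁ y) # w₂`. -/
def cross (y : H) : T ⊗[k] T →ₗ[k] Boson hH := tmulAct (k := k) y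

theorem cross_tmul (y : H) (a b : T) :
    cross hH y (a ⊗ₜ b) = inH hH (a • y) * inT hH b := (inH_mul_inT hH _ _).symm

theorem inT_mul_inH (t : T) (y : H) :
    inT hH t * inH hH y = cross hH y (comul t) := by
  have h := LinearMap.congr_fun (opT_opH hH t y) ((1 : H) ⊗ₜ[k] (1 : T))
  have h2 := mul_one (cross hH y (comul t))
  rw [Module.End.mul_apply, opH_tmul, mul_one] at h
  refine Eq.trans ?_ (h.trans h2)
  change op (k := k) ((1 : H) ⊗ₜ[k] t) (y ⊗ₜ[k] (1 : T)) = _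
  rw [op_one_tmul]

/-- An algebra map out of `H # T`. -/
def lift {B : Type u} [Ring B] [Algebra k B] (f : H →ₐ[k] B) (g : T →ₐ[k] B)
    (hfg : ∀ (t : T) (y : H), g t * f y =
      LinearMap.mul' k B (TensorProduct.map (f.toLinearMap ∘ₗ actOn k T y) g.toLinearMap
        (comul (R := k) t))) : Boson hH →ₐ[k] B :=
  AlgHom.ofLinearMap (LinearMap.mul' k B ∘ₗ TensorProduct.map f.toLinearMap g.toLinearMap :
      H ⊗[k] T →ₗ[k] B)
    (by
      change LinearMap.mul' k B (TensorProduct.map f.toLinearMap g.toLinearMap (1 ⊗ₜ 1)) = 1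
      simp)
    (by
      set F : Boson hH →ₗ[k] B :=
        (LinearMap.mul' k B ∘ₗ TensorProduct.map f.toLinearMap g.toLinearMap :
          H ⊗[k] T →ₗ[k] B) with hF
      have h1 : ∀ h t, F (mk hH h t) = f h * g t := fun _ _ => rfl
      have h2 : ∀ h z r, F (inH hH h * z * inT hH r) = f h * F z * g r := by
        intro h z r
        induction z using Boson.induction_on with
        | zero => simp
        | add a b ha hb => simp only [map_add, mul_add, add_mul, ha, hb]
        | tmul a b =>
          rw [← inH_mul_inT, ← mul_assoc, ← map_mul, mul_assoc, ← map_mul, inH_mul_inT,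
            inH_mul_inT, h1, h1, map_mul, map_mul]
          simp only [mul_assoc]
      have h3 : ∀ (y : H) (w : T ⊗[k] T), F (cross hH y w) =
          LinearMap.mul' k B (TensorProduct.map (f.toLinearMap ∘ₗ actOn k T y) g.toLinearMap w) := by
        intro y w
        induction w with
        | zero => simp
        | add a b ha hb => simp only [map_add, ha, hb]
        | tmul a b => rw [cross_tmul, inH_mul_inT, h1]; simp
      intro x y
      induction x using Boson.induction_on with
      | zero => simp
      | add a b ha hb => simp only [map_add, add_mul, ha, hb]
      | tmul h t =>
        induction y using Boson.induction_on with
        | zero => simp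
        | add a b ha hb => simp only [map_add, mul_add, ha, hb]
        | tmul y r =>
          have : mk hH h t * mk hH y r = inH hH h * cross hH y (comul (R := k) t) * inT hH r := by
            rw [← inH_mul_inT, ← inH_mul_inT, ← inT_mul_inH]
            simp only [mul_assoc]
          rw [this, h2, h3, ← hfg, h1, h1]
          simp only [mul_assoc])

section
variable {B : Type u} [Ring B] [Algebra k B] (f : H →ₐ[k] B) (g : T →ₐ[k] B)
    (hfg : ∀ (t : T) (y : H), g t * f y =
      LinearMap.mul' k B (TensorProduct.map (f.toLinearMap ∘ₗ actOn k T y) g.toLinearMap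
        (comul (R := k) t)))

theorem lift_mk (h : H) (t : T) : lift hH f g hfg (mk hH h t) = f h * g t := rfl

theorem lift_inH (h : H) : lift hH f g hfg (inH hH h) = f h :=
  (lift_mk hH f g hfg h 1).trans (by simp)

theorem lift_inT (t : T) : lift hH f g hfg (inT hH t) = g t :=
  (lift_mk hH f g hfg 1 t).trans (by simp)

end

theorem algHom_ext {B : Type u} [Ring B] [Algebra k B] {f g : Boson hH →ₐ[k] B}
    (h1 : ∀ h, f (inH hH h) = g (inH hH h)) (h2 : ∀ t, f (inT hH t) = g (inT hH t)) : f = g := by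
  refine AlgHom.ext fun x => ?_
  induction x using Boson.induction_on with
  | zero => simp
  | add a b ha hb => simp only [map_add, ha, hb]
  | tmul h t => rw [← inH_mul_inT, map_mul, map_mul, h1, h2]

section RSums

variable (R)

theorem exists_sum : ∃ S : Finset (T × T), (R.R : T ⊗[k] T) = ∑ i ∈ S, i.1 ⊗ₜ[k] i.2 :=
  TensorProduct.exists_finset _

variable {R}

theorem comul_id_sum {S : Finset (T × T)} (hS : (R.R : T ⊗[k] T) = ∑ i ∈ S, i.1 ⊗ₜ[k] i.2)
    {M : Type u} [AddCommGroup M] [Module k M] (Φ : T ⊗[k] (T ⊗[k] T) →ₗ[k] M) :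
    ∑ i ∈ S, Φ (TensorProduct.assoc k T T T (comul (R := k) i.1 ⊗ₜ[k] i.2)) =
      ∑ i ∈ S, ∑ j ∈ S, Φ (i.1 ⊗ₜ (j.1 ⊗ₜ (i.2 * j.2))) := by
  have h := congrArg Φ R.comul_id
  simpa [hS, tmul_sum, Finset.sum_mul_sum] using h

theorem id_comul_sum {S : Finset (T × T)} (hS : (R.R : T ⊗[k] T) = ∑ i ∈ S, i.1 ⊗ₜ[k] i.2)
    {M : Type u} [AddCommGroup M] [Module k M] (Φ : T ⊗[k] (T ⊗[k] T) →ₗ[k] M) :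
    ∑ i ∈ S, Φ (i.1 ⊗ₜ comul (R := k) i.2) =
      ∑ i ∈ S, ∑ j ∈ S, Φ ((i.1 * j.1) ⊗ₜ (j.2 ⊗ₜ i.2)) := by
  have h := congrArg Φ R.id_comul
  simpa [hS, Finset.sum_mul_sum] using h

theorem counit_id_sum {S : Finset (T × T)} (hS : (R.R : T ⊗[k] T) = ∑ i ∈ S, i.1 ⊗ₜ[k] i.2) :
    ∑ i ∈ S, counit (R := k) i.1 • i.2 = (1 : T) := by
  have h := congrArg (TensorProduct.lid k T) R.counit_id
  simpa [hS] using h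

theorem id_counit_sum {S : Finset (T × T)} (hS : (R.R : T ⊗[k] T) = ∑ i ∈ S, i.1 ⊗ₜ[k] i.2) :
    ∑ i ∈ S, counit (R := k) i.2 • i.1 = (1 : T) := by
  have h := congrArg (TensorProduct.rid k T) R.id_counit
  simpa [hS] using h

end RSums

/-- `a ⊗ b ↦ (a # q) ⊗ (p b # 1)` for `p ⊗ q` in `T ⊗ T`. -/
def cop : T ⊗[k] T →ₗ[k] H ⊗[k] H →ₗ[k] Boson hH ⊗[k] Boson hH :=
  TensorProduct.homTensorHomMap (RingHom.id k) H H (Boson hH) (Boson hH) ∘ₗ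
    TensorProduct.map
      ((LinearMap.lcomp k (Boson hH) (inH hH).toLinearMap) ∘ₗ
        (LinearMap.mul k (Boson hH)).flip ∘ₗ (inT hH).toLinearMap)
      ((LinearMap.llcomp k H H (Boson hH) (inH hH).toLinearMap) ∘ₗ
        (Algebra.lsmul k k H : T →ₐ[k] _).toLinearMap) ∘ₗ
    (TensorProduct.comm k T T).toLinearMap

@[simp]
theorem cop_tmul (p q : T) (a b : H) :
    cop hH (p ⊗ₜ q) (a ⊗ₜ b) = (inH hH a * inT hH q) ⊗ₜ[k] inH hH (p • b) := rfl

theorem braidedMul_tmul {S : Finset (T × T)}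
    (hS : (R.R : T ⊗[k] T) = ∑ i ∈ S, i.1 ⊗ₜ[k] i.2) (a b c d : H) :
    R.braidedMul H ((a ⊗ₜ b) ⊗ₜ (c ⊗ₜ d)) =
      ∑ i ∈ S, (a * (i.2 • c)) ⊗ₜ[k] ((i.1 • b) * d) := by
  simp [RMatrix.braidedMul, RMatrix.braiding, hS, sum_tmul, tmul_sum]

theorem smul_mul_sum (hH : BraidedHopf R H) (t : T) (a b : H) :
    t • (a * b) = (LinearMap.mul' k H ∘ₗ TensorProduct.map (actOn k T a) (actOn k T b))
      (comul (R := k) t) := by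
  rw [hH.smul_mul]
  generalize comul (R := k) t = w
  induction w with
  | zero => simp
  | add a b ha hb => simp only [map_add, LinearMap.add_apply, ha, hb]
  | tmul a b => simp

theorem cop_mul (X Y : H ⊗[k] H) :
    cop hH R.R (R.braidedMul H (X ⊗ₜ Y)) = cop hH R.R X * cop hH R.R Y := by
  obtain ⟨S, hS⟩ := exists_sum R
  induction X with
  | zero => simp
  | add a b ha hb => simp only [map_add, add_mul, add_tmul, ha, hb]
  | tmul a b =>
    induction Y with
    | zero => simp
    | add a b ha hb => simp only [map_add, mul_add, tmul_add, ha, hb]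
    | tmul c d =>
      rw [braidedMul_tmul hS, hS]
      simp only [map_sum, LinearMap.sum_apply, cop_tmul, Finset.sum_mul_sum,
        Algebra.TensorProduct.tmul_mul_tmul]
      have hL : ∀ i : T × T, ∑ j ∈ S, (inH hH (a * i.2 • c) * inT hH j.2) ⊗ₜ[k]
          inH hH (j.1 • (i.1 • b * d)) = ∑ j ∈ S, ∑ l ∈ S,
          (inH hH (a * i.2 • c) * inT hH (j.2 * l.2)) ⊗ₜ[k]
            (inH hH ((j.1 * i.1) • b) * inH hH (l.1 • d)) := by
        intro i
        let Φ : T ⊗[k] (T ⊗[k] T) →ₗ[k] Boson hH ⊗[k] Boson hH :=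
          (TensorProduct.comm k _ _).toLinearMap ∘ₗ
          TensorProduct.map ((inH hH).toLinearMap ∘ₗ LinearMap.mul' k H ∘ₗ
            TensorProduct.map (actOn k T (i.1 • b)) (actOn k T d))
            (LinearMap.mulLeft k (inH hH (a * i.2 • c)) ∘ₗ (inT hH).toLinearMap) ∘ₗ
          (TensorProduct.assoc k T T T).symm.toLinearMap
        have h := comul_id_sum hS Φ
        simp only [Φ, LinearMap.comp_apply, LinearEquiv.coe_coe, LinearEquiv.symm_apply_apply,
          TensorProduct.map_tmul, TensorProduct.comm_tmul, TensorProduct.assoc_symm_tmul] at h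
        simp only [smul_mul_sum hH, LinearMap.comp_apply]
        refine h.trans ?_
        simp [mul_smul, mul_assoc]
      have hR : ∀ l : T × T, ∑ i ∈ S, (inH hH a * inT hH i.2 * (inH hH c * inT hH l.2)) ⊗ₜ[k]
          (inH hH (i.1 • b) * inH hH (l.1 • d)) = ∑ j ∈ S, ∑ i ∈ S,
          (inH hH (a * i.2 • c) * inT hH (j.2 * l.2)) ⊗ₜ[k]
            (inH hH ((j.1 * i.1) • b) * inH hH (l.1 • d)) := by
        intro l
        let Φ : T ⊗[k] (T ⊗[k] T) →ₗ[k] Boson hH ⊗[k] Boson hH :=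
          (TensorProduct.comm k _ _).toLinearMap ∘ₗ
          TensorProduct.map (LinearMap.mulRight k (inH hH (l.1 • d)) ∘ₗ (inH hH).toLinearMap ∘ₗ
            actOn k T b)
            (LinearMap.mulLeft k (inH hH a) ∘ₗ LinearMap.mulRight k (inT hH l.2) ∘ₗ cross hH c)
        have h := id_comul_sum hS Φ
        simp only [Φ, LinearMap.comp_apply, LinearEquiv.coe_coe,
          TensorProduct.map_tmul, TensorProduct.comm_tmul, ← inT_mul_inH] at h
        refine Eq.trans ?_ (h.trans ?_)
        · simp [mul_assoc]
        · simp [cross_tmul, mul_assoc]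
      rw [Finset.sum_congr rfl fun i _ => hL i]
      conv_rhs => rw [Finset.sum_comm]
      rw [Finset.sum_congr rfl fun i _ => hR i]
      rw [Finset.sum_comm]
      conv_rhs => rw [Finset.sum_comm]
      refine Finset.sum_congr rfl fun j _ => ?_
      rw [Finset.sum_comm]

/-- `h ↦ (h₁ # R²) ⊗ (R¹ h₂ # 1)`. -/
def comulH : H →ₐ[k] Boson hH ⊗[k] Boson hH :=
  AlgHom.ofLinearMap (cop hH R.R ∘ₗ comul)
    (by
      obtain ⟨S, hS⟩ := exists_sum R
      have h := counit_id_sum hS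
      rw [LinearMap.comp_apply, hH.comul_one, hS]
      simp only [map_sum, LinearMap.sum_apply, cop_tmul, hH.smul_one, map_one, one_mul, map_smul,
        tmul_smul]
      simp only [smul_tmul', ← sum_tmul, ← map_smul, ← map_sum, h, map_one]
      rfl)
    (fun x y => by
      rw [LinearMap.comp_apply, hH.comul_mul, cop_mul]; rfl)

theorem comulH_apply (h : H) : comulH hH h = cop hH R.R (comul h) := rfl

/-- `t ↦ (1 # t₁) ⊗ (1 # t₂)`. -/
def comulT : T →ₐ[k] Boson hH ⊗[k] Boson hH :=
  (Algebra.TensorProduct.map (inT hH) (inT hH)).comp (Bialgebra.comulAlgHom k T)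

theorem comulT_apply (t : T) :
    comulT hH t = Algebra.TensorProduct.map (inT hH) (inT hH) (comul (R := k) t) := rfl

/-- `(u ⊗ v) ⊗ (w ⊗ s) ↦ u ⊗ (f (v ⊗ w) ⊗ s)`. -/
def midMap (f : T ⊗[k] T →ₗ[k] T ⊗[k] T) :
    (T ⊗[k] T) ⊗[k] (T ⊗[k] T) →ₗ[k] T ⊗[k] ((T ⊗[k] T) ⊗[k] T) :=
  (f.rTensor T ∘ₗ (TensorProduct.assoc k T T T).symm.toLinearMap).lTensor T ∘ₗ
    (TensorProduct.assoc k T T (T ⊗[k] T)).toLinearMap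

@[simp]
theorem midMap_tmul (f : T ⊗[k] T →ₗ[k] T ⊗[k] T) (a b c d : T) :
    midMap f ((a ⊗ₜ b) ⊗ₜ (c ⊗ₜ d)) = a ⊗ₜ (f (b ⊗ₜ c) ⊗ₜ d) := by
  simp [midMap]

theorem midMap_comul (f : T ⊗[k] T →ₗ[k] T ⊗[k] T) (t : T) :
    midMap f (TensorProduct.map (comul (R := k)) (comul (R := k)) (comul (R := k) t)) =
      ((f ∘ₗ comul).rTensor T).lTensor T
        ((comul (R := k) (A := T)).lTensor T (comul (R := k) t)) := by
  have h1 : ∀ w : T ⊗[k] T, midMap f (TensorProduct.map (comul (R := k)) (comul (R := k)) w) =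
      ((f.rTensor T ∘ₗ (TensorProduct.assoc k T T T).symm.toLinearMap) ∘ₗ
        (comul (R := k) (A := T)).lTensor T).lTensor T
        (TensorProduct.assoc k T T T ((comul (R := k)).rTensor T w)) := by
    intro w
    induction w with
    | zero => simp
    | add a b ha hb => simp only [map_add, ha, hb]
    | tmul a b =>
      simp only [TensorProduct.map_tmul, LinearMap.rTensor_tmul]
      generalize comul (R := k) a = c
      induction c with
      | zero => simp
      | add c d hc hd => simp only [map_add, add_tmul, hc, hd]
      | tmul c d => simp [midMap]
  have h2 : ∀ w : T ⊗[k] T,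
      ((f.rTensor T ∘ₗ (TensorProduct.assoc k T T T).symm.toLinearMap) ∘ₗ
        (comul (R := k) (A := T)).lTensor T).lTensor T ((comul (R := k)).lTensor T w) =
      ((f ∘ₗ comul).rTensor T).lTensor T ((comul (R := k) (A := T)).lTensor T w) := by
    intro w
    induction w with
    | zero => simp
    | add a b ha hb => simp only [map_add, ha, hb]
    | tmul a b =>
      simp only [LinearMap.lTensor_tmul, LinearMap.comp_apply, LinearEquiv.coe_coe,
        coassoc_symm_apply]
      congr 1
      rw [LinearMap.rTensor_comp_apply]
  rw [h1, coassoc_apply, h2]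

theorem comm_comul_mul (R : RMatrix k T) (t : T) :
    TensorProduct.comm k T T (comul (R := k) t) * (R.R : T ⊗[k] T) =
      (R.R : T ⊗[k] T) * comul (R := k) t := by
  rw [R.comul_cop, mul_assoc, Units.inv_mul, mul_one]

/-- `u ⊗ ((m ⊗ n) ⊗ s) ↦ (u a # n) ⊗ (m b # s)`. -/
def theta (a b : H) : T ⊗[k] ((T ⊗[k] T) ⊗[k] T) →ₗ[k] Boson hH ⊗[k] Boson hH :=
  LinearMap.mul' k _ ∘ₗ TensorProduct.map
    ((Algebra.TensorProduct.includeLeft : Boson hH →ₐ[k] _).toLinearMap ∘ₗ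
      (inH hH).toLinearMap ∘ₗ actOn k T a)
    (LinearMap.mul' k _ ∘ₗ TensorProduct.map
      (TensorProduct.map (inT hH).toLinearMap ((inH hH).toLinearMap ∘ₗ actOn k T b) ∘ₗ
        (TensorProduct.comm k T T).toLinearMap)
      ((Algebra.TensorProduct.includeRight : Boson hH →ₐ[k] _).toLinearMap ∘ₗ
        (inT hH).toLinearMap))

@[simp]
theorem theta_tmul (a b : H) (u m n s : T) :
    theta hH a b (u ⊗ₜ ((m ⊗ₜ n) ⊗ₜ s)) =
      (inH hH (u • a) * inT hH n) ⊗ₜ[k] (inH hH (m • b) * inT hH s) := by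
  simp [theta]

theorem comulT_mul_cop (t : T) (w : T ⊗[k] T) (a b : H) :
    comulT hH t * cop hH w (a ⊗ₜ b) =
      theta hH a b (midMap (LinearMap.mulRight k w ∘ₗ (TensorProduct.comm k T T).toLinearMap)
        (TensorProduct.map (comul (R := k)) (comul (R := k)) (comul (R := k) t))) := by
  rw [comulT_apply]
  generalize comul (R := k) t = v
  induction v with
  | zero => simp
  | add c d hc hd => simp only [map_add, add_mul, hc, hd]
  | tmul t₁ t₂ =>
    induction w with
    | zero =>
      simp only [map_zero, LinearMap.zero_apply, mul_zero, LinearMap.mulRight_zero_eq_zero,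
        LinearMap.zero_comp]
      simp [midMap]
    | add c d hc hd =>
      rw [map_add, LinearMap.add_apply, mul_add, hc, hd, ← map_add]
      congr 1
      simp only [midMap, LinearMap.comp_apply, TensorProduct.map_tmul]
      rw [← LinearMap.add_apply, ← LinearMap.lTensor_add, ← LinearMap.add_comp,
        ← LinearMap.rTensor_add, ← LinearMap.add_comp]
      congr 5
      ext
      simp [mul_add]
    | tmul p q =>
      simp only [TensorProduct.map_tmul, cop_tmul, Algebra.TensorProduct.map_tmul,
        Algebra.TensorProduct.tmul_mul_tmul]
      rw [← mul_assoc, inT_mul_inH, inT_mul_inH]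
      generalize comul (R := k) t₁ = c₁
      generalize comul (R := k) t₂ = c₂
      induction c₁ with
      | zero => simp
      | add c d hc hd => simp only [map_add, add_mul, add_tmul, hc, hd]
      | tmul u v =>
        induction c₂ with
        | zero => simp
        | add c d hc hd => simp only [map_add, tmul_add, hc, hd]
        | tmul x y => simp [cross_tmul, mul_smul, mul_assoc]

theorem cop_act_mul (t : T) (w : T ⊗[k] T) (a b : H) :
    LinearMap.mul' k _ (TensorProduct.map
        (cop hH w ∘ₗ (act2 k T T H H).toLinearMap.flip (a ⊗ₜ b) ∘ₗ comul)
        (comulT hH).toLinearMap (comul (R := k) t)) =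
      theta hH a b (midMap (LinearMap.mulLeft k w)
        (TensorProduct.map (comul (R := k)) (comul (R := k)) (comul (R := k) t))) := by
  generalize comul (R := k) t = v
  induction v with
  | zero => simp
  | add c d hc hd => simp only [map_add, hc, hd]
  | tmul t₁ t₂ =>
    induction w with
    | zero =>
      simp only [map_zero, LinearMap.zero_apply,
        LinearMap.zero_comp, TensorProduct.map_tmul, LinearMap.mul'_apply, zero_mul]
      have : LinearMap.mulLeft k (0 : T ⊗[k] T) = 0 := by ext; simp
      simp [midMap, this]
    | add c d hc hd =>
      simp only [TensorProduct.map_tmul, LinearMap.mul'_apply, LinearMap.comp_apply] at hc hd ⊢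
      rw [map_add, LinearMap.add_apply, add_mul, hc, hd, ← map_add]
      congr 1
      simp only [midMap, LinearMap.comp_apply]
      rw [← LinearMap.add_apply, ← LinearMap.lTensor_add, ← LinearMap.add_comp,
        ← LinearMap.rTensor_add]
      congr 4
      ext
      simp [add_mul]
    | tmul p q =>
      simp only [TensorProduct.map_tmul, LinearMap.mul'_apply, LinearMap.comp_apply,
        AlgHom.toLinearMap_apply, comulT_apply, LinearMap.flip_apply]
      generalize comul (R := k) t₁ = c₁
      generalize comul (R := k) t₂ = c₂
      induction c₁ with
      | zero => simp
      | add c d hc hd => simp only [map_add, LinearMap.add_apply, add_mul, add_tmul, hc, hd]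
      | tmul u v =>
        induction c₂ with
        | zero => simp
        | add c d hc hd => simp only [map_add, tmul_add, mul_add, hc, hd]
        | tmul x y => simp [mul_smul, mul_assoc]

theorem comulT_comulH (t : T) (y : H) : comulT hH t * comulH hH y =
      LinearMap.mul' k _ (TensorProduct.map ((comulH hH).toLinearMap ∘ₗ actOn k T y)
        (comulT hH).toLinearMap (comul (R := k) t)) := by
  have h0 : (comulH hH).toLinearMap ∘ₗ actOn k T y =
      cop hH R.R ∘ₗ (act2 k T T H H).toLinearMap.flip (comul (R := k) y) ∘ₗ comul := by
    ext t
    simp [comulH_apply, hH.comul_smul]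
  rw [h0, comulH_apply]
  generalize comul (R := k) y = z
  induction z with
  | zero => simp
  | add c d hc hd =>
    simp only [map_add, mul_add, hc, hd, LinearMap.comp_add, LinearMap.add_comp,
      TensorProduct.map_add_left, LinearMap.add_apply]
  | tmul a b =>
    have h1 : (LinearMap.mulRight k (R.R : T ⊗[k] T) ∘ₗ (TensorProduct.comm k T T).toLinearMap) ∘ₗ
        comul (R := k) = LinearMap.mulLeft k (R.R : T ⊗[k] T) ∘ₗ comul (R := k) :=
      LinearMap.ext fun t => comm_comul_mul R t
    rw [comulT_mul_cop, cop_act_mul, midMap_comul, midMap_comul, h1]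

/-- The comultiplication `Δ(h # t) = (h₁ # R² t₁) ⊗ (R¹ h₂ # t₂)` of the bosonization. -/
def comulB : Boson hH →ₐ[k] Boson hH ⊗[k] Boson hH :=
  lift hH (comulH hH) (comulT hH) (comulT_comulH hH)

/-- The counit of `H`, as an algebra map. -/
def counitH : H →ₐ[k] k := AlgHom.ofLinearMap counit hH.counit_one hH.counit_mul

/-- The counit `ε(h # t) = ε(h) ε(t)` of the bosonization. -/
def counitB : Boson hH →ₐ[k] k :=
  lift hH (counitH hH) (Bialgebra.counitAlgHom k T) (by
    intro t y
    have h1 : ∀ w : T ⊗[k] T, LinearMap.mul' k k (TensorProduct.map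
        ((counitH hH).toLinearMap ∘ₗ actOn k T y) (Bialgebra.counitAlgHom k T).toLinearMap w) =
        counit (R := k) y * counit (R := k)
          (TensorProduct.lid k T ((counit (R := k)).rTensor T w)) := by
      intro w
      induction w with
      | zero => simp
      | add c d hc hd => simp only [map_add, mul_add, hc, hd]
      | tmul a b =>
        simp [counitH, hH.counit_smul]
        ring
    rw [h1, rTensor_counit_comul]
    simp [counitH, mul_comm])

theorem counitH_apply (h : H) : counitH hH h = counit (R := k) h := rfl

theorem comulB_inH (h : H) : comulB hH (inH hH h) = cop hH R.R (comul h) :=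
  lift_inH hH _ _ _ h

theorem comulB_inT (t : T) : comulB hH (inT hH t) =
    Algebra.TensorProduct.map (inT hH) (inT hH) (comul (R := k) t) :=
  lift_inT hH _ _ _ t

theorem counitB_inH (h : H) : counitB hH (inH hH h) = counit (R := k) h :=
  lift_inH hH _ _ _ h

theorem counitB_inT (t : T) : counitB hH (inT hH t) = counit (R := k) t :=
  lift_inT hH _ _ _ t

/-- `a ⊗ (b ⊗ c) ↦ (a # p₁) ⊗ ((p₂ b # p₃) ⊗ (p₄ c # 1))`, summed over the two `R`-matrices. -/
def tri (S : Finset (T × T)) :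
    H ⊗[k] (H ⊗[k] H) →ₗ[k] Boson hH ⊗[k] (Boson hH ⊗[k] Boson hH) :=
  ∑ i ∈ S, ∑ j ∈ S, ∑ l ∈ S,
    TensorProduct.map (LinearMap.mulRight k (inT hH (l.2 * j.2)) ∘ₗ (inH hH).toLinearMap)
      (TensorProduct.map
        (LinearMap.mulRight k (inT hH i.2) ∘ₗ (inH hH).toLinearMap ∘ₗ
          Algebra.lsmul k k H l.1)
        ((inH hH).toLinearMap ∘ₗ Algebra.lsmul k k H (i.1 * j.1)))

theorem tri_tmul (S : Finset (T × T)) (a b c : H) :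
    tri hH S (a ⊗ₜ (b ⊗ₜ c)) = ∑ i ∈ S, ∑ j ∈ S, ∑ l ∈ S,
      (inH hH a * inT hH (l.2 * j.2)) ⊗ₜ[k]
        ((inH hH (l.1 • b) * inT hH i.2) ⊗ₜ[k] inH hH ((i.1 * j.1) • c)) := by
  simp [tri, mul_assoc, mul_smul]

set_option synthInstance.maxHeartbeats 200000 in
theorem coassoc_left {S : Finset (T × T)}
    (hS : (R.R : T ⊗[k] T) = ∑ i ∈ S, i.1 ⊗ₜ[k] i.2) (z : H ⊗[k] H) :
    TensorProduct.assoc k _ _ _ (Algebra.TensorProduct.map (comulB hH) (.id k (Boson hH))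
      (cop hH R.R z)) = tri hH S (TensorProduct.assoc k _ _ _ ((comul (R := k)).rTensor H z)) := by
  induction z with
  | zero => simp
  | add c d hc hd => simp only [map_add, hc, hd]
  | tmul a b =>
    rw [hS]
    simp only [map_sum, LinearMap.sum_apply, cop_tmul, Algebra.TensorProduct.map_tmul, map_mul,
      comulB_inH, comulB_inT, LinearMap.rTensor_tmul, AlgHom.coe_id, id_eq]
    generalize comul (R := k) a = c
    induction c with
    | zero => simp
    | add c d hc hd =>
      simp only [map_add, add_tmul, add_mul, Finset.sum_add_distrib, hc, hd]
    | tmul a₁ a₂ =>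
      rw [TensorProduct.assoc_tmul, tri_tmul]
      let Φ : T ⊗[k] (T ⊗[k] T) →ₗ[k] Boson hH ⊗[k] (Boson hH ⊗[k] Boson hH) :=
        (TensorProduct.assoc k _ _ _).toLinearMap ∘ₗ
        (TensorProduct.comm k _ _).toLinearMap ∘ₗ
        TensorProduct.map ((inH hH).toLinearMap ∘ₗ actOn k T b)
          (LinearMap.mulLeft k (cop hH R.R (a₁ ⊗ₜ a₂)) ∘ₗ
            (Algebra.TensorProduct.map (inT hH) (inT hH)).toLinearMap)
      refine (id_comul_sum hS Φ).trans ?_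
      refine Finset.sum_congr rfl fun i _ => Finset.sum_congr rfl fun j _ => ?_
      simp [Φ, hS, Finset.sum_mul, sum_tmul, mul_assoc, mul_smul]

theorem coassoc_right {S : Finset (T × T)}
    (hS : (R.R : T ⊗[k] T) = ∑ i ∈ S, i.1 ⊗ₜ[k] i.2) (z : H ⊗[k] H) :
    Algebra.TensorProduct.map (.id k (Boson hH)) (comulB hH)
      (cop hH R.R z) = tri hH S ((comul (R := k)).lTensor H z) := by
  induction z with
  | zero => simp
  | add c d hc hd => simp only [map_add, hc, hd]
  | tmul a b =>
    conv_lhs => rw [hS]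
    simp only [map_sum, LinearMap.sum_apply, cop_tmul, Algebra.TensorProduct.map_tmul,
      comulB_inH, LinearMap.lTensor_tmul, AlgHom.coe_id, id_eq, hH.comul_smul]
    generalize comul (R := k) b = c
    induction c with
    | zero => simp
    | add c d hc hd =>
      simp only [map_add, tmul_add, Finset.sum_add_distrib, hc, hd]
    | tmul b₁ b₂ =>
      rw [tri_tmul]
      let Φ : T ⊗[k] (T ⊗[k] T) →ₗ[k] Boson hH ⊗[k] (Boson hH ⊗[k] Boson hH) :=
        (TensorProduct.comm k _ _).toLinearMap ∘ₗ
        TensorProduct.map (cop hH R.R ∘ₗ TensorProduct.map (actOn k T b₁) (actOn k T b₂))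
          (LinearMap.mulLeft k (inH hH a) ∘ₗ (inT hH).toLinearMap) ∘ₗ
        (TensorProduct.assoc k T T T).symm.toLinearMap
      have h := comul_id_sum hS Φ
      simp only [Φ, LinearMap.comp_apply, LinearEquiv.coe_coe, LinearEquiv.symm_apply_apply,
        TensorProduct.map_tmul, TensorProduct.comm_tmul, TensorProduct.assoc_symm_tmul] at h
      refine Eq.trans (Finset.sum_congr rfl fun i _ => ?_) (h.trans ?_)
      · congr 2
        generalize comul (R := k) i.1 = v
        induction v with
        | zero => simp
        | add c d hc hd => simp only [map_add, LinearMap.add_apply, hc, hd]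
        | tmul c d => simp
      · simp only [hS, map_sum, LinearMap.sum_apply, cop_tmul, tmul_sum, actOn_apply,
          LinearMap.mulLeft_apply, AlgHom.toLinearMap_apply, mul_smul]
        conv_rhs => enter [2, i]; rw [Finset.sum_comm]
        rw [Finset.sum_comm]
        conv_rhs => rw [Finset.sum_comm]
        conv_lhs => rw [Finset.sum_comm]
        refine Finset.sum_congr rfl fun i _ => ?_
        rw [Finset.sum_comm]

set_option synthInstance.maxHeartbeats 200000 in
instance : Bialgebra k (Boson hH) :=
  Bialgebra.ofAlgHom (comulB hH) (counitB hH)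
    (by
      obtain ⟨S, hS⟩ := exists_sum R
      refine algHom_ext hH (fun h => ?_) fun t => ?_
      · change TensorProduct.assoc k _ _ _ (Algebra.TensorProduct.map (comulB hH) (.id k (Boson hH))
          (comulB hH (inH hH h))) = Algebra.TensorProduct.map (.id k (Boson hH)) (comulB hH)
          (comulB hH (inH hH h))
        rw [comulB_inH, coassoc_left hH hS, coassoc_right hH hS, coassoc_apply]
      · change TensorProduct.assoc k _ _ _ (Algebra.TensorProduct.map (comulB hH) (.id k (Boson hH))
          (comulB hH (inT hH t))) = Algebra.TensorProduct.map (.id k (Boson hH)) (comulB hH)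
          (comulB hH (inT hH t))
        rw [comulB_inT]
        have hl : ∀ w : T ⊗[k] T, TensorProduct.assoc k _ _ _
            (Algebra.TensorProduct.map (comulB hH) (.id k (Boson hH))
            (Algebra.TensorProduct.map (inT hH) (inT hH) w)) =
            TensorProduct.map (inT hH).toLinearMap (TensorProduct.map (inT hH).toLinearMap
              (inT hH).toLinearMap)
              (TensorProduct.assoc k _ _ _ ((comul (R := k)).rTensor T w)) := by
          intro w
          induction w with
          | zero => simp
          | add c d hc hd => simp only [map_add, hc, hd]
          | tmul a b =>
            simp only [Algebra.TensorProduct.map_tmul, comulB_inT, LinearMap.rTensor_tmul,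
              AlgHom.coe_id, id_eq]
            generalize comul (R := k) a = c
            induction c with
            | zero => simp
            | add c d hc hd => simp only [map_add, add_tmul, hc, hd]
            | tmul c d => simp
        have hr : ∀ w : T ⊗[k] T, 
            (Algebra.TensorProduct.map (.id k (Boson hH)) (comulB hH)
            (Algebra.TensorProduct.map (inT hH) (inT hH) w)) =
            TensorProduct.map (inT hH).toLinearMap (TensorProduct.map (inT hH).toLinearMap
              (inT hH).toLinearMap) ((comul (R := k)).lTensor T w) := by
          intro w
          induction w with
          | zero => simp
          | add c d hc hd => simp only [map_add, hc, hd]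
          | tmul a b =>
            simp only [Algebra.TensorProduct.map_tmul, comulB_inT, LinearMap.lTensor_tmul,
              AlgHom.coe_id, id_eq]
            generalize comul (R := k) b = c
            induction c with
            | zero => simp
            | add c d hc hd => simp only [map_add, tmul_add, hc, hd]
            | tmul c d => simp
        rw [hl, hr, coassoc_apply])
    (by
      obtain ⟨S, hS⟩ := exists_sum R
      refine algHom_ext hH (fun h => ?_) fun t => ?_
      · change Algebra.TensorProduct.map (counitB hH) (.id k (Boson hH))
          (comulB hH (inH hH h)) = 1 ⊗ₜ inH hH h
        have hl : ∀ w : H ⊗[k] H, Algebra.TensorProduct.map (counitB hH) (.id k (Boson hH))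
            (cop hH R.R w) = (inH hH).toLinearMap.lTensor k ((counit (R := k)).rTensor H w) := by
          intro w
          induction w with
          | zero => simp
          | add c d hc hd => simp only [map_add, hc, hd]
          | tmul a b =>
            simp only [hS, map_sum, LinearMap.sum_apply, cop_tmul, Algebra.TensorProduct.map_tmul,
              map_mul, counitB_inH, counitB_inT, AlgHom.coe_id, id_eq, LinearMap.rTensor_tmul,
              LinearMap.lTensor_tmul, AlgHom.toLinearMap_apply]
            have h := congrArg (fun t : T => counit (R := k) a ⊗ₜ[k] inH hH (t • b))
              (id_counit_sum hS)
            simpa [Finset.sum_smul, tmul_sum, mul_comm, ← smul_eq_mul, ← smul_tmul'] using h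
        rw [comulB_inH, hl, rTensor_counit_comul]
        simp
      · change Algebra.TensorProduct.map (counitB hH) (.id k (Boson hH))
          (comulB hH (inT hH t)) = 1 ⊗ₜ inT hH t
        have hl : ∀ w : T ⊗[k] T, Algebra.TensorProduct.map (counitB hH) (.id k (Boson hH))
            (Algebra.TensorProduct.map (inT hH) (inT hH) w) =
            (inT hH).toLinearMap.lTensor k ((counit (R := k)).rTensor T w) := by
          intro w
          induction w with
          | zero => simp
          | add c d hc hd => simp only [map_add, hc, hd]
          | tmul a b => simp [counitB_inT]
        rw [comulB_inT, hl, rTensor_counit_comul]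
        simp)
    (by
      obtain ⟨S, hS⟩ := exists_sum R
      refine algHom_ext hH (fun h => ?_) fun t => ?_
      · change Algebra.TensorProduct.map (.id k (Boson hH)) (counitB hH)
          (comulB hH (inH hH h)) = inH hH h ⊗ₜ 1
        have hl : ∀ w : H ⊗[k] H, Algebra.TensorProduct.map (.id k (Boson hH)) (counitB hH)
            (cop hH R.R w) = (inH hH).toLinearMap.rTensor k ((counit (R := k)).lTensor H w) := by
          intro w
          induction w with
          | zero => simp
          | add c d hc hd => simp only [map_add, hc, hd]
          | tmul a b =>
            simp only [hS, map_sum, LinearMap.sum_apply, cop_tmul, Algebra.TensorProduct.map_tmul,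
              counitB_inH, AlgHom.coe_id, id_eq, LinearMap.rTensor_tmul,
              LinearMap.lTensor_tmul, AlgHom.toLinearMap_apply, hH.counit_smul]
            have h := congrArg (fun t : T => (inH hH a * inT hH t) ⊗ₜ[k] counit (R := k) b)
              (counit_id_sum hS)
            have e : ∀ (x : Boson hH) (c d : k), x ⊗ₜ[k] (c * d) = (c • x) ⊗ₜ[k] d :=
              fun x c d => by rw [smul_tmul, smul_eq_mul]
            simpa only [e, map_sum, map_smul, Finset.mul_sum, sum_tmul, mul_smul_comm, map_one,
              mul_one] using h
        rw [comulB_inH, hl, lTensor_counit_comul]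
        simp
      · change Algebra.TensorProduct.map (.id k (Boson hH)) (counitB hH)
          (comulB hH (inT hH t)) = inT hH t ⊗ₜ 1
        have hl : ∀ w : T ⊗[k] T, Algebra.TensorProduct.map (.id k (Boson hH)) (counitB hH)
            (Algebra.TensorProduct.map (inT hH) (inT hH) w) =
            (inT hH).toLinearMap.rTensor k ((counit (R := k)).lTensor T w) := by
          intro w
          induction w with
          | zero => simp
          | add c d hc hd => simp only [map_add, hc, hd]
          | tmul a b => simp [counitB_inT]
        rw [comulB_inT, hl, lTensor_counit_comul]
        simp)

theorem comul_mk (h : H) (t : T) : comul (R := k) (mk hH h t) =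
    cop hH R.R (comul h) * Algebra.TensorProduct.map (inT hH) (inT hH) (comul (R := k) t) := rfl

theorem counit_mk (h : H) (t : T) :
    counit (R := k) (mk hH h t) = counit (R := k) h * counit (R := k) t := rfl

/-- `h ↦ S(R²) S_H(R¹ h)`. -/
def antipodeH : H →ₗ[k] Boson hH :=
  LinearMap.mul' k (Boson hH) ∘ₗ
    TensorProduct.map ((inT hH).toLinearMap ∘ₗ HopfAlgebra.antipode k)
      ((inH hH).toLinearMap ∘ₗ hH.antipode) ∘ₗ
    act2 k T T T H (TensorProduct.comm k T T (R.R : T ⊗[k] T)) ∘ₗ TensorProduct.mk k T H 1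

theorem antipodeH_apply {S : Finset (T × T)}
    (hS : (R.R : T ⊗[k] T) = ∑ i ∈ S, i.1 ⊗ₜ[k] i.2) (h : H) :
    antipodeH hH h = ∑ i ∈ S, inT hH (HopfAlgebra.antipode k i.2) *
      inH hH (hH.antipode (i.1 • h)) := by
  simp [antipodeH, hS]

/-- The antipode `S(h # t) = (1 # S(R² t)) (S_H(R¹ h) # 1)` of the bosonization. -/
def antipodeB : Boson hH →ₗ[k] Boson hH :=
  (LinearMap.mul' k (Boson hH) ∘ₗ
    TensorProduct.map ((inT hH).toLinearMap ∘ₗ HopfAlgebra.antipode k) (antipodeH hH) ∘ₗ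
    (TensorProduct.comm k H T).toLinearMap : H ⊗[k] T →ₗ[k] Boson hH)

theorem antipodeB_mk (h : H) (t : T) :
    antipodeB hH (mk hH h t) = inT hH (HopfAlgebra.antipode k t) * antipodeH hH h := rfl

theorem antipodeB_mul_inT (x : Boson hH) (y : T) :
    antipodeB hH (x * inT hH y) = inT hH (HopfAlgebra.antipode k y) * antipodeB hH x := by
  induction x using Boson.induction_on with
  | zero => simp
  | add a b ha hb => simp only [map_add, add_mul, mul_add, ha, hb]
  | tmul h t =>
    rw [← inH_mul_inT, mul_assoc, ← map_mul, inH_mul_inT, inH_mul_inT, antipodeB_mk, antipodeB_mk,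
      HopfAlgebra.antipode_mul_antidistrib, map_mul, mul_assoc]

theorem antipodeB_inH (h : H) : antipodeB hH (inH hH h) = antipodeH hH h := by
  have := antipodeB_mk hH h 1
  rwa [← inH_mul_inT, map_one, mul_one, HopfAlgebra.antipode_one, map_one, one_mul] at this

/-- `p ⊗ q ↦ S(p) q`. -/
def convL : Boson hH ⊗[k] Boson hH →ₗ[k] Boson hH :=
  LinearMap.mul' k (Boson hH) ∘ₗ (antipodeB hH).rTensor _

/-- `p ⊗ q ↦ p S(q)`. -/
def convR : Boson hH ⊗[k] Boson hH →ₗ[k] Boson hH :=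
  LinearMap.mul' k (Boson hH) ∘ₗ (antipodeB hH).lTensor _

@[simp]
theorem convL_tmul (x y : Boson hH) : convL hH (x ⊗ₜ y) = antipodeB hH x * y := rfl

@[simp]
theorem convR_tmul (x y : Boson hH) : convR hH (x ⊗ₜ y) = x * antipodeB hH y := rfl

theorem convL_mul (Z : Boson hH ⊗[k] Boson hH) (s t : T) :
    convL hH (Z * (inT hH s ⊗ₜ inT hH t)) =
      inT hH (HopfAlgebra.antipode k s) * convL hH Z * inT hH t := by
  induction Z with
  | zero => simp
  | add a b ha hb => simp only [map_add, add_mul, mul_add, ha, hb]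
  | tmul p q =>
    rw [Algebra.TensorProduct.tmul_mul_tmul, convL_tmul, convL_tmul, antipodeB_mul_inT]
    simp only [mul_assoc]

theorem convR_mul (p q : Boson hH) (s t : T) :
    convR hH ((p ⊗ₜ q) * (inT hH s ⊗ₜ inT hH t)) =
      p * inT hH (s * HopfAlgebra.antipode k t) * antipodeB hH q := by
  rw [Algebra.TensorProduct.tmul_mul_tmul, convR_tmul, antipodeB_mul_inT, map_mul]
  simp only [mul_assoc]

theorem convL_cop_tmul {S : Finset (T × T)} (hS : (R.R : T ⊗[k] T) = ∑ i ∈ S, i.1 ⊗ₜ[k] i.2)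
    (a b : H) : convL hH (cop hH R.R (a ⊗ₜ b)) = ∑ i ∈ S, inT hH (HopfAlgebra.antipode k i.2) *
      inH hH (LinearMap.mul' k H (hH.antipode.rTensor H
        (act2 k T T H H (comul (R := k) i.1) (a ⊗ₜ b)))) := by
  let Φ : T ⊗[k] (T ⊗[k] T) →ₗ[k] Boson hH :=
    LinearMap.mul' k _ ∘ₗ TensorProduct.map
      ((inT hH).toLinearMap ∘ₗ HopfAlgebra.antipode k)
      ((inH hH).toLinearMap ∘ₗ LinearMap.mul' k H ∘ₗ hH.antipode.rTensor H ∘ₗ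
        (act2 k T T H H).toLinearMap.flip (a ⊗ₜ b)) ∘ₗ
      (TensorProduct.comm k _ _).toLinearMap ∘ₗ (TensorProduct.assoc k T T T).symm.toLinearMap
  have h := comul_id_sum hS Φ
  have e1 : ∀ (v : T ⊗[k] T) (y : T), Φ (TensorProduct.assoc k T T T (v ⊗ₜ y)) =
      inT hH (HopfAlgebra.antipode k y) * inH hH (LinearMap.mul' k H (hH.antipode.rTensor H
        (act2 k T T H H v (a ⊗ₜ b)))) := by
    intro v y
    simp only [Φ, LinearMap.comp_apply, LinearEquiv.coe_coe, LinearEquiv.symm_apply_apply,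
      TensorProduct.comm_tmul, TensorProduct.map_tmul, LinearMap.mul'_apply]
    rfl
  have e2 : ∀ x y z : T, Φ (x ⊗ₜ (y ⊗ₜ z)) = inT hH (HopfAlgebra.antipode k z) *
      (inH hH (hH.antipode (x • a)) * inH hH (y • b)) := by
    intro x y z
    rw [← map_mul]
    rfl
  simp only [e1, e2] at h
  rw [h, hS]
  simp only [map_sum, LinearMap.sum_apply, cop_tmul, convL_tmul, antipodeB_mul_inT, antipodeB_inH,
    antipodeH_apply hH hS, Finset.mul_sum, Finset.sum_mul, HopfAlgebra.antipode_mul_antidistrib,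
    map_mul, mul_assoc]
  exact Finset.sum_comm

theorem convL_cop (h : H) : convL hH (cop hH R.R (comul h)) = counit (R := k) h • 1 := by
  obtain ⟨S, hS⟩ := exists_sum R
  have h1 : ∀ z : H ⊗[k] H, convL hH (cop hH R.R z) =
      ∑ i ∈ S, inT hH (HopfAlgebra.antipode k i.2) *
      inH hH (LinearMap.mul' k H (hH.antipode.rTensor H
        (act2 k T T H H (comul (R := k) i.1) z))) := by
    intro z
    induction z with
    | zero => simp
    | add c d hc hd => simp only [map_add, mul_add, hc, hd, Finset.sum_add_distrib]
    | tmul a b => exact convL_cop_tmul hH hS a b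
  have h2 := congrArg (fun t : T => inT hH (HopfAlgebra.antipode k t)) (counit_id_sum hS)
  simp only [map_sum, map_smul, HopfAlgebra.antipode_one, map_one] at h2
  simp only [h1, ← hH.comul_smul, hH.antipode_mul, hH.counit_smul, map_smul, map_one,
    mul_smul, mul_smul_comm, mul_one]
  rw [← h2, Finset.smul_sum]
  exact Finset.sum_congr rfl fun i _ => smul_comm _ _ _

theorem convR_cop (h : H) : convR hH (cop hH R.R (comul h)) = counit (R := k) h • 1 := by
  obtain ⟨S, hS⟩ := exists_sum R
  have h1 : ∀ z : H ⊗[k] H, convR hH (cop hH R.R z) =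
      inH hH (LinearMap.mul' k H (hH.antipode.lTensor H z)) := by
    intro z
    induction z with
    | zero => simp
    | add c d hc hd => simp only [map_add, hc, hd]
    | tmul a b =>
      let Φ : T ⊗[k] (T ⊗[k] T) →ₗ[k] Boson hH :=
        LinearMap.mul' k _ ∘ₗ TensorProduct.map
          (LinearMap.mulLeft k (inH hH a) ∘ₗ (inT hH).toLinearMap ∘ₗ LinearMap.mul' k T ∘ₗ
            (HopfAlgebra.antipode k).lTensor T)
          ((inH hH).toLinearMap ∘ₗ hH.antipode ∘ₗ actOn k T b) ∘ₗ
        (TensorProduct.comm k _ _).toLinearMap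
      have h := id_comul_sum hS Φ
      have e1 : ∀ (x : T) (v : T ⊗[k] T), Φ (x ⊗ₜ v) = inH hH a * inT hH (LinearMap.mul' k T
          ((HopfAlgebra.antipode k).lTensor T v)) * inH hH (hH.antipode (x • b)) :=
        fun x v => rfl
      have e2 : ∀ x y z : T, Φ (x ⊗ₜ (y ⊗ₜ z)) = inH hH a *
          (inT hH y * (inT hH (HopfAlgebra.antipode k z) * inH hH (hH.antipode (x • b)))) := by
        intro x y z
        rw [e1]
        simp [mul_assoc]
      simp only [e2] at h
      have h3 := congrArg (fun t : T => inH hH a * inH hH (hH.antipode (t • b))) (id_counit_sum hS)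
      simp only [Finset.sum_smul, map_sum, smul_assoc, map_smul, one_smul, Finset.mul_sum,
        mul_smul_comm] at h3
      rw [LinearMap.lTensor_tmul, LinearMap.mul'_apply, map_mul, ← h3, hS]
      have h4 : ∀ i ∈ S, Φ (i.1 ⊗ₜ comul (R := k) i.2) =
          counit (R := k) i.2 • (inH hH a * inH hH (hH.antipode (i.1 • b))) := by
        intro i _
        rw [e1, HopfAlgebra.mul_antipode_lTensor_comul_apply, AlgHom.commutes, ← Algebra.commutes,
          mul_assoc, Algebra.smul_def]
      rw [← Finset.sum_congr rfl h4, h]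
      simp only [map_sum, LinearMap.sum_apply, cop_tmul, convR_tmul, antipodeB_inH,
        antipodeH_apply hH hS, Finset.mul_sum, mul_assoc, mul_smul]
      exact Finset.sum_comm
  rw [h1, hH.mul_antipode, map_smul, map_one]

theorem antipode_left (h : H) (t : T) :
    convL hH (comul (R := k) (mk hH h t)) = counit (R := k) (mk hH h t) • 1 := by
  have h1 : ∀ w : T ⊗[k] T, convL hH (cop hH R.R (comul h) *
      Algebra.TensorProduct.map (inT hH) (inT hH) w) = counit (R := k) h •
        inT hH (LinearMap.mul' k T ((HopfAlgebra.antipode k).rTensor T w)) := by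
    intro w
    induction w with
    | zero => simp
    | add c d hc hd => simp only [map_add, mul_add, smul_add, hc, hd]
    | tmul c d =>
      rw [Algebra.TensorProduct.map_tmul, convL_mul, convL_cop]
      simp
  rw [comul_mk, counit_mk, h1, HopfAlgebra.mul_antipode_rTensor_comul_apply, AlgHom.commutes,
    Algebra.algebraMap_eq_smul_one, smul_smul]

theorem antipode_right (h : H) (t : T) :
    convR hH (comul (R := k) (mk hH h t)) = counit (R := k) (mk hH h t) • 1 := by
  have h1 : ∀ (p q : Boson hH) (w : T ⊗[k] T), convR hH ((p ⊗ₜ q) *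
      Algebra.TensorProduct.map (inT hH) (inT hH) w) = 
        p * inT hH (LinearMap.mul' k T ((HopfAlgebra.antipode k).lTensor T w)) *
          antipodeB hH q := by
    intro p q w
    induction w with
    | zero => simp
    | add c d hc hd => simp only [map_add, mul_add, add_mul, hc, hd]
    | tmul c d =>
      rw [Algebra.TensorProduct.map_tmul, convR_mul]
      simp
  have h2 : ∀ Z : Boson hH ⊗[k] Boson hH, convR hH (Z *
      Algebra.TensorProduct.map (inT hH) (inT hH) (comul (R := k) t)) =
        counit (R := k) t • convR hH Z := by
    intro Z
    induction Z with
    | zero => simp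
    | add c d hc hd => simp only [map_add, add_mul, smul_add, hc, hd]
    | tmul p q =>
      rw [h1, HopfAlgebra.mul_antipode_lTensor_comul_apply, AlgHom.commutes, ← Algebra.commutes,
        mul_assoc, Algebra.smul_def, convR_tmul]
  rw [comul_mk, counit_mk, h2, convR_cop, smul_smul, mul_comm]

instance : HopfAlgebra k (Boson hH) where
  antipode := antipodeB hH
  mul_antipode_rTensor_comul := by
    refine LinearMap.ext fun x => ?_
    change convL hH (comul (R := k) x) = algebraMap k _ (counit (R := k) x)
    rw [Algebra.algebraMap_eq_smul_one]
    induction x using Boson.induction_on with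
    | zero => simp
    | add c d hc hd => simp only [map_add, add_smul, hc, hd]
    | tmul h t => exact antipode_left hH h t
  mul_antipode_lTensor_comul := by
    refine LinearMap.ext fun x => ?_
    change convR hH (comul (R := k) x) = algebraMap k _ (counit (R := k) x)
    rw [Algebra.algebraMap_eq_smul_one]
    induction x using Boson.induction_on with
    | zero => simp
    | add c d hc hd => simp only [map_add, add_smul, hc, hd]
    | tmul h t => exact antipode_right hH h t

instance [Module.Finite k H] [Module.Finite k T] : Module.Finite k (Boson hH) :=
  inferInstanceAs (Module.Finite k (H ⊗[k] T))

/-- The projection `h # t ↦ ε(h) t` of Hopf algebras. -/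
def proj : Boson hH →ₐ[k] T :=
  lift hH ((Algebra.ofId k T).comp (counitH hH)) (AlgHom.id k T) (by
    intro t y
    have h1 : ∀ w : T ⊗[k] T, LinearMap.mul' k T (TensorProduct.map
        (((Algebra.ofId k T).comp (counitH hH)).toLinearMap ∘ₗ actOn k T y)
        (AlgHom.id k T).toLinearMap w) = counit (R := k) y •
          TensorProduct.lid k T ((counit (R := k)).rTensor T w) := by
      intro w
      induction w with
      | zero => simp
      | add c d hc hd => simp only [map_add, smul_add, hc, hd]
      | tmul a b =>
        have e : counitH hH (a • y) = counit (R := k) y * counit (R := k) a :=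
          (hH.counit_smul a y).trans (mul_comm _ _)
        simp only [TensorProduct.map_tmul, LinearMap.comp_apply, AlgHom.toLinearMap_apply,
          AlgHom.comp_apply, actOn_apply, e, LinearMap.mul'_apply, Algebra.ofId_apply,
          LinearMap.rTensor_tmul, TensorProduct.lid_tmul, map_mul, AlgHom.id_apply, Algebra.smul_def,
          mul_assoc]
    rw [h1, rTensor_counit_comul]
    have e : counitH hH y = counit (R := k) y := rfl
    simp [e, Algebra.ofId_apply, Algebra.smul_def, Algebra.commutes])

end Boson
end Bosonization

section Categories

variable (k : Type u) [Field k]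

/-- A finite-dimensional representation of the algebra `B`, that is a finite-dimensional left
`B`-module. -/
structure FDMod (B : Type u) [Ring B] [Algebra k B] where
  carrier : Type u
  [addCommGroup : AddCommGroup carrier]
  [module : Module k carrier]
  [finite : Module.Finite k carrier]
  act : B →ₐ[k] Module.End k carrier

namespace FDMod

attribute [instance] FDMod.addCommGroup FDMod.module FDMod.finite

instance (B : Type u) [Ring B] [Algebra k B] : CoeSort (FDMod k B) (Type u) :=
  ⟨FDMod.carrier⟩

section Basic

variable {k} {B : Type u} [Ring B] [Algebra k B]

/-- The space `Hom_B(M, N)`. -/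
def homs (M N : FDMod k B) : Submodule k (M →ₗ[k] N) where
  carrier := {f | ∀ (b : B) (m : M), f (M.act b m) = N.act b (f m)}
  add_mem' := fun hf hg b m => by
    rw [LinearMap.add_apply, LinearMap.add_apply, map_add, hf b m, hg b m]
  zero_mem' := fun b m => by rw [LinearMap.zero_apply, LinearMap.zero_apply, map_zero]
  smul_mem' := fun c f hf b m => by
    rw [LinearMap.smul_apply, LinearMap.smul_apply, map_smul, hf b m]

instance : Category (FDMod k B) where
  Hom M N := homs M N
  id M := ⟨LinearMap.id, fun _ _ => rfl⟩
  comp f g := ⟨g.1 ∘ₗ f.1, fun b m => by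
    rw [LinearMap.comp_apply, f.2 b m, g.2 b (f.1 m)]; rfl⟩

/-- The linear map underlying a morphism. -/
def lin {M N : FDMod k B} (f : M ⟶ N) : M →ₗ[k] N := f.1

theorem lin_act {M N : FDMod k B} (f : M ⟶ N) (b : B) (m : M) :
    lin f (M.act b m) = N.act b (lin f m) := f.2 b m

/-- A morphism, from a linear map that commutes with the action. -/
def ofLin {M N : FDMod k B} (f : M →ₗ[k] N)
    (h : ∀ (b : B) (m : M), f (M.act b m) = N.act b (f m)) : M ⟶ N := ⟨f, h⟩

@[simp]
theorem lin_ofLin {M N : FDMod k B} (f : M →ₗ[k] N)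
    (h : ∀ (b : B) (m : M), f (M.act b m) = N.act b (f m)) : lin (ofLin f h) = f := rfl

@[simp]
theorem lin_id (M : FDMod k B) : lin (𝟙 M) = LinearMap.id := rfl

@[simp]
theorem lin_comp {M N L : FDMod k B} (f : M ⟶ N) (g : N ⟶ L) :
    lin (f ≫ g) = lin g ∘ₗ lin f := rfl

theorem hom_ext {M N : FDMod k B} {f g : M ⟶ N} (h : lin f = lin g) : f = g := Subtype.ext h

/-- An isomorphism, from a linear equivalence that commutes with the action. -/
def isoOfLin {M N : FDMod k B} (e : M ≃ₗ[k] N)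
    (h : ∀ (b : B) (m : M), e (M.act b m) = N.act b (e m)) : M ≅ N where
  hom := ofLin e.toLinearMap h
  inv := ofLin e.symm.toLinearMap fun b n => by
    apply e.injective
    change e (e.symm _) = e _
    rw [e.apply_symm_apply, h, LinearEquiv.coe_coe, e.apply_symm_apply]
  hom_inv_id := hom_ext (LinearMap.ext fun m => e.symm_apply_apply m)
  inv_hom_id := hom_ext (LinearMap.ext fun m => e.apply_symm_apply m)

@[simp]
theorem lin_isoOfLin_hom {M N : FDMod k B} (e : M ≃ₗ[k] N)
    (h : ∀ (b : B) (m : M), e (M.act b m) = N.act b (e m)) :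
    lin (isoOfLin e h).hom = e.toLinearMap := rfl

@[simp]
theorem lin_isoOfLin_inv {M N : FDMod k B} (e : M ≃ₗ[k] N)
    (h : ∀ (b : B) (m : M), e (M.act b m) = N.act b (e m)) :
    lin (isoOfLin e h).inv = e.symm.toLinearMap := rfl

instance instPreadditive : Preadditive (FDMod k B) where
  homGroup M N := inferInstanceAs (AddCommGroup (homs M N))
  add_comp _ _ _ f f' g := hom_ext (LinearMap.comp_add f.1 f'.1 g.1)
  comp_add _ _ _ f g g' := hom_ext (LinearMap.add_comp f.1 g'.1 g.1)

instance : Linear k (FDMod k B) where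
  homModule M N := inferInstanceAs (Module k (homs M N))
  smul_comp _ _ _ r f g := hom_ext (LinearMap.comp_smul g.1 r f.1)
  comp_smul _ _ _ f r g := hom_ext (LinearMap.smul_comp r g.1 f.1)

end Basic

end FDMod

/-- The action of `A ⊗ B` on `X ⊗ Y` defined by actions of `A` on `X` and of `B` on `Y`. -/
def tensorAct {k A B X Y : Type u} [Field k] [Ring A] [Algebra k A] [Ring B] [Algebra k B]
    [AddCommGroup X] [Module k X] [AddCommGroup Y] [Module k Y]
    (f : A →ₐ[k] Module.End k X) (g : B →ₐ[k] Module.End k Y) :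
    A ⊗[k] B →ₐ[k] Module.End k (X ⊗[k] Y) :=
  (Module.endTensorEndAlgHom (R := k) (S := k) (A := k) (M := X) (N := Y)).comp
    (Algebra.TensorProduct.map f g)

@[simp]
theorem tensorAct_tmul {k A B X Y : Type u} [Field k] [Ring A] [Algebra k A] [Ring B]
    [Algebra k B] [AddCommGroup X] [Module k X] [AddCommGroup Y] [Module k Y]
    (f : A →ₐ[k] Module.End k X) (g : B →ₐ[k] Module.End k Y) (a : A) (b : B) (x : X) (y : Y) :
    tensorAct f g (a ⊗ₜ b) (x ⊗ₜ y) = f a x ⊗ₜ[k] g b y := rfl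

section TensorActLemmas

variable {k A B C X Y Z X' Y' : Type u} [Field k] [Ring A] [Algebra k A] [Ring B] [Algebra k B]
  [Ring C] [Algebra k C] [AddCommGroup X] [Module k X] [AddCommGroup Y] [Module k Y]
  [AddCommGroup Z] [Module k Z] [AddCommGroup X'] [Module k X'] [AddCommGroup Y'] [Module k Y']
  (f : A →ₐ[k] Module.End k X) (g : B →ₐ[k] Module.End k Y)

theorem map_tensorAct (f' : A →ₐ[k] Module.End k X') (g' : B →ₐ[k] Module.End k Y')
    (p : X →ₗ[k] X') (q : Y →ₗ[k] Y') (hp : ∀ a x, p (f a x) = f' a (p x))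
    (hq : ∀ b y, q (g b y) = g' b (q y)) (w : A ⊗[k] B) (z : X ⊗[k] Y) :
    TensorProduct.map p q (tensorAct f g w z) = tensorAct f' g' w (TensorProduct.map p q z) := by
  induction w with
  | zero => simp
  | add c d hc hd => simp only [map_add, LinearMap.add_apply, hc, hd]
  | tmul a b =>
    induction z with
    | zero => simp
    | add c d hc hd => simp only [map_add, hc, hd]
    | tmul x m => simp [hp, hq]

theorem assoc_tensorAct {K : Type u} [Ring K] [Algebra k K] (h : K →ₐ[k] Module.End k Z)
    (D : C →ₐ[k] A ⊗[k] B) (w : C ⊗[k] K) (z : (X ⊗[k] Y) ⊗[k] Z) :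
    TensorProduct.assoc k X Y Z (tensorAct ((tensorAct f g).comp D) h w z) =
      tensorAct f (tensorAct g h) (TensorProduct.assoc k A B K (D.toLinearMap.rTensor K w))
        (TensorProduct.assoc k X Y Z z) := by
  induction w with
  | zero => simp
  | add c d hc hd => simp only [map_add, LinearMap.add_apply, hc, hd]
  | tmul a b =>
    induction z with
    | zero => simp
    | add c d hc hd => simp only [map_add, hc, hd]
    | tmul x m =>
      rw [tensorAct_tmul, AlgHom.comp_apply, LinearMap.rTensor_tmul, AlgHom.toLinearMap_apply]
      generalize D a = v
      induction v with
      | zero => simp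
      | add c d hc hd => simp only [map_add, LinearMap.add_apply, add_tmul, hc, hd]
      | tmul c d =>
        induction x with
        | zero => simp
        | add c d hc hd => simp only [map_add, add_tmul, hc, hd]
        | tmul x y => simp

theorem tensorAct_comp {E : Type u} [Ring E] [Algebra k E] (e : E →ₐ[k] Module.End k Z)
    (D : C →ₐ[k] A ⊗[k] B) (w : E ⊗[k] C) (z : Z ⊗[k] (X ⊗[k] Y)) :
    tensorAct e ((tensorAct f g).comp D) w z =
      tensorAct e (tensorAct f g) (D.toLinearMap.lTensor E w) z := by
  induction w with
  | zero => simp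
  | add c d hc hd => simp only [map_add, LinearMap.add_apply, hc, hd]
  | tmul a b =>
    induction z with
    | zero => simp
    | add c d hc hd => simp only [map_add, hc, hd]
    | tmul x m => rfl

theorem lid_tensorAct (e : A →ₐ[k] k) (w : A ⊗[k] B) (z : k ⊗[k] Y) :
    TensorProduct.lid k Y (tensorAct ((Algebra.ofId k (Module.End k k)).comp e) g w z) =
      g (TensorProduct.lid k B (e.toLinearMap.rTensor B w)) (TensorProduct.lid k Y z) := by
  induction w with
  | zero => simp
  | add c d hc hd => simp only [map_add, LinearMap.add_apply, hc, hd]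
  | tmul a b =>
    induction z with
    | zero => simp
    | add c d hc hd => simp only [map_add, hc, hd]
    | tmul x m => simpa [Algebra.ofId_apply, mul_smul] using smul_comm _ _ _

theorem rid_tensorAct (e : B →ₐ[k] k) (w : A ⊗[k] B) (z : X ⊗[k] k) :
    TensorProduct.rid k X (tensorAct f ((Algebra.ofId k (Module.End k k)).comp e) w z) =
      f (TensorProduct.rid k A (e.toLinearMap.lTensor A w)) (TensorProduct.rid k X z) := by
  induction w with
  | zero => simp
  | add c d hc hd => simp only [map_add, LinearMap.add_apply, hc, hd]
  | tmul a b =>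
    induction z with
    | zero => simp
    | add c d hc hd => simp only [map_add, hc, hd]
    | tmul x m => simpa [Algebra.ofId_apply, mul_smul] using smul_comm _ _ _

end TensorActLemmas

/-- A left `A`-comodule algebra `K`. -/
class ComoduleAlgebra (A K : Type u) [Ring A] [Bialgebra k A] [Ring K] [Algebra k K] where
  coact : K →ₐ[k] A ⊗[k] K
  coassoc : ∀ x : K, TensorProduct.assoc k A A K ((comul (R := k)).rTensor K (coact x)) =
    coact.toLinearMap.lTensor A (coact x)
  counit_coact : ∀ x : K, (counit (R := k)).rTensor K (coact x) = (1 : k) ⊗ₜ[k] x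

section Tensor

variable (A : Type u) [Ring A] [Bialgebra k A]

instance : ComoduleAlgebra k A A where
  coact := Bialgebra.comulAlgHom k A
  coassoc := coassoc_apply
  counit_coact := rTensor_counit_comul

variable {k A} {K : Type u} [Ring K] [Algebra k K] [ComoduleAlgebra k A K]

namespace FDMod

/-- The `K`-module `X ⊗ M`, with `b (x ⊗ m) = b₋₁ x ⊗ b₀ m`. For `K = A` it is the tensor product
of two `A`-modules. -/
def tens (X : FDMod k A) (M : FDMod k K) : FDMod k K where
  carrier := X ⊗[k] M
  act := (tensorAct X.act M.act).comp (ComoduleAlgebra.coact (A := A))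

theorem tens_act (X : FDMod k A) (M : FDMod k K) (b : K) (z : X ⊗[k] M) :
    (tens X M).act b z = tensorAct X.act M.act (ComoduleAlgebra.coact b) z := rfl

/-- The trivial `A`-module `k`. -/
def unit : FDMod k A where
  carrier := k
  act := (Algebra.ofId k (Module.End k k)).comp (Bialgebra.counitAlgHom k A)

theorem unit_act (a : A) (r : k) : (unit (k := k) (A := A)).act a r = counit (R := k) a * r := rfl

/-- The tensor product of two morphisms. -/
def tensHom {X Y : FDMod k A} {M N : FDMod k K} (f : X ⟶ Y) (g : M ⟶ N) : tens X M ⟶ tens Y N :=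
  ofLin (TensorProduct.map (lin f) (lin g)) fun b z =>
    map_tensorAct X.act M.act Y.act N.act (lin f) (lin g) (lin_act f) (lin_act g)
      (ComoduleAlgebra.coact b) z

@[simp]
theorem lin_tensHom {X Y : FDMod k A} {M N : FDMod k K} (f : X ⟶ Y) (g : M ⟶ N) :
    lin (tensHom f g) = TensorProduct.map (lin f) (lin g) := rfl

/-- The associativity isomorphism `(X ⊗ Y) ⊗ M ≅ X ⊗ (Y ⊗ M)`. -/
def tensAssoc (X Y : FDMod k A) (M : FDMod k K) : tens (tens X Y) M ≅ tens X (tens Y M) :=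
  isoOfLin (TensorProduct.assoc k X Y M) fun b z =>
    (assoc_tensorAct X.act Y.act M.act (ComoduleAlgebra.coact (K := A)) (ComoduleAlgebra.coact b)
      z).trans ((congrArg (fun w => tensorAct X.act (tensorAct Y.act M.act) w
        (TensorProduct.assoc k X Y M z)) (ComoduleAlgebra.coassoc b)).trans
          (tensorAct_comp Y.act M.act X.act (ComoduleAlgebra.coact (K := K)) _ _).symm)

@[simp]
theorem lin_tensAssoc_hom (X Y : FDMod k A) (M : FDMod k K) :
    lin (tensAssoc X Y M).hom = (TensorProduct.assoc k X Y M).toLinearMap := rfl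

@[simp]
theorem lin_tensAssoc_inv (X Y : FDMod k A) (M : FDMod k K) :
    lin (tensAssoc X Y M).inv = (TensorProduct.assoc k X Y M).symm.toLinearMap := rfl

/-- The unit isomorphism `k ⊗ M ≅ M`. -/
def tensUnit (M : FDMod k K) : tens (unit : FDMod k A) M ≅ M :=
  isoOfLin (TensorProduct.lid k M) fun b z =>
    (lid_tensorAct M.act (Bialgebra.counitAlgHom k A) (ComoduleAlgebra.coact b) z).trans
      (congrArg (fun b => M.act b (TensorProduct.lid k M z))
        ((congrArg (TensorProduct.lid k K) (ComoduleAlgebra.counit_coact b)).trans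
          ((TensorProduct.lid_tmul b 1).trans (one_smul k b))))

@[simp]
theorem lin_tensUnit_hom (M : FDMod k K) :
    lin (tensUnit (A := A) M).hom = (TensorProduct.lid k M).toLinearMap := rfl

@[simp]
theorem lin_tensUnit_inv (M : FDMod k K) :
    lin (tensUnit (A := A) M).inv = (TensorProduct.lid k M).symm.toLinearMap := rfl

/-- The unit isomorphism `X ⊗ k ≅ X` of `A`-modules. -/
def tensRightUnit (X : FDMod k A) : tens X (unit : FDMod k A) ≅ X :=
  isoOfLin (TensorProduct.rid k X) fun b z =>
    (rid_tensorAct X.act (Bialgebra.counitAlgHom k A) (comul (R := k) b) z).trans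
      (congrArg (fun b => X.act b (TensorProduct.rid k X z))
        ((congrArg (TensorProduct.rid k A) (lTensor_counit_comul b)).trans
          ((TensorProduct.rid_tmul b 1).trans (one_smul k b))))

instance : MonoidalCategoryStruct (FDMod k A) where
  tensorObj X Y := tens X Y
  whiskerLeft X _ _ f := tensHom (𝟙 X) f
  whiskerRight f Y := tensHom f (𝟙 Y)
  tensorHom f g := tensHom f g
  tensorUnit := unit
  associator X Y Z := tensAssoc X Y Z
  leftUnitor X := tensUnit X
  rightUnitor X := tensRightUnit X

instance : MonoidalCategory (FDMod k A) where
  tensorHom_def _ _ := hom_ext (TensorProduct.ext' fun _ _ => rfl)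
  id_tensorHom_id _ _ := hom_ext (TensorProduct.ext' fun _ _ => rfl)
  tensorHom_comp_tensorHom _ _ _ _ := hom_ext (TensorProduct.ext' fun _ _ => rfl)
  whiskerLeft_id _ _ := hom_ext (TensorProduct.ext' fun _ _ => rfl)
  id_whiskerRight _ _ := hom_ext (TensorProduct.ext' fun _ _ => rfl)
  associator_naturality _ _ _ := hom_ext (TensorProduct.ext_threefold fun _ _ _ => rfl)
  leftUnitor_naturality f := hom_ext (TensorProduct.ext' fun (r : k) x =>
    (map_smul (lin f) r x).symm)
  rightUnitor_naturality f := hom_ext (TensorProduct.ext' fun x (r : k) =>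
    (map_smul (lin f) r x).symm)
  pentagon _ _ _ _ := hom_ext (TensorProduct.ext_fourfold fun _ _ _ _ => rfl)
  triangle _ _ := hom_ext (TensorProduct.ext_threefold fun x (r : k) y =>
    (TensorProduct.smul_tmul r x y).symm)

/-- The data of the action of `Rep(A)` on the category of `K`-modules. -/
instance instActionStruct :
    MonoidalCategory.MonoidalLeftActionStruct (FDMod k A) (FDMod k K) where
  actionObj X M := tens X M
  actionHomLeft f M := tensHom f (𝟙 M)
  actionHomRight X _ _ g := tensHom (𝟙 X) g
  actionHom f g := tensHom f g
  actionAssocIso X Y M := tensAssoc X Y M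
  actionUnitIso M := tensUnit M

end FDMod
end Tensor
end Categories

section InternalHom

theorem lift_tensorAct {k A B X Y N : Type u} [Field k] [Ring A] [Algebra k A] [Ring B]
    [Algebra k B] [AddCommGroup X] [Module k X] [AddCommGroup Y] [Module k Y] [AddCommGroup N]
    [Module k N] (f : A →ₐ[k] Module.End k X) (g : B →ₐ[k] Module.End k Y) (G : X →ₗ[k] Y →ₗ[k] N)
    (x : X) (L : A ⊗[k] Y →ₗ[k] N) (hL : ∀ a y, L (a ⊗ₜ y) = G (f a x) y) (w : A ⊗[k] B) (y : Y) :
    TensorProduct.lift G (tensorAct f g w (x ⊗ₜ y)) =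
      L (tensorAct (Algebra.lmul k A) g w ((1 : A) ⊗ₜ y)) := by
  induction w with
  | zero => simp
  | add c d hc hd => simp only [map_add, LinearMap.add_apply, hc, hd]
  | tmul a b => simp [hL]

variable {k : Type u} [Field k] {A : Type u} [Ring A] [Bialgebra k A]
  {K : Type u} [Ring K] [Algebra k K] [ComoduleAlgebra k A K]

namespace FDMod

/-- The pure tensors of `X ⊗ M`. -/
def pure (X : FDMod k A) (M : FDMod k K) : X →ₗ[k] M →ₗ[k] tens X M := TensorProduct.mk k X M

theorem tens_ext {X : FDMod k A} {M N : FDMod k K} {f g : tens X M ⟶ N}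
    (h : ∀ x m, lin f (pure X M x m) = lin g (pure X M x m)) : f = g :=
  hom_ext (TensorProduct.ext' h)

variable [Module.Finite k A]

/-- The regular module. -/
def reg (k : Type u) [Field k] (B : Type u) [Ring B] [Algebra k B] [Module.Finite k B] :
    FDMod k B where
  carrier := B
  act := Algebra.lmul k B

/-- An element of the algebra as an element of the regular module. -/
def regMk {B : Type u} [Ring B] [Algebra k B] [Module.Finite k B] : B →ₗ[k] reg k B :=
  LinearMap.id

/-- The morphism `g ↦ g h` from the regular module to itself. -/
def regRight (h : A) : reg k A ⟶ reg k A :=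
  ofLin (LinearMap.mulRight k h : A →ₗ[k] A) fun a x => mul_assoc a x h

/-- The morphism `h ↦ h x` from the regular module to `X`. -/
def orbit (X : FDMod k A) (x : X) : reg k A ⟶ X :=
  ofLin (X.act.toLinearMap.flip x : A →ₗ[k] X) fun a h =>
    LinearMap.congr_fun (map_mul X.act a h) x

/-- The internal Hom of `M` and `N`: the space `Hom_K(A ⊗ M, N)` with the action
`(h α)(g ⊗ m) = α(g h ⊗ m)` of `A`. -/
def uHom (M N : FDMod k K) : FDMod k A where
  carrier := homs (tens (reg k A) M) N
  act := AlgHom.ofLinearMap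
    { toFun := fun h =>
        { toFun := fun α => tensHom (regRight h) (𝟙 M) ≫ α
          map_add' := fun _ _ => Preadditive.comp_add _ _ _ _ _ _
          map_smul' := fun r α => Linear.comp_smul _ _ _ (tensHom (regRight h) (𝟙 M)) r α }
      map_add' := fun h h' => by
        refine LinearMap.ext fun α => tens_ext fun (g : A) m => ?_
        change lin α (pure (reg k A) M (regMk (g * (h + h'))) m) =
          lin α (pure (reg k A) M (regMk (g * h)) m) +
          lin α (pure (reg k A) M (regMk (g * h')) m)
        rw [mul_add, map_add, map_add, LinearMap.add_apply, map_add]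
      map_smul' := fun r h => by
        refine LinearMap.ext fun α => tens_ext fun (g : A) m => ?_
        change lin α (pure (reg k A) M (regMk (g * (r • h))) m) =
          r • lin α (pure (reg k A) M (regMk (g * h)) m)
        rw [mul_smul_comm, map_smul, map_smul, LinearMap.smul_apply, map_smul] }
    (by
      refine LinearMap.ext fun α => tens_ext fun (g : A) m => ?_
      exact congrArg (fun a : A => lin α (pure (reg k A) M (regMk a) m)) (mul_one g))
    (fun h h' => by
      refine LinearMap.ext fun α => tens_ext fun (g : A) m => ?_
      exact congrArg (fun a : A => lin α (pure (reg k A) M (regMk a) m))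
        (mul_assoc g h h').symm)

/-- An element of the internal Hom as a morphism `A ⊗ M → N`. -/
def uHom.hom {M N : FDMod k K} (α : uHom (A := A) M N) : tens (reg k A) M ⟶ N := α

/-- The value `α(h ⊗ m)` of an element of the internal Hom. -/
def uEval {M N : FDMod k K} (h : A) : uHom (A := A) M N →ₗ[k] M →ₗ[k] N where
  toFun α := lin (uHom.hom α) ∘ₗ pure (reg k A) M (regMk h)
  map_add' _ _ := rfl
  map_smul' _ _ := rfl

theorem uEval_act {M N : FDMod k K} (a h : A) (m : M) (α : uHom (A := A) M N) :
    uEval h ((uHom (A := A) M N).act a α) m = uEval (h * a) α m := rfl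

/-- The functoriality of the internal Hom: `α ↦ g ∘ α ∘ (id ⊗ f)`. -/
def uHomMap {M M' N N' : FDMod k K} (f : M' ⟶ M) (g : N ⟶ N') :
    uHom (A := A) M N ⟶ uHom (A := A) M' N' :=
  ofLin
    { toFun := fun α => tensHom (𝟙 (reg k A)) f ≫ uHom.hom α ≫ g
      map_add' := fun _ _ => hom_ext (LinearMap.ext fun _ => map_add (lin g) _ _)
      map_smul' := fun r _ => hom_ext (LinearMap.ext fun _ => map_smul (lin g) r _) }
    (fun _ _ => tens_ext fun _ _ => rfl)

/-- The bijection `Hom_K(X ⊗ M, N) → Hom_A(X, uHom(M, N))`, `f ↦ (x ↦ (h ⊗ m ↦ f(h x ⊗ m)))`. -/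
def psi {X : FDMod k A} {M N : FDMod k K} (f : tens X M ⟶ N) : X ⟶ uHom (A := A) M N :=
  ofLin
    { toFun := fun x => tensHom (orbit X x) (𝟙 M) ≫ f
      map_add' := fun x y => by
        refine tens_ext fun (h : A) m => ?_
        change lin f (pure X M (X.act h (x + y)) m) =
          lin f (pure X M (X.act h x) m) + lin f (pure X M (X.act h y) m)
        rw [map_add, map_add, LinearMap.add_apply, map_add]
      map_smul' := fun r x => by
        refine tens_ext fun (h : A) m => ?_
        change lin f (pure X M (X.act h (r • x)) m) =
          r • lin f (pure X M (X.act h x) m)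
        rw [map_smul, map_smul, LinearMap.smul_apply, map_smul] }
    (fun a x => by
      refine tens_ext fun (h : A) m => ?_
      exact congrArg (fun e : Module.End k X => lin f (pure X M (e x) m))
        (map_mul X.act h a).symm)

/-- The bijection `Hom_A(X, uHom(M, N)) → Hom_K(X ⊗ M, N)`, `g ↦ (x ⊗ m ↦ g(x)(1 ⊗ m))`. -/
def phi {X : FDMod k A} {M N : FDMod k K} (g : X ⟶ uHom (A := A) M N) : tens X M ⟶ N :=
  ofLin (TensorProduct.lift (uEval (1 : A) ∘ₗ lin g) : X ⊗[k] M →ₗ[k] N)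
    (fun b z => by
      have h1 : ∀ (x : X) (m : M), TensorProduct.lift (uEval (1 : A) ∘ₗ lin g)
          (tensorAct X.act M.act (ComoduleAlgebra.coact b) (x ⊗ₜ m)) =
          N.act b (uEval (1 : A) (lin g x) m) := by
        intro x m
        rw [lift_tensorAct X.act M.act (uEval (1 : A) ∘ₗ lin g) x
          (lin (uHom.hom (lin g x)) : A ⊗[k] M →ₗ[k] N)]
        · exact lin_act (uHom.hom (lin g x)) b (pure (reg k A) M (regMk 1) m)
        · intro a m
          rw [LinearMap.comp_apply, lin_act, uEval_act, one_mul]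
          rfl
      refine TensorProduct.induction_on z ?_ h1 ?_
      · exact (congrArg _ (map_zero _)).trans ((map_zero _).trans
          ((congrArg (N.act b) (map_zero _)).trans (map_zero (N.act b))).symm)
      · intro c d hc hd
        refine (congrArg _ (map_add _ c d)).trans ((map_add _ _ _).trans
          ((congrArg₂ (· + ·) hc hd).trans ?_))
        exact ((congrArg (N.act b) (map_add _ c d)).trans (map_add (N.act b) _ _)).symm)

/-- The unit `X → uHom(M, X ⊗ M)`. -/
def ucoev (X : FDMod k A) (M : FDMod k K) : X ⟶ uHom (A := A) M (tens X M) := psi (𝟙 _)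

/-- The evaluation `uHom(M, N) ⊗ M → N`. -/
def uev (M N : FDMod k K) : tens (uHom (A := A) M N) M ⟶ N := phi (𝟙 _)

/-- The composition `uHom(M₂, M₃) ⊗ uHom(M₁, M₂) → uHom(M₁, M₃)`. -/
def ucomp (M₁ M₂ M₃ : FDMod k K) :
    tens (uHom (A := A) M₂ M₃) (uHom (A := A) M₁ M₂) ⟶ uHom (A := A) M₁ M₃ :=
  psi ((tensAssoc _ _ _).hom ≫ tensHom (𝟙 _) (uev M₁ M₂) ≫ uev M₂ M₃)

end FDMod

end InternalHom

section Bimodules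

variable (k : Type u) [Field k] (A : Type u) [Ring A] [Bialgebra k A]
  (K : Type u) [Ring K] [Algebra k K] [ComoduleAlgebra k A K]

/-- A finite-dimensional `K`-bimodule with a left `A`-comodule structure that is a morphism of
`K`-bimodules. -/
structure HopfBimodule where
  carrier : Type u
  [addCommGroup : AddCommGroup carrier]
  [module : Module k carrier]
  [finite : Module.Finite k carrier]
  left : K →ₐ[k] Module.End k carrier
  right : Kᵐᵒᵖ →ₐ[k] Module.End k carrier
  left_right : ∀ (x : K) (y : Kᵐᵒᵖ) (p : carrier), left x (right y p) = right y (left x p)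
  coact : carrier →ₗ[k] A ⊗[k] carrier
  coassoc : ∀ p, TensorProduct.assoc k A A carrier ((comul (R := k)).rTensor carrier (coact p)) =
    coact.lTensor A (coact p)
  counit_coact : ∀ p, (counit (R := k)).rTensor carrier (coact p) = (1 : k) ⊗ₜ[k] p
  coact_left : ∀ (x : K) (p : carrier), coact (left x p) =
    tensorAct (Algebra.lmul k A) left (ComoduleAlgebra.coact x) (coact p)
  coact_right : ∀ (x : K) (p : carrier), coact (right (MulOpposite.op x) p) =
    tensorAct (Algebra.lsmul k k A : Aᵐᵒᵖ →ₐ[k] Module.End k A) right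
      (TensorProduct.map (MulOpposite.opLinearEquiv k).toLinearMap
        (MulOpposite.opLinearEquiv k).toLinearMap (ComoduleAlgebra.coact (k := k) (A := A) x))
      (coact p)

namespace HopfBimodule

attribute [instance] HopfBimodule.addCommGroup HopfBimodule.module HopfBimodule.finite

instance : CoeSort (HopfBimodule k A K) (Type u) := ⟨HopfBimodule.carrier⟩

/-- The bimodule `K`. -/
def regular [Module.Finite k K] : HopfBimodule k A K where
  carrier := K
  left := Algebra.lmul k K
  right := Algebra.lsmul k k K
  left_right x y p := (mul_assoc x p y.unop).symm
  coact := (ComoduleAlgebra.coact (k := k) (A := A) (K := K)).toLinearMap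
  coassoc := ComoduleAlgebra.coassoc
  counit_coact := ComoduleAlgebra.counit_coact
  coact_left x p := by
    have h : ∀ w z : A ⊗[k] K, tensorAct (Algebra.lmul k A) (Algebra.lmul k K) w z = w * z := by
      intro w z
      induction w with
      | zero => simp
      | add c d hc hd => simp only [map_add, LinearMap.add_apply, add_mul, hc, hd]
      | tmul a b =>
        induction z with
        | zero => simp
        | add c d hc hd => simp only [map_add, mul_add, hc, hd]
        | tmul a b => simp
    rw [h]
    exact map_mul (ComoduleAlgebra.coact (k := k) (A := A)) x p
  coact_right x p := by
    have h : ∀ w z : A ⊗[k] K,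
        tensorAct (Algebra.lsmul k k A : Aᵐᵒᵖ →ₐ[k] Module.End k A)
          (Algebra.lsmul k k K : Kᵐᵒᵖ →ₐ[k] Module.End k K)
          (TensorProduct.map (MulOpposite.opLinearEquiv k).toLinearMap
          (MulOpposite.opLinearEquiv k).toLinearMap w) z = z * w := by
      intro w z
      induction w with
      | zero => simp
      | add c d hc hd => simp only [map_add, LinearMap.add_apply, mul_add, hc, hd]
      | tmul a b =>
        induction z with
        | zero => simp
        | add c d hc hd => simp only [map_add, add_mul, hc, hd]
        | tmul a b => simp
    rw [h]
    exact map_mul (ComoduleAlgebra.coact (k := k) (A := A)) p x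

variable {k A K} (P : HopfBimodule k A K)

/-- The left `K`-module underlying a bimodule. -/
def leftModule : FDMod k K where
  carrier := P
  act := P.left

/-- The relations `p x ⊗ m = p ⊗ x m`. -/
def relations (M : FDMod k K) : Submodule k (P ⊗[k] M) :=
  Submodule.span k {z | ∃ (x : K) (p : P) (m : M),
    z = P.right (MulOpposite.op x) p ⊗ₜ m - p ⊗ₜ M.act x m}

theorem relations_le {M : FDMod k K} {N : Type u} [AddCommGroup N] [Module k N]
    (f : P ⊗[k] M →ₗ[k] N)
    (h : ∀ x p m, f (P.right (MulOpposite.op x) p ⊗ₜ m) = f (p ⊗ₜ M.act x m)) :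
    P.relations M ≤ LinearMap.ker f := by
  refine Submodule.span_le.2 ?_
  rintro _ ⟨x, p, m, rfl⟩
  change f _ = 0
  rw [map_sub, h, sub_self]

theorem mk_eq (M : FDMod k K) (x : K) (p : P) (m : M) :
    (P.relations M).mkQ (P.right (MulOpposite.op x) p ⊗ₜ m) =
      (P.relations M).mkQ (p ⊗ₜ M.act x m) := by
  refine (Submodule.Quotient.eq _).2 (Submodule.subset_span ⟨x, p, m, rfl⟩)

/-- The left `K`-module `P ⊗_K M`. -/
def tensor (M : FDMod k K) : FDMod k K where
  carrier := (P ⊗[k] M) ⧸ P.relations M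
  act := AlgHom.ofLinearMap
    { toFun := fun x => (P.relations M).liftQ ((P.relations M).mkQ ∘ₗ (P.left x).rTensor M)
        (P.relations_le _ fun y p m => by
          rw [LinearMap.comp_apply, LinearMap.comp_apply, LinearMap.rTensor_tmul,
            LinearMap.rTensor_tmul, P.left_right, P.mk_eq])
      map_add' := fun x y => by
        refine Submodule.linearMap_qext _ (TensorProduct.ext' fun p m => ?_)
        change (P.relations M).mkQ (P.left (x + y) p ⊗ₜ m) =
          (P.relations M).mkQ (P.left x p ⊗ₜ m) + (P.relations M).mkQ (P.left y p ⊗ₜ m)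
        rw [map_add, LinearMap.add_apply, add_tmul, map_add]
      map_smul' := fun r x => by
        refine Submodule.linearMap_qext _ (TensorProduct.ext' fun p m => ?_)
        change (P.relations M).mkQ (P.left (r • x) p ⊗ₜ m) =
          r • (P.relations M).mkQ (P.left x p ⊗ₜ m)
        rw [map_smul, LinearMap.smul_apply, ← smul_tmul', map_smul] }
    (by
      refine Submodule.linearMap_qext _ (TensorProduct.ext' fun p m => ?_)
      change (P.relations M).mkQ (P.left 1 p ⊗ₜ m) = (P.relations M).mkQ (p ⊗ₜ m)
      rw [map_one]
      rfl)
    (fun x y => by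
      refine Submodule.linearMap_qext _ (TensorProduct.ext' fun p m => ?_)
      change (P.relations M).mkQ (P.left (x * y) p ⊗ₜ m) =
        (P.relations M).mkQ (P.left x (P.left y p) ⊗ₜ m)
      rw [map_mul]
      rfl)

/-- The element `p ⊗ m` of `P ⊗_K M`. -/
def pure (M : FDMod k K) : P →ₗ[k] M →ₗ[k] P.tensor M :=
  (TensorProduct.mk k P M).compr₂ (P.relations M).mkQ

theorem pure_right (M : FDMod k K) (x : K) (p : P) (m : M) :
    P.pure M (P.right (MulOpposite.op x) p) m = P.pure M p (M.act x m) := P.mk_eq M x p m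

theorem act_pure (M : FDMod k K) (x : K) (p : P) (m : M) :
    (P.tensor M).act x (P.pure M p m) = P.pure M (P.left x p) m := rfl

theorem lin_ext {M : FDMod k K} {N : Type u} [AddCommGroup N] [Module k N]
    {f g : P.tensor M →ₗ[k] N} (h : ∀ p m, f (P.pure M p m) = g (P.pure M p m)) : f = g :=
  Submodule.linearMap_qext _ (TensorProduct.ext' h)

theorem ext {M N : FDMod k K} {f g : P.tensor M ⟶ N}
    (h : ∀ p m, FDMod.lin f (P.pure M p m) = FDMod.lin g (P.pure M p m)) : f = g :=
  FDMod.hom_ext (P.lin_ext h)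

/-- A linear map out of `P ⊗_K M`. -/
def lift {M : FDMod k K} {N : Type u} [AddCommGroup N] [Module k N] (f : P →ₗ[k] M →ₗ[k] N)
    (h : ∀ x p m, f (P.right (MulOpposite.op x) p) m = f p (M.act x m)) : P.tensor M →ₗ[k] N :=
  (P.relations M).liftQ (TensorProduct.lift f) (P.relations_le _ fun x p m => by
    rw [TensorProduct.lift.tmul, TensorProduct.lift.tmul, h])

@[simp]
theorem lift_pure {M : FDMod k K} {N : Type u} [AddCommGroup N] [Module k N]
    (f : P →ₗ[k] M →ₗ[k] N)
    (h : ∀ x p m, f (P.right (MulOpposite.op x) p) m = f p (M.act x m)) (p : P) (m : M) :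
    P.lift f h (P.pure M p m) = f p m := rfl

/-- A morphism out of `P ⊗_K M`. -/
def liftHom {M N : FDMod k K} (f : P →ₗ[k] M →ₗ[k] N)
    (h : ∀ x p m, f (P.right (MulOpposite.op x) p) m = f p (M.act x m))
    (h' : ∀ x p m, f (P.left x p) m = N.act x (f p m)) : P.tensor M ⟶ N :=
  FDMod.ofLin (P.lift f h) fun x =>
    LinearMap.congr_fun (f := P.lift f h ∘ₗ (P.tensor M).act x) (g := N.act x ∘ₗ P.lift f h)
      (P.lin_ext fun p m => h' x p m)

/-- The functor `P ⊗_K -`. -/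
def tensorFunctor : FDMod k K ⥤ FDMod k K where
  obj M := P.tensor M
  map {M N} f := P.liftHom ((P.pure N).compl₂ (FDMod.lin f))
    (fun x p m => by
      rw [LinearMap.compl₂_apply, LinearMap.compl₂_apply, pure_right, FDMod.lin_act])
    (fun x p m => rfl)
  map_id _ := P.ext fun _ _ => rfl
  map_comp _ _ := P.ext fun _ _ => rfl

/-- The map `(a ⊗ p) ⊗ (x ⊗ m) ↦ a x ⊗ (p ⊗ m)`. -/
def structMap (X : FDMod k A) (M : FDMod k K) :
    A ⊗[k] P →ₗ[k] X ⊗[k] M →ₗ[k] X ⊗[k] P.tensor M :=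
  TensorProduct.homTensorHomMap (RingHom.id k) X M X (P.tensor M) ∘ₗ
    TensorProduct.map X.act.toLinearMap (P.pure M)

@[simp]
theorem structMap_tmul (X : FDMod k A) (M : FDMod k K) (a : A) (p : P) (x : X) (m : M) :
    P.structMap X M (a ⊗ₜ p) (x ⊗ₜ m) = X.act a x ⊗ₜ[k] P.pure M p m := rfl

/-- The module structure `P ⊗_K (X ⊗ M) → X ⊗ (P ⊗_K M)`, `p ⊗ x ⊗ m ↦ p₋₁ x ⊗ p₀ ⊗ m`, of the
functor `P ⊗_K -`. -/
def structHom (X : FDMod k A) (M : FDMod k K) :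
    P.tensor (FDMod.tens X M) ⟶ FDMod.tens X (P.tensor M) :=
  P.liftHom (P.structMap X M ∘ₗ P.coact)
    (fun b p z => by
      have h : ∀ (v : A ⊗[k] K) (w : A ⊗[k] P) (z : X ⊗[k] M), P.structMap X M
          (tensorAct (Algebra.lsmul k k A : Aᵐᵒᵖ →ₐ[k] Module.End k A) P.right
            (TensorProduct.map (MulOpposite.opLinearEquiv k).toLinearMap
              (MulOpposite.opLinearEquiv k).toLinearMap v) w) z =
          P.structMap X M w (tensorAct X.act M.act v z) := by
        intro v w z
        induction v with
        | zero => simp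
        | add c d hc hd => simp only [map_add, LinearMap.add_apply, hc, hd]
        | tmul a b =>
          induction w with
          | zero => simp
          | add c d hc hd => simp only [map_add, LinearMap.add_apply, hc, hd]
          | tmul c p =>
            induction z with
            | zero => simp
            | add c d hc hd => simp only [map_add, hc, hd]
            | tmul x m => simp [pure_right]
      exact (congrArg (fun w => P.structMap X M w z) (P.coact_right b p)).trans (h _ _ z))
    (fun b p z => by
      have h : ∀ (v : A ⊗[k] K) (w : A ⊗[k] P) (z : X ⊗[k] M), P.structMap X M
          (tensorAct (Algebra.lmul k A) P.left v w) z =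
          tensorAct X.act (P.tensor M).act v (P.structMap X M w z) := by
        intro v w z
        induction v with
        | zero => simp
        | add c d hc hd => simp only [map_add, LinearMap.add_apply, hc, hd]
        | tmul a b =>
          induction w with
          | zero => simp
          | add c d hc hd => simp only [map_add, LinearMap.add_apply, hc, hd]
          | tmul c p =>
            induction z with
            | zero => simp
            | add c d hc hd => simp only [map_add, hc, hd]
            | tmul x m => simp [act_pure]
      exact (congrArg (fun w => P.structMap X M w z) (P.coact_left b p)).trans (h _ _ z))

/-- The canonical isomorphism `K ⊗_K M → M`. -/
def regularUnit [Module.Finite k K] (M : FDMod k K) : (regular k A K).tensor M ⟶ M :=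
  (regular k A K).liftHom (M.act.toLinearMap : K →ₗ[k] Module.End k M)
    (fun x (p : K) m => LinearMap.congr_fun (map_mul M.act p x) m)
    (fun x (p : K) m => LinearMap.congr_fun (map_mul M.act x p) m)

end HopfBimodule
end Bimodules

section Central

variable {k : Type u} [Field k] {T : Type u} [Ring T] [HopfAlgebra k T] {R : RMatrix k T}
  {H : Type u} [Ring H] [Algebra k H] [Coalgebra k H] [Module T H] [IsScalarTower k T H]
  (hH : BraidedHopf R H)

namespace Boson

theorem comul_inH (h : H) : comul (R := k) (inH hH h) = cop hH R.R (comul h) := comulB_inH hH h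

theorem comul_inT (t : T) : comul (R := k) (inT hH t) =
    Algebra.TensorProduct.map (inT hH) (inT hH) (comul (R := k) t) := comulB_inT hH t

theorem proj_inH (h : H) : proj hH (inH hH h) = algebraMap k T (counit h) := lift_inH hH _ _ _ h

theorem proj_inT (t : T) : proj hH (inT hH t) = t := lift_inT hH _ _ _ t

theorem proj_mk (h : H) (t : T) : proj hH (mk hH h t) = counit (R := k) h • t :=
  (Algebra.smul_def _ _).symm

theorem map_id_proj_cop (z : H ⊗[k] H) :
    Algebra.TensorProduct.map (AlgHom.id k (Boson hH)) (proj hH) (cop hH R.R z) =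
      inH hH (TensorProduct.rid k H ((counit (R := k)).lTensor H z)) ⊗ₜ[k] (1 : T) := by
  obtain ⟨S, hS⟩ := exists_sum R
  induction z with
  | zero => simp
  | add c d hc hd => simp only [map_add, add_tmul, hc, hd]
  | tmul a b =>
    have h := congrArg (fun t : T => (counit (R := k) b • (inH hH a * inT hH t)) ⊗ₜ[k] (1 : T))
      (counit_id_sum hS)
    simp only [map_sum, map_smul, Finset.mul_sum, Finset.smul_sum, sum_tmul, map_one,
      mul_one] at h
    rw [LinearMap.lTensor_tmul, TensorProduct.rid_tmul, map_smul, ← h, hS]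
    simp only [map_sum, LinearMap.sum_apply, cop_tmul, Algebra.TensorProduct.map_tmul, proj_inH,
      hH.counit_smul, AlgHom.id_apply]
    refine Finset.sum_congr rfl fun i _ => ?_
    rw [Algebra.algebraMap_eq_smul_one, tmul_smul, smul_tmul', mul_smul_comm, smul_smul, mul_comm]

theorem map_proj_id_cop (z : H ⊗[k] H) :
    Algebra.TensorProduct.map (proj hH) (AlgHom.id k (Boson hH)) (cop hH R.R z) =
      TensorProduct.comm k (Boson hH) T (((inH hH).toLinearMap ∘ₗ
        actOn k T (TensorProduct.lid k H ((counit (R := k)).rTensor H z))).rTensor T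
          (R.R : T ⊗[k] T)) := by
  obtain ⟨S, hS⟩ := exists_sum R
  induction z with
  | zero =>
    rw [map_zero, map_zero, map_zero, map_zero, hS]
    simp
  | add c d hc hd =>
    rw [map_add, map_add, hc, hd, hS]
    simp [tmul_add, Finset.sum_add_distrib]
  | tmul a b =>
    rw [hS]
    simp only [map_sum, LinearMap.sum_apply, cop_tmul, Algebra.TensorProduct.map_tmul, proj_inH,
      map_mul, proj_inT, AlgHom.id_apply, LinearMap.rTensor_tmul, TensorProduct.lid_tmul,
      LinearMap.comp_apply, actOn_apply, AlgHom.toLinearMap_apply, TensorProduct.comm_tmul]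
    refine Finset.sum_congr rfl fun i _ => ?_
    rw [← Algebra.smul_def, smul_comm i.1 (counit (R := k) a) b,
      map_smul (inH hH) (counit (R := k) a) (i.1 • b), tmul_smul, smul_tmul']

/-- The element `(1 # R¹) ⊗ R²`. -/
def rElt : Boson hH ⊗[k] T :=
  Algebra.TensorProduct.map (inT hH) (AlgHom.id k T) (R.R : T ⊗[k] T)

/-- The inverse of `(1 # R¹) ⊗ R²`. -/
def rEltInv : Boson hH ⊗[k] T :=
  Algebra.TensorProduct.map (inT hH) (AlgHom.id k T) ((R.R⁻¹ : (T ⊗[k] T)ˣ) : T ⊗[k] T)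

theorem rElt_mul_inv : rElt hH * rEltInv hH = 1 := by
  rw [rElt, rEltInv, ← map_mul, Units.mul_inv, map_one]

theorem rEltInv_mul : rEltInv hH * rElt hH = 1 := by
  rw [rElt, rEltInv, ← map_mul, Units.inv_mul, map_one]

/-- `a ↦ a₁ ⊗ π(a₂)`. -/
def coRight : Boson hH →ₐ[k] Boson hH ⊗[k] T :=
  (Algebra.TensorProduct.map (AlgHom.id k (Boson hH)) (proj hH)).comp
    (Bialgebra.comulAlgHom k (Boson hH))

/-- `a ↦ π(a₁) ⊗ a₂`. -/
def coLeft : Boson hH →ₐ[k] T ⊗[k] Boson hH :=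
  (Algebra.TensorProduct.map (proj hH) (AlgHom.id k (Boson hH))).comp
    (Bialgebra.comulAlgHom k (Boson hH))

theorem coRight_inH (h : H) : coRight hH (inH hH h) = inH hH h ⊗ₜ 1 := by
  change Algebra.TensorProduct.map _ _ (comul (R := k) (inH hH h)) = _
  rw [comul_inH, map_id_proj_cop, lTensor_counit_comul, TensorProduct.rid_tmul, one_smul]

theorem coLeft_inH (h : H) : coLeft hH (inH hH h) =
    TensorProduct.comm k (Boson hH) T (((inH hH).toLinearMap ∘ₗ
        actOn k T h).rTensor T (R.R : T ⊗[k] T)) := by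
  change Algebra.TensorProduct.map _ _ (comul (R := k) (inH hH h)) = _
  rw [comul_inH, map_proj_id_cop, rTensor_counit_comul, TensorProduct.lid_tmul, one_smul]

theorem coRight_inT (t : T) : coRight hH (inT hH t) =
    Algebra.TensorProduct.map (inT hH) (AlgHom.id k T) (comul (R := k) t) := by
  change Algebra.TensorProduct.map _ _ (comul (R := k) (inT hH t)) = _
  rw [comul_inT]
  generalize comul (R := k) t = w
  induction w with
  | zero => simp
  | add c d hc hd => simp only [map_add, hc, hd]
  | tmul a b => simp [proj_inT]

theorem coLeft_inT (t : T) : coLeft hH (inT hH t) = TensorProduct.comm k (Boson hH) T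
    (Algebra.TensorProduct.map (inT hH) (AlgHom.id k T)
      (TensorProduct.comm k T T (comul (R := k) t))) := by
  change Algebra.TensorProduct.map _ _ (comul (R := k) (inT hH t)) = _
  rw [comul_inT]
  generalize comul (R := k) t = w
  induction w with
  | zero => simp
  | add c d hc hd => simp only [map_add, hc, hd]
  | tmul a b => simp [proj_inT]

/-- `a ↦ a₂ ⊗ π(a₁)`. -/
def coOp : Boson hH →ₐ[k] Boson hH ⊗[k] T :=
  (Algebra.TensorProduct.comm k T (Boson hH)).toAlgHom.comp (coLeft hH)

theorem coOp_apply (a : Boson hH) : coOp hH a = (TensorProduct.comm k (Boson hH) T).symm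
    (coLeft hH a) := rfl

theorem rElt_coRight (a : Boson hH) : rElt hH * coRight hH a = coOp hH a * rElt hH := by
  obtain ⟨S, hS⟩ := exists_sum R
  have hHH : ∀ h : H, rElt hH * coRight hH (inH hH h) = coOp hH (inH hH h) * rElt hH := by
    intro h
    let Φ : T ⊗[k] (T ⊗[k] T) →ₗ[k] Boson hH ⊗[k] T :=
      (LinearMap.rTensor T (cross hH h)) ∘ₗ (TensorProduct.assoc k T T T).symm.toLinearMap
    have h1 := comul_id_sum hS Φ
    have e1 : ∀ x y : T, Φ (TensorProduct.assoc k T T T (comul (R := k) x ⊗ₜ y)) =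
        (inT hH x * inH hH h) ⊗ₜ[k] y := by
      intro x y
      rw [LinearMap.comp_apply, LinearEquiv.coe_coe, LinearEquiv.symm_apply_apply,
        LinearMap.rTensor_tmul, inT_mul_inH]
    have e2 : ∀ x y z : T, Φ (x ⊗ₜ (y ⊗ₜ z)) = (inH hH (x • h) * inT hH y) ⊗ₜ[k] z := by
      intro x y z
      rw [LinearMap.comp_apply, LinearEquiv.coe_coe, TensorProduct.assoc_symm_tmul,
        LinearMap.rTensor_tmul, cross_tmul]
    simp only [e1, e2] at h1
    rw [coRight_inH, coOp_apply, coLeft_inH, LinearEquiv.symm_apply_apply, rElt, hS]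
    simp only [map_sum, Finset.sum_mul_sum]
    simpa [Finset.sum_mul] using h1
  have hT : ∀ t : T, rElt hH * coRight hH (inT hH t) = coOp hH (inT hH t) * rElt hH := by
    intro t
    rw [coRight_inT, coOp_apply, coLeft_inT, LinearEquiv.symm_apply_apply, rElt, ← map_mul,
      ← map_mul, comm_comul_mul]
  induction a using Boson.induction_on with
  | zero => simp
  | add a b ha hb => simp only [map_add, mul_add, add_mul, ha, hb]
  | tmul h t =>
    rw [← inH_mul_inT, map_mul, map_mul, ← mul_assoc, hHH, mul_assoc, hT, mul_assoc]

theorem proj_comul (a : Boson hH) : Algebra.TensorProduct.map (proj hH) (proj hH)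
    (comul (R := k) a) = comul (R := k) (proj hH a) := by
  have h : (Algebra.TensorProduct.map (proj hH) (AlgHom.id k T)).comp (coRight hH) =
      (Bialgebra.comulAlgHom k T).comp (proj hH) := by
    refine algHom_ext hH (fun h => ?_) (fun t => ?_)
    · rw [AlgHom.comp_apply, AlgHom.comp_apply, coRight_inH, proj_inH,
        Algebra.TensorProduct.map_tmul, proj_inH, AlgHom.commutes, map_one,
        Algebra.TensorProduct.algebraMap_apply]
    · rw [AlgHom.comp_apply, AlgHom.comp_apply, coRight_inT, proj_inT]
      change _ = comul (R := k) t
      generalize comul (R := k) t = w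
      induction w with
      | zero => simp
      | add c d hc hd => simp only [map_add, hc, hd]
      | tmul a b => simp [proj_inT]
  refine Eq.trans ?_ (AlgHom.congr_fun h a)
  change _ = Algebra.TensorProduct.map (proj hH) (AlgHom.id k T)
    (Algebra.TensorProduct.map (AlgHom.id k (Boson hH)) (proj hH) (comul (R := k) a))
  generalize comul (R := k) a = w
  induction w with
  | zero => simp
  | add c d hc hd => simp only [map_add, hc, hd]
  | tmul a b => simp

theorem counit_proj (a : Boson hH) : counit (R := k) (proj hH a) = counit (R := k) a := by
  induction a using Boson.induction_on with
  | zero => simp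
  | add a b ha hb => simp only [map_add, ha, hb]
  | tmul h t => rw [proj_mk, counit_mk, map_smul, smul_eq_mul]

end Boson

theorem tensorAct_comp_right {k A B C X Y : Type u} [Field k] [Ring A] [Algebra k A] [Ring B]
    [Algebra k B] [Ring C] [Algebra k C] [AddCommGroup X] [Module k X] [AddCommGroup Y]
    [Module k Y] (f : A →ₐ[k] Module.End k X) (g : B →ₐ[k] Module.End k Y) (p : C →ₐ[k] B)
    (w : A ⊗[k] C) :
    tensorAct f (g.comp p) w = tensorAct f g (Algebra.TensorProduct.map (AlgHom.id k A) p w) := by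
  induction w with
  | zero => simp
  | add c d hc hd => simp only [map_add, hc, hd]
  | tmul a b => exact TensorProduct.ext' fun _ _ => rfl

theorem tensorAct_comp_left {k A B C X Y : Type u} [Field k] [Ring A] [Algebra k A] [Ring B]
    [Algebra k B] [Ring C] [Algebra k C] [AddCommGroup X] [Module k X] [AddCommGroup Y]
    [Module k Y] (f : A →ₐ[k] Module.End k X) (g : B →ₐ[k] Module.End k Y) (p : C →ₐ[k] A)
    (w : C ⊗[k] B) :
    tensorAct (f.comp p) g w = tensorAct f g (Algebra.TensorProduct.map p (AlgHom.id k B) w) := by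
  induction w with
  | zero => simp
  | add c d hc hd => simp only [map_add, hc, hd]
  | tmul a b => exact TensorProduct.ext' fun _ _ => rfl

theorem comm_tensorAct {k A B X Y : Type u} [Field k] [Ring A] [Algebra k A] [Ring B]
    [Algebra k B] [AddCommGroup X] [Module k X] [AddCommGroup Y]
    [Module k Y] (f : A →ₐ[k] Module.End k X) (g : B →ₐ[k] Module.End k Y)
    (w : A ⊗[k] B) (z : X ⊗[k] Y) :
    TensorProduct.comm k X Y (tensorAct f g w z) =
      tensorAct g f (TensorProduct.comm k A B w) (TensorProduct.comm k X Y z) := by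
  induction w with
  | zero => simp
  | add c d hc hd => simp only [map_add, LinearMap.add_apply, hc, hd]
  | tmul a b =>
    induction z with
    | zero => simp
    | add c d hc hd => simp only [map_add, hc, hd]
    | tmul x y => simp

/-- The contragredient action, `(t j)(v) = j(S(t) v)`. -/
def dualAct {V : Type u} [AddCommGroup V] [Module k V] (f : T →ₐ[k] Module.End k V) :
    T →ₐ[k] Module.End k (Module.Dual k V) :=
  AlgHom.ofLinearMap
    ((LinearMap.llcomp k V V k).flip ∘ₗ f.toLinearMap ∘ₗ HopfAlgebra.antipode k)
    (by
      refine LinearMap.ext fun j => LinearMap.ext fun v => ?_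
      change j (f (HopfAlgebra.antipode k 1) v) = j v
      rw [HopfAlgebra.antipode_one, map_one]
      rfl)
    (fun s t => by
      refine LinearMap.ext fun j => LinearMap.ext fun v => ?_
      change j (f (HopfAlgebra.antipode k (s * t)) v) =
        j (f (HopfAlgebra.antipode k t) (f (HopfAlgebra.antipode k s) v))
      rw [HopfAlgebra.antipode_mul_antidistrib, map_mul]
      rfl)

theorem dualAct_apply {V : Type u} [AddCommGroup V] [Module k V] (f : T →ₐ[k] Module.End k V)
    (t : T) (j : Module.Dual k V) (v : V) :
    dualAct f t j v = j (f (HopfAlgebra.antipode k t) v) := rfl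

theorem contractLeft_tensorAct {V : Type u} [AddCommGroup V] [Module k V]
    (f : T →ₐ[k] Module.End k V) (t : T) (z : Module.Dual k V ⊗[k] V) :
    contractLeft k V (tensorAct (dualAct f) f (comul (R := k) t) z) =
      counit (R := k) t * contractLeft k V z := by
  have h1 : ∀ (w : T ⊗[k] T) (j : Module.Dual k V) (v : V), contractLeft k V
      (tensorAct (dualAct f) f w (j ⊗ₜ[k] v)) =
      j (f (LinearMap.mul' k T ((HopfAlgebra.antipode k).rTensor T w)) v) := by
    intro w j v
    induction w with
    | zero => simp
    | add c d hc hd => simp only [map_add, LinearMap.add_apply, hc, hd]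
    | tmul a b =>
      rw [tensorAct_tmul, contractLeft_apply, dualAct_apply, LinearMap.rTensor_tmul,
        LinearMap.mul'_apply, map_mul]
      rfl
  induction z with
  | zero => simp
  | add c d hc hd => simp only [map_add, mul_add, hc, hd]
  | tmul j v =>
    rw [h1, HopfAlgebra.mul_antipode_rTensor_comul_apply, AlgHom.commutes, contractLeft_apply,
      Module.algebraMap_end_apply, map_smul, smul_eq_mul]

namespace FDMod

/-- The `H # T`-module `V_π` induced from the `T`-module `V` by the projection `H # T → T`. -/
def infl (V : FDMod k T) : FDMod k (Boson hH) where
  carrier := V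
  act := V.act.comp (Boson.proj hH)

/-- The dual `T`-module. -/
def dual (V : FDMod k T) : FDMod k T where
  carrier := Module.Dual k V
  act := dualAct V.act

/-- The evaluation `V* ⊗ V → k` as a morphism of `H # T`-modules. -/
def evalHom (V : FDMod k T) : tens (infl hH (dual V)) (infl hH V) ⟶ unit :=
  ofLin (contractLeft k V : Module.Dual k V ⊗[k] V →ₗ[k] k) fun a z => by
    have h2 : tensorAct ((dualAct V.act).comp (Boson.proj hH)) (V.act.comp (Boson.proj hH))
        (comul (R := k) a) =
        tensorAct (dualAct V.act) V.act (comul (R := k) (Boson.proj hH a)) := by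
      rw [tensorAct_comp_right, tensorAct_comp_left, ← Boson.proj_comul]
      generalize comul (R := k) a = w
      congr 1
      induction w with
      | zero => simp
      | add c d hc hd => simp only [map_add, hc, hd]
      | tmul a b => simp
    have h3 := contractLeft_tensorAct V.act (Boson.proj hH a) z
    rw [Boson.counit_proj, ← h2] at h3
    exact h3

/-- The action of `(1 # R¹) ⊗ R²` on `X ⊗ V`. -/
def rEquiv (V : FDMod k T) (X : FDMod k (Boson hH)) : X ⊗[k] V ≃ₗ[k] X ⊗[k] V :=
  LinearEquiv.ofLinearMap (tensorAct X.act V.act (Boson.rElt hH))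
    (tensorAct X.act V.act (Boson.rEltInv hH))
    ((map_mul (tensorAct X.act V.act) _ _).symm.trans
      ((congrArg _ (Boson.rElt_mul_inv hH)).trans (map_one _)))
    ((map_mul (tensorAct X.act V.act) _ _).symm.trans
      ((congrArg _ (Boson.rEltInv_mul hH)).trans (map_one _)))

/-- The linear equivalence `X ⊗ V ≃ V ⊗ X`, `x ⊗ v ↦ R² v ⊗ (1 # R¹) x`. -/
def braidEquiv (V : FDMod k T) (X : FDMod k (Boson hH)) : X ⊗[k] V ≃ₗ[k] V ⊗[k] X :=
  rEquiv hH V X ≪≫ₗ TensorProduct.comm k X V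

theorem braidEquiv_act (V : FDMod k T) (X : FDMod k (Boson hH)) (a : Boson hH) (z : X ⊗[k] V) :
    braidEquiv hH V X (tensorAct X.act (V.act.comp (Boson.proj hH)) (comul (R := k) a) z) =
      tensorAct (V.act.comp (Boson.proj hH)) X.act (comul (R := k) a) (braidEquiv hH V X z) := by
  rw [tensorAct_comp_right, tensorAct_comp_left]
  change TensorProduct.comm k X V (tensorAct X.act V.act (Boson.rElt hH)
    (tensorAct X.act V.act (Boson.coRight hH a) z)) = tensorAct V.act X.act (Boson.coLeft hH a)
      (TensorProduct.comm k X V (tensorAct X.act V.act (Boson.rElt hH) z))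
  rw [← Module.End.mul_apply, ← map_mul, Boson.rElt_coRight, map_mul, Module.End.mul_apply,
    comm_tensorAct, Boson.coOp_apply, LinearEquiv.apply_symm_apply]

/-- The half-braiding `V ⊗ X ≅ X ⊗ V`, `v ⊗ x ↦ (1 # r¹) x ⊗ r² v` with `r = R⁻¹`, of the central
functor `V ↦ V_π`. -/
def braid (V : FDMod k T) (X : FDMod k (Boson hH)) :
    tens (infl hH V) X ≅ tens X (infl hH V) :=
  (isoOfLin (M := tens X (infl hH V)) (N := tens (infl hH V) X) (braidEquiv hH V X)
    (braidEquiv_act hH V X)).symm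

end FDMod
end Central

section RelativeEnds

variable {k : Type u} [Field k] {A : Type u} [Ring A] [Bialgebra k A]
  {K : Type u} [Ring K] [Algebra k K] [ComoduleAlgebra k A K]

namespace FDMod

/-- The functor `X ⊗ -`. -/
def tensLeft (K : Type u) [Ring K] [Algebra k K] [ComoduleAlgebra k A K] (X : FDMod k A) :
    FDMod k K ⥤ FDMod k K where
  obj M := tens X M
  map f := tensHom (𝟙 X) f
  map_id _ := hom_ext (TensorProduct.ext' fun _ _ => rfl)
  map_comp _ _ := hom_ext (TensorProduct.ext' fun _ _ => rfl)

/-- The functor `- ⊗ M`. -/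
def tensRight (A : Type u) [Ring A] [Bialgebra k A] [ComoduleAlgebra k A K] (M : FDMod k K) :
    FDMod k A ⥤ FDMod k K where
  obj X := tens X M
  map f := tensHom f (𝟙 M)
  map_id _ := hom_ext (TensorProduct.ext' fun _ _ => rfl)
  map_comp _ _ := hom_ext (TensorProduct.ext' fun _ _ => rfl)

end FDMod

end RelativeEnds

section RelativeEndsOverT

variable {k : Type u} [Field k] {T : Type u} [Ring T] [HopfAlgebra k T] [Module.Finite k T]
  {R : RMatrix k T} {H : Type u} [Ring H] [Algebra k H] [Coalgebra k H] [Module.Finite k H]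
  [Module T H] [IsScalarTower k T H] (hH : BraidedHopf R H)
  (K : Type u) [Ring K] [Algebra k K] [ComoduleAlgebra k (Boson hH) K]

open FDMod

/-- An endofunctor `F` of the category of `K`-modules with morphisms
`d_{V,N} : F(V ⊗ N) → V ⊗ F(N)`, for `V` in `Rep(T)`. The category `Rep(T)` acts by `V ↦ V_π`. -/
structure VFunctor where
  F : FDMod k K ⥤ FDMod k K
  d : ∀ (V : FDMod k T) (N : FDMod k K),
    F.obj (tens (infl hH V) N) ⟶ tens (infl hH V) (F.obj N)

namespace VFunctor

variable {hH K}

/-- For `f : X ⊗ M → F(V ⊗ N)`, the morphism `X ⊗ (V* ⊗ M) → F(N)` that is the composition of the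
inverse half-braiding `X ⊗ V* → V* ⊗ X` of `V*`, of `d_{V,N} f`, and of the evaluation of `V`. -/
def gamma (Φ : VFunctor hH K) {X : FDMod k (Boson hH)} (V : FDMod k T) {M N : FDMod k K}
    (f : tens X M ⟶ Φ.F.obj (tens (infl hH V) N)) :
    tens X (tens (infl hH (dual V)) M) ⟶ Φ.F.obj N :=
  (tensAssoc X (infl hH (dual V)) M).inv ≫
    tensHom (braid hH (dual V) X).inv (𝟙 M) ≫
    (tensAssoc (infl hH (dual V)) X M).hom ≫
    tensHom (𝟙 (infl hH (dual V))) (f ≫ Φ.d V N) ≫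
    (tensAssoc (infl hH (dual V)) (infl hH V) (Φ.F.obj N)).inv ≫
    tensHom (evalHom hH V) (𝟙 (Φ.F.obj N)) ≫
    (tensUnit (Φ.F.obj N)).hom

/-- The prebalancing `uHom(M, F(V ⊗ N)) → uHom(V* ⊗ M, F(N))`. -/
def beta (Φ : VFunctor hH K) (V : FDMod k T) (M N : FDMod k K) :
    uHom (A := Boson hH) M (Φ.F.obj (tens (infl hH V) N)) ⟶
      uHom (A := Boson hH) (tens (infl hH (dual V)) M) (Φ.F.obj N) :=
  psi (Φ.gamma V (phi (𝟙 (uHom (A := Boson hH) M (Φ.F.obj (tens (infl hH V) N))))))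

/-- A family of morphisms `ξ_M : E → uHom(M, F(M))` that is dinatural and compatible with the
prebalancing. -/
structure IsBalanced (Φ : VFunctor hH K) (E : FDMod k (Boson hH))
    (ξ : ∀ M, E ⟶ uHom (A := Boson hH) M (Φ.F.obj M)) : Prop where
  dinatural : ∀ {M N : FDMod k K} (f : M ⟶ N),
    ξ M ≫ uHomMap (𝟙 M) (Φ.F.map f) = ξ N ≫ uHomMap f (𝟙 (Φ.F.obj N))
  balanced : ∀ (V : FDMod k T) (M : FDMod k K),
    ξ M ≫ uHomMap (tensHom (evalHom hH V) (𝟙 M) ≫ (tensUnit M).hom) (𝟙 (Φ.F.obj M)) =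
      ξ (tens (infl hH V) M) ≫ Φ.beta V (tens (infl hH V) M) M ≫
        uHomMap (tensAssoc (infl hH (dual V)) (infl hH V) M).hom (𝟙 (Φ.F.obj M))

/-- A relative end `∮_M uHom(M, F(M))`. -/
structure RelEnd (Φ : VFunctor hH K) where
  obj : FDMod k (Boson hH)
  π : ∀ M : FDMod k K, obj ⟶ uHom (A := Boson hH) M (Φ.F.obj M)
  isBalanced : Φ.IsBalanced obj π
  exists_unique : ∀ (E : FDMod k (Boson hH))
    (ξ : ∀ M, E ⟶ uHom (A := Boson hH) M (Φ.F.obj M)), Φ.IsBalanced E ξ →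
      ∃! g : E ⟶ obj, ∀ M, ξ M = g ≫ π M

/-- The morphism `(∮_M uHom(M, F(M))) ⊗ M → F(M)` corresponding to `π_M`; as `M` varies, these form
the counit, at `F`, of the adjunction between `X ↦ X ⊗ -` and the relative end. -/
def RelEnd.counit {Φ : VFunctor hH K} (E : Φ.RelEnd) (M : FDMod k K) :
    tens E.obj M ⟶ Φ.F.obj M := phi (E.π M)

/-- The functor `F ◁ X : M ↦ F(X ⊗ M)`. -/
def rightAct (Φ : VFunctor hH K) (X : FDMod k (Boson hH)) : VFunctor hH K where
  F := tensLeft K X ⋙ Φ.F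
  d V N := Φ.F.map ((tensAssoc X (infl hH V) N).inv ≫ tensHom (braid hH V X).inv (𝟙 N) ≫
    (tensAssoc (infl hH V) X N).hom) ≫ Φ.d V (tens X N)

/-- The functor `X ▷ F : M ↦ X ⊗ F(M)`. -/
def leftAct (X : FDMod k (Boson hH)) (Φ : VFunctor hH K) : VFunctor hH K where
  F := Φ.F ⋙ tensLeft K X
  d V N := tensHom (𝟙 X) (Φ.d V N) ≫ (tensAssoc X (infl hH V) (Φ.F.obj N)).inv ≫
    tensHom (braid hH V X).inv (𝟙 (Φ.F.obj N)) ≫ (tensAssoc (infl hH V) X (Φ.F.obj N)).hom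

end VFunctor

namespace HopfBimodule

variable {hH K} (P : HopfBimodule k (Boson hH) K)

/-- The functor `P ⊗_K -`. -/
def functor : VFunctor hH K where
  F := P.tensorFunctor
  d V N := P.structHom (infl hH V) N

/-- The object `Z(ρ̄)(P)` of the Drinfeld center of `Rep(H # T)`. The functor `ρ̄` sends `F` to the
relative end `∮_M uHom(M, F(M))`, and `E` is `ρ̄(P ⊗_K -)`. It is a functor of bimodule categories
by `right X : ρ̄(F ◁ X) ≅ ρ̄(F) ⊗ X` and `left X : ρ̄(X ▷ F) ≅ X ⊗ ρ̄(F)`, which come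
from the unit and the counit of the adjunction. The half-braiding of `E` is
`left X ∘ ρ̄(c_X) ∘ (right X)⁻¹`, where `c_{X,M} : P ⊗_K (X ⊗ M) → X ⊗ (P ⊗_K M)`
is the module structure of `P ⊗_K -`. -/
structure CenterObj (E : P.functor.RelEnd) where
  endRight : ∀ X, (P.functor.rightAct X).RelEnd
  endLeft : ∀ X, (P.functor.leftAct X).RelEnd
  right : ∀ X, (endRight X).obj ≅ tens E.obj X
  left : ∀ X, (endLeft X).obj ≅ tens X E.obj
  right_spec : ∀ (X : FDMod k (Boson hH)) (M : FDMod k K), (right X).inv ≫ (endRight X).π M =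
    ucoev (tens E.obj X) M ≫ uHomMap (𝟙 M) ((tensAssoc E.obj X M).hom ≫ E.counit (tens X M))
  left_spec : ∀ (X : FDMod k (Boson hH)) (M : FDMod k K), (left X).inv ≫ (endLeft X).π M =
    ucoev (tens X E.obj) M ≫ uHomMap (𝟙 M) ((tensAssoc X E.obj M).hom ≫
      tensHom (𝟙 X) (E.counit M))
  constr : ∀ X, (endRight X).obj ⟶ (endLeft X).obj
  constr_spec : ∀ (X : FDMod k (Boson hH)) (M : FDMod k K), constr X ≫ (endLeft X).π M =
    (endRight X).π M ≫ uHomMap (𝟙 M) (P.structHom X M)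
  half : HalfBraiding E.obj
  half_spec : ∀ X : FDMod k (Boson hH),
    (half.β X).hom = (right X).inv ≫ constr X ≫ (left X).hom

/-- The coaction `e ↦ σ(e ⊗ 1)` of `H # T` corresponding to the half-braiding `σ`. -/
def CenterObj.coaction {P : HopfBimodule k (Boson hH) K} {E : P.functor.RelEnd}
    (Z : P.CenterObj E) : E.obj →ₗ[k] Boson hH ⊗[k] E.obj :=
  lin (N := tens (reg k (Boson hH)) E.obj) (Z.half.β (reg k (Boson hH))).hom ∘ₗ
    (FDMod.pure E.obj (reg k (Boson hH))).flip (regMk 1)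

end HopfBimodule

end RelativeEndsOverT

/-- A left coaction `δ` of the Hopf algebra `A` on the `A`-module `X` that makes `X` a
Yetter-Drinfeld module: `δ(h e) = h₁ e₋₁ S(h₃) ⊗ h₂ e₀`. -/
structure IsYetterDrinfeld {k A : Type u} [Field k] [Ring A] [HopfAlgebra k A] (X : FDMod k A)
    (δ : X →ₗ[k] A ⊗[k] X) : Prop where
  coassoc : ∀ e, TensorProduct.assoc k A A X ((comul (R := k)).rTensor X (δ e)) =
    δ.lTensor A (δ e)
  counit_coact : ∀ e, (counit (R := k)).rTensor X (δ e) = (1 : k) ⊗ₜ[k] e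
  compat : ∀ (h : A) (n : ℕ) (a b c : Fin n → A),
    (comul (R := k)).lTensor A (comul (R := k) h) = ∑ i, a i ⊗ₜ[k] (b i ⊗ₜ[k] c i) →
    ∀ e : X, δ (X.act h e) = ∑ i, TensorProduct.map
      (LinearMap.mulLeftRight k (a i, HopfAlgebra.antipode k (c i))) (X.act (b i)) (δ e)

section RelativeS

variable {k : Type u} [Field k] {T : Type u} [Ring T] [HopfAlgebra k T] [Module.Finite k T]
  {R : RMatrix k T} {H : Type u} [Ring H] [Algebra k H] [Coalgebra k H] [Module.Finite k H]
  [Module T H] [IsScalarTower k T H] (hH : BraidedHopf R H)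
  {K : Type u} [Ring K] [Algebra k K] [ComoduleAlgebra k (Boson hH) K]

open FDMod

/-- The `T`-coaction `x ⊗ y ↦ R² π(y₋₁) ⊗ ((1 # R¹) x ⊗ y₀)` on `X ⊗ K`. -/
def coactR (K : Type u) [Ring K] [Algebra k K] [ComoduleAlgebra k (Boson hH) K]
    (X : FDMod k (Boson hH)) : X ⊗[k] K →ₗ[k] T ⊗[k] (X ⊗[k] K) :=
  (TensorProduct.leftComm k X T K).toLinearMap ∘ₗ (TensorProduct.assoc k X T K).toLinearMap ∘ₗ
    (tensorAct X.act (Algebra.lmul k T) (Boson.rElt hH)).rTensor K ∘ₗ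
    (TensorProduct.assoc k X T K).symm.toLinearMap ∘ₗ
    ((Boson.proj hH).toLinearMap.rTensor K ∘ₗ
      (ComoduleAlgebra.coact (A := Boson hH) (K := K)).toLinearMap).lTensor X

theorem coactR_naturality {X Y : FDMod k (Boson hH)} (f : X ⟶ Y) (z : X ⊗[k] K) :
    coactR hH K Y ((lin f).rTensor K z) = ((lin f).rTensor K).lTensor T (coactR hH K X z) := by
  induction z with
  | zero => simp only [map_zero]
  | add c d hc hd => simp only [map_add, hc, hd]
  | tmul x y =>
    simp only [coactR, LinearMap.comp_apply, LinearMap.rTensor_tmul, LinearMap.lTensor_tmul]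
    generalize (Boson.proj hH).toLinearMap.rTensor K
      ((ComoduleAlgebra.coact (A := Boson hH) (K := K)).toLinearMap y) = w
    induction w with
    | zero => simp only [map_zero, tmul_zero]
    | add c d hc hd => simp only [map_add, tmul_add, hc, hd]
    | tmul t y =>
      simp only [LinearEquiv.coe_coe, TensorProduct.assoc_symm_tmul, LinearMap.rTensor_tmul]
      generalize Boson.rElt hH = r
      induction r with
      | zero => simp only [map_zero, LinearMap.zero_apply, zero_tmul]
      | add c d hc hd => simp only [map_add, LinearMap.add_apply, add_tmul, hc, hd]
      | tmul a s =>
        simp only [tensorAct_tmul, TensorProduct.assoc_tmul, TensorProduct.leftComm_tmul,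
          LinearMap.lTensor_tmul, LinearMap.rTensor_tmul, lin_act]

/-- The `T`-coaction on `(H # T) ⊗ K`. -/
def coactReg (K : Type u) [Ring K] [Algebra k K] [ComoduleAlgebra k (Boson hH) K] :
    Boson hH ⊗[k] K →ₗ[k] T ⊗[k] (Boson hH ⊗[k] K) := coactR hH K (reg k (Boson hH))

theorem coactReg_mulRight (a : Boson hH) (z : Boson hH ⊗[k] K) :
    coactReg hH K ((LinearMap.mulRight k a).rTensor K z) =
      ((LinearMap.mulRight k a).rTensor K).lTensor T (coactReg hH K z) :=
  coactR_naturality hH (regRight a) z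

namespace HopfBimodule

variable {hH} [Module.Finite k K] (P : HopfBimodule k (Boson hH) K)

/-- The conditions on a linear map `f : (H # T) ⊗ K → P` that `f(h ⊗ y) = f(h ⊗ 1) y` and that `f`
is a morphism of `T`-comodules; the coaction of `T` on `P` is induced by the projection
`H # T → T`. -/
structure IsColinear (f : Boson hH ⊗[k] K →ₗ[k] P) : Prop where
  right_linear : ∀ (h : Boson hH) (y : K),
    f (h ⊗ₜ y) = P.right (MulOpposite.op y) (f (h ⊗ₜ 1))
  colinear : ∀ z : Boson hH ⊗[k] K, f.lTensor T (coactReg hH K z) =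
    (Boson.proj hH).toLinearMap.rTensor P (P.coact (f z))

theorem IsColinear.zero : P.IsColinear (0 : Boson hH ⊗[k] K →ₗ[k] P) where
  right_linear h y := by simp
  colinear z := by simp

theorem IsColinear.add {P : HopfBimodule k (Boson hH) K} {f g : Boson hH ⊗[k] K →ₗ[k] P}
    (hf : P.IsColinear f) (hg : P.IsColinear g) : P.IsColinear (f + g) where
  right_linear h y := by
    rw [LinearMap.add_apply, LinearMap.add_apply, map_add, hf.right_linear, hg.right_linear]
  colinear z := by
    rw [LinearMap.lTensor_add, LinearMap.add_apply, LinearMap.add_apply, map_add, map_add,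
      hf.colinear, hg.colinear]

theorem IsColinear.smul {P : HopfBimodule k (Boson hH) K} {f : Boson hH ⊗[k] K →ₗ[k] P}
    (hf : P.IsColinear f) (r : k) : P.IsColinear (r • f) where
  right_linear h y := by
    rw [LinearMap.smul_apply, LinearMap.smul_apply, map_smul, hf.right_linear]
  colinear z := by
    rw [LinearMap.lTensor_smul, LinearMap.smul_apply, LinearMap.smul_apply, map_smul, map_smul,
      hf.colinear]

theorem IsColinear.comp_mulRight {P : HopfBimodule k (Boson hH) K}
    {f : Boson hH ⊗[k] K →ₗ[k] P} (hf : P.IsColinear f) (a : Boson hH) :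
    P.IsColinear (f ∘ₗ (LinearMap.mulRight k a).rTensor K) where
  right_linear h y := hf.right_linear (h * a) y
  colinear z := by
    rw [LinearMap.lTensor_comp, LinearMap.comp_apply, LinearMap.comp_apply, ← hf.colinear,
      coactReg_mulRight]

/-- The space `S^T(H, K, P)` of those left `K`-linear maps `α : (H # T) ⊗ K → P` that are morphisms
of `T`-comodules and satisfy `α(h ⊗ y) = α(h ⊗ 1) y`. -/
def sSpace : Submodule k (uHom (A := Boson hH) (reg k K) P.leftModule) where
  carrier := {α | P.IsColinear (lin (uHom.hom α))}
  add_mem' := fun hα hβ => IsColinear.add hα hβ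
  zero_mem' := IsColinear.zero P
  smul_mem' := fun r _ hα => IsColinear.smul hα r

/-- The `H # T`-module `S^T(H, K, P)`, with `(h α)(x ⊗ y) = α(x h ⊗ y)`. -/
def sT : FDMod k (Boson hH) where
  carrier := P.sSpace
  act := AlgHom.ofLinearMap
    { toFun := fun h => ((uHom (A := Boson hH) (reg k K) P.leftModule).act h).restrict
        fun _ hα => IsColinear.comp_mulRight hα h
      map_add' := fun h h' => LinearMap.ext fun α => Subtype.ext
        (LinearMap.congr_fun (map_add (uHom (A := Boson hH) (reg k K) P.leftModule).act h h') α.1)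
      map_smul' := fun r h => LinearMap.ext fun α => Subtype.ext
        (LinearMap.congr_fun (map_smul (uHom (A := Boson hH) (reg k K) P.leftModule).act r h)
          α.1) }
    (LinearMap.ext fun α => Subtype.ext
      (LinearMap.congr_fun (map_one (uHom (A := Boson hH) (reg k K) P.leftModule).act) α.1))
    (fun h h' => LinearMap.ext fun α => Subtype.ext
      (LinearMap.congr_fun (map_mul (uHom (A := Boson hH) (reg k K) P.leftModule).act h h') α.1))

/-- The map `α ↦ α(x ⊗ y)`. -/
def sEval (x : Boson hH) (y : K) : P.sT →ₗ[k] P where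
  toFun α := lin (uHom.hom α.1) (FDMod.pure (reg k (Boson hH)) (reg k K) (regMk x) (regMk y))
  map_add' _ _ := rfl
  map_smul' _ _ := rfl

theorem sEval_act (h x : Boson hH) (y : K) (α : P.sT) :
    P.sEval x y (P.sT.act h α) = P.sEval (x * h) y α := rfl

/-- The formula `α₋₁ ⊗ α₀(x ⊗ y) = S(x₁) α(x₂ ⊗ 1)₋₁ x₃ ⊗ α(x₂ ⊗ 1)₀ y` for a map
`δ : S^T(H, K, P) → (H # T) ⊗ S^T(H, K, P)`, `α ↦ α₋₁ ⊗ α₀`. -/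
def IsCoaction (δ : P.sT →ₗ[k] Boson hH ⊗[k] P.sT) : Prop :=
  ∀ (x : Boson hH) (n : ℕ) (a b c : Fin n → Boson hH),
    (comul (R := k)).lTensor (Boson hH) (comul (R := k) x) = ∑ i, a i ⊗ₜ[k] (b i ⊗ₜ[k] c i) →
    ∀ (y : K) (α : P.sT), (P.sEval x y).lTensor (Boson hH) (δ α) =
      ∑ i, TensorProduct.map (LinearMap.mulLeftRight k (HopfAlgebra.antipode k (a i), c i))
        (P.right (MulOpposite.op y)) (P.coact (P.sEval (b i) 1 α))

/-- The canonical property `f(α) = λ`, `λ_M(h ⊗ m) = α(h ⊗ 1) ⊗ m`, of a morphism `f` from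
`S^T(H, K, P)` to the relative end. -/
def IsCanonical {E : P.functor.RelEnd} (f : P.sT ⟶ E.obj) : Prop :=
  ∀ (M : FDMod k K) (α : P.sT) (h : Boson hH) (m : M),
    uEval h (lin (f ≫ E.π M) α) m = P.pure M (P.sEval h 1 α) m

/-- The product `(α β)(x ⊗ y) = α(x₁ ⊗ β(x₂ ⊗ y))` and the unit `x ⊗ y ↦ ε(x) y` of
`S^T(H, K, K)`. -/
structure IsSMul (m : MonObj (regular k (Boson hH) K).sT) : Prop where
  mul : ∀ (x : Boson hH) (n : ℕ) (a b : Fin n → Boson hH),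
    comul (R := k) x = ∑ i, a i ⊗ₜ[k] b i →
    ∀ (y : K) (α β : (regular k (Boson hH) K).sT),
      (regular k (Boson hH) K).sEval x y (lin m.mul (FDMod.pure _ _ α β)) =
        ∑ i, (regular k (Boson hH) K).sEval (a i)
          ((regular k (Boson hH) K).sEval (b i) y β : K) α
  one : ∀ (x : Boson hH) (y : K) (r : k),
    (regular k (Boson hH) K).sEval x y (lin m.one r) = r • counit (R := k) x • (y : K)

/-- The morphism `∮_M uHom(M, K ⊗_K M) → uHom(M, M)`. -/
def endProj (E : (regular k (Boson hH) K).functor.RelEnd) (M : FDMod k K) :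
    E.obj ⟶ uHom (A := Boson hH) M M :=
  E.π M ≫ uHomMap (𝟙 M) (regularUnit M)

/-- The product of the relative end `∮_M uHom(M, M)` induced by the composition of the algebras
`uHom(M, M)`. -/
structure IsEndMul {E : (regular k (Boson hH) K).functor.RelEnd} (m : MonObj E.obj) : Prop where
  mul : ∀ M : FDMod k K, m.mul ≫ endProj E M =
    tensHom (endProj E M) (endProj E M) ≫ ucomp M M M
  one : ∀ M : FDMod k K, m.one ≫ endProj E M =
    ucoev (FDMod.unit : FDMod k (Boson hH)) M ≫ uHomMap (𝟙 M) (tensUnit M).hom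

end HopfBimodule
end RelativeS

end

/-! By the internal Hom adjunction, a dinatural family `E → uHom(M, F(M))` is the same as a family
of `K`-linear maps `γ_M : E ⊗ M → F(M)` natural in `M`. The balancing condition contains the
antipode, through the dual of `V`. Written on elements it reads `v ⊗ γ(e ⊗ m) = S(R²) d γ(R¹ e ⊗ v ⊗
m)`. Since `R¹ ⊗ S(R²)` is inverse to `R` in `T ⊗ Tᵒᵖ`, this is equivalent to `d γ(e ⊗ v ⊗ m) = R² v
⊗ γ(R¹ e ⊗ m)`, which says that `γ` is a transformation of module functors over `Rep(T)`
(`VFunctor.isBalanced_iff`). A relative end is thus an object that represents such transformations,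
and its universal property can be used without duals.

For `F = P ⊗_K -`, naturality along the maps `K → M`, `b ↦ b m`, forces `γ_M(e ⊗ m) = p(e) ⊗ m` for
one linear map `p : E → P`. The module condition, tested on the regular `T`-module at `v = 1`, says
`π(p(e)₋₁) ⊗ p(e)₀ = R² ⊗ p(R¹ e)`. These are the conditions that make `x ⊗ y ↦ p(x e) y` an element
of `S^T(H, K, P)`. Hence `S^T(H, K, P)` with `α ⊗ m ↦ α(1 ⊗ 1) ⊗ m` is a relative end
(`HopfBimodule.sT_universal`), and it is canonically isomorphic to any other.

For the half-braiding, duality of `X` shows that `X ⊗ E` is a relative end of `X ▷ F`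
(`RelEnd.leftAct_universal`). Composing the counit of `E` at `X ⊗ M` with `c_X` gives a
transformation out of `E ⊗ X`, and hence a unique `σ_X : E ⊗ X → X ⊗ E`. Naturality, the tensor
axiom and the unit axiom follow from uniqueness, the last two with the coassociativity and the
counit of `P`. A half-braiding is determined by the coaction `e ↦ σ(e ⊗ 1)` on the regular module,
and `A`-linearity of `σ` is the Yetter-Drinfeld condition. On `S^T`, evaluation at `1 ⊗ 1` carries
this coaction to that of `P`, and the action of `A` propagates the value to all `x`, which produces
the formula with `S(x₁)` and `x₃`.

Invertibility of `σ_X`, and with it the fact that `E ⊗ X` is a relative end of `F ◁ X`, needs the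
inverse of the antipode of `A`. Bijectivity of the antipode of a finite-dimensional Hopf algebra is
proved by means of an integral, constructed as a trace: `b ↦ Tr(a ↦ (b S²(a))₁ f((b S²(a))₂))`.

For `P = K` the transformations are families `E ⊗ M → M`. Both products are determined by composing
such families, since an element `α` of `S^T` acts on `M` as the element `α(1 ⊗ 1)` of `K`. The
statements on the module category reduce to exactness of tensor products over a field. -/

noncomputable section

/-! ### The antipode and the comultiplication. -/

section Antipode

open LinearMap (mul')

variable {k : Type u} [Field k] {A : Type u} [Ring A] [HopfAlgebra k A]

namespace HopfAlgebra

/-- `S(a)₁ ⊗ S(a)₂ = S(a₂) ⊗ S(a₁)`. -/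
theorem comul_antipode (a : A) : comul (R := k) (antipode k a) =
    TensorProduct.comm k A A (TensorProduct.map (antipode k) (antipode k) (comul (R := k) a)) := by
  let iL : A →ₐ[k] A ⊗[k] A := Algebra.TensorProduct.includeLeft
  let iR : A →ₐ[k] A ⊗[k] A := Algebra.TensorProduct.includeRight
  -- In the convolution algebra `Hom(A, A ⊗ A)`, an algebra map `i` has the left inverse `i ∘ S`. As
  -- `Δ` is the product of the two inclusions of `A`, reversing their inverses gives a left inverse
  -- of `Δ`. It has to agree with the right inverse `Δ ∘ S`.
  have hS : ∀ i : A →ₐ[k] A ⊗[k] A, WithConv.toConv (i.toLinearMap ∘ₗ antipode k) *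
      WithConv.toConv i.toLinearMap = 1 := by
    intro i
    apply WithConv.ext
    refine LinearMap.ext fun a => ?_
    change LinearMap.mul' k _ (TensorProduct.map _ _ (comul (R := k) a)) =
      algebraMap k _ (counit (R := k) a)
    have h := congrArg i (mul_antipode_rTensor_comul_apply (R := k) a)
    rw [AlgHom.commutes] at h
    rw [← h]
    generalize comul (R := k) a = w
    induction w with
    | zero => simp
    | add c d hc hd => simp only [map_add, hc, hd]
    | tmul c d => simp
  have hc : WithConv.toConv (comul (R := k) (A := A)) =
      WithConv.toConv iL.toLinearMap * WithConv.toConv iR.toLinearMap := by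
    apply WithConv.ext
    refine LinearMap.ext fun a => ?_
    change _ = LinearMap.mul' k _ (TensorProduct.map _ _ (comul (R := k) a))
    change comul (R := k) a = _
    generalize comul (R := k) a = w
    induction w with
    | zero => simp
    | add c d hc hd => rw [map_add, map_add, ← hc, ← hd]
    | tmul c d => simp [iL, iR]
  have h1 : (WithConv.toConv (iR.toLinearMap ∘ₗ antipode k) *
      WithConv.toConv (iL.toLinearMap ∘ₗ antipode k)) *
        WithConv.toConv (comul (R := k) (A := A)) = 1 := by
    rw [hc, mul_assoc, ← mul_assoc (WithConv.toConv (iL.toLinearMap ∘ₗ antipode k)), hS, one_mul, hS]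
  have h2 := left_inv_eq_right_inv h1 (LinearMap.comul_right_inv (R := k) (C := A))
  have h3 := congrArg (fun f : WithConv (A →ₗ[k] A ⊗[k] A) => f.ofConv a) h2
  refine Eq.trans h3.symm ?_
  change LinearMap.mul' k _ (TensorProduct.map _ _ (comul (R := k) a)) = _
  generalize comul (R := k) a = w
  induction w with
  | zero => simp
  | add c d hc hd => simp only [map_add, hc, hd]
  | tmul c d => simp [iL, iR]

/-- `(b S(a₁))₁ a₂ ⊗ (b S(a₁))₂ = b₁ ⊗ b₂ S(a)`. -/
theorem comul_mul_antipode (b : A) (a : A) :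
    mul' k (A ⊗[k] A) (TensorProduct.map (comul (R := k) ∘ₗ LinearMap.mulLeft k b ∘ₗ antipode k)
      (Algebra.TensorProduct.includeLeft : A →ₐ[k] A ⊗[k] A).toLinearMap (comul (R := k) a)) =
    comul (R := k) b * (1 ⊗ₜ antipode k a) := by
  -- `Φ(x ⊗ y ⊗ z) = Δ(b) (S(y) z ⊗ S(x))`. On `(Δ ⊗ id)Δ(a)` it is the left side, because `S`
  -- reverses `Δ`; on `(id ⊗ Δ)Δ(a)` the factor `S(y) z` collapses to a counit.
  let Φ : A ⊗[k] (A ⊗[k] A) →ₗ[k] A ⊗[k] A := LinearMap.mulLeft k (comul (R := k) b) ∘ₗ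
    TensorProduct.comm k A A ∘ₗ TensorProduct.map (antipode k)
      (mul' k A ∘ₗ (antipode k).rTensor A)
  have h := congrArg Φ (coassoc_apply (R := k) a)
  have e1 : ∀ w : A ⊗[k] A, mul' k (A ⊗[k] A) (TensorProduct.map
      (comul (R := k) ∘ₗ LinearMap.mulLeft k b ∘ₗ antipode k)
      (Algebra.TensorProduct.includeLeft : A →ₐ[k] A ⊗[k] A).toLinearMap w) =
      Φ (TensorProduct.assoc k A A A ((comul (R := k)).rTensor A w)) := by
    intro w
    induction w with
    | zero => simp
    | add c d hc hd => simp only [map_add, hc, hd]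
    | tmul c d =>
      simp only [TensorProduct.map_tmul, LinearMap.comp_apply, LinearMap.mulLeft_apply,
        Bialgebra.comul_mul, comul_antipode, LinearMap.mul'_apply, LinearMap.rTensor_tmul,
        mul_assoc]
      generalize comul (R := k) c = v
      induction v with
      | zero => simp
      | add c d hc hd => simp only [map_add, add_mul, mul_add, add_tmul, hc, hd]
      | tmul p q => simp [Φ]
  have e2 : ∀ w : A ⊗[k] A, Φ ((comul (R := k)).lTensor A w) =
      comul (R := k) b * (1 ⊗ₜ antipode k (TensorProduct.rid k A ((counit (R := k)).lTensor A w))) := by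
    intro w
    induction w with
    | zero => simp
    | add c d hc hd => simp only [map_add, tmul_add, mul_add, hc, hd]
    | tmul c d =>
      simp only [Φ, LinearMap.comp_apply, LinearMap.lTensor_tmul, TensorProduct.map_tmul,
        mul_antipode_rTensor_comul_apply, LinearMap.mulLeft_apply, LinearEquiv.coe_coe,
        TensorProduct.comm_tmul, TensorProduct.rid_tmul, Algebra.algebraMap_eq_smul_one,
        map_smul, smul_tmul', tmul_smul]
  rw [e1, h, e2, lTensor_counit_comul, TensorProduct.rid_tmul, one_smul]

/-- `S²(a₂) S(a₁) = ε(a)`. -/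
theorem antipode_antipode_mul (a : A) : mul' k A (TensorProduct.map (antipode k ∘ₗ antipode k)
    (antipode k) (TensorProduct.comm k A A (comul (R := k) a))) =
      algebraMap k A (counit (R := k) a) := by
  have h := congrArg (antipode k) (mul_antipode_lTensor_comul_apply (R := k) a)
  rw [Algebra.algebraMap_eq_smul_one, map_smul, antipode_one] at h
  rw [Algebra.algebraMap_eq_smul_one, ← h]
  generalize comul (R := k) a = w
  induction w with
  | zero => simp
  | add c d hc hd => simp only [map_add, hc, hd]
  | tmul c d => simp [antipode_mul_antidistrib]

/-- `z ↦ z₁ f(z₂)`. -/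
def leftConv (f : Module.Dual k A) : A →ₗ[k] A :=
  (TensorProduct.rid k A).toLinearMap ∘ₗ f.lTensor A ∘ₗ comul

/-- Coassociativity: `leftConv f` works on the right leg of `Δ`, so it commutes with the coaction of
`A` on itself from the left. -/
theorem comul_leftConv (f : Module.Dual k A) (z : A) :
    comul (R := k) (leftConv f z) = (leftConv f).lTensor A (comul (R := k) z) := by
  let Φ : A ⊗[k] (A ⊗[k] A) →ₗ[k] A ⊗[k] A :=
    ((TensorProduct.rid k A).toLinearMap ∘ₗ f.lTensor A).lTensor A
  have h := congrArg Φ (coassoc_apply (R := k) z)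
  have e1 : ∀ w : A ⊗[k] A, comul (R := k) (TensorProduct.rid k A (f.lTensor A w)) =
      Φ (TensorProduct.assoc k A A A ((comul (R := k)).rTensor A w)) := by
    intro w
    induction w with
    | zero => simp
    | add c d hc hd => simp only [map_add, hc, hd]
    | tmul c d =>
      simp only [LinearMap.lTensor_tmul, TensorProduct.rid_tmul, map_smul, LinearMap.rTensor_tmul]
      generalize comul (R := k) c = v
      induction v with
      | zero => simp
      | add c d hc hd => simp only [map_add, smul_add, add_tmul, hc, hd]
      | tmul p q => simp [Φ]
  refine (e1 _).trans (h.trans ?_)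
  generalize comul (R := k) z = w
  induction w with
  | zero => simp
  | add c d hc hd => simp only [map_add, hc, hd]
  | tmul c d => rfl

theorem counit_leftConv (f : Module.Dual k A) (z : A) : counit (R := k) (leftConv f z) = f z := by
  have h := congrArg (fun w => f (TensorProduct.lid k A w)) (rTensor_counit_comul (R := k) z)
  simp only [TensorProduct.lid_tmul, one_smul] at h
  rw [← h]
  change counit (R := k) (TensorProduct.rid k A (f.lTensor A (comul (R := k) z))) = _
  generalize comul (R := k) z = w
  induction w with
  | zero => simp
  | add c d hc hd => simp only [map_add, hc, hd]
  | tmul c d => simp [mul_comm]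

/-- `S(z₁) z₂ f(z₃)` collapses to a scalar. In the trace computations below this produces a map of
rank at most one. -/
theorem mul_antipode_leftConv (f : Module.Dual k A) (z : A) :
    mul' k A (TensorProduct.map (antipode k) (leftConv f) (comul (R := k) z)) = algebraMap k A (f z) := by
  have h := mul_antipode_rTensor_comul_apply (R := k) (leftConv f z)
  rw [comul_leftConv, counit_leftConv] at h
  rw [← h]
  generalize comul (R := k) z = w
  induction w with
  | zero => simp
  | add c d hc hd => simp only [map_add, hc, hd]
  | tmul c d => rfl

end HopfAlgebra
end Antipode

/-! ### Integrals as traces, and injectivity of the antipode. -/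

section Integral

open LinearMap (mul')

section Trace

variable {k : Type u} [Field k] {M N : Type u} [AddCommGroup M] [Module k M] [Module.Finite k M]
  [AddCommGroup N] [Module k N] [Module.Finite k N]

theorem LinearMap.trace_eq_sum (f : M →ₗ[k] M) : LinearMap.trace k M f =
    ∑ i, (Module.finBasis k M).coord i (f (Module.finBasis k M i)) := by
  rw [LinearMap.trace_eq_matrix_trace k (Module.finBasis k M), Matrix.trace]
  exact Finset.sum_congr rfl fun i _ => LinearMap.toMatrix_apply _ _ _ _ _

theorem LinearMap.trace_tensor_eq_sum (f : M ⊗[k] N →ₗ[k] M ⊗[k] N) :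
    LinearMap.trace k (M ⊗[k] N) f = ∑ i, ∑ j,
      TensorProduct.lid k k (TensorProduct.map ((Module.finBasis k M).coord i)
        ((Module.finBasis k N).coord j) (f (Module.finBasis k M i ⊗ₜ Module.finBasis k N j))) := by
  let b := (Module.finBasis k M).tensorProduct (Module.finBasis k N)
  have e : ∀ i j z, b.repr z (i, j) = TensorProduct.lid k k (TensorProduct.map
      ((Module.finBasis k M).coord i) ((Module.finBasis k N).coord j) z) := by
    intro i j z
    induction z with
    | zero => simp
    | add c d hc hd => simp only [map_add, Finsupp.add_apply, hc, hd]
    | tmul m n => simp [b, mul_comm]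
  rw [LinearMap.trace_eq_matrix_trace k b, Matrix.trace, Fintype.sum_prod_type]
  refine Finset.sum_congr rfl fun i _ => Finset.sum_congr rfl fun j _ => ?_
  rw [Matrix.diag_apply, LinearMap.toMatrix_apply, e, Module.Basis.tensorProduct_apply]

/-- Partial trace over the first factor. The sum over the basis stays inside the trace because in
the application it collapses to a single endomorphism before the trace is taken. -/
theorem LinearMap.trace_tensor_left (f : M ⊗[k] N →ₗ[k] M ⊗[k] N) :
    LinearMap.trace k (M ⊗[k] N) f = LinearMap.trace k N (∑ i,
      (TensorProduct.lid k N).toLinearMap ∘ₗ ((Module.finBasis k M).coord i).rTensor N ∘ₗ f ∘ₗ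
        TensorProduct.mk k M N (Module.finBasis k M i)) := by
  rw [trace_tensor_eq_sum, map_sum]
  refine Finset.sum_congr rfl fun i _ => ?_
  rw [trace_eq_sum]
  refine Finset.sum_congr rfl fun j _ => ?_
  simp only [LinearMap.comp_apply, TensorProduct.mk_apply]
  generalize f _ = z
  induction z with
  | zero => simp
  | add c d hc hd => simp only [map_add, hc, hd]
  | tmul m n => simp

/-- Partial trace over the second factor. Here the sum is outside because in the application every
summand vanishes separately. -/
theorem LinearMap.trace_tensor_right (f : M ⊗[k] N →ₗ[k] M ⊗[k] N) :
    LinearMap.trace k (M ⊗[k] N) f = ∑ i, LinearMap.trace k M (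
      (TensorProduct.rid k M).toLinearMap ∘ₗ ((Module.finBasis k N).coord i).lTensor M ∘ₗ f ∘ₗ
        (TensorProduct.mk k M N).flip (Module.finBasis k N i)) := by
  rw [trace_tensor_eq_sum, Finset.sum_comm]
  refine Finset.sum_congr rfl fun i _ => ?_
  rw [trace_eq_sum]
  refine Finset.sum_congr rfl fun j _ => ?_
  simp only [LinearMap.comp_apply, TensorProduct.mk_apply, LinearMap.flip_apply]
  generalize f _ = z
  induction z with
  | zero => simp
  | add c d hc hd => simp only [map_add, hc, hd]
  | tmul m n => simp [mul_comm]

end Trace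

variable {k : Type u} [Field k] {A : Type u} [Ring A] [HopfAlgebra k A]

namespace HopfAlgebra

/-- `(b S²(a₂))₁ S(a₁) ⊗ (b S²(a₂))₂ = b₁ ⊗ b₂ S²(a)`. -/
theorem comul_mul_antipode_antipode (b : A) (a : A) :
    mul' k (A ⊗[k] A) (TensorProduct.map
      (comul (R := k) ∘ₗ LinearMap.mulLeft k b ∘ₗ antipode k ∘ₗ antipode k)
      ((Algebra.TensorProduct.includeLeft : A →ₐ[k] A ⊗[k] A).toLinearMap ∘ₗ antipode k)
        (TensorProduct.comm k A A (comul (R := k) a))) =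
    comul (R := k) b * (1 ⊗ₜ antipode k (antipode k a)) := by
  rw [← comul_mul_antipode, comul_antipode]
  generalize comul (R := k) a = w
  induction w with
  | zero => simp
  | add c d hc hd => simp only [map_add, hc, hd]
  | tmul c d => simp

/-- The functional `b ↦ Tr(a ↦ (b S²(a))₁ f((b S²(a))₂))`. -/
def traceIntegral (f : Module.Dual k A) : Module.Dual k A :=
  LinearMap.trace k A ∘ₗ
    ((LinearMap.llcomp k A A A) (leftConv f) ∘ₗ (LinearMap.llcomp k A A A).flip
      (antipode k ∘ₗ antipode k) ∘ₗ LinearMap.mul k A)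

theorem traceIntegral_apply (f : Module.Dual k A) (b : A) : traceIntegral f b =
    LinearMap.trace k A (leftConv f ∘ₗ LinearMap.mulLeft k b ∘ₗ antipode k ∘ₗ antipode k) := rfl

variable [Module.Finite k A]

/-- If all these traces vanished, every value `f(b)` would vanish as well: cyclicity of the trace
rewrites `f(b)`, the trace of a rank-one map, as a sum of values of trace functionals. -/
theorem exists_traceIntegral_ne_zero [Nontrivial A] :
    ∃ f : Module.Dual k A, traceIntegral f ≠ 0 := by
  by_contra! h
  have h1 : ∀ (f : Module.Dual k A) (b : A), f b = 0 := by
    intro f b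
    let C : A →ₗ[k] A ⊗[k] A := (leftConv f).lTensor A ∘ₗ comul
    let β : A →ₗ[k] A := LinearMap.mulLeft k b ∘ₗ antipode k
    let m : A ⊗[k] A →ₗ[k] A := mul' k A ∘ₗ (antipode k).rTensor A
    -- With `C(z) = z₁ ⊗ z₂ f(z₃)`, `β(a) = b S(a)` and `m(x ⊗ y) = S(x) y`, the composite is `a ↦
    -- f(b S(a)) 1`, whose trace is its functional at `1`.
    have h2 : LinearMap.trace k A (m ∘ₗ C ∘ₗ β) = f b := by
      have e : m ∘ₗ C ∘ₗ β = (f ∘ₗ β).smulRight (1 : A) := by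
        refine LinearMap.ext fun a => ?_
        rw [LinearMap.smulRight_apply, ← Algebra.algebraMap_eq_smul_one, LinearMap.comp_apply f,
          ← mul_antipode_leftConv]
        simp only [m, C, LinearMap.comp_apply]
        generalize comul (R := k) (β a) = w
        induction w with
        | zero => simp
        | add c d hc hd => simp only [map_add, hc, hd]
        | tmul c d => rfl
      rw [e, LinearMap.trace_smulRight]
      simp [β]
    -- The composite in the other order is `x ⊗ y ↦ C(b S(y) S²(x))`. For a fixed basis vector `y`
    -- and its coordinate functional, the partial trace is again a `traceIntegral`, at the element
    -- `b S(y)`.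
    have h3 : LinearMap.trace k (A ⊗[k] A) ((C ∘ₗ β) ∘ₗ m) = 0 := by
      rw [LinearMap.trace_tensor_right]
      refine Finset.sum_eq_zero fun i _ => ?_
      let b' : A := b * antipode k (Module.finBasis k A i)
      have e : (TensorProduct.rid k A).toLinearMap ∘ₗ
          ((Module.finBasis k A).coord i).lTensor A ∘ₗ ((C ∘ₗ β) ∘ₗ m) ∘ₗ
            (TensorProduct.mk k A A).flip (Module.finBasis k A i) =
          leftConv ((Module.finBasis k A).coord i ∘ₗ leftConv f) ∘ₗ
            LinearMap.mulLeft k b' ∘ₗ antipode k ∘ₗ antipode k := by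
        refine LinearMap.ext fun a => ?_
        simp only [leftConv, C, β, m, b', LinearMap.comp_apply, TensorProduct.mk_apply,
          LinearMap.flip_apply, LinearMap.rTensor_tmul, LinearMap.mul'_apply,
          LinearMap.mulLeft_apply, antipode_mul_antidistrib, mul_assoc, LinearEquiv.coe_coe]
        generalize comul (R := k) (A := A) _ = w
        induction w with
        | zero => simp
        | add c d hc hd => simp only [map_add, hc, hd]
        | tmul c d => simp
      rw [e]
      exact LinearMap.congr_fun (h _) b'
    rw [← h2, ← LinearMap.trace_comp_comm' m (C ∘ₗ β), h3]
  obtain ⟨a, ha⟩ := exists_ne (0 : A)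
  exact ha ((Module.forall_dual_apply_eq_zero_iff k a).1 fun f => h1 f a)

/-- This is the integral property `b₁ l(b₂) = l(b) 1`. Paired with a functional `ξ`, the two sides
are the traces of `N ∘ Δ` and `Δ ∘ N` for one map `N : A ⊗ A → A`, so they agree by cyclicity. -/
theorem leftConv_traceIntegral (f : Module.Dual k A) (b : A) :
    leftConv (traceIntegral f) b = algebraMap k A (traceIntegral f b) := by
  rw [← sub_eq_zero, ← Module.forall_dual_apply_eq_zero_iff k]
  intro ξ
  rw [map_sub, sub_eq_zero, Algebra.algebraMap_eq_smul_one, map_smul, smul_eq_mul]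
  let q : A →ₗ[k] A := antipode k ∘ₗ antipode k
  let ω : A ⊗[k] A →ₗ[k] A := (TensorProduct.lid k A).toLinearMap ∘ₗ TensorProduct.map ξ (leftConv f)
  -- `N(x ⊗ y) = ω(Δ(b S²(y)) (S(x) ⊗ 1))`, chosen so that `comul_mul_antipode_antipode` simplifies
  -- it on `Δ(a)` to `ω(Δ(b) (1 ⊗ S²(a)))`.
  let N : A ⊗[k] A →ₗ[k] A := ω ∘ₗ mul' k (A ⊗[k] A) ∘ₗ (TensorProduct.map
      (comul (R := k) ∘ₗ LinearMap.mulLeft k b ∘ₗ q)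
      ((Algebra.TensorProduct.includeLeft : A →ₐ[k] A ⊗[k] A).toLinearMap ∘ₗ antipode k)) ∘ₗ
        (TensorProduct.comm k A A).toLinearMap
  have h1 : ξ (leftConv (traceIntegral f) b) = LinearMap.trace k A (N ∘ₗ comul) := by
    have e : N ∘ₗ comul = ω ∘ₗ LinearMap.mulLeft k (comul (R := k) b) ∘ₗ
        TensorProduct.mk k A A 1 ∘ₗ q :=
      LinearMap.ext fun a => congrArg ω (comul_mul_antipode_antipode b a)
    rw [e, leftConv]
    simp only [LinearMap.comp_apply]
    generalize comul (R := k) b = w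
    induction w with
    | zero => simp
    | add c d hc hd =>
      have : LinearMap.mulLeft k (c + d) = LinearMap.mulLeft k c + LinearMap.mulLeft k d :=
        map_add (LinearMap.mul k (A ⊗[k] A)) c d
      rw [this, LinearMap.add_comp, LinearMap.comp_add, map_add, map_add, map_add, map_add, hc, hd]
    | tmul c d =>
      have : ω ∘ₗ LinearMap.mulLeft k (c ⊗ₜ[k] d) ∘ₗ TensorProduct.mk k A A 1 ∘ₗ q =
          ξ c • (leftConv f ∘ₗ LinearMap.mulLeft k d ∘ₗ q) :=
        LinearMap.ext fun a => by simp [ω]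
      rw [this, map_smul]
      simp [traceIntegral_apply, q, mul_comm]
  -- Put `z = b S²(v)`. The partial trace over the first factor contracts a basis with its
  -- coordinates and leaves `ξ(z₁ S(z₂))` times `leftConv f z₃`, which is `ξ(1)` times `leftConv f
  -- z`.
  have h2 : LinearMap.trace k (A ⊗[k] A) (comul ∘ₗ N) = traceIntegral f b * ξ 1 := by
    rw [LinearMap.trace_tensor_left, traceIntegral_apply, mul_comm, ← smul_eq_mul, ← map_smul]
    congr 1
    refine LinearMap.ext fun v => ?_
    rw [LinearMap.sum_apply]
    let z := b * q v
    let Φ : A ⊗[k] (A ⊗[k] A) →ₗ[k] A := (TensorProduct.lid k A).toLinearMap ∘ₗ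
      TensorProduct.map (ξ ∘ₗ mul' k A ∘ₗ (antipode k).lTensor A) (leftConv f) ∘ₗ
        (TensorProduct.assoc k A A A).symm.toLinearMap
    have h3 := congrArg Φ (coassoc_apply (R := k) z)
    have e1 : ∀ w : A ⊗[k] A, Φ (TensorProduct.assoc k A A A ((comul (R := k)).rTensor A w)) =
        ξ 1 • leftConv f (TensorProduct.lid k A ((counit (R := k)).rTensor A w)) := by
      intro w
      induction w with
      | zero => simp
      | add c d hc hd => simp only [map_add, smul_add, hc, hd]
      | tmul c d =>
        simp only [Φ, LinearMap.comp_apply, LinearEquiv.coe_coe, LinearEquiv.symm_apply_apply,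
          LinearMap.rTensor_tmul, TensorProduct.map_tmul, mul_antipode_lTensor_comul_apply,
          TensorProduct.lid_tmul, Algebra.algebraMap_eq_smul_one, map_smul, smul_eq_mul, smul_smul,
          mul_comm]
    have e2 : ∀ w : A ⊗[k] A, (∑ i, TensorProduct.lid k A (((Module.finBasis k A).coord i).rTensor A
        (comul (R := k) (ω (w * (antipode k (Module.finBasis k A i) ⊗ₜ 1)))))) =
        Φ ((comul (R := k)).lTensor A w) := by
      intro w
      induction w with
      | zero => simp
      | add c d hc hd => simp only [map_add, add_mul, Finset.sum_add_distrib, hc, hd]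
      | tmul c d =>
        simp only [Algebra.TensorProduct.tmul_mul_tmul, mul_one, ω, LinearMap.comp_apply,
          TensorProduct.map_tmul, LinearEquiv.coe_coe, TensorProduct.lid_tmul, map_smul,
          comul_leftConv, LinearMap.lTensor_tmul]
        generalize comul (R := k) d = y
        induction y with
        | zero => simp
        | add c d hc hd => simp only [map_add, tmul_add, smul_add, Finset.sum_add_distrib, hc, hd]
        | tmul x y =>
          simp only [LinearMap.lTensor_tmul, LinearMap.rTensor_tmul, TensorProduct.lid_tmul, Φ,
            LinearMap.comp_apply, LinearEquiv.coe_coe, TensorProduct.assoc_symm_tmul,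
            TensorProduct.map_tmul, LinearMap.mul'_apply, smul_smul, ← Finset.sum_smul]
          congr 1
          have hx := (Module.finBasis k A).sum_repr x
          conv_rhs => rw [← hx]
          simp only [map_sum, map_smul, Finset.mul_sum, mul_smul_comm, smul_eq_mul,
            Module.Basis.coord_apply, mul_comm]
    rw [e1, rTensor_counit_comul, TensorProduct.lid_tmul, one_smul] at h3
    refine Eq.trans (Finset.sum_congr rfl fun i _ => ?_) ((e2 (comul (R := k) z)).trans h3.symm)
    rfl
  rw [h1, ← h2, LinearMap.trace_comp_comm']

/-- Let `l` be a nonzero functional with `b₁ l(b₂) = l(b) 1`. If `S(a) = 0`, then `l(b S(a₁)) a₂ =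
0` for all `b`. Replacing `b` by `b S²(-)` and using `S²(a₂) S(a₁) = ε(a)` turns this into `l(b) a =
0`. -/
theorem antipode_injective : Function.Injective (antipode k (A := A)) := by
  refine (injective_iff_map_eq_zero _).2 fun a ha => ?_
  by_contra ha'
  haveI : Nontrivial A := ⟨a, 0, ha'⟩
  obtain ⟨f, hf⟩ := exists_traceIntegral_ne_zero (k := k) (A := A)
  set l := traceIntegral f with hl
  have hl' : ∀ b, leftConv l b = algebraMap k A (l b) := leftConv_traceIntegral f
  obtain ⟨b, hb⟩ : ∃ b, l b ≠ 0 := by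
    by_contra! h
    exact hf (LinearMap.ext h)
  let Θ : A → A ⊗[k] A →ₗ[k] A := fun b => (TensorProduct.lid k A).toLinearMap ∘ₗ
    (l ∘ₗ LinearMap.mulLeft k b ∘ₗ antipode k).rTensor A
  -- Apply `id ⊗ l` to `comul_mul_antipode`. The right side contains `S(a) = 0`, and on the left the
  -- integral property removes the first leg of `Δ(b S(a₁))`.
  have h1 : ∀ b, Θ b (comul (R := k) a) = 0 := by
    intro b
    have h := congrArg (fun w => TensorProduct.rid k A (l.lTensor A w)) (comul_mul_antipode b a)
    simp only [ha, tmul_zero, mul_zero, map_zero] at h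
    rw [← h]
    generalize comul (R := k) a = w
    induction w with
    | zero => simp
    | add c d hc hd => simp only [map_add, hc, hd]
    | tmul c d =>
      have e : ∀ w : A ⊗[k] A, TensorProduct.rid k A (l.lTensor A (w * (d ⊗ₜ 1))) =
          TensorProduct.rid k A (l.lTensor A w) * d := by
        intro w
        induction w with
        | zero => simp
        | add c d hc hd => simp only [map_add, add_mul, hc, hd]
        | tmul c d => simp
      have e' := hl' (b * antipode k c)
      rw [leftConv, LinearMap.comp_apply, LinearMap.comp_apply, LinearEquiv.coe_coe] at e'
      simp only [Θ, TensorProduct.map_tmul, LinearMap.mul'_apply, AlgHom.toLinearMap_apply,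
        Algebra.TensorProduct.includeLeft_apply, e, LinearMap.comp_apply, LinearMap.mulLeft_apply,
        e', LinearMap.rTensor_tmul, LinearEquiv.coe_coe, TensorProduct.lid_tmul, Algebra.smul_def]
  let q : A →ₗ[k] A := antipode k ∘ₗ antipode k
  let Φ : A ⊗[k] (A ⊗[k] A) →ₗ[k] A := (TensorProduct.lid k A).toLinearMap ∘ₗ
    (l ∘ₗ LinearMap.mulLeft k b ∘ₗ mul' k A ∘ₗ TensorProduct.map q (antipode k) ∘ₗ
      (TensorProduct.comm k A A).toLinearMap).rTensor A ∘ₗ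
        (TensorProduct.assoc k A A A).symm.toLinearMap
  have h2 := congrArg Φ (coassoc_apply (R := k) a)
  have e1 : ∀ w : A ⊗[k] A, Φ (TensorProduct.assoc k A A A ((comul (R := k)).rTensor A w)) =
      l b • TensorProduct.lid k A ((counit (R := k)).rTensor A w) := by
    intro w
    induction w with
    | zero => simp
    | add c d hc hd => simp only [map_add, smul_add, hc, hd]
    | tmul c d =>
      have := antipode_antipode_mul (k := k) c
      simp only [Φ, q, LinearMap.comp_apply, LinearEquiv.coe_coe, LinearEquiv.symm_apply_apply,
        LinearMap.rTensor_tmul, this, TensorProduct.lid_tmul, Algebra.algebraMap_eq_smul_one,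
        map_smul, LinearMap.mulLeft_apply, mul_one, smul_eq_mul, smul_smul, mul_comm]
  -- In `l(b S²(y) S(x)) z` the factor `S²(y)` depends on the argument, whereas `h1` is about a
  -- fixed `b`. Expanding `S²(y)` in a basis moves the dependence into the coordinates and leaves
  -- `Θ` at the fixed elements `b eⱼ`.
  have e2 : ∀ w : A ⊗[k] A, Φ ((comul (R := k)).lTensor A w) =
      ∑ j, TensorProduct.lid k A (((Module.finBasis k A).coord j ∘ₗ q).rTensor A
        (comul (R := k) (Θ (b * Module.finBasis k A j) w))) := by
    intro w
    induction w with
    | zero => simp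
    | add c d hc hd => simp only [map_add, Finset.sum_add_distrib, hc, hd]
    | tmul c d =>
      simp only [Θ, LinearMap.comp_apply, LinearMap.lTensor_tmul, LinearMap.rTensor_tmul,
        LinearEquiv.coe_coe, TensorProduct.lid_tmul, map_smul, LinearMap.mulLeft_apply]
      generalize comul (R := k) d = y
      induction y with
      | zero => simp
      | add c d hc hd => simp only [map_add, tmul_add, smul_add, Finset.sum_add_distrib, hc, hd]
      | tmul x y =>
        simp only [Φ, LinearMap.comp_apply, LinearEquiv.coe_coe, TensorProduct.assoc_symm_tmul,
          LinearMap.rTensor_tmul, TensorProduct.comm_tmul, TensorProduct.map_tmul,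
          LinearMap.mul'_apply, TensorProduct.lid_tmul, smul_smul, ← Finset.sum_smul,
          LinearMap.mulLeft_apply]
        congr 1
        have hx := (Module.finBasis k A).sum_repr (q x)
        conv_lhs => rw [← hx]
        simp only [map_sum, map_smul, Finset.sum_mul, Finset.mul_sum, mul_smul_comm,
          smul_mul_assoc, smul_eq_mul, Module.Basis.coord_apply, mul_comm, mul_assoc]
  rw [e1, rTensor_counit_comul, e2, TensorProduct.lid_tmul, one_smul] at h2
  simp only [h1, map_zero, Finset.sum_const_zero] at h2
  exact (smul_eq_zero.1 h2).elim hb ha'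

end HopfAlgebra
end Integral

/-- Sweedler sums indexed by `Fin n`, the form in which coproducts enter `IsCoaction`, `IsSMul` and
`IsYetterDrinfeld`. -/
theorem TensorProduct.exists_sum_fin {k M N : Type u} [Field k] [AddCommGroup M] [Module k M]
    [AddCommGroup N] [Module k N] (z : M ⊗[k] N) :
    ∃ (n : ℕ) (a : Fin n → M) (b : Fin n → N), z = ∑ i, a i ⊗ₜ[k] b i := by
  obtain ⟨S, hS⟩ := TensorProduct.exists_finset z
  refine ⟨S.card, fun i => (S.equivFin.symm i).1.1, fun i => (S.equivFin.symm i).1.2, ?_⟩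
  rw [hS, ← Finset.sum_coe_sort]
  exact (Equiv.sum_comp S.equivFin.symm (fun i : S => i.1.1 ⊗ₜ[k] i.1.2)).symm

/-! ### Elements of tensor products and the internal Hom adjunction. -/

section Basic
variable {k : Type u} [Field k] {A : Type u} [Ring A] [Bialgebra k A]
  {K : Type u} [Ring K] [Algebra k K] [ComoduleAlgebra k A K]
namespace FDMod

theorem lin_comp_apply {M N L : FDMod k K} (f : M ⟶ N) (g : N ⟶ L) (m : M) :
    lin (f ≫ g) m = lin g (lin f m) := rfl

theorem lin_id_apply {M : FDMod k K} (m : M) : lin (𝟙 M) m = m := rfl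

@[simp]
theorem lin_tensHom_pure {X Y : FDMod k A} {M N : FDMod k K} (f : X ⟶ Y) (g : M ⟶ N) (x : X)
    (m : M) : lin (tensHom f g) (pure X M x m) = pure Y N (lin f x) (lin g m) := rfl

@[simp]
theorem lin_tensAssoc_hom_pure (X Y : FDMod k A) (M : FDMod k K) (x : X) (y : Y) (m : M) :
    lin (tensAssoc X Y M).hom (pure (tens X Y) M (pure X Y x y) m) =
      pure X (tens Y M) x (pure Y M y m) := rfl

@[simp]
theorem lin_tensAssoc_inv_pure (X Y : FDMod k A) (M : FDMod k K) (x : X) (y : Y) (m : M) :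
    lin (tensAssoc X Y M).inv (pure X (tens Y M) x (pure Y M y m)) =
      pure (tens X Y) M (pure X Y x y) m := rfl

@[simp]
theorem lin_tensUnit_hom_pure (M : FDMod k K) (r : k) (m : M) :
    lin (tensUnit (A := A) M).hom (pure unit M r m) = r • m := rfl

@[elab_as_elim]
theorem tens_induction {X : FDMod k A} {M : FDMod k K} {p : tens X M → Prop} (z : tens X M)
    (zero : p 0) (pure : ∀ x m, p (pure X M x m)) (add : ∀ x y, p x → p y → p (x + y)) : p z :=
  TensorProduct.induction_on z zero pure add

theorem tens_lin_ext {X : FDMod k A} {M : FDMod k K} {N : Type u} [AddCommGroup N] [Module k N]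
    {f g : tens X M →ₗ[k] N} (h : ∀ x m, f (pure X M x m) = g (pure X M x m)) : f = g :=
  TensorProduct.ext' h

theorem tens_ext_right {X Y : FDMod k A} {M N : FDMod k K} {f g : tens X (tens Y M) ⟶ N}
    (h : ∀ x y m, lin f (pure X (tens Y M) x (pure Y M y m)) =
      lin g (pure X (tens Y M) x (pure Y M y m))) : f = g :=
  tens_ext fun x z => LinearMap.congr_fun
    (f := lin f ∘ₗ pure X (tens Y M) x) (g := lin g ∘ₗ pure X (tens Y M) x)
    (tens_lin_ext fun y m => h x y m) z

theorem tens_ext_threefold {X Y : FDMod k A} {M N : FDMod k K} {f g : tens (tens X Y) M ⟶ N}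
    (h : ∀ x y m, lin f (pure (tens X Y) M (pure X Y x y) m) =
      lin g (pure (tens X Y) M (pure X Y x y) m)) : f = g :=
  hom_ext (TensorProduct.ext_threefold h)

/-- The map `ξ ⊗ id` from `X ⊗ M` to `M`. -/
def slice {X : FDMod k A} (M : FDMod k K) (ξ : Module.Dual k X) : tens X M →ₗ[k] M :=
  (TensorProduct.lid k M).toLinearMap ∘ₗ ξ.rTensor M

@[simp]
theorem slice_pure {X : FDMod k A} {M : FDMod k K} (ξ : Module.Dual k X) (x : X) (m : M) :
    slice M ξ (pure X M x m) = ξ x • m := rfl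

/-- Expand the first factor in a basis of the finite-dimensional space `X`. Pairing with functionals
on `X` replaces maps into `X ⊗ M` by maps out of its dual, both in the balancing condition and in
the treatment of `X ▷ F`. -/
theorem eq_of_slice {X : FDMod k A} {M : FDMod k K} {z w : tens X M}
    (h : ∀ ξ, slice M ξ z = slice M ξ w) : z = w := by
  let b := Module.finBasis k X
  have h1 : ∀ z : X ⊗[k] M, z = ∑ i, b i ⊗ₜ[k] slice M (b.coord i) z := by
    intro z
    induction z with
    | zero => exact (Finset.sum_eq_zero fun i _ =>
        (congrArg (b i ⊗ₜ[k] ·) (map_zero (slice M (b.coord i)))).trans (tmul_zero _ _)).symm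
    | add x y hx hy =>
      have e : ∀ i, slice M (b.coord i) (x + y) = slice M (b.coord i) x + slice M (b.coord i) y :=
        fun i => map_add _ _ _
      simp only [e, tmul_add, Finset.sum_add_distrib]
      rw [← hx, ← hy]
    | tmul x m =>
      have e : ∀ i, slice M (b.coord i) (x ⊗ₜ[k] m) = b.coord i x • m := fun i => rfl
      simp only [e, tmul_smul, smul_tmul', ← sum_tmul]
      congr 1
      exact (b.sum_repr x).symm
  rw [h1 z, h1 w]
  exact Finset.sum_congr rfl fun i _ => by rw [h]

theorem tens_act_pure (X : FDMod k A) (M : FDMod k K) {b : K} {n : ℕ} {a : Fin n → A}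
    {c : Fin n → K} (h : ComoduleAlgebra.coact (k := k) (A := A) b = ∑ i, a i ⊗ₜ[k] c i) (x : X) (m : M) :
    (tens X M).act b (pure X M x m) = ∑ i, pure X M (X.act (a i) x) (M.act (c i) m) := by
  have e : tensorAct X.act M.act (∑ i, a i ⊗ₜ[k] c i) (x ⊗ₜ m) =
      ∑ i, X.act (a i) x ⊗ₜ[k] M.act (c i) m := by simp
  rw [← h] at e
  exact e

variable [Module.Finite k A]

@[simp]
theorem phi_pure {X : FDMod k A} {M N : FDMod k K} (g : X ⟶ uHom (A := A) M N) (x : X) (m : M) :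
    lin (phi g) (pure X M x m) = uEval 1 (lin g x) m := rfl

@[simp]
theorem uEval_psi {X : FDMod k A} {M N : FDMod k K} (f : tens X M ⟶ N) (h : A) (x : X) (m : M) :
    uEval h (lin (psi f) x) m = lin f (pure X M (X.act h x) m) := rfl

theorem uHom_ext {M N : FDMod k K} {α β : uHom (A := A) M N}
    (h : ∀ a m, uEval a α m = uEval a β m) : α = β :=
  tens_ext h

/-- By `A`-linearity the value of the image of `x` at `a ⊗ m` is the value of the image of `a x` at
`1 ⊗ m`, so evaluation at `1` detects everything. -/
theorem hom_uHom_ext {X : FDMod k A} {M N : FDMod k K} {f g : X ⟶ uHom (A := A) M N}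
    (h : ∀ x m, uEval (1 : A) (lin f x) m = uEval 1 (lin g x) m) : f = g := by
  refine hom_ext (LinearMap.ext fun x => uHom_ext fun a m => ?_)
  have := h (X.act a x) m
  rwa [lin_act, lin_act, uEval_act, uEval_act, one_mul] at this

/-- Together with `psi_phi` this is the adjunction between `- ⊗ M` and `uHom(M, -)`. Identities
between morphisms into internal Homs are checked after applying `phi`. -/
theorem phi_psi {X : FDMod k A} {M N : FDMod k K} (f : tens X M ⟶ N) : phi (psi f) = f :=
  tens_ext fun x m => by rw [phi_pure, uEval_psi, map_one]; rfl

theorem psi_phi {X : FDMod k A} {M N : FDMod k K} (g : X ⟶ uHom (A := A) M N) :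
    psi (phi g) = g :=
  hom_uHom_ext fun x m => by rw [uEval_psi, phi_pure, map_one]; rfl

theorem phi_injective {X : FDMod k A} {M N : FDMod k K} {f g : X ⟶ uHom (A := A) M N}
    (h : phi f = phi g) : f = g := by
  rw [← psi_phi f, h, psi_phi]

theorem phi_comp_left {X Y : FDMod k A} {M N : FDMod k K} (f : Y ⟶ X)
    (g : X ⟶ uHom (A := A) M N) : phi (f ≫ g) = tensHom f (𝟙 M) ≫ phi g :=
  tens_ext fun _ _ => rfl

theorem phi_comp_uHomMap_id {X : FDMod k A} {M N N' : FDMod k K} (g : X ⟶ uHom (A := A) M N)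
    (f' : N ⟶ N') : phi (g ≫ uHomMap (𝟙 M) f') = phi g ≫ f' :=
  tens_ext fun _ _ => rfl

theorem phi_comp_id_uHomMap {X : FDMod k A} {M M' N : FDMod k K} (g : X ⟶ uHom (A := A) M N)
    (f : M' ⟶ M) : phi (g ≫ uHomMap f (𝟙 N)) = tensHom (𝟙 X) f ≫ phi g :=
  tens_ext fun _ _ => rfl

theorem uEval_eq_phi {X : FDMod k A} {M N : FDMod k K} (g : X ⟶ uHom (A := A) M N) (h : A)
    (x : X) (m : M) : uEval h (lin g x) m = lin (phi g) (pure X M (X.act h x) m) := by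
  rw [phi_pure, lin_act, uEval_act, one_mul]

end FDMod
end Basic

/-! ### Inverting `R` by the antipode in its second leg. -/

section RIdentities

variable {k : Type u} [Field k] {T : Type u} [Ring T] [HopfAlgebra k T] {R : RMatrix k T}

/-- A presentation `R = ∑ i ∈ S, i.1 ⊗ i.2` of an `R`-matrix. -/
theorem RMatrix.sum_antipode_mul {S : Finset (T × T)}
    (hS : (R.R : T ⊗[k] T) = ∑ i ∈ S, i.1 ⊗ₜ[k] i.2) :
    ∑ i ∈ S, ∑ j ∈ S, (i.1 * j.1) ⊗ₜ[k] (HopfAlgebra.antipode k j.2 * i.2) = 1 ⊗ₜ 1 := by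
  -- Contract the last two legs of `(id ⊗ Δ)(R) = R₁₃ R₁₂` by `s ⊗ t ↦ S(s) t`; the left side
  -- becomes `1 ⊗ 1` by the counit axiom.
  have h := Boson.id_comul_sum hS ((LinearMap.mul' k T ∘ₗ
    (HopfAlgebra.antipode k).rTensor T).lTensor T)
  have h2 := congrArg (fun t : T => t ⊗ₜ[k] (1 : T)) (Boson.id_counit_sum hS)
  simp only [LinearMap.lTensor_tmul, LinearMap.comp_apply, LinearMap.rTensor_tmul,
    LinearMap.mul'_apply, HopfAlgebra.mul_antipode_rTensor_comul_apply] at h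
  rw [← h, ← h2, sum_tmul]
  exact Finset.sum_congr rfl fun i _ => by
    rw [Algebra.algebraMap_eq_smul_one, tmul_smul, smul_tmul']

theorem RMatrix.sum_mul_antipode {S : Finset (T × T)}
    (hS : (R.R : T ⊗[k] T) = ∑ i ∈ S, i.1 ⊗ₜ[k] i.2) :
    ∑ i ∈ S, ∑ j ∈ S, (i.1 * j.1) ⊗ₜ[k] (j.2 * HopfAlgebra.antipode k i.2) = 1 ⊗ₜ 1 := by
  -- The contraction `s ⊗ t ↦ s S(t)` gives the identity on the other side: `(id ⊗ S)(R)` is a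
  -- two-sided inverse of `R` in `T ⊗ Tᵒᵖ`.
  have h := Boson.id_comul_sum hS ((LinearMap.mul' k T ∘ₗ
    (HopfAlgebra.antipode k).lTensor T).lTensor T)
  have h2 := congrArg (fun t : T => t ⊗ₜ[k] (1 : T)) (Boson.id_counit_sum hS)
  simp only [LinearMap.lTensor_tmul, LinearMap.comp_apply,
    LinearMap.mul'_apply, HopfAlgebra.mul_antipode_lTensor_comul_apply] at h
  rw [← h, ← h2, sum_tmul]
  exact Finset.sum_congr rfl fun i _ => by
    rw [Algebra.algebraMap_eq_smul_one, tmul_smul, smul_tmul']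

/-- If `D` and `G` are maps between `T`-modules, then `G(e) = S(R²) D(R¹ e)` if and only if
`D(e) = R² G(R¹ e)`. -/
theorem RMatrix.eq_sum_antipode_iff {S : Finset (T × T)}
    (hS : (R.R : T ⊗[k] T) = ∑ i ∈ S, i.1 ⊗ₜ[k] i.2) {E W : Type u} [AddCommGroup E] [Module k E]
    [AddCommGroup W] [Module k W] (f : T →ₐ[k] Module.End k E) (g : T →ₐ[k] Module.End k W)
    (D G : E →ₗ[k] W) :
    (∀ e, G e = ∑ i ∈ S, g (HopfAlgebra.antipode k i.2) (D (f i.1 e))) ↔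
      ∀ e, D e = ∑ i ∈ S, g i.2 (G (f i.1 e)) := by
  -- On `Hom(E, W)` the operators `D ↦ R² D(R¹ -)` and `D ↦ S(R²) D(R¹ -)` are mutually inverse. The
  -- two preceding identities, evaluated by `Ψ`, give the two composites.
  let Ψ : (E →ₗ[k] W) → E → T ⊗[k] T →ₗ[k] W := fun D e =>
    TensorProduct.lift (LinearMap.flip g.toLinearMap ∘ₗ D ∘ₗ LinearMap.flip f.toLinearMap e)
  have hΨ : ∀ D e (s t : T), Ψ D e (s ⊗ₜ t) = g t (D (f s e)) := fun _ _ _ _ => rfl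
  constructor
  · intro h e
    have h1 := congrArg (Ψ D e) (RMatrix.sum_mul_antipode hS)
    simp only [map_sum, hΨ, map_one, map_mul, Module.End.mul_apply, Module.End.one_apply] at h1
    rw [← h1, Finset.sum_comm]
    simp only [h, map_sum]
  · intro h e
    have h1 := congrArg (Ψ G e) (RMatrix.sum_antipode_mul hS)
    simp only [map_sum, hΨ, map_one, map_mul, Module.End.mul_apply, Module.End.one_apply] at h1
    rw [← h1, Finset.sum_comm]
    simp only [h, map_sum]

end RIdentities

/-! ### Balanced families are transformations of module functors. -/

section ModuleTrans

variable {k : Type u} [Field k] {T : Type u} [Ring T] [HopfAlgebra k T]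
  {R : RMatrix k T} {H : Type u} [Ring H] [Algebra k H] [Coalgebra k H]
  [Module T H] [IsScalarTower k T H] {hH : BraidedHopf R H}

namespace FDMod

theorem infl_act_inT (V : FDMod k T) (t : T) (v : infl hH V) :
    (infl hH V).act (Boson.inT hH t) v = V.act t v :=
  congrArg (fun t => V.act t v) (Boson.proj_inT hH t)

/-- A functional on `V` as an element of `(V*)_π`. -/
def dualMk (V : FDMod k T) : Module.Dual k (infl hH V) →ₗ[k] infl hH (dual V) := LinearMap.id

theorem dualMk_surjective (V : FDMod k T) :
    Function.Surjective (dualMk (hH := hH) V) := fun j => ⟨j, rfl⟩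

theorem act_dualMk (V : FDMod k T) (t : T) (j : Module.Dual k (infl hH V)) :
    (infl hH (dual V)).act (Boson.inT hH t) (dualMk V j) =
      dualMk V (j ∘ₗ (infl hH V).act (Boson.inT hH (HopfAlgebra.antipode k t))) := by
  refine (infl_act_inT (dual V) t j).trans (LinearMap.ext fun v => ?_)
  exact congrArg j (infl_act_inT V _ v).symm

theorem lin_evalHom_pure (V : FDMod k T) (j : Module.Dual k (infl hH V)) (v : infl hH V) :
    lin (evalHom hH V) (pure (infl hH (dual V)) (infl hH V) (dualMk V j) v) = j v := rfl

/-- The half-braiding is defined as the inverse of this map. Its inverse is therefore the direction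
with `R` and not `R⁻¹`, and only that direction is needed on elements. -/
theorem lin_braid_inv_pure {S : Finset (T × T)}
    (hS : (R.R : T ⊗[k] T) = ∑ i ∈ S, i.1 ⊗ₜ[k] i.2) (V : FDMod k T) (X : FDMod k (Boson hH))
    (x : X) (v : infl hH V) : lin (braid hH V X).inv (pure X (infl hH V) x v) =
      ∑ i ∈ S, pure (infl hH V) X ((infl hH V).act (Boson.inT hH i.2) v)
        (X.act (Boson.inT hH i.1) x) := by
  have e : TensorProduct.comm k X V (tensorAct X.act V.act (Boson.rElt hH) (x ⊗ₜ v)) =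
      ∑ i ∈ S, V.act i.2 v ⊗ₜ[k] X.act (Boson.inT hH i.1) x := by
    rw [Boson.rElt, hS]
    simp only [map_sum, LinearMap.sum_apply, Algebra.TensorProduct.map_tmul]
    rfl
  refine Eq.trans e (Finset.sum_congr rfl fun i _ => ?_)
  exact congrArg (fun w => w ⊗ₜ[k] X.act (Boson.inT hH i.1) x) (infl_act_inT V i.2 v).symm

end FDMod

open FDMod

variable [Module.Finite k T] [Module.Finite k H]
  {K : Type u} [Ring K] [Algebra k K] [ComoduleAlgebra k (Boson hH) K]

namespace VFunctor

/-- A natural transformation `E ⊗ - → F` of module functors over `Rep(T)`. -/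
structure IsModuleTrans (Φ : VFunctor hH K) (E : FDMod k (Boson hH))
    (γ : ∀ M, tens E M ⟶ Φ.F.obj M) : Prop where
  natural : ∀ {M N : FDMod k K} (f : M ⟶ N), γ M ≫ Φ.F.map f = tensHom (𝟙 E) f ≫ γ N
  module : ∀ (V : FDMod k T) (M : FDMod k K), γ (tens (infl hH V) M) ≫ Φ.d V M =
    (tensAssoc E (infl hH V) M).inv ≫ tensHom (braid hH V E).inv (𝟙 M) ≫
      (tensAssoc (infl hH V) E M).hom ≫ tensHom (𝟙 (infl hH V)) (γ M)

theorem lin_braid_module {S : Finset (T × T)}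
    (hS : (R.R : T ⊗[k] T) = ∑ i ∈ S, i.1 ⊗ₜ[k] i.2) {E : FDMod k (Boson hH)} {V : FDMod k T}
    {M N : FDMod k K} (g : tens E M ⟶ N) (e : E) (v : infl hH V) (m : M) :
    lin ((tensAssoc E (infl hH V) M).inv ≫ tensHom (braid hH V E).inv (𝟙 M) ≫
      (tensAssoc (infl hH V) E M).hom ≫ tensHom (𝟙 (infl hH V)) g)
      (pure E (tens (infl hH V) M) e (pure (infl hH V) M v m)) =
    ∑ i ∈ S, pure (infl hH V) N ((infl hH V).act (Boson.inT hH i.2) v)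
      (lin g (pure E M (E.act (Boson.inT hH i.1) e) m)) := by
  simp only [lin_comp_apply, lin_tensAssoc_inv_pure, lin_tensHom_pure, lin_id_apply,
    lin_braid_inv_pure hS, map_sum, LinearMap.sum_apply, lin_tensAssoc_hom_pure]

theorem module_of_apply {Φ : VFunctor hH K} {E : FDMod k (Boson hH)}
    {γ : ∀ M, tens E M ⟶ Φ.F.obj M} {S : Finset (T × T)}
    (hS : (R.R : T ⊗[k] T) = ∑ i ∈ S, i.1 ⊗ₜ[k] i.2) {V : FDMod k T} {M : FDMod k K}
    (h : ∀ (e : E) (v : infl hH V) (m : M), lin (Φ.d V M) (lin (γ (tens (infl hH V) M))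
      (pure E (tens (infl hH V) M) e (pure (infl hH V) M v m))) =
    ∑ i ∈ S, pure (infl hH V) (Φ.F.obj M) ((infl hH V).act (Boson.inT hH i.2) v)
      (lin (γ M) (pure E M (E.act (Boson.inT hH i.1) e) m))) :
    γ (tens (infl hH V) M) ≫ Φ.d V M =
    (tensAssoc E (infl hH V) M).inv ≫ tensHom (braid hH V E).inv (𝟙 M) ≫
      (tensAssoc (infl hH V) E M).hom ≫ tensHom (𝟙 (infl hH V)) (γ M) :=
  tens_ext_right fun e v m => (h e v m).trans (lin_braid_module hS (γ M) e v m).symm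

/-- The inverse half-braiding lets `R²` act on the functional `j`. The contragredient action turns
this into precomposition with `S(R²)`, which is where the antipode enters the balancing condition.
-/
theorem gamma_apply {S : Finset (T × T)}
    (hS : (R.R : T ⊗[k] T) = ∑ i ∈ S, i.1 ⊗ₜ[k] i.2)
    (Φ : VFunctor hH K) {X : FDMod k (Boson hH)} {V : FDMod k T} {M N : FDMod k K}
    (f : tens X M ⟶ Φ.F.obj (tens (infl hH V) N)) (x : X) (j : Module.Dual k (infl hH V)) (m : M) :
    lin (Φ.gamma V f)
        (pure X (tens (infl hH (dual V)) M) x (pure (infl hH (dual V)) M (dualMk V j) m)) =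
      ∑ i ∈ S, slice (Φ.F.obj N)
        (j ∘ₗ (infl hH V).act (Boson.inT hH (HopfAlgebra.antipode k i.2)))
        (lin (Φ.d V N) (lin f (pure X M (X.act (Boson.inT hH i.1) x) m))) := by
  simp only [gamma, lin_comp_apply, lin_tensAssoc_inv_pure, lin_tensHom_pure, lin_id_apply,
    lin_braid_inv_pure hS, map_sum, LinearMap.sum_apply, lin_tensAssoc_hom_pure, act_dualMk]
  refine Finset.sum_congr rfl fun i _ => ?_
  generalize lin (Φ.d V N) _ = z
  generalize j ∘ₗ (infl hH V).act (Boson.inT hH (HopfAlgebra.antipode k i.2)) = j'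
  induction z using tens_induction with
  | zero => simp only [map_zero]
  | add a b ha hb => simp only [map_add, ha, hb]
  | pure v n =>
    simp only [lin_tensAssoc_inv_pure, lin_tensHom_pure, lin_id_apply, slice_pure,
      lin_evalHom_pure, lin_tensUnit_hom_pure]

/-- The prebalancing is defined from the universal evaluation at the internal Hom. Naturality of the
half-braiding in `X` carries it to every morphism from `X` to the internal Hom. -/
theorem phi_comp_beta (Φ : VFunctor hH K) {X : FDMod k (Boson hH)} {V : FDMod k T}
    {M N : FDMod k K} (g : X ⟶ uHom (A := Boson hH) M (Φ.F.obj (tens (infl hH V) N))) :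
    phi (g ≫ Φ.beta V M N) = Φ.gamma V (phi g) := by
  rw [phi_comp_left, beta, phi_psi]
  refine tens_ext_right fun x j m => ?_
  obtain ⟨S, hS⟩ := Boson.exists_sum R
  obtain ⟨j, rfl⟩ := dualMk_surjective V j
  simp only [lin_comp_apply, lin_tensHom_pure, gamma_apply hS, lin_id_apply, phi_pure, lin_act]

/-- The balancing condition on elements: a scalar `j(v)` on one side, a pairing with `j ∘ S(R²)` on
the other. -/
theorem balanced_iff_apply {S : Finset (T × T)}
    (hS : (R.R : T ⊗[k] T) = ∑ i ∈ S, i.1 ⊗ₜ[k] i.2) (Φ : VFunctor hH K) (E : FDMod k (Boson hH))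
    (ξ : ∀ M, E ⟶ uHom (A := Boson hH) M (Φ.F.obj M)) (V : FDMod k T) (M : FDMod k K) :
    (ξ M ≫ uHomMap (tensHom (evalHom hH V) (𝟙 M) ≫ (tensUnit M).hom) (𝟙 (Φ.F.obj M)) =
      ξ (tens (infl hH V) M) ≫ Φ.beta V (tens (infl hH V) M) M ≫
        uHomMap (tensAssoc (infl hH (dual V)) (infl hH V) M).hom (𝟙 (Φ.F.obj M))) ↔
    ∀ (e : E) (j : Module.Dual k (infl hH V)) (v : infl hH V) (m : M),
      j v • lin (phi (ξ M)) (pure E M e m) = ∑ i ∈ S, slice (Φ.F.obj M)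
        (j ∘ₗ (infl hH V).act (Boson.inT hH (HopfAlgebra.antipode k i.2)))
        (lin (Φ.d V M) (lin (phi (ξ (tens (infl hH V) M))) (pure E (tens (infl hH V) M)
          (E.act (Boson.inT hH i.1) e) (pure (infl hH V) M v m)))) := by
  have e1 : ∀ (e : E) (j : Module.Dual k (infl hH V)) (v : infl hH V) (m : M),
      lin (phi (ξ M ≫ uHomMap (tensHom (evalHom hH V) (𝟙 M) ≫ (tensUnit M).hom)
        (𝟙 (Φ.F.obj M)))) (pure E _ e (pure _ M
          (pure (infl hH (dual V)) (infl hH V) (dualMk V j) v) m)) =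
      j v • lin (phi (ξ M)) (pure E M e m) := by
    intro e j v m
    rw [phi_comp_id_uHomMap]
    simp only [lin_comp_apply, lin_tensHom_pure, lin_id_apply,
      lin_evalHom_pure, lin_tensUnit_hom_pure, map_smul]
  have e2 : ∀ (e : E) (j : Module.Dual k (infl hH V)) (v : infl hH V) (m : M),
      lin (phi (ξ (tens (infl hH V) M) ≫ Φ.beta V (tens (infl hH V) M) M ≫
        uHomMap (tensAssoc (infl hH (dual V)) (infl hH V) M).hom (𝟙 (Φ.F.obj M))))
          (pure E _ e (pure _ M (pure (infl hH (dual V)) (infl hH V) (dualMk V j) v) m)) =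
      ∑ i ∈ S, slice (Φ.F.obj M)
        (j ∘ₗ (infl hH V).act (Boson.inT hH (HopfAlgebra.antipode k i.2)))
        (lin (Φ.d V M) (lin (phi (ξ (tens (infl hH V) M))) (pure E (tens (infl hH V) M)
          (E.act (Boson.inT hH i.1) e) (pure (infl hH V) M v m)))) := by
    intro e j v m
    rw [← Category.assoc, phi_comp_id_uHomMap, phi_comp_beta]
    simp only [lin_comp_apply, lin_tensHom_pure, lin_id_apply, lin_tensAssoc_hom_pure,
      gamma_apply hS]
  constructor
  · intro h e j v m
    rw [← e1, ← e2, h]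
  · intro h
    refine phi_injective (tens_ext fun e z => ?_)
    induction z using tens_induction with
    | zero => simp only [map_zero]
    | add a b ha hb => simp only [map_add, ha, hb]
    | pure w m =>
      induction w using tens_induction with
      | zero => simp only [map_zero, LinearMap.zero_apply]
      | add a b ha hb => simp only [map_add, LinearMap.add_apply, ha, hb]
      | pure j v =>
        obtain ⟨j, rfl⟩ := dualMk_surjective V j
        rw [e1, e2, h]

/-- The action of `T` on the first factor of `V ⊗ M`. -/
def leftFactorAct (V : FDMod k T) (M : FDMod k K) :
    T →ₐ[k] Module.End k (tens (infl hH V) M) :=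
  (tensorAct V.act M.act).comp (Algebra.TensorProduct.includeLeft : T →ₐ[k] T ⊗[k] K)

theorem leftFactorAct_pure (V : FDMod k T) (M : FDMod k K) (t : T) (v : infl hH V) (m : M) :
    leftFactorAct V M t (pure (infl hH V) M v m) =
      pure (infl hH V) M ((infl hH V).act (Boson.inT hH t) v) m := by
  refine Eq.trans (b := V.act t v ⊗ₜ[k] M.act 1 m) rfl ?_
  rw [map_one]
  exact congrArg (fun w => w ⊗ₜ[k] m) (infl_act_inT V t v).symm

theorem slice_leftFactorAct (V : FDMod k T) (M : FDMod k K) (t : T)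
    (j : Module.Dual k (infl hH V)) (z : tens (infl hH V) M) :
    slice M j (leftFactorAct V M t z) = slice M (j ∘ₗ (infl hH V).act (Boson.inT hH t)) z := by
  induction z using tens_induction with
  | zero => simp only [map_zero]
  | add a b ha hb => simp only [map_add, ha, hb]
  | pure v m => rw [leftFactorAct_pure, slice_pure, slice_pure]; rfl

/-- Dinaturality is naturality of the adjoint maps. The balancing condition, freed from the
functional `j`, is the module condition after an inversion of `R` by `RMatrix.eq_sum_antipode_iff`.
This turns the end into a representing object. -/
theorem isBalanced_iff (Φ : VFunctor hH K) (E : FDMod k (Boson hH))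
    (ξ : ∀ M, E ⟶ uHom (A := Boson hH) M (Φ.F.obj M)) :
    Φ.IsBalanced E ξ ↔ Φ.IsModuleTrans E fun M => phi (ξ M) := by
  obtain ⟨S, hS⟩ := Boson.exists_sum R
  have key : ∀ (V : FDMod k T) (M : FDMod k K),
      (ξ M ≫ uHomMap (tensHom (evalHom hH V) (𝟙 M) ≫ (tensUnit M).hom) (𝟙 (Φ.F.obj M)) =
      ξ (tens (infl hH V) M) ≫ Φ.beta V (tens (infl hH V) M) M ≫
        uHomMap (tensAssoc (infl hH (dual V)) (infl hH V) M).hom (𝟙 (Φ.F.obj M))) ↔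
      (phi (ξ (tens (infl hH V) M)) ≫ Φ.d V M =
        (tensAssoc E (infl hH V) M).inv ≫ tensHom (braid hH V E).inv (𝟙 M) ≫
        (tensAssoc (infl hH V) E M).hom ≫ tensHom (𝟙 (infl hH V)) (phi (ξ M))) := by
    intro V M
    -- For fixed `v` and `m`, let `D(e)` be `d γ(e ⊗ v ⊗ m)` and `G(e)` be `v ⊗ γ(e ⊗ m)`. Balancing
    -- says `G = S(R²) D(R¹ -)`, and the module condition says `D = R² G(R¹ -)`.
    let D : infl hH V → M → E →ₗ[k] tens (infl hH V) (Φ.F.obj M) := fun v m =>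
      lin (phi (ξ (tens (infl hH V) M)) ≫ Φ.d V M) ∘ₗ
        (pure E (tens (infl hH V) M)).flip (pure (infl hH V) M v m)
    let G : infl hH V → M → E →ₗ[k] tens (infl hH V) (Φ.F.obj M) := fun v m =>
      pure (infl hH V) (Φ.F.obj M) v ∘ₗ lin (phi (ξ M)) ∘ₗ (pure E M).flip m
    have hG : ∀ v m e, G v m e = pure (infl hH V) (Φ.F.obj M) v (lin (phi (ξ M)) (pure E M e m)) :=
      fun _ _ _ => rfl
    have hD : ∀ v m e, D v m e = lin (Φ.d V M) (lin (phi (ξ (tens (infl hH V) M)))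
        (pure E (tens (infl hH V) M) e (pure (infl hH V) M v m))) := fun _ _ _ => rfl
    have e1 := fun (v : infl hH V) (m : M) => RMatrix.eq_sum_antipode_iff hS
      (E.act.comp (Boson.inT hH)) (leftFactorAct V (Φ.F.obj M)) (D v m) (G v m)
    simp only [hG, hD, AlgHom.comp_apply, leftFactorAct_pure] at e1
    rw [balanced_iff_apply hS]
    constructor
    · intro h
      refine module_of_apply (γ := fun M => phi (ξ M)) hS fun e v m => (e1 v m).1 ?_ e
      intro e
      refine eq_of_slice fun j => ?_
      rw [slice_pure, h, map_sum]
      exact Finset.sum_congr rfl fun i _ => (slice_leftFactorAct _ _ _ _ _).symm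
    · intro h e j v m
      have := (e1 v m).2 (fun e => (congrArg (fun g => lin g (pure E (tens (infl hH V) M) e
        (pure (infl hH V) M v m))) h).trans (lin_braid_module hS (phi (ξ M)) e v m)) e
      rw [← slice_pure, this, map_sum]
      exact Finset.sum_congr rfl fun i _ => slice_leftFactorAct _ _ _ _ _
  constructor
  · intro h
    refine ⟨fun {M N} f => ?_, fun V M => (key V M).1 (h.balanced V M)⟩
    have := congrArg phi (h.dinatural f)
    rwa [phi_comp_uHomMap_id, phi_comp_id_uHomMap] at this
  · intro h
    refine ⟨fun {M N} f => phi_injective ?_, fun V M => (key V M).2 (h.module V M)⟩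
    rw [phi_comp_uHomMap_id, phi_comp_id_uHomMap]
    exact h.natural f

end VFunctor
end ModuleTrans

section TensorMap

variable {k : Type u} [Field k] {A : Type u} [Ring A] [Bialgebra k A]
  {K : Type u} [Ring K] [Algebra k K] [ComoduleAlgebra k A K]

open FDMod

namespace HopfBimodule

variable (P : HopfBimodule k A K)

/-- The morphism `P ⊗_K f` for a morphism `f`. -/
def mapHom {M N : FDMod k K} (f : M ⟶ N) : P.tensor M ⟶ P.tensor N := P.tensorFunctor.map f

@[simp]
theorem lin_mapHom_pure {M N : FDMod k K} (f : M ⟶ N) (p : P) (m : M) :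
    lin (P.mapHom f) (P.pure M p m) = P.pure N p (lin f m) := rfl

theorem mapHom_comp {M N L : FDMod k K} (f : M ⟶ N) (g : N ⟶ L) :
    P.mapHom (f ≫ g) = P.mapHom f ≫ P.mapHom g := P.tensorFunctor.map_comp f g

theorem mapHom_id (M : FDMod k K) : P.mapHom (𝟙 M) = 𝟙 (P.tensor M) := P.tensorFunctor.map_id M

end HopfBimodule

end TensorMap

/-! ### The space `S^T(H, K, P)` is a relative end of `P ⊗_K -`. -/

section RelEnds

variable {k : Type u} [Field k] {T : Type u} [Ring T] [HopfAlgebra k T] [Module.Finite k T]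
  {R : RMatrix k T} {H : Type u} [Ring H] [Algebra k H] [Coalgebra k H] [Module.Finite k H]
  [Module T H] [IsScalarTower k T H] {hH : BraidedHopf R H}
  {K : Type u} [Ring K] [Algebra k K] [ComoduleAlgebra k (Boson hH) K]

open FDMod

namespace VFunctor

theorem RelEnd.isModuleTrans {Φ : VFunctor hH K} (E : Φ.RelEnd) :
    Φ.IsModuleTrans E.obj E.counit :=
  (Φ.isBalanced_iff E.obj E.π).1 E.isBalanced

/-- The universal property transported through the adjunction: morphisms `Y → E` correspond to
module transformations `Y ⊗ - → F`. This is the right adjoint of `X ↦ X ▷ -` at `F`. -/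
theorem RelEnd.existsUnique_hom {Φ : VFunctor hH K} (E : Φ.RelEnd) {Y : FDMod k (Boson hH)}
    {γ : ∀ M, tens Y M ⟶ Φ.F.obj M} (h : Φ.IsModuleTrans Y γ) :
    ∃! g : Y ⟶ E.obj, ∀ M, γ M = tensHom g (𝟙 M) ≫ E.counit M := by
  have e : ∀ (g : Y ⟶ E.obj) (M), (psi (γ M) = g ≫ E.π M) ↔
      γ M = tensHom g (𝟙 M) ≫ E.counit M := by
    intro g M
    rw [RelEnd.counit, ← phi_comp_left]
    exact ⟨fun h => by rw [← h, phi_psi], fun h => by rw [h, psi_phi]⟩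
  have h2 := E.exists_unique Y (fun M => psi (γ M)) ((Φ.isBalanced_iff _ _).2 (by
    simpa only [phi_psi] using h))
  simpa only [e] using h2

/-- Uniqueness in the universal property applies to balanced families only. Restricting the
universal family along `g` gives a balanced family, so the condition holds automatically. -/
theorem RelEnd.hom_ext {Φ : VFunctor hH K} (E : Φ.RelEnd) {Y : FDMod k (Boson hH)}
    {g g' : Y ⟶ E.obj}
    (h : ∀ M, tensHom g (𝟙 M) ≫ E.counit M = tensHom g' (𝟙 M) ≫ E.counit M) : g = g' := by
  have h1 : Φ.IsModuleTrans Y fun M => tensHom g (𝟙 M) ≫ E.counit M := by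
    have h0 := (Φ.isBalanced_iff Y fun M => g ≫ E.π M).1 ⟨fun f => ?_, fun V M => ?_⟩
    · simpa only [phi_comp_left, RelEnd.counit] using h0
    · rw [Category.assoc, Category.assoc, E.isBalanced.dinatural]
    · rw [Category.assoc, Category.assoc, E.isBalanced.balanced]
  exact (E.existsUnique_hom h1).unique (fun _ => rfl) h

/-- A relative end, from a universal transformation of module functors. -/
def RelEnd.ofCounit {Φ : VFunctor hH K} (E : FDMod k (Boson hH))
    (γ : ∀ M, tens E M ⟶ Φ.F.obj M) (h : Φ.IsModuleTrans E γ)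
    (hu : ∀ (Y : FDMod k (Boson hH)) (γ' : ∀ M, tens Y M ⟶ Φ.F.obj M), Φ.IsModuleTrans Y γ' →
      ∃! g : Y ⟶ E, ∀ M, γ' M = tensHom g (𝟙 M) ≫ γ M) : Φ.RelEnd where
  obj := E
  π M := psi (γ M)
  isBalanced := (Φ.isBalanced_iff _ _).2 (by simpa only [phi_psi] using h)
  exists_unique Y ξ hξ := by
    have h2 := hu Y (fun M => phi (ξ M)) ((Φ.isBalanced_iff _ _).1 hξ)
    have e : ∀ (g : Y ⟶ E) (M), (ξ M = g ≫ psi (γ M)) ↔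
        phi (ξ M) = tensHom g (𝟙 M) ≫ γ M := by
      intro g M
      refine ⟨fun h => by rw [h, phi_comp_left, phi_psi], fun h => phi_injective ?_⟩
      rw [h, phi_comp_left, phi_psi]
    simpa only [e] using h2

@[simp]
theorem RelEnd.counit_ofCounit {Φ : VFunctor hH K} (E : FDMod k (Boson hH))
    (γ : ∀ M, tens E M ⟶ Φ.F.obj M) (h : Φ.IsModuleTrans E γ)
    (hu : ∀ (Y : FDMod k (Boson hH)) (γ' : ∀ M, tens Y M ⟶ Φ.F.obj M), Φ.IsModuleTrans Y γ' →
      ∃! g : Y ⟶ E, ∀ M, γ' M = tensHom g (𝟙 M) ≫ γ M) (M : FDMod k K) :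
    (RelEnd.ofCounit E γ h hu).counit M = γ M := phi_psi _

end VFunctor

namespace FDMod

/-- The morphism `b ↦ b m` from the regular module to `M`. -/
def fromReg {B : Type u} [Ring B] [Algebra k B] [Module.Finite k B] (M : FDMod k B) (m : M) :
    reg k B ⟶ M :=
  ofLin (M.act.toLinearMap.flip m : B →ₗ[k] M) fun a h => LinearMap.congr_fun (map_mul M.act a h) m

theorem lin_fromReg {B : Type u} [Ring B] [Algebra k B] [Module.Finite k B] (M : FDMod k B)
    (m : M) (b : B) : lin (fromReg M m) (regMk b) = M.act b m := rfl

theorem lin_fromReg_one {B : Type u} [Ring B] [Algebra k B] [Module.Finite k B] (M : FDMod k B)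
    (m : M) : lin (fromReg M m) (regMk 1) = m := by
  rw [lin_fromReg, map_one]
  rfl

end FDMod

namespace HopfBimodule

variable [Module.Finite k K] (P : HopfBimodule k (Boson hH) K)

theorem sEval_right (x : Boson hH) (y : K) (α : P.sT) :
    P.sEval x y α = P.right (MulOpposite.op y) (P.sEval x 1 α) :=
  IsColinear.right_linear α.2 x y

theorem sT_ext {α β : P.sT} (h : ∀ x, P.sEval x 1 α = P.sEval x 1 β) : α = β := by
  refine Subtype.ext (tens_ext fun x y => ?_)
  have := P.sEval_right x y
  exact (this α).trans ((congrArg _ (h x)).trans (this β).symm)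

theorem left_sEval {b : K} {n : ℕ} {a : Fin n → Boson hH} {c : Fin n → K}
    (h : ComoduleAlgebra.coact (k := k) (A := Boson hH) b = ∑ i, a i ⊗ₜ[k] c i) (x : Boson hH) (y : K)
    (α : P.sT) : P.left b (P.sEval x y α) = ∑ i, P.sEval (a i * x) (c i * y) α := by
  have h1 := lin_act (uHom.hom α.1) b (FDMod.pure (reg k (Boson hH)) (reg k K) (regMk x) (regMk y))
  rw [tens_act_pure _ _ h, map_sum] at h1
  exact h1.symm

theorem coactR_tmul {S : Finset (T × T)} (hS : (R.R : T ⊗[k] T) = ∑ i ∈ S, i.1 ⊗ₜ[k] i.2)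
    {y : K} {n : ℕ} {a : Fin n → Boson hH} {c : Fin n → K}
    (hy : ComoduleAlgebra.coact (k := k) (A := Boson hH) y = ∑ i, a i ⊗ₜ[k] c i)
    (X : FDMod k (Boson hH)) (x : X) :
    coactR hH K X (x ⊗ₜ y) =
      ∑ l, ∑ i ∈ S, (i.2 * Boson.proj hH (a l)) ⊗ₜ[k] (X.act (Boson.inT hH i.1) x ⊗ₜ c l) := by
  simp only [coactR, LinearMap.comp_apply, LinearMap.lTensor_tmul, LinearEquiv.coe_coe,
    AlgHom.toLinearMap_apply, hy, map_sum, LinearMap.rTensor_tmul, TensorProduct.assoc_symm_tmul,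
    tmul_sum, Boson.rElt, hS, LinearMap.sum_apply, Algebra.TensorProduct.map_tmul, sum_tmul,
    tensorAct_tmul, TensorProduct.assoc_tmul, TensorProduct.leftComm_tmul]
  rfl

theorem lTensor_coactReg {S : Finset (T × T)} (hS : (R.R : T ⊗[k] T) = ∑ i ∈ S, i.1 ⊗ₜ[k] i.2)
    {y : K} {n : ℕ} {a : Fin n → Boson hH} {c : Fin n → K}
    (hy : ComoduleAlgebra.coact (k := k) (A := Boson hH) y = ∑ i, a i ⊗ₜ[k] c i)
    (f : Boson hH ⊗[k] K →ₗ[k] P) (x : Boson hH) :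
    f.lTensor T (coactReg hH K (x ⊗ₜ y)) =
      ∑ l, ∑ i ∈ S, (i.2 * Boson.proj hH (a l)) ⊗ₜ[k] f ((Boson.inT hH i.1 * x) ⊗ₜ c l) := by
  have h : coactReg hH K (x ⊗ₜ y) = ∑ l, ∑ i ∈ S, (i.2 * Boson.proj hH (a l)) ⊗ₜ[k]
      ((Boson.inT hH i.1 * x) ⊗ₜ c l) := coactR_tmul hS hy (reg k (Boson hH)) x
  rw [h]
  simp only [map_sum, LinearMap.lTensor_tmul]

theorem lTensor_coactReg_one {S : Finset (T × T)}
    (hS : (R.R : T ⊗[k] T) = ∑ i ∈ S, i.1 ⊗ₜ[k] i.2) (f : Boson hH ⊗[k] K →ₗ[k] P) (x : Boson hH) :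
    f.lTensor T (coactReg hH K (x ⊗ₜ 1)) =
      ∑ i ∈ S, i.2 ⊗ₜ[k] f ((Boson.inT hH i.1 * x) ⊗ₜ 1) := by
  have hy : ComoduleAlgebra.coact (k := k) (A := Boson hH) (1 : K) =
      ∑ i : Fin 1, (fun _ => 1 : Fin 1 → Boson hH) i ⊗ₜ[k] (fun _ => 1 : Fin 1 → K) i := by
    simp [Algebra.TensorProduct.one_def]
  rw [P.lTensor_coactReg hS hy]
  simp

theorem proj_coact_right {y : K} {n : ℕ} {a : Fin n → Boson hH} {c : Fin n → K}
    (hy : ComoduleAlgebra.coact (k := k) (A := Boson hH) y = ∑ i, a i ⊗ₜ[k] c i) (p : P) :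
    (Boson.proj hH).toLinearMap.rTensor P (P.coact (P.right (MulOpposite.op y) p)) =
      ∑ i, TensorProduct.map (LinearMap.mulRight k (Boson.proj hH (a i)))
        (P.right (MulOpposite.op (c i))) ((Boson.proj hH).toLinearMap.rTensor P (P.coact p)) := by
  rw [P.coact_right, hy]
  simp only [map_sum, LinearMap.sum_apply]
  refine Finset.sum_congr rfl fun i _ => ?_
  generalize P.coact p = w
  induction w with
  | zero => simp
  | add c d hc hd => simp only [map_add, hc, hd]
  | tmul b p => simp

/-- The coaction of `P` is right `K`-linear and `y` enters `coactReg` through `π(y₋₁)` on the right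
and `y₀`. For a map with `f(h ⊗ y) = f(h ⊗ 1) y`, colinearity at `y = 1` is thus enough. -/
theorem isColinear_of_one {S : Finset (T × T)}
    (hS : (R.R : T ⊗[k] T) = ∑ i ∈ S, i.1 ⊗ₜ[k] i.2) {f : Boson hH ⊗[k] K →ₗ[k] P}
    (h : ∀ (h : Boson hH) (y : K), f (h ⊗ₜ y) = P.right (MulOpposite.op y) (f (h ⊗ₜ 1)))
    (h' : ∀ x, (Boson.proj hH).toLinearMap.rTensor P (P.coact (f (x ⊗ₜ 1))) =
      ∑ i ∈ S, i.2 ⊗ₜ[k] f ((Boson.inT hH i.1 * x) ⊗ₜ 1)) : P.IsColinear f where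
  right_linear := h
  colinear z := by
    induction z with
    | zero => simp
    | add c d hc hd => simp only [map_add, hc, hd]
    | tmul x y =>
      obtain ⟨n, a, c, hy⟩ := TensorProduct.exists_sum_fin
        (ComoduleAlgebra.coact (k := k) (A := Boson hH) y)
      rw [P.lTensor_coactReg hS hy, h, P.proj_coact_right hy, h']
      refine Finset.sum_congr rfl fun l _ => ?_
      rw [map_sum]
      refine Finset.sum_congr rfl fun i _ => ?_
      rw [TensorProduct.map_tmul, ← h]
      rfl

theorem proj_coact_sEval {S : Finset (T × T)} (hS : (R.R : T ⊗[k] T) = ∑ i ∈ S, i.1 ⊗ₜ[k] i.2)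
    (x : Boson hH) (α : P.sT) :
    (Boson.proj hH).toLinearMap.rTensor P (P.coact (P.sEval x 1 α)) =
      ∑ i ∈ S, i.2 ⊗ₜ[k] P.sEval (Boson.inT hH i.1 * x) 1 α :=
  (IsColinear.colinear α.2 (x ⊗ₜ 1)).symm.trans (P.lTensor_coactReg_one hS _ x)

/-- The map `α ⊗ m ↦ α(1 ⊗ 1) ⊗ m` from `S^T(H, K, P) ⊗ M` to `P ⊗_K M`. -/
def sCounitLin (M : FDMod k K) : tens P.sT M →ₗ[k] P.tensor M :=
  TensorProduct.lift (P.pure M ∘ₗ P.sEval 1 1)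

theorem sCounitLin_pure (M : FDMod k K) (α : P.sT) (m : M) :
    P.sCounitLin M (FDMod.pure P.sT M α m) = P.pure M (P.sEval 1 1 α) m := rfl

/-- The morphism `α ⊗ m ↦ α(1 ⊗ 1) ⊗ m` from `S^T(H, K, P) ⊗ M` to `P ⊗_K M`. -/
def sCounit (M : FDMod k K) : tens P.sT M ⟶ P.tensor M :=
  ofLin (P.sCounitLin M) fun b z => by
    induction z using tens_induction with
    | zero => simp only [map_zero]
    | add c d hc hd => simp only [map_add, hc, hd]
    | pure α m =>
      obtain ⟨n, a, c, hb⟩ := TensorProduct.exists_sum_fin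
        (ComoduleAlgebra.coact (k := k) (A := Boson hH) b)
      -- Left `K`-linearity of `α` gives `b α(1 ⊗ 1) = (b₋₁ α)(1 ⊗ 1) b₀`, and `b₀` passes through
      -- the tensor product over `K` to act on `m`.
      rw [tens_act_pure _ _ hb, sCounitLin_pure, P.act_pure, P.left_sEval hb, map_sum, map_sum,
        LinearMap.sum_apply]
      refine Finset.sum_congr rfl fun i _ => ?_
      rw [sCounitLin_pure, sEval_act, one_mul, mul_one, mul_one, P.sEval_right _ (c i), pure_right]

@[simp]
theorem lin_sCounit_pure (M : FDMod k K) (α : P.sT) (m : M) :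
    lin (P.sCounit M) (FDMod.pure P.sT M α m) = P.pure M (P.sEval 1 1 α) m := rfl

theorem lin_structHom_pure (X : FDMod k (Boson hH)) (M : FDMod k K) (p : P) (x : X) (m : M) :
    lin (P.structHom X M) (P.pure (tens X M) p (FDMod.pure X M x m)) =
      P.structMap X M (P.coact p) (x ⊗ₜ m) := rfl

/-- The fields of `P.functor` are unfolded here once, so that rewriting can use `mapHom` and
`structHom`. -/
theorem functor_isModuleTrans_iff {Y : FDMod k (Boson hH)} {γ : ∀ M, tens Y M ⟶ P.tensor M} :
    P.functor.IsModuleTrans Y γ ↔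
      (∀ {M N : FDMod k K} (f : M ⟶ N), γ M ≫ P.mapHom f = tensHom (𝟙 Y) f ≫ γ N) ∧
      ∀ (V : FDMod k T) (M : FDMod k K), γ (tens (infl hH V) M) ≫ P.structHom (infl hH V) M =
        (tensAssoc Y (infl hH V) M).inv ≫ tensHom (braid hH V Y).inv (𝟙 M) ≫
          (tensAssoc (infl hH V) Y M).hom ≫ tensHom (𝟙 (infl hH V)) (γ M) :=
  ⟨fun h => ⟨h.natural, h.module⟩, fun h => ⟨h.1, h.2⟩⟩

/-- The map `t ⊗ p ↦ t v ⊗ (p ⊗ m)`. -/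
def projStruct (V : FDMod k T) (M : FDMod k K) (v : infl hH V) (m : M) :
    T ⊗[k] P →ₗ[k] tens (infl hH V) (P.tensor M) :=
  TensorProduct.map (((infl hH V).act.comp (Boson.inT hH)).toLinearMap.flip v) ((P.pure M).flip m)

theorem projStruct_tmul (V : FDMod k T) (M : FDMod k K) (v : infl hH V) (m : M) (t : T) (p : P) :
    P.projStruct V M v m (t ⊗ₜ p) =
      FDMod.pure (infl hH V) (P.tensor M) ((infl hH V).act (Boson.inT hH t) v) (P.pure M p m) := rfl

/-- `A` acts on `V_π` through `π`, so the module structure over `Rep(T)` depends only on the induced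
`T`-coaction of `P`. -/
theorem structMap_infl (V : FDMod k T) (M : FDMod k K) (v : infl hH V) (m : M)
    (w : Boson hH ⊗[k] P) : P.structMap (infl hH V) M w (v ⊗ₜ m) =
      P.projStruct V M v m ((Boson.proj hH).toLinearMap.rTensor P w) := by
  induction w with
  | zero => simp only [map_zero, LinearMap.zero_apply]; rfl
  | add c d hc hd => simp only [map_add, LinearMap.add_apply, hc, hd]; rfl
  | tmul a p =>
    rw [structMap_tmul, LinearMap.rTensor_tmul, projStruct_tmul, infl_act_inT]
    rfl

/-- On `α ⊗ v ⊗ m` the module condition reads `π(p₋₁) v ⊗ p₀ ⊗ m = R² v ⊗ α(R¹ ⊗ 1) ⊗ m` with `p =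
α(1 ⊗ 1)`, which is colinearity of `α` at `1 ⊗ 1`. -/
theorem isModuleTrans_sCounit : P.functor.IsModuleTrans P.sT P.sCounit := by
  obtain ⟨S, hS⟩ := Boson.exists_sum R
  refine P.functor_isModuleTrans_iff.2 ⟨fun {M N} f => tens_ext fun α m => ?_, fun V M =>
    FDMod.tens_ext_right fun α v m => ?_⟩
  · simp only [lin_comp_apply, lin_sCounit_pure, lin_mapHom_pure, lin_tensHom_pure, lin_id_apply]
  · rw [VFunctor.lin_braid_module hS, lin_comp_apply, lin_sCounit_pure, lin_structHom_pure,
      structMap_infl, P.proj_coact_sEval hS, map_sum]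
    refine Finset.sum_congr rfl fun i _ => ?_
    rw [projStruct_tmul, lin_sCounit_pure, sEval_act, one_mul, mul_one]

/-- The isomorphism `P ⊗_K K → P`. -/
def rightUnit : P.tensor (reg k K) ⟶ P.leftModule :=
  P.liftHom ((LinearMap.flip ((P.right.toLinearMap ∘ₗ
      (MulOpposite.opLinearEquiv k).toLinearMap : K →ₗ[k] Module.End k P))))
    (fun x p (m : K) => by
      change P.right (MulOpposite.op m) (P.right (MulOpposite.op x) p) =
        P.right (MulOpposite.op (x * m)) p
      rw [MulOpposite.op_mul, map_mul]
      rfl)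
    (fun x p (m : K) => (P.left_right x (MulOpposite.op m) p).symm)

theorem lin_rightUnit_pure (p : P) (y : K) : lin P.rightUnit (P.pure (reg k K) p (regMk y)) =
    P.right (MulOpposite.op y) p := rfl

theorem pure_lin_rightUnit (z : P.tensor (reg k K)) :
    P.pure (reg k K) (lin P.rightUnit z) (regMk 1) = z := by
  refine LinearMap.congr_fun (f := (P.pure (reg k K)).flip (regMk 1) ∘ₗ
    lin P.rightUnit) (g := LinearMap.id) (P.lin_ext fun p (m : K) => ?_) z
  refine (P.pure_right (reg k K) m p (regMk (1 : K))).trans ?_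
  exact congrArg (fun m : K => P.pure (reg k K) p m) (mul_one m)

theorem lin_rightUnit_pure_one (p : P) : lin P.rightUnit (P.pure (reg k K) p (regMk 1)) = p := by
  rw [lin_rightUnit_pure, MulOpposite.op_one, map_one]
  rfl

variable {P} {Y : FDMod k (Boson hH)} {γ : ∀ M, tens Y M ⟶ P.tensor M}

/-- The map `Y → P` induced by the component at `K` of a transformation `Y ⊗ - → P ⊗_K -`. -/
def atOne (γ : ∀ M, tens Y M ⟶ P.tensor M) : Y →ₗ[k] P :=
  lin P.rightUnit ∘ₗ lin (γ (reg k K)) ∘ₗ (FDMod.pure Y (reg k K)).flip (regMk 1)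

/-- Every `m` is the image of `1` under the morphism `K → M`, `b ↦ b m`, so naturality determines
the whole family from its component at `K`. -/
theorem lin_eq_pure_atOne (h : P.functor.IsModuleTrans Y γ) (M : FDMod k K) (y : Y) (m : M) :
    lin (γ M) (FDMod.pure Y M y m) = P.pure M (atOne γ y) m := by
  have h1 := congrArg (fun f => lin f (FDMod.pure Y (reg k K) y (regMk 1)))
    ((P.functor_isModuleTrans_iff.1 h).1 (fromReg M m))
  have h2 : lin (γ (reg k K)) (FDMod.pure Y (reg k K) y (regMk 1)) =
      P.pure (reg k K) (atOne γ y) (regMk 1) := (P.pure_lin_rightUnit _).symm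
  simp only [lin_comp_apply, lin_tensHom_pure, lin_id_apply, lin_fromReg_one, h2,
    lin_mapHom_pure] at h1
  exact h1.symm

/-- The module condition for the regular `T`-module at `v = 1` and for `M = K`. The vector `t v` is
then `t` itself, so the identity in `V ⊗ (P ⊗_K K)` becomes an identity in `T ⊗ P`. -/
theorem proj_coact_atOne {S : Finset (T × T)} (hS : (R.R : T ⊗[k] T) = ∑ i ∈ S, i.1 ⊗ₜ[k] i.2)
    (h : P.functor.IsModuleTrans Y γ) (y : Y) :
    (Boson.proj hH).toLinearMap.rTensor P (P.coact (atOne γ y)) =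
      ∑ i ∈ S, i.2 ⊗ₜ[k] atOne γ (Y.act (Boson.inT hH i.1) y) := by
  let V := reg k T
  let v : infl hH V := (regMk 1 : reg k T)
  have h2 := congrArg (fun f => lin f (FDMod.pure Y (tens (infl hH V) (reg k K)) y
    (FDMod.pure (infl hH V) (reg k K) v (regMk 1)))) ((P.functor_isModuleTrans_iff.1 h).2 V (reg k K))
  simp only [VFunctor.lin_braid_module hS, lin_comp_apply, lin_eq_pure_atOne h,
    lin_structHom_pure, structMap_infl] at h2
  let θ : tens (infl hH V) (P.tensor (reg k K)) →ₗ[k] T ⊗[k] P :=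
    TensorProduct.map (LinearMap.id : T →ₗ[k] T) (lin P.rightUnit)
  have hθ : ∀ (t : T) (p : P), θ (FDMod.pure (infl hH V) (P.tensor (reg k K))
      ((infl hH V).act (Boson.inT hH t) v) (P.pure (reg k K) p (regMk 1))) = t ⊗ₜ p := by
    intro t p
    rw [infl_act_inT]
    change (t * 1) ⊗ₜ[k] lin P.rightUnit (P.pure (reg k K) p (regMk 1)) = _
    rw [mul_one, lin_rightUnit_pure_one]
    rfl
  have hθ' : ∀ w, θ (P.projStruct V (reg k K) v (regMk 1) w) = w := by
    intro w
    induction w with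
    | zero => simp only [map_zero]
    | add c d hc hd => simp only [map_add, hc, hd]
    | tmul t p => rw [projStruct_tmul, hθ]
  have h3 := congrArg θ h2
  rw [hθ', map_sum] at h3
  exact h3.trans (Finset.sum_congr rfl fun i _ => hθ _ _)

/-- This map is `x ⊗ b ↦ p(x y) b` with `p = atOne γ`. Right linearity is visible, and colinearity
at `b = 1` is `proj_coact_atOne`. -/
theorem isColinear_psi (h : P.functor.IsModuleTrans Y γ) (y : Y) :
    P.IsColinear (lin (uHom.hom (lin (psi (γ (reg k K) ≫ P.rightUnit)) y))) := by
  obtain ⟨S, hS⟩ := Boson.exists_sum R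
  let f : Boson hH ⊗[k] K →ₗ[k] P :=
    lin (uHom.hom (lin (psi (γ (reg k K) ≫ P.rightUnit)) y))
  change P.IsColinear f
  have e : ∀ (x : Boson hH) (b : K),
      f (x ⊗ₜ b) =
      P.right (MulOpposite.op b) (atOne γ (Y.act x y)) := by
    intro x b
    exact (congrArg (lin P.rightUnit) (lin_eq_pure_atOne h (reg k K) (Y.act x y) (regMk b))).trans
      (P.lin_rightUnit_pure _ _)
  have e1 : ∀ x : Boson hH, f (x ⊗ₜ 1) =
      atOne γ (Y.act x y) := by
    intro x
    rw [e, MulOpposite.op_one, map_one]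
    rfl
  refine P.isColinear_of_one hS (fun x b => ?_) fun x => ?_
  · rw [e, e1]
  · rw [e1, proj_coact_atOne hS h]
    refine Finset.sum_congr rfl fun i _ => ?_
    rw [e1, map_mul]
    rfl

/-- The morphism to `S^T(H, K, P)` defined by a transformation `Y ⊗ - → P ⊗_K -`. -/
def sLift (h : P.functor.IsModuleTrans Y γ) : Y ⟶ P.sT :=
  ofLin ((lin (psi (γ (reg k K) ≫ P.rightUnit))).codRestrict P.sSpace (isColinear_psi h))
    fun a y => Subtype.ext (lin_act (psi (γ (reg k K) ≫ P.rightUnit)) a y)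

theorem sEval_sLift (h : P.functor.IsModuleTrans Y γ) (x : Boson hH) (y : Y) :
    P.sEval x 1 (lin (sLift h) y) = atOne γ (Y.act x y) := rfl

/-- A transformation is determined by `p = atOne γ`, and it factors through `y ↦ (x ⊗ b ↦ p(x y)
b)`. Evaluating any other factorization at `K` and at `x y` recovers the same values at `x ⊗ 1`. -/
theorem sT_universal (h : P.functor.IsModuleTrans Y γ) :
    ∃! g : Y ⟶ P.sT, ∀ M, γ M = tensHom g (𝟙 M) ≫ P.sCounit M := by
  refine ⟨sLift h, fun M => tens_ext fun y m => ?_, fun g hg => ?_⟩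
  · rw [lin_comp_apply, lin_tensHom_pure, lin_sCounit_pure, lin_eq_pure_atOne h, sEval_sLift,
      map_one]
    rfl
  · refine FDMod.hom_ext (LinearMap.ext fun y => P.sT_ext fun x => ?_)
    rw [sEval_sLift]
    have h1 := congrArg (fun f => lin P.rightUnit (lin f
      (FDMod.pure Y (reg k K) (Y.act x y) (regMk 1)))) (hg (reg k K))
    refine Eq.trans ?_ h1.symm
    simp only [lin_comp_apply, lin_tensHom_pure, lin_sCounit_pure, lin_id_apply]
    rw [lin_rightUnit_pure_one, lin_act, sEval_act, one_mul]

variable (P) in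
/-- The relative end `S^T(H, K, P)`. -/
def sRelEnd : P.functor.RelEnd :=
  VFunctor.RelEnd.ofCounit P.sT P.sCounit P.isModuleTrans_sCounit fun _ _ h => sT_universal h

end HopfBimodule
end RelEnds

/-! ### Morphisms into `X ⊗ N` and morphisms out of the tensor product with the dual. -/

section Duality

variable {k : Type u} [Field k] {A : Type u} [Ring A] [HopfAlgebra k A]
  {K : Type u} [Ring K] [Algebra k K] [ComoduleAlgebra k A K]

namespace FDMod

/-- A functional on `X` as an element of `X*`. -/
def dualElt (X : FDMod k A) : Module.Dual k X →ₗ[k] dual X := LinearMap.id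

theorem dualElt_surjective (X : FDMod k A) : Function.Surjective (dualElt X) := fun j => ⟨j, rfl⟩

/-- The evaluation `X* ⊗ X → k`. -/
def dualEval (X : FDMod k A) : tens (dual X) X ⟶ (unit : FDMod k A) :=
  ofLin (contractLeft k X : Module.Dual k X ⊗[k] X →ₗ[k] k) fun a z =>
    contractLeft_tensorAct X.act a z

theorem lin_dualEval_pure (X : FDMod k A) (ξ : Module.Dual k X) (x : X) :
    lin (dualEval X) (pure (dual X) X (dualElt X ξ) x) = ξ x := rfl

/-- The morphism `X* ⊗ Z → N` that corresponds to a morphism `Z → X ⊗ N`. -/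
def sliceHom {X : FDMod k A} {Z N : FDMod k K} (f : Z ⟶ tens X N) : tens (dual X) Z ⟶ N :=
  tensHom (𝟙 (dual X)) f ≫ (tensAssoc (dual X) X N).inv ≫ tensHom (dualEval X) (𝟙 N) ≫
    (tensUnit N).hom

theorem lin_sliceHom_pure {X : FDMod k A} {Z N : FDMod k K} (f : Z ⟶ tens X N)
    (ξ : Module.Dual k X) (z : Z) :
    lin (sliceHom f) (pure (dual X) Z (dualElt X ξ) z) = slice N ξ (lin f z) := by
  simp only [sliceHom, lin_comp_apply, lin_tensHom_pure, lin_id_apply]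
  generalize lin f z = w
  induction w using tens_induction with
  | zero => simp only [map_zero]
  | add a b ha hb => simp only [map_add, ha, hb]
  | pure x n =>
    simp only [lin_tensAssoc_inv_pure, lin_tensHom_pure, lin_id_apply, slice_pure,
      lin_dualEval_pure, lin_tensUnit_hom_pure]

theorem lin_slice {X : FDMod k A} {M N : FDMod k K} (f : M ⟶ N) (ξ : Module.Dual k X)
    (z : tens X M) : lin f (slice M ξ z) = slice N ξ (lin (tensHom (𝟙 X) f) z) := by
  induction z using tens_induction with
  | zero => simp only [map_zero]
  | add a b ha hb => simp only [map_add, ha, hb]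
  | pure x n => simp only [slice_pure, map_smul, lin_tensHom_pure, lin_id_apply]

theorem slice_act {X Y : FDMod k A} (ξ : Module.Dual k X) (a : A) (z : tens X Y) {n : ℕ}
    {b c : Fin n → A} (h : comul (R := k) a = ∑ i, b i ⊗ₜ[k] c i) :
    slice Y ξ ((tens X Y).act a z) = ∑ i, Y.act (c i) (slice Y (ξ ∘ₗ X.act (b i)) z) := by
  induction z using tens_induction with
  | zero => simp only [map_zero, Finset.sum_const_zero]
  | add a b ha hb => simp only [map_add, ha, hb, Finset.sum_add_distrib]
  | pure x y =>
    rw [tens_act_pure X Y h, map_sum]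
    refine Finset.sum_congr rfl fun i _ => ?_
    rw [slice_pure, slice_pure, map_smul]
    rfl

/-- The linear map `Y → X ⊗ N` whose slices are given by `G : X* ⊗ Y → N`. -/
def unsliceLin {X Y N : FDMod k A} (G : tens (dual X) Y ⟶ N) : Y →ₗ[k] tens X N :=
  ∑ i, pure X N (Module.finBasis k X i) ∘ₗ lin G ∘ₗ
    pure (dual X) Y (dualElt X ((Module.finBasis k X).coord i))

theorem slice_unsliceLin {X Y N : FDMod k A} (G : tens (dual X) Y ⟶ N) (ξ : Module.Dual k X)
    (y : Y) : slice N ξ (unsliceLin G y) = lin G (pure (dual X) Y (dualElt X ξ) y) := by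
  have h : ξ = ∑ i, ξ (Module.finBasis k X i) • (Module.finBasis k X).coord i :=
    ((Module.finBasis k X).sum_dual_apply_smul_coord ξ).symm
  simp only [unsliceLin, LinearMap.sum_apply, map_sum, LinearMap.comp_apply, slice_pure]
  conv_rhs => rw [h]
  simp only [map_sum, LinearMap.sum_apply, map_smul, LinearMap.smul_apply]

/-- The morphism `Y → X ⊗ N` that corresponds to a morphism `X* ⊗ Y → N`. -/
def unslice {X Y N : FDMod k A} (G : tens (dual X) Y ⟶ N) : Y ⟶ tens X N :=
  ofLin (unsliceLin G) fun a y => eq_of_slice fun ξ => by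
    obtain ⟨n, b, c, h⟩ := TensorProduct.exists_sum_fin (comul (R := k) a)
    rw [slice_unsliceLin, slice_act ξ a _ h]
    simp only [slice_unsliceLin, ← lin_act]
    -- `Ω(u ⊗ c ⊗ d) = G(ξ ∘ u S(c) ⊗ d y)`. On `(id ⊗ Δ)Δ(a)` it is the slice of `a` acting on the
    -- tensor, by linearity of `G`; on `(Δ ⊗ id)Δ(a)` the product `u S(c)` collapses and leaves `G(ξ
    -- ⊗ a y)`.
    let Ω : A ⊗[k] (A ⊗[k] A) →ₗ[k] N := lin G ∘ₗ
      (TensorProduct.map ((LinearMap.llcomp k X X k ξ) ∘ₗ X.act.toLinearMap ∘ₗ LinearMap.mul' k A ∘ₗ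
        (HopfAlgebra.antipode k).lTensor A) (Y.act.toLinearMap.flip y) :
          (A ⊗[k] A) ⊗[k] A →ₗ[k] tens (dual X) Y) ∘ₗ (TensorProduct.assoc k A A A).symm.toLinearMap
    have h1 : ∀ (u : A) (w : A ⊗[k] A), Ω (u ⊗ₜ w) = lin G (tensorAct (dual X).act Y.act w
        (dualElt X (ξ ∘ₗ X.act u) ⊗ₜ[k] y)) := by
      intro u w
      induction w with
      | zero =>
        rw [tmul_zero, map_zero, map_zero, LinearMap.zero_apply]
        exact (map_zero (lin G)).symm
      | add c d hc hd => 
        rw [tmul_add, map_add, hc, hd, map_add, LinearMap.add_apply]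
        exact (map_add (lin G) _ _).symm
      | tmul c d =>
        refine congrArg (fun j => lin G (pure (dual X) Y j (Y.act d y))) ?_
        change ξ ∘ₗ X.act (u * HopfAlgebra.antipode k c) = _
        rw [map_mul]
        rfl
    have h2 : ∀ (w : A ⊗[k] A) (u : A), Ω (TensorProduct.assoc k A A A (w ⊗ₜ u)) =
        lin G (pure (dual X) Y (dualElt X (ξ ∘ₗ X.act (LinearMap.mul' k A
          ((HopfAlgebra.antipode k).lTensor A w)))) (Y.act u y)) := by
      intro w u
      refine (congrArg (fun z => lin G (TensorProduct.map ((LinearMap.llcomp k X X k ξ) ∘ₗ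
        X.act.toLinearMap ∘ₗ LinearMap.mul' k A ∘ₗ (HopfAlgebra.antipode k).lTensor A)
        (Y.act.toLinearMap.flip y) z)) (LinearEquiv.symm_apply_apply _ (w ⊗ₜ u))).trans rfl
    have h3 := congrArg Ω (coassoc_apply (R := k) a)
    rw [h] at h3
    simp only [map_sum, LinearMap.rTensor_tmul, LinearMap.lTensor_tmul, h1, h2,
      HopfAlgebra.mul_antipode_lTensor_comul_apply] at h3
    refine Eq.trans ?_ h3
    have h4 : ∀ i, lin G (pure (dual X) Y (dualElt X (ξ ∘ₗ X.act
        (algebraMap k A (counit (R := k) (b i))))) (Y.act (c i) y)) =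
        lin G (pure (dual X) Y (dualElt X ξ) (Y.act (counit (R := k) (b i) • c i) y)) := by
      intro i
      rw [AlgHom.commutes]
      have e : ξ ∘ₗ algebraMap k (Module.End k X) (counit (R := k) (b i)) =
        counit (R := k) (b i) • ξ := by ext; simp
      rw [e, map_smul (dualElt X), map_smul (pure (dual X) Y), LinearMap.smul_apply,
        map_smul (lin G), map_smul Y.act, LinearMap.smul_apply, map_smul (pure _ _ _),
        map_smul (lin G)]
    simp only [h4, ← map_sum, ← LinearMap.sum_apply]
    have h5 := congrArg (TensorProduct.lid k A) (rTensor_counit_comul (R := k) a)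
    rw [h] at h5
    simp only [map_sum, LinearMap.rTensor_tmul, TensorProduct.lid_tmul, one_smul] at h5
    rw [h5]

theorem slice_unslice {X Y N : FDMod k A} (G : tens (dual X) Y ⟶ N) (ξ : Module.Dual k X)
    (y : Y) : slice N ξ (lin (unslice G) y) = lin G (pure (dual X) Y (dualElt X ξ) y) :=
  slice_unsliceLin G ξ y

end FDMod
end Duality

/-! ### Naturality of the tensor constraints. -/

section TensFunctoriality

variable {k : Type u} [Field k] {A : Type u} [Ring A] [Bialgebra k A]
  {K : Type u} [Ring K] [Algebra k K] [ComoduleAlgebra k A K]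

namespace FDMod

theorem tensHom_id_comp (X : FDMod k A) {M N L : FDMod k K} (f : M ⟶ N) (g : N ⟶ L) :
    tensHom (𝟙 X) (f ≫ g) = tensHom (𝟙 X) f ≫ tensHom (𝟙 X) g :=
  tens_ext fun _ _ => rfl

theorem tensHom_comp_id {X Y Z : FDMod k A} (f : X ⟶ Y) (g : Y ⟶ Z) (M : FDMod k K) :
    tensHom (f ≫ g) (𝟙 M) = tensHom f (𝟙 M) ≫ tensHom g (𝟙 M) :=
  tens_ext fun _ _ => rfl

theorem tensHom_id_id (X : FDMod k A) (M : FDMod k K) : tensHom (𝟙 X) (𝟙 M) = 𝟙 (tens X M) :=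
  tens_ext fun _ _ => rfl

theorem tensHom_exchange {X Y : FDMod k A} {M N : FDMod k K} (f : X ⟶ Y) (g : M ⟶ N) :
    tensHom (𝟙 X) g ≫ tensHom f (𝟙 N) = tensHom f (𝟙 M) ≫ tensHom (𝟙 Y) g :=
  tens_ext fun _ _ => rfl

theorem tensAssoc_hom_natural_right (X Y : FDMod k A) {M N : FDMod k K} (f : M ⟶ N) :
    tensHom (𝟙 (tens X Y)) f ≫ (tensAssoc X Y N).hom =
      (tensAssoc X Y M).hom ≫ tensHom (𝟙 X) (tensHom (𝟙 Y) f) :=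
  tens_ext_threefold fun _ _ _ => rfl

theorem tensAssoc_hom_natural_middle (X : FDMod k A) {Y Z : FDMod k A} (M : FDMod k K) (f : Y ⟶ Z) :
    tensHom (tensHom (𝟙 X) f) (𝟙 M) ≫ (tensAssoc X Z M).hom =
      (tensAssoc X Y M).hom ≫ tensHom (𝟙 X) (tensHom f (𝟙 M)) :=
  tens_ext_threefold fun _ _ _ => rfl

theorem tensAssoc_hom_natural_left {X Z : FDMod k A} (Y : FDMod k A) (M : FDMod k K) (f : X ⟶ Z) :
    tensHom (tensHom f (𝟙 Y)) (𝟙 M) ≫ (tensAssoc Z Y M).hom =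
      (tensAssoc X Y M).hom ≫ tensHom f (𝟙 (tens Y M)) :=
  tens_ext_threefold fun _ _ _ => rfl

theorem tensUnit_hom_natural {M N : FDMod k K} (f : M ⟶ N) :
    tensHom (𝟙 (unit : FDMod k A)) f ≫ (tensUnit N).hom = (tensUnit M).hom ≫ f :=
  tens_ext fun (r : k) m => (map_smul (lin f) r m).symm

theorem slice_tensAssoc {X E : FDMod k A} {M N : FDMod k K} (φ : tens E M ⟶ N)
    (ξ : Module.Dual k X) (w : tens X E) (m : M) :
    slice N ξ (lin ((tensAssoc X E M).hom ≫ tensHom (𝟙 X) φ) (pure (tens X E) M w m)) =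
      lin φ (pure E M (slice E ξ w) m) := by
  induction w using tens_induction with
  | zero => simp only [map_zero, LinearMap.zero_apply]
  | add a b ha hb => simp only [map_add, LinearMap.add_apply, ha, hb]
  | pure x e =>
    simp only [lin_comp_apply, lin_tensAssoc_hom_pure, lin_tensHom_pure, lin_id_apply, slice_pure,
      map_smul, LinearMap.smul_apply]

end FDMod
end TensFunctoriality

/-! ### Moving `V` past `X` by the `R`-matrix. -/

section Swap

variable {k : Type u} [Field k] {T : Type u} [Ring T] [HopfAlgebra k T]
  {R : RMatrix k T} {H : Type u} [Ring H] [Algebra k H] [Coalgebra k H]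
  [Module T H] [IsScalarTower k T H] {hH : BraidedHopf R H}
  {K : Type u} [Ring K] [Algebra k K] [ComoduleAlgebra k (Boson hH) K]

namespace FDMod

/-- The morphism `X ⊗ (V ⊗ M) → V ⊗ (X ⊗ M)`, `x ⊗ v ⊗ m ↦ R² v ⊗ R¹ x ⊗ m`. -/
def swap (X : FDMod k (Boson hH)) (V : FDMod k T) (M : FDMod k K) :
    tens X (tens (infl hH V) M) ⟶ tens (infl hH V) (tens X M) :=
  (tensAssoc X (infl hH V) M).inv ≫ tensHom (braid hH V X).inv (𝟙 M) ≫
    (tensAssoc (infl hH V) X M).hom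

theorem lin_swap_pure {S : Finset (T × T)}
    (hS : (R.R : T ⊗[k] T) = ∑ i ∈ S, i.1 ⊗ₜ[k] i.2) (X : FDMod k (Boson hH)) (V : FDMod k T)
    (M : FDMod k K) (x : X) (v : infl hH V) (m : M) :
    lin (swap X V M) (pure X (tens (infl hH V) M) x (pure (infl hH V) M v m)) =
      ∑ i ∈ S, pure (infl hH V) (tens X M) ((infl hH V).act (Boson.inT hH i.2) v)
        (pure X M (X.act (Boson.inT hH i.1) x) m) := by
  simp only [swap, lin_comp_apply, lin_tensAssoc_inv_pure, lin_tensHom_pure, lin_id_apply,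
    lin_braid_inv_pure hS, map_sum, LinearMap.sum_apply, lin_tensAssoc_hom_pure]

theorem swap_natural_left {X Y : FDMod k (Boson hH)} (V : FDMod k T) (M : FDMod k K) (f : X ⟶ Y) :
    tensHom f (𝟙 (tens (infl hH V) M)) ≫ swap Y V M =
      swap X V M ≫ tensHom (𝟙 (infl hH V)) (tensHom f (𝟙 M)) := by
  obtain ⟨S, hS⟩ := Boson.exists_sum R
  refine tens_ext_right fun x v m => ?_
  simp only [lin_comp_apply, lin_tensHom_pure, lin_id_apply, lin_swap_pure hS, map_sum, lin_act]

theorem swap_natural_right (X : FDMod k (Boson hH)) (V : FDMod k T) {M N : FDMod k K} (f : M ⟶ N) :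
    tensHom (𝟙 X) (tensHom (𝟙 (infl hH V)) f) ≫ swap X V N =
      swap X V M ≫ tensHom (𝟙 (infl hH V)) (tensHom (𝟙 X) f) := by
  obtain ⟨S, hS⟩ := Boson.exists_sum R
  refine tens_ext_right fun x v m => ?_
  simp only [lin_comp_apply, lin_tensHom_pure, lin_id_apply, lin_swap_pure hS, map_sum]

/-- The identity `(ε ⊗ id)(R) = 1`. -/
theorem swap_unit (V : FDMod k T) (M : FDMod k K) :
    swap (unit : FDMod k (Boson hH)) V M ≫ tensHom (𝟙 (infl hH V)) (tensUnit M).hom =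
      (tensUnit (tens (infl hH V) M)).hom := by
  obtain ⟨S, hS⟩ := Boson.exists_sum R
  refine tens_ext_right fun r v m => ?_
  have e : ∀ t : T, (unit : FDMod k (Boson hH)).act (Boson.inT hH t) r =
      counit (R := k) t • r := fun t => congrArg (fun c : k => c • r) (Boson.counitB_inT hH t)
  let c : k := r
  have e1 : ∀ (N : FDMod k K) (n : N), lin (tensUnit (A := Boson hH) N).hom (pure unit N r n) =
      c • n := fun _ _ => rfl
  simp only [lin_comp_apply, lin_swap_pure hS, map_sum, lin_tensHom_pure, lin_id_apply, e, e1,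
    map_smul, LinearMap.smul_apply]
  have h := congrArg (fun t : T => pure (infl hH V) M ((infl hH V).act (Boson.inT hH t) v) (c • m))
    (Boson.counit_id_sum hS)
  simp only [map_sum, map_smul (Boson.inT hH), map_smul (infl hH V).act, LinearMap.sum_apply,
    LinearMap.smul_apply, map_one, Module.End.one_apply, map_smul (pure (infl hH V) M)] at h
  simpa only [map_smul] using h

/-- The hexagon: `(Δ ⊗ id)(R) = R₁₃ R₂₃` splits the passage of `V` across `X ⊗ Y` into a passage
across `Y` followed by one across `X`. -/
theorem swap_tens (X Y : FDMod k (Boson hH)) (V : FDMod k T) (M : FDMod k K) :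
    swap (tens X Y) V M ≫ tensHom (𝟙 (infl hH V)) (tensAssoc X Y M).hom =
      (tensAssoc X Y (tens (infl hH V) M)).hom ≫ tensHom (𝟙 X) (swap Y V M) ≫
        swap X V (tens Y M) := by
  obtain ⟨S, hS⟩ := Boson.exists_sum R
  refine tens_ext fun w z => ?_
  induction z using tens_induction with
  | zero => simp only [map_zero]
  | add a b ha hb => simp only [map_add, ha, hb]
  | pure v m =>
  induction w using tens_induction with
  | zero => simp only [map_zero, LinearMap.zero_apply]
  | add a b ha hb => simp only [map_add, LinearMap.add_apply, ha, hb]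
  | pure x y =>
  let Ψ : (T ⊗[k] T) →ₗ[k] tens X Y := TensorProduct.map
    ((X.act.comp (Boson.inT hH)).toLinearMap.flip x) ((Y.act.comp (Boson.inT hH)).toLinearMap.flip y)
  let Φ : T ⊗[k] (T ⊗[k] T) →ₗ[k] tens (infl hH V) (tens X (tens Y M)) :=
    TensorProduct.lift ((pure (infl hH V) (tens X (tens Y M))).flip.compl₁₂
      (lin (tensAssoc X Y M).hom ∘ₗ (pure (tens X Y) M).flip m ∘ₗ Ψ)
      (((infl hH V).act.comp (Boson.inT hH)).toLinearMap.flip v)) ∘ₗ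
      (TensorProduct.assoc k T T T).symm.toLinearMap
  have h := Boson.comul_id_sum hS Φ
  have e1 : ∀ t : T, (tens X Y).act (Boson.inT hH t) (pure X Y x y) = Ψ (comul (R := k) t) := by
    intro t
    refine (congrArg (fun w => tensorAct X.act Y.act w (x ⊗ₜ y)) (Boson.comul_inT hH t)).trans ?_
    generalize comul (R := k) t = w
    induction w with
    | zero => simp only [map_zero, LinearMap.zero_apply]; rfl
    | add a b ha hb => simp only [map_add, LinearMap.add_apply, ha, hb]; rfl
    | tmul a b => rfl
  have e2 : ∀ (w : T ⊗[k] T) (t : T), Φ (TensorProduct.assoc k T T T (w ⊗ₜ t)) =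
      pure (infl hH V) _ ((infl hH V).act (Boson.inT hH t) v)
        (lin (tensAssoc X Y M).hom (pure (tens X Y) M (Ψ w) m)) := by
    intro w t
    simp only [Φ, LinearMap.comp_apply, LinearEquiv.coe_coe, LinearEquiv.symm_apply_apply]
    rfl
  have e3 : ∀ a b c : T, Φ (a ⊗ₜ (b ⊗ₜ c)) =
      pure (infl hH V) _ ((infl hH V).act (Boson.inT hH c) v)
        (pure X _ (X.act (Boson.inT hH a) x) (pure Y M (Y.act (Boson.inT hH b) y) m)) :=
    fun _ _ _ => rfl
  simp only [e2, e3] at h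
  simp only [lin_comp_apply, lin_swap_pure hS, map_sum, lin_tensHom_pure, lin_id_apply, e1,
    lin_tensAssoc_hom_pure]
  rw [h, Finset.sum_comm]
  simp only [map_mul, Module.End.mul_apply]

end FDMod

end Swap

/-! ### The functors `X ▷ F` and `F ◁ X`, and the relative end of `X ▷ F`. -/

section LeftRightAct

variable {k : Type u} [Field k] {T : Type u} [Ring T] [HopfAlgebra k T] [Module.Finite k T]
  {R : RMatrix k T} {H : Type u} [Ring H] [Algebra k H] [Coalgebra k H] [Module.Finite k H]
  [Module T H] [IsScalarTower k T H] {hH : BraidedHopf R H}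
  {K : Type u} [Ring K] [Algebra k K] [ComoduleAlgebra k (Boson hH) K]

open FDMod

namespace VFunctor

variable {Φ : VFunctor hH K} {X Y : FDMod k (Boson hH)}

theorem IsModuleTrans.natural' {γ : ∀ M, tens Y M ⟶ Φ.F.obj M} (h : Φ.IsModuleTrans Y γ)
    {M N : FDMod k K} (f : M ⟶ N) : γ M ≫ Φ.F.map f = tensHom (𝟙 Y) f ≫ γ N := h.natural f

theorem IsModuleTrans.swap {γ : ∀ M, tens Y M ⟶ Φ.F.obj M} (h : Φ.IsModuleTrans Y γ)
    (V : FDMod k T) (M : FDMod k K) : γ (tens (infl hH V) M) ≫ Φ.d V M =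
      swap Y V M ≫ tensHom (𝟙 (infl hH V)) (γ M) := by
  rw [h.module, FDMod.swap]
  simp only [Category.assoc]

theorem isModuleTrans_of_swap {γ : ∀ M, tens Y M ⟶ Φ.F.obj M}
    (h : ∀ {M N : FDMod k K} (f : M ⟶ N), γ M ≫ Φ.F.map f = tensHom (𝟙 Y) f ≫ γ N)
    (h' : ∀ (V : FDMod k T) (M : FDMod k K), γ (tens (infl hH V) M) ≫ Φ.d V M =
      FDMod.swap Y V M ≫ tensHom (𝟙 (infl hH V)) (γ M)) : Φ.IsModuleTrans Y γ :=
  ⟨h, fun V M => by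
    rw [h', FDMod.swap]
    simp only [Category.assoc]⟩

/-- With the structure of `X ▷ F` written through `swap`, associators disappear from the module
condition, and the hexagon applies as a rewriting rule. -/
theorem leftAct_isModuleTrans_iff {γ : ∀ M, tens Y M ⟶ tens X (Φ.F.obj M)} :
    (leftAct X Φ).IsModuleTrans Y γ ↔
      (∀ {M N : FDMod k K} (f : M ⟶ N),
        γ M ≫ tensHom (𝟙 X) (Φ.F.map f) = tensHom (𝟙 Y) f ≫ γ N) ∧
      ∀ (V : FDMod k T) (M : FDMod k K), γ (tens (infl hH V) M) ≫ tensHom (𝟙 X) (Φ.d V M) ≫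
        swap X V (Φ.F.obj M) = swap Y V M ≫ tensHom (𝟙 (infl hH V)) (γ M) :=
  ⟨fun h => ⟨h.natural', fun V M => h.swap V M⟩, fun h => isModuleTrans_of_swap h.1 h.2⟩

theorem rightAct_isModuleTrans_iff {γ : ∀ M, tens Y M ⟶ Φ.F.obj (tens X M)} :
    (Φ.rightAct X).IsModuleTrans Y γ ↔
      (∀ {M N : FDMod k K} (f : M ⟶ N),
        γ M ≫ Φ.F.map (tensHom (𝟙 X) f) = tensHom (𝟙 Y) f ≫ γ N) ∧
      ∀ (V : FDMod k T) (M : FDMod k K), γ (tens (infl hH V) M) ≫ Φ.F.map (swap X V M) ≫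
        Φ.d V (tens X M) = swap Y V M ≫ tensHom (𝟙 (infl hH V)) (γ M) :=
  ⟨fun h => ⟨h.natural', fun V M => h.swap V M⟩, fun h => isModuleTrans_of_swap h.1 h.2⟩

/-- The transformation `(X ⊗ Y) ⊗ M → X ⊗ F(M)` defined by a transformation `Y ⊗ M → F(M)`. -/
def leftTrans (X : FDMod k (Boson hH)) {F : FDMod k K → FDMod k K} (γ : ∀ M, tens Y M ⟶ F M)
    (M : FDMod k K) : tens (tens X Y) M ⟶ tens X (F M) :=
  (tensAssoc X Y M).hom ≫ tensHom (𝟙 X) (γ M)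

/-- The transformation `(Y ⊗ X) ⊗ M → F(X ⊗ M)` defined by a transformation `Y ⊗ M → F(M)`. -/
def rightTrans (X : FDMod k (Boson hH)) {F : FDMod k K → FDMod k K} (γ : ∀ M, tens Y M ⟶ F M)
    (M : FDMod k K) : tens (tens Y X) M ⟶ F (tens X M) :=
  (tensAssoc Y X M).hom ≫ γ (tens X M)

/-- The hexagon `swap_tens` separates the swap of `V` with `X ⊗ Y` into the swap with `Y`, which the
hypothesis on `γ` absorbs, and the swap with `X`, which is part of the structure of `X ▷ F`. -/
theorem IsModuleTrans.leftAct {γ : ∀ M, tens Y M ⟶ Φ.F.obj M} (h : Φ.IsModuleTrans Y γ)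
    (X : FDMod k (Boson hH)) : (leftAct X Φ).IsModuleTrans (tens X Y) (leftTrans X γ) := by
  refine leftAct_isModuleTrans_iff.2 ⟨fun {M N} f => ?_, fun V M => ?_⟩ <;> simp only [leftTrans]
  · rw [Category.assoc, ← tensHom_id_comp, h.natural, tensHom_id_comp, ← Category.assoc,
      ← tensAssoc_hom_natural_right, Category.assoc]
  · rw [tensHom_id_comp (infl hH V), ← Category.assoc (FDMod.swap _ _ _), swap_tens]
    simp only [Category.assoc]
    rw [← swap_natural_right, ← Category.assoc (tensHom _ _), ← tensHom_id_comp, h.swap,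
      tensHom_id_comp]
    simp only [Category.assoc]

theorem IsModuleTrans.rightAct {γ : ∀ M, tens Y M ⟶ Φ.F.obj M} (h : Φ.IsModuleTrans Y γ)
    (X : FDMod k (Boson hH)) : (Φ.rightAct X).IsModuleTrans (tens Y X) (rightTrans X γ) := by
  refine rightAct_isModuleTrans_iff.2 ⟨fun {M N} f => ?_, fun V M => ?_⟩ <;> simp only [rightTrans]
  · rw [Category.assoc, h.natural, ← Category.assoc, ← tensAssoc_hom_natural_right, Category.assoc]
  · rw [tensHom_id_comp (infl hH V), ← Category.assoc (FDMod.swap _ _ _), swap_tens]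
    simp only [Category.assoc]
    rw [← h.swap, ← Category.assoc (γ _), h.natural]
    simp only [Category.assoc]

theorem sliceHom_eq {Z N : FDMod k K} (f : Z ⟶ tens X N) :
    sliceHom f = tensHom (𝟙 (dual X)) f ≫ sliceHom (𝟙 (tens X N)) := by
  simp only [sliceHom, tensHom_id_id, Category.id_comp]

theorem sliceHom_natural {M N : FDMod k K} (f : M ⟶ N) :
    sliceHom (𝟙 (tens X M)) ≫ f = tensHom (𝟙 (dual X)) (tensHom (𝟙 X) f) ≫
      sliceHom (𝟙 (tens X N)) := by
  refine tens_ext fun ξ z => ?_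
  obtain ⟨ξ, rfl⟩ := dualElt_surjective X ξ
  simp only [lin_comp_apply, lin_sliceHom_pure, lin_tensHom_pure, lin_id_apply, lin_slice]

/-- The evaluation of `X` is a morphism to the unit, so `V` passes it by naturality and passes the
unit trivially. Moving `V` across `X` and then across the dual of `X` is therefore invisible after
evaluation. -/
theorem sliceHom_swap (V : FDMod k T) (N : FDMod k K) :
    sliceHom (𝟙 (tens X (tens (infl hH V) N))) =
      tensHom (𝟙 (dual X)) (FDMod.swap X V N) ≫ FDMod.swap (dual X) V (tens X N) ≫
        tensHom (𝟙 (infl hH V)) (sliceHom (𝟙 (tens X N))) := by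
  have h1 := swap_tens (dual X) X V N
  have h2 := swap_natural_left V N (dualEval X)
  have h3 := swap_unit (hH := hH) V N
  have h4 : tensHom (𝟙 (dual X)) (FDMod.swap X V N) ≫ FDMod.swap (dual X) V (tens X N) =
      (tensAssoc (dual X) X (tens (infl hH V) N)).inv ≫ FDMod.swap (tens (dual X) X) V N ≫
        tensHom (𝟙 (infl hH V)) (tensAssoc (dual X) X N).hom := by
    rw [h1, Iso.inv_hom_id_assoc]
  rw [← Category.assoc (tensHom _ _), h4, sliceHom, sliceHom]
  simp only [tensHom_id_id, Category.id_comp, Category.assoc]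
  rw [← tensHom_id_comp, Iso.hom_inv_id_assoc, tensHom_id_comp, ← Category.assoc (FDMod.swap _ _ _),
    ← h2, Category.assoc, h3]

/-- Duality of `X` moves `X` from the target to the source of a transformation and preserves the
module condition, by `sliceHom_swap` and the hexagon. -/
theorem IsModuleTrans.sliceHom {γ : ∀ M, tens Y M ⟶ tens X (Φ.F.obj M)}
    (h : (VFunctor.leftAct X Φ).IsModuleTrans Y γ) : Φ.IsModuleTrans (tens (dual X) Y)
      fun M => (tensAssoc (dual X) Y M).hom ≫ sliceHom (γ M) := by
  have h' := leftAct_isModuleTrans_iff.1 h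
  refine isModuleTrans_of_swap (fun {M N} f => ?_) fun V M => ?_
  · rw [sliceHom_eq (γ M), sliceHom_eq (γ N)]
    simp only [Category.assoc]
    rw [sliceHom_natural, ← Category.assoc (tensHom _ _), ← tensHom_id_comp, h'.1, tensHom_id_comp,
      ← Category.assoc (tensHom _ _), tensAssoc_hom_natural_right]
    simp only [Category.assoc]
  · rw [sliceHom_eq (γ M), sliceHom_eq]
    simp only [Category.assoc]
    rw [sliceHom_natural, sliceHom_swap, ← Category.assoc (tensHom _ _), ← tensHom_id_comp,
      ← Category.assoc (tensHom _ _), ← tensHom_id_comp, Category.assoc, h'.2 V M,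
      tensHom_id_comp, tensHom_id_comp, tensHom_id_comp, ← Category.assoc (FDMod.swap _ _ _),
      swap_tens]
    simp only [Category.assoc]
    rw [← Category.assoc (tensHom (𝟙 (dual X)) (tensHom _ _)), swap_natural_right]
    simp only [Category.assoc]

/-- Transformations `Y ⊗ - → X ▷ F` become transformations from `X* ⊗ Y` to `F`, hence morphisms `X*
⊗ Y → E`, hence morphisms `Y → X ⊗ E`. No condition on `F` is needed. -/
theorem RelEnd.leftAct_universal (E : Φ.RelEnd) {γ : ∀ M, tens Y M ⟶ tens X (Φ.F.obj M)}
    (h : (VFunctor.leftAct X Φ).IsModuleTrans Y γ) :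
    ∃! g : Y ⟶ tens X E.obj, ∀ M, γ M =
      tensHom g (𝟙 M) ≫ leftTrans X E.counit M := by
  obtain ⟨G, hG, -⟩ := E.existsUnique_hom h.sliceHom
  refine ⟨unslice G, fun M => tens_ext fun y m => eq_of_slice fun ξ => ?_, fun g hg => ?_⟩
  · rw [lin_comp_apply, lin_tensHom_pure, leftTrans, slice_tensAssoc, slice_unslice, lin_id_apply]
    have h1 := congrArg (fun f => lin f (pure (tens (dual X) Y) M
      (pure (dual X) Y (dualElt X ξ) y) m)) (hG M)
    simpa only [lin_comp_apply, lin_tensHom_pure, lin_id_apply, lin_tensAssoc_hom_pure,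
      lin_sliceHom_pure] using h1
  · have e : FDMod.sliceHom g = FDMod.sliceHom (unslice G) := by
      refine E.hom_ext fun M => tens_ext_threefold fun ξ y m => ?_
      obtain ⟨ξ, rfl⟩ := dualElt_surjective X ξ
      have h1 := congrArg (fun f => lin f (pure (tens (dual X) Y) M
        (pure (dual X) Y (dualElt X ξ) y) m)) (hG M)
      have h2 := congrArg (fun f => slice (Φ.F.obj M) ξ (lin f (pure Y M y m))) (hg M)
      simp only [lin_comp_apply, lin_tensHom_pure, lin_id_apply, lin_tensAssoc_hom_pure,
        lin_sliceHom_pure, slice_unslice] at h1 h2 ⊢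
      rw [← h1, h2]
      exact (slice_tensAssoc _ _ _ _).symm
    refine FDMod.hom_ext (LinearMap.ext fun y => eq_of_slice fun ξ => ?_)
    have := congrArg (fun f => lin f (pure (dual X) Y (dualElt X ξ) y)) e
    simpa only [lin_sliceHom_pure] using this

/-- The relative end `X ⊗ E` of `X ▷ F`. -/
def RelEnd.leftAct (E : Φ.RelEnd) (X : FDMod k (Boson hH)) : (VFunctor.leftAct X Φ).RelEnd :=
  RelEnd.ofCounit (tens X E.obj) (leftTrans X E.counit) (E.isModuleTrans.leftAct X) fun _ _ h => E.leftAct_universal h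

end VFunctor

end LeftRightAct

/-! ### The module structure of `P ⊗_K -`. -/

section StructHom

variable {k : Type u} [Field k] {A : Type u} [Ring A] [Bialgebra k A]
  {K : Type u} [Ring K] [Algebra k K] [ComoduleAlgebra k A K]

open FDMod

namespace HopfBimodule

variable (P : HopfBimodule k A K)

theorem ext_tens {X : FDMod k A} {M N : FDMod k K} {f g : P.tensor (tens X M) ⟶ N}
    (h : ∀ p x m, lin f (P.pure (tens X M) p (FDMod.pure X M x m)) =
      lin g (P.pure (tens X M) p (FDMod.pure X M x m))) : f = g :=
  P.ext fun p z => LinearMap.congr_fun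
    (f := lin f ∘ₗ P.pure (tens X M) p) (g := lin g ∘ₗ P.pure (tens X M) p)
    (tens_lin_ext fun x m => h p x m) z

/-- The map `a ⊗ p ↦ a x ⊗ (p ⊗ m)`. -/
def structAt (X : FDMod k A) (M : FDMod k K) (x : X) (m : M) :
    A ⊗[k] P →ₗ[k] tens X (P.tensor M) :=
  (P.structMap X M).flip (x ⊗ₜ m)

theorem structAt_tmul (X : FDMod k A) (M : FDMod k K) (x : X) (m : M) (a : A) (p : P) :
    P.structAt X M x m (a ⊗ₜ p) = FDMod.pure X (P.tensor M) (X.act a x) (P.pure M p m) := rfl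

theorem lin_structHom_pure_pure (X : FDMod k A) (M : FDMod k K) (p : P) (x : X) (m : M) :
    lin (P.structHom X M) (P.pure (tens X M) p (FDMod.pure X M x m)) =
      P.structAt X M x m (P.coact p) := rfl

theorem structHom_natural_left {X Y : FDMod k A} (f : X ⟶ Y) (M : FDMod k K) :
    P.mapHom (tensHom f (𝟙 M)) ≫ P.structHom Y M =
      P.structHom X M ≫ tensHom f (𝟙 (P.tensor M)) := by
  refine P.ext_tens fun p x m => ?_
  simp only [lin_comp_apply, lin_mapHom_pure, lin_tensHom_pure, lin_id_apply,
    lin_structHom_pure_pure]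
  generalize P.coact p = w
  induction w with
  | zero => simp only [map_zero]
  | add c d hc hd => simp only [map_add, hc, hd]
  | tmul a p => simp only [structAt_tmul, lin_tensHom_pure, lin_id_apply, lin_act]

theorem structHom_natural_right (X : FDMod k A) {M N : FDMod k K} (f : M ⟶ N) :
    P.mapHom (tensHom (𝟙 X) f) ≫ P.structHom X N =
      P.structHom X M ≫ tensHom (𝟙 X) (P.mapHom f) := by
  refine P.ext_tens fun p x m => ?_
  simp only [lin_comp_apply, lin_mapHom_pure, lin_tensHom_pure, lin_id_apply,
    lin_structHom_pure_pure]
  generalize P.coact p = w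
  induction w with
  | zero => simp only [map_zero]
  | add c d hc hd => simp only [map_add, hc, hd]
  | tmul a p => simp only [structAt_tmul, lin_tensHom_pure, lin_id_apply, lin_mapHom_pure]

/-- Coassociativity of the coaction of `P`: acting on `x ⊗ y` by `p₋₁` through `Δ` is the same as
acting on `x`, and then on `y` by the coaction of `p₀`. -/
theorem structHom_tens (X Y : FDMod k A) (M : FDMod k K) :
    P.structHom (tens X Y) M ≫ (tensAssoc X Y (P.tensor M)).hom =
      P.mapHom (tensAssoc X Y M).hom ≫ P.structHom X (tens Y M) ≫
        tensHom (𝟙 X) (P.structHom Y M) := by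
  refine P.ext_tens fun p w m => ?_
  induction w using tens_induction with
  | zero => simp only [map_zero, LinearMap.zero_apply]
  | add a b ha hb => simp only [map_add, LinearMap.add_apply, ha, hb]
  | pure x y =>
  let Φ : A ⊗[k] (A ⊗[k] P) →ₗ[k] tens X (tens Y (P.tensor M)) :=
    TensorProduct.map (X.act.toLinearMap.flip x) (P.structAt Y M y m)
  have e1 : ∀ w : A ⊗[k] P, lin (tensAssoc X Y (P.tensor M)).hom
      (P.structAt (tens X Y) M (FDMod.pure X Y x y) m w) =
      Φ (TensorProduct.assoc k A A P ((comul (R := k)).rTensor P w)) := by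
    intro w
    induction w with
    | zero => simp only [map_zero]
    | add c d hc hd => simp only [map_add, hc, hd]
    | tmul a p =>
      obtain ⟨n, b, c, h⟩ := TensorProduct.exists_sum_fin (comul (R := k) a)
      rw [structAt_tmul, tens_act_pure X Y h, LinearMap.rTensor_tmul, h]
      simp only [map_sum, LinearMap.sum_apply, sum_tmul, lin_tensAssoc_hom_pure,
        TensorProduct.assoc_tmul]
      rfl
  have e2 : ∀ w : A ⊗[k] P, lin (tensHom (𝟙 X) (P.structHom Y M))
      (P.structAt X (tens Y M) x (FDMod.pure Y M y m) w) = Φ (P.coact.lTensor A w) := by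
    intro w
    induction w with
    | zero => simp only [map_zero]
    | add c d hc hd => simp only [map_add, hc, hd]
    | tmul a p =>
      rw [structAt_tmul, lin_tensHom_pure, lin_structHom_pure_pure]
      rfl
  simp only [lin_comp_apply, lin_mapHom_pure, lin_structHom_pure_pure, lin_tensAssoc_hom_pure, e1,
    e2, P.coassoc]

end HopfBimodule
end StructHom

/-! ### The morphisms `σ_X` and their naturality and tensor axiom. -/

section HalfBraid

variable {k : Type u} [Field k] {T : Type u} [Ring T] [HopfAlgebra k T] [Module.Finite k T]
  {R : RMatrix k T} {H : Type u} [Ring H] [Algebra k H] [Coalgebra k H] [Module.Finite k H]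
  [Module T H] [IsScalarTower k T H] {hH : BraidedHopf R H}
  {K : Type u} [Ring K] [Algebra k K] [ComoduleAlgebra k (Boson hH) K]

open FDMod

namespace HopfBimodule

open VFunctor

variable {P : HopfBimodule k (Boson hH) K} {X Y : FDMod k (Boson hH)}

theorem isModuleTrans_iff_swap {γ : ∀ M, tens Y M ⟶ P.tensor M} :
    P.functor.IsModuleTrans Y γ ↔
      (∀ {M N : FDMod k K} (f : M ⟶ N), γ M ≫ P.mapHom f = tensHom (𝟙 Y) f ≫ γ N) ∧
      ∀ (V : FDMod k T) (M : FDMod k K), γ (tens (infl hH V) M) ≫ P.structHom (infl hH V) M =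
        swap Y V M ≫ tensHom (𝟙 (infl hH V)) (γ M) :=
  ⟨fun h => ⟨h.natural', fun V M => h.swap V M⟩, fun h => isModuleTrans_of_swap h.1 h.2⟩

theorem rightAct_iff {γ : ∀ M, tens Y M ⟶ P.tensor (tens X M)} :
    (P.functor.rightAct X).IsModuleTrans Y γ ↔
      (∀ {M N : FDMod k K} (f : M ⟶ N),
        γ M ≫ P.mapHom (tensHom (𝟙 X) f) = tensHom (𝟙 Y) f ≫ γ N) ∧
      ∀ (V : FDMod k T) (M : FDMod k K), γ (tens (infl hH V) M) ≫ P.mapHom (swap X V M) ≫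
        P.structHom (infl hH V) (tens X M) =
          swap Y V M ≫ tensHom (𝟙 (infl hH V)) (γ M) :=
  rightAct_isModuleTrans_iff (Φ := P.functor)

theorem leftAct_iff {γ : ∀ M, tens Y M ⟶ tens X (P.tensor M)} :
    (VFunctor.leftAct X P.functor).IsModuleTrans Y γ ↔
      (∀ {M N : FDMod k K} (f : M ⟶ N),
        γ M ≫ tensHom (𝟙 X) (P.mapHom f) = tensHom (𝟙 Y) f ≫ γ N) ∧
      ∀ (V : FDMod k T) (M : FDMod k K), γ (tens (infl hH V) M) ≫
        tensHom (𝟙 X) (P.structHom (infl hH V) M) ≫ swap X V (P.tensor M) =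
          swap Y V M ≫ tensHom (𝟙 (infl hH V)) (γ M) :=
  leftAct_isModuleTrans_iff (Φ := P.functor)

/-- Both sides are obtained from the structure for a tensor product, of `V` and `X` on the left and
of `X` and `V` on the right, and naturality along the inverse half-braiding `X ⊗ V → V ⊗ X`
identifies them. -/
theorem structHom_swap (X : FDMod k (Boson hH)) (V : FDMod k T) (M : FDMod k K) :
    P.mapHom (swap X V M) ≫ P.structHom (infl hH V) (tens X M) ≫
      tensHom (𝟙 (infl hH V)) (P.structHom X M) =
    P.structHom X (tens (infl hH V) M) ≫ tensHom (𝟙 X) (P.structHom (infl hH V) M) ≫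
      swap X V (P.tensor M) := by
  have h1 := P.structHom_tens X (infl hH V) M
  have h2 : P.mapHom (tensAssoc X (infl hH V) M).inv ≫ P.structHom (tens X (infl hH V)) M =
      P.structHom X (tens (infl hH V) M) ≫ tensHom (𝟙 X) (P.structHom (infl hH V) M) ≫
        (tensAssoc X (infl hH V) (P.tensor M)).inv := by
    rw [← Category.assoc _ _ (Iso.inv _), Iso.eq_comp_inv, Category.assoc, h1, ← Category.assoc,
      ← mapHom_comp, Iso.inv_hom_id, mapHom_id, Category.id_comp]
  rw [swap, swap, mapHom_comp, mapHom_comp]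
  simp only [Category.assoc]
  rw [← P.structHom_tens, ← Category.assoc (P.mapHom (tensHom _ _)), structHom_natural_left,
    Category.assoc, ← Category.assoc, h2]
  simp only [Category.assoc]

/-- The maps `c_X` form a transformation of module functors from `F ◁ X` to `X ▷ F`; its effect on
transformations defines `ρ̄(c_X)`. -/
theorem isModuleTrans_structHom {γ : ∀ M, tens Y M ⟶ P.tensor (tens X M)}
    (h : (P.functor.rightAct X).IsModuleTrans Y γ) :
    (VFunctor.leftAct X P.functor).IsModuleTrans Y fun M => γ M ≫ P.structHom X M := by
  have h' := rightAct_iff.1 h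
  refine leftAct_iff (γ := fun M => γ M ≫ P.structHom X M).2
    ⟨fun {M N} f => ?_, fun V M => ?_⟩
  · rw [Category.assoc, ← structHom_natural_right, ← Category.assoc, h'.1, Category.assoc]
  · rw [Category.assoc, ← structHom_swap, tensHom_id_comp, ← Category.assoc (swap _ _ _), ← h'.2 V M]
    simp only [Category.assoc]

/-- The morphism `E ⊗ M → P ⊗_K M` of a relative end. -/
def ev (E : P.functor.RelEnd) (M : FDMod k K) : tens E.obj M ⟶ P.tensor M := E.counit M

theorem ev_natural (E : P.functor.RelEnd) {M N : FDMod k K} (f : M ⟶ N) :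
    ev E M ≫ P.mapHom f = tensHom (𝟙 E.obj) f ≫ ev E N := E.isModuleTrans.natural f

theorem isModuleTrans_rightTrans (E : P.functor.RelEnd) (X : FDMod k (Boson hH)) :
    (VFunctor.leftAct X P.functor).IsModuleTrans (tens E.obj X)
      fun M => rightTrans X (ev E) M ≫ P.structHom X M :=
  isModuleTrans_structHom (E.isModuleTrans.rightAct X)

/-- Only the universal property of `X ⊗ E` is used. The half-braiding thus exists before `E ⊗ X` is
known to be a relative end of `F ◁ X`, a fact that will be deduced from its invertibility. -/
theorem exists_sigma (E : P.functor.RelEnd) (X : FDMod k (Boson hH)) :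
    ∃! g : tens E.obj X ⟶ tens X E.obj, ∀ M, rightTrans X (ev E) M ≫ P.structHom X M =
      tensHom g (𝟙 M) ≫ leftTrans X (ev E) M :=
  E.leftAct_universal (isModuleTrans_rightTrans E X)

/-- The morphism `E ⊗ X → X ⊗ E` induced by the module structure of `P ⊗_K -`. -/
def sigma (E : P.functor.RelEnd) (X : FDMod k (Boson hH)) : tens E.obj X ⟶ tens X E.obj :=
  (exists_sigma E X).choose

theorem sigma_spec (E : P.functor.RelEnd) (X : FDMod k (Boson hH)) (M : FDMod k K) :
    rightTrans X (ev E) M ≫ P.structHom X M =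
      tensHom (sigma E X) (𝟙 M) ≫ leftTrans X (ev E) M :=
  (exists_sigma E X).choose_spec.1 M

theorem eq_sigma {E : P.functor.RelEnd} {X : FDMod k (Boson hH)} {g : tens E.obj X ⟶ tens X E.obj}
    (h : ∀ M, rightTrans X (ev E) M ≫ P.structHom X M =
      tensHom g (𝟙 M) ≫ leftTrans X (ev E) M) : g = sigma E X :=
  (exists_sigma E X).choose_spec.2 g h

/-- Uniqueness for the relative end `X ⊗ E`; the axioms of `σ` are checked by this test. -/
theorem tens_hom_ext (E : P.functor.RelEnd) {Z X : FDMod k (Boson hH)} {g g' : Z ⟶ tens X E.obj}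
    (h : ∀ M, tensHom g (𝟙 M) ≫ leftTrans X (ev E) M =
      tensHom g' (𝟙 M) ≫ leftTrans X (ev E) M) : g = g' := by
  refine (E.leftAct X).hom_ext fun M => ?_
  have e : (E.leftAct X).counit M = leftTrans X (ev E) M := RelEnd.counit_ofCounit _ _ _ _ _
  rw [e]
  exact h M

theorem sigma_natural (E : P.functor.RelEnd) (f : X ⟶ Y) :
    tensHom (𝟙 E.obj) f ≫ sigma E Y = sigma E X ≫ tensHom f (𝟙 E.obj) := by
  refine tens_hom_ext E fun M => ?_
  rw [tensHom_comp_id, tensHom_comp_id, Category.assoc, Category.assoc, ← sigma_spec]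
  have e : tensHom (tensHom f (𝟙 E.obj)) (𝟙 M) ≫ leftTrans Y (ev E) M =
      leftTrans X (ev E) M ≫ tensHom f (𝟙 (P.tensor M)) := by
    rw [leftTrans, leftTrans, ← Category.assoc, tensAssoc_hom_natural_left, Category.assoc,
      Category.assoc, tensHom_exchange]
  rw [e, ← Category.assoc (tensHom (sigma E X) _), ← sigma_spec, Category.assoc,
    ← structHom_natural_left, rightTrans, rightTrans, ← Category.assoc (tensHom _ _),
    ← Category.assoc (tensHom _ _), tensAssoc_hom_natural_middle]
  simp only [Category.assoc]
  rw [← Category.assoc (ev E _), ev_natural, Category.assoc]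

theorem sigma_spec_apply (E : P.functor.RelEnd) (X : FDMod k (Boson hH)) (M : FDMod k K)
    (w : tens E.obj X) (m : M) :
    lin (P.structHom X M) (lin (ev E (tens X M))
      (lin (tensAssoc E.obj X M).hom (FDMod.pure (tens E.obj X) M w m))) =
    lin (tensHom (𝟙 X) (ev E M)) (lin (tensAssoc X E.obj M).hom
      (FDMod.pure (tens X E.obj) M (lin (sigma E X) w) m)) :=
  congrArg (fun f => lin f (FDMod.pure (tens E.obj X) M w m)) (sigma_spec E X M)

/-- After composition with the universal transformation, the left side is the structure of `P ⊗_K -`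
for `X ⊗ Y`. By `structHom_tens` this is the structure for `X` followed by that for `Y`, each of
which is the defining property of one `σ`. -/
theorem sigma_tens (E : P.functor.RelEnd) (X Y : FDMod k (Boson hH)) :
    sigma E (tens X Y) = (tensAssoc E.obj X Y).inv ≫ tensHom (sigma E X) (𝟙 Y) ≫
      (tensAssoc X E.obj Y).hom ≫ tensHom (𝟙 X) (sigma E Y) ≫ (tensAssoc X Y E.obj).inv := by
  refine tens_hom_ext E fun M => ?_
  rw [← sigma_spec, ← cancel_mono (tensAssoc X Y (P.tensor M)).hom, rightTrans]
  simp only [Category.assoc]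
  rw [P.structHom_tens, ← Category.assoc (ev E _), ev_natural]
  refine tens_ext fun w m => ?_
  induction w using tens_induction with
  | zero => simp only [map_zero, LinearMap.zero_apply]
  | add a b ha hb => simp only [map_add, LinearMap.add_apply, ha, hb]
  | pure e w =>
  induction w using tens_induction with
  | zero => simp only [map_zero, LinearMap.zero_apply]
  | add a b ha hb => simp only [map_add, LinearMap.add_apply, ha, hb]
  | pure x y =>
  -- The defining property of `σ_X` is used at the module `Y ⊗ M`, so that `σ_Y` can be applied
  -- afterwards at `M`.
  have h1 := sigma_spec_apply E X (tens Y M) (FDMod.pure E.obj X e x) (FDMod.pure Y M y m)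
  simp only [lin_tensAssoc_hom_pure] at h1
  simp only [lin_comp_apply, lin_tensAssoc_hom_pure, lin_tensHom_pure, lin_id_apply,
    lin_tensAssoc_inv_pure, h1]
  generalize lin (sigma E X) (FDMod.pure E.obj X e x) = w
  induction w using tens_induction with
  | zero => simp only [map_zero, LinearMap.zero_apply]
  | add a b ha hb => simp only [map_add, LinearMap.add_apply, ha, hb]
  | pure x e =>
  have h2 := sigma_spec_apply E Y M (FDMod.pure E.obj Y e y) m
  simp only [lin_tensAssoc_hom_pure] at h2
  simp only [lin_tensAssoc_hom_pure, lin_tensHom_pure, lin_id_apply, h2]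
  generalize lin (sigma E Y) (FDMod.pure E.obj Y e y) = w
  induction w using tens_induction with
  | zero => simp only [map_zero, LinearMap.zero_apply]
  | add a b ha hb => simp only [map_add, LinearMap.add_apply, ha, hb]
  | pure y e =>
  simp only [lin_tensAssoc_hom_pure, lin_tensHom_pure, lin_id_apply, lin_tensAssoc_inv_pure,
    leftTrans, lin_comp_apply]

end HopfBimodule
end HalfBraid

/-! ### The inverse of the antipode. -/

section InverseAntipode

open LinearMap (mul')

variable {k : Type u} [Field k] {A : Type u} [Ring A] [HopfAlgebra k A] [Module.Finite k A]

namespace HopfAlgebra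

variable (k A) in
/-- The inverse of the antipode of a finite-dimensional Hopf algebra. -/
def antipodeInv : A →ₗ[k] A :=
  (LinearEquiv.ofInjectiveEndo (antipode k (A := A)) antipode_injective).symm.toLinearMap

theorem antipode_antipodeInv (a : A) : antipode k (antipodeInv k A a) = a :=
  (LinearEquiv.ofInjectiveEndo (antipode k (A := A)) antipode_injective).apply_symm_apply a

theorem antipodeInv_mul (a b : A) :
    antipodeInv k A (a * b) = antipodeInv k A b * antipodeInv k A a :=
  antipode_injective (k := k) (by
    rw [antipode_mul_antidistrib, antipode_antipodeInv, antipode_antipodeInv, antipode_antipodeInv])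

/-- `S⁻¹(a₂) a₁ = ε(a)`. -/
theorem antipodeInv_mul_comm_comul (a : A) : mul' k A ((antipodeInv k A).rTensor A
    (TensorProduct.comm k A A (comul (R := k) a))) = algebraMap k A (counit (R := k) a) := by
  apply antipode_injective (k := k)
  have h := mul_antipode_rTensor_comul_apply (R := k) a
  rw [Algebra.algebraMap_eq_smul_one, map_smul, antipode_one, ← Algebra.algebraMap_eq_smul_one, ← h]
  generalize comul (R := k) a = w
  induction w with
  | zero => simp
  | add c d hc hd => simp only [map_add, hc, hd]
  | tmul c d => simp [antipode_mul_antidistrib, antipode_antipodeInv]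

/-- `a₂ S⁻¹(a₁) = ε(a)`. -/
theorem mul_antipodeInv_comm_comul (a : A) : mul' k A ((antipodeInv k A).lTensor A
    (TensorProduct.comm k A A (comul (R := k) a))) = algebraMap k A (counit (R := k) a) := by
  apply antipode_injective (k := k)
  have h := mul_antipode_lTensor_comul_apply (R := k) a
  rw [Algebra.algebraMap_eq_smul_one, map_smul, antipode_one, ← Algebra.algebraMap_eq_smul_one, ← h]
  generalize comul (R := k) a = w
  induction w with
  | zero => simp
  | add c d hc hd => simp only [map_add, hc, hd]
  | tmul c d => simp [antipode_mul_antidistrib, antipode_antipodeInv]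

end HopfAlgebra
end InverseAntipode

/-! ### From half-braidings to Yetter-Drinfeld coactions. -/

section Coactions

variable {k : Type u} [Field k] {A : Type u} [Ring A] [HopfAlgebra k A] [Module.Finite k A]

namespace FDMod

variable {E : FDMod k A}

/-- The conditions on morphisms `E ⊗ X → X ⊗ E` to be natural and compatible with tensor products
and with the unit. -/
structure IsHalfBraiding (E : FDMod k A) (β : ∀ X : FDMod k A, tens E X ⟶ tens X E) : Prop where
  natural : ∀ {X Y : FDMod k A} (f : X ⟶ Y),
    tensHom (𝟙 E) f ≫ β Y = β X ≫ tensHom f (𝟙 E)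
  tens : ∀ X Y : FDMod k A, β (tens X Y) = (tensAssoc E X Y).inv ≫ tensHom (β X) (𝟙 Y) ≫
    (tensAssoc X E Y).hom ≫ tensHom (𝟙 X) (β Y) ≫ (tensAssoc X Y E).inv
  unit : β unit ≫ (tensUnit E).hom = (tensRightUnit E).hom

/-- The coaction `e ↦ β(e ⊗ 1)`. -/
def coactOf (β : ∀ X : FDMod k A, tens E X ⟶ tens X E) : E →ₗ[k] A ⊗[k] E :=
  lin (N := tens (reg k A) E) (β (reg k A)) ∘ₗ (pure E (reg k A)).flip (regMk 1)

/-- The map `a ⊗ e ↦ a x ⊗ e`. -/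
def actAt (E X : FDMod k A) (x : X) : A ⊗[k] E →ₗ[k] tens X E :=
  (X.act.toLinearMap.flip x).rTensor E

theorem actAt_tmul (X : FDMod k A) (x : X) (a : A) (e : E) :
    actAt E X x (a ⊗ₜ e) = pure X E (X.act a x) e := rfl

theorem lin_orbit (X : FDMod k A) (x : X) (a : A) : lin (orbit X x) (regMk a) = X.act a x := rfl

namespace IsHalfBraiding

variable {β : ∀ X : FDMod k A, FDMod.tens E X ⟶ FDMod.tens X E} (h : IsHalfBraiding E β)
include h

/-- Naturality along `A → X`, `a ↦ a x`: a half-braiding is determined by its component at the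
regular module, at `e ⊗ 1`. -/
theorem apply_pure (X : FDMod k A) (e : E) (x : X) :
    lin (β X) (pure E X e x) = actAt E X x (coactOf β e) := by
  have h1 := congrArg (fun f => lin f (pure E (reg k A) e (regMk 1))) (h.natural (orbit X x))
  simp only [lin_comp_apply, lin_tensHom_pure, lin_id_apply, lin_orbit, map_one,
    Module.End.one_apply] at h1
  exact h1

/-- The tensor axiom for two copies of the regular module, at `1 ⊗ 1`, where `a` acts as `Δ(a)`. -/
theorem coassoc (e : E) : TensorProduct.assoc k A A E ((comul (R := k)).rTensor E (coactOf β e)) =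
    (coactOf β).lTensor A (coactOf β e) := by
  have h1 := congrArg (fun f => lin f (pure E (FDMod.tens (reg k A) (reg k A)) e
    (pure (reg k A) (reg k A) (regMk 1) (regMk 1)))) (h.tens (reg k A) (reg k A))
  simp only [lin_comp_apply, lin_tensAssoc_inv_pure, lin_tensHom_pure, lin_id_apply,
    h.apply_pure] at h1
  have h2 := congrArg (lin (tensAssoc (reg k A) (reg k A) E).hom) h1
  rw [← lin_comp_apply _ (tensAssoc (reg k A) (reg k A) E).hom, Iso.inv_hom_id, lin_id_apply] at h2
  have e1 : ∀ w : A ⊗[k] E, lin (tensAssoc (reg k A) (reg k A) E).hom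
      (actAt E (FDMod.tens (reg k A) (reg k A)) (pure (reg k A) (reg k A) (regMk 1) (regMk 1)) w) =
      TensorProduct.assoc k A A E ((comul (R := k)).rTensor E w) := by
    intro w
    induction w with
    | zero => simp only [map_zero]; rfl
    | add c d hc hd => simp only [map_add, hc, hd]; rfl
    | tmul a e =>
      have : (FDMod.tens (reg k A) (reg k A)).act a (pure (reg k A) (reg k A) (regMk 1) (regMk 1)) =
          (comul (R := k) a : A ⊗[k] A) := by
        obtain ⟨n, b, c, h⟩ := TensorProduct.exists_sum_fin (comul (R := k) a)
        rw [tens_act_pure _ _ h, h]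
        refine Finset.sum_congr rfl fun i _ => ?_
        change (b i * 1) ⊗ₜ[k] (c i * 1) = _
        rw [mul_one, mul_one]
      rw [actAt_tmul, this]
      rfl
  have e2 : ∀ w : A ⊗[k] E, lin (tensHom (𝟙 (reg k A)) (β (reg k A)))
      (lin (tensAssoc (reg k A) E (reg k A)).hom (pure (FDMod.tens (reg k A) E) (reg k A)
        (actAt E (reg k A) (regMk 1) w) (regMk 1))) = (coactOf β).lTensor A w := by
    intro w
    induction w with
    | zero => simp only [map_zero, LinearMap.zero_apply]; rfl
    | add c d hc hd => simp only [map_add, LinearMap.add_apply, hc, hd]; rfl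
    | tmul a e =>
      rw [actAt_tmul, lin_tensAssoc_hom_pure, lin_tensHom_pure]
      change (a * 1) ⊗ₜ[k] coactOf β e = _
      rw [mul_one]
      rfl
  exact (e1 _).symm.trans (h2.trans (e2 _))

theorem counit_coact (e : E) :
    (counit (R := k)).rTensor E (coactOf β e) = (1 : k) ⊗ₜ[k] e := by
  let r : (FDMod.unit : FDMod k A) := (1 : k)
  have h1 := congrArg (fun f => lin f (pure E FDMod.unit e r)) h.unit
  simp only [lin_comp_apply, h.apply_pure] at h1
  apply (TensorProduct.lid k E).injective
  have e1 : ∀ w : A ⊗[k] E, TensorProduct.lid k E ((counit (R := k)).rTensor E w) =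
      lin (tensUnit E).hom (actAt E FDMod.unit r w) := by
    intro w
    induction w with
    | zero => simp only [map_zero]
    | add c d hc hd => simp only [map_add, hc, hd]
    | tmul a e =>
      change counit (R := k) a • e = (counit (R := k) a * 1) • e
      rw [mul_one]
  rw [e1, h1]
  rfl

/-- Linearity of the half-braiding of the regular module at `e ⊗ 1`: `a₁ e₋₁ ⊗ a₂ e₀ = (a₁ e)₋₁ a₂ ⊗
(a₁ e)₀`. This is the Yetter-Drinfeld condition in a form without antipode. -/
theorem act_coact {a : A} {n : ℕ} {b c : Fin n → A} (ha : comul (R := k) a = ∑ i, b i ⊗ₜ[k] c i)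
    (e : E) : ∑ i, TensorProduct.map (LinearMap.mulLeft k (b i)) (E.act (c i)) (coactOf β e) =
      ∑ i, (LinearMap.mulRight k (c i)).rTensor E (coactOf β (E.act (b i) e)) := by
  have h1 := lin_act (β (reg k A)) a (pure E (reg k A) e (regMk 1))
  rw [tens_act_pure _ _ ha, map_sum, h.apply_pure] at h1
  have e1 : ∀ (x : A) (e : E), lin (β (reg k A)) (pure E (reg k A) e ((reg k A).act x (regMk 1))) =
      (LinearMap.mulRight k x).rTensor E (coactOf β e) := by
    intro x e
    rw [h.apply_pure]
    change (LinearMap.mulRight k (x * 1)).rTensor E _ = _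
    rw [mul_one]
  have e2 : ∀ w : A ⊗[k] E, (FDMod.tens (reg k A) E).act a (actAt E (reg k A) (regMk 1) w) =
      ∑ i, TensorProduct.map (LinearMap.mulLeft k (b i)) (E.act (c i)) w := by
    intro w
    induction w with
    | zero => simp only [map_zero, Finset.sum_const_zero]; rfl
    | add c d hc hd => simp only [map_add, hc, hd, Finset.sum_add_distrib]; rfl
    | tmul x e =>
      rw [actAt_tmul, tens_act_pure _ _ ha]
      refine Finset.sum_congr rfl fun i _ => ?_
      change (b i * (x * 1)) ⊗ₜ[k] E.act (c i) e = _
      rw [mul_one]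
      rfl
  rw [← e2, ← h1]
  exact Finset.sum_congr rfl fun i _ => e1 _ _

/-- Multiplying `a₁ e₋₁ ⊗ a₂ e₀ = (a₁ e)₋₁ a₂ ⊗ (a₁ e)₀` on the right of the first factor by `S(a₃)`
frees `(a e)₋₁` and gives the condition with `S`. -/
theorem isYetterDrinfeld : IsYetterDrinfeld E (coactOf β) where
  coassoc := h.coassoc
  counit_coact := h.counit_coact
  compat a n b c d habc e := by
    let Q : A →ₗ[k] Module.End k (A ⊗[k] E) := LinearMap.rTensorHom E ∘ₗ (LinearMap.mul k A).flip
    let S : A →ₗ[k] A := HopfAlgebra.antipode k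
    let G : A ⊗[k] A →ₗ[k] A ⊗[k] E :=
      (tensorAct (Algebra.lmul k A) E.act).toLinearMap.flip (coactOf β e)
    let G' : A ⊗[k] A →ₗ[k] A ⊗[k] E :=
      TensorProduct.lift (Q.flip ∘ₗ coactOf β ∘ₗ E.act.toLinearMap.flip e)
    let Ψ (F : A ⊗[k] A →ₗ[k] A ⊗[k] E) : (A ⊗[k] A) ⊗[k] A →ₗ[k] A ⊗[k] E :=
      TensorProduct.lift ((Q ∘ₗ S).flip ∘ₗ F)
    -- `G` and `G'` are the two sides of `act_coact`, and `Ψ` multiplies by the antipode of the last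
    -- leg on the right.
    have hG : G ∘ₗ comul = G' ∘ₗ comul := by
      ext a
      obtain ⟨n, b, c, ha⟩ := TensorProduct.exists_sum_fin (comul (R := k) a)
      have := h.act_coact ha e
      rw [LinearMap.comp_apply, LinearMap.comp_apply, ha, map_sum, map_sum]
      exact this
    have hΨ : ∀ w : A ⊗[k] A, Ψ G ((comul (R := k)).rTensor A w) =
        Ψ G' ((comul (R := k)).rTensor A w) := by
      intro w
      induction w with
      | zero => simp only [map_zero]
      | add c d hc hd => simp only [map_add, hc, hd]
      | tmul x y => exact congrArg (Q (S y)) (LinearMap.congr_fun hG x)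
    -- `Ξ(x ⊗ y ⊗ z) = (x e)₋₁ y S(z) ⊗ (x e)₀`, the same as `Ψ G'` up to the bracketing of `Δ²(a)`;
    -- its last two legs collapse.
    let Ξ : A ⊗[k] (A ⊗[k] A) →ₗ[k] A ⊗[k] E := TensorProduct.lift
      ((Q ∘ₗ LinearMap.mul' k A ∘ₗ S.lTensor A).flip ∘ₗ coactOf β ∘ₗ E.act.toLinearMap.flip e)
    have h1 : ∀ w : A ⊗[k] (A ⊗[k] A), Ψ G' ((TensorProduct.assoc k A A A).symm w) = Ξ w := by
      intro w
      induction w with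
      | zero => simp only [map_zero]
      | add c d hc hd => simp only [map_add, hc, hd]
      | tmul x w =>
        induction w with
        | zero => simp only [map_zero, tmul_zero]
        | add c d hc hd => simp only [map_add, tmul_add, hc, hd]
        | tmul y z =>
          change Q (S z) (Q y (coactOf β (E.act x e))) = Q (y * S z) (coactOf β (E.act x e))
          generalize coactOf β (E.act x e) = v
          induction v with
          | zero => simp only [map_zero]
          | add c d hc hd => simp only [map_add, hc, hd]
          | tmul p q => exact congrArg (· ⊗ₜ[k] q) (mul_assoc p y (S z))
    have h2 : ∀ w : A ⊗[k] A, Ξ ((comul (R := k)).lTensor A w) =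
        coactOf β (E.act (TensorProduct.rid k A ((counit (R := k)).lTensor A w)) e) := by
      intro w
      induction w with
      | zero => simp only [map_zero, LinearMap.zero_apply]
      | add c d hc hd => simp only [map_add, LinearMap.add_apply, hc, hd]
      | tmul x y =>
        change Q (LinearMap.mul' k A (S.lTensor A (comul (R := k) y))) (coactOf β (E.act x e)) = _
        rw [HopfAlgebra.mul_antipode_lTensor_comul_apply, LinearMap.lTensor_tmul,
          TensorProduct.rid_tmul, map_smul, LinearMap.smul_apply, map_smul,
          Algebra.algebraMap_eq_smul_one, map_smul, LinearMap.smul_apply]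
        congr 1
        generalize coactOf β (E.act x e) = v
        induction v with
        | zero => simp only [map_zero]
        | add c d hc hd => simp only [map_add, hc, hd]
        | tmul p q => exact congrArg (· ⊗ₜ[k] q) (mul_one p)
    have h3 := h2 (comul (R := k) a)
    rw [lTensor_counit_comul, TensorProduct.rid_tmul, one_smul, ← h1, coassoc_symm_apply,
      ← hΨ, ← coassoc_symm_apply, habc] at h3
    rw [← h3, map_sum, map_sum]
    refine Finset.sum_congr rfl fun i _ => ?_
    change Q (S (d i)) (tensorAct (Algebra.lmul k A) E.act (b i ⊗ₜ c i) (coactOf β e)) = _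
    generalize coactOf β e = v
    induction v with
    | zero => simp only [map_zero]
    | add c d hc hd => simp only [map_add, hc, hd]
    | tmul p q => rfl

end IsHalfBraiding
end FDMod
end Coactions

/-! ### Invertibility of half-braidings and of the module structure. -/

section HalfBraidingIso

variable {k : Type u} [Field k] {A : Type u} [Ring A] [HopfAlgebra k A] [Module.Finite k A]

namespace FDMod

theorem isIso_of_injective {X Y : FDMod k A} (f : X ⟶ Y) (h : Function.Injective (lin f))
    (hd : Module.finrank k X = Module.finrank k Y) : IsIso f := by
  let e : X ≃ₗ[k] Y := LinearEquiv.ofInjectiveOfFinrankEq (lin f) h hd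
  have he : (isoOfLin e fun a x => lin_act f a x).hom = f := hom_ext (LinearMap.ext fun x => rfl)
  rw [← he]
  infer_instance

namespace IsHalfBraiding

variable {E : FDMod k A} {β : ∀ X : FDMod k A, FDMod.tens E X ⟶ FDMod.tens X E}
  (h : IsHalfBraiding E β)
include h

/-- The map `x ⊗ e ↦ S⁻¹(e₋₁) x ⊗ e₀` undoes `β_X` up to the flip, by coassociativity and `S⁻¹(a₂)
a₁ = ε(a)`. Since `E ⊗ X` and `X ⊗ E` have the same dimension, one side suffices for invertibility.
-/
theorem injective (X : FDMod k A) : Function.Injective (lin (β X)) := by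
  let S' : A →ₗ[k] A := HopfAlgebra.antipodeInv k A
  let L : X →ₗ[k] A ⊗[k] E →ₗ[k] X ⊗[k] E :=
    LinearMap.rTensorHom E ∘ₗ (X.act.toLinearMap ∘ₗ S').flip
  let L' : FDMod.tens X E →ₗ[k] X ⊗[k] E := TensorProduct.lift (L.compl₂ (coactOf β))
  let Θ (x : X) : A ⊗[k] (A ⊗[k] E) →ₗ[k] X ⊗[k] E :=
    TensorProduct.lift (L ∘ₗ X.act.toLinearMap.flip x)
  let C : FDMod.tens E X ≃ₗ[k] X ⊗[k] E := TensorProduct.comm k E X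
  have h1 : ∀ x (w : A ⊗[k] E), L' (actAt E X x w) = Θ x ((coactOf β).lTensor A w) := by
    intro x w
    induction w with
    | zero => simp only [map_zero]
    | add c d hc hd => simp only [map_add, hc, hd]
    | tmul a e => rfl
  have h2 : ∀ x (w : A ⊗[k] E), Θ x (TensorProduct.assoc k A A E ((comul (R := k)).rTensor E w)) =
      x ⊗ₜ[k] TensorProduct.lid k E ((counit (R := k)).rTensor E w) := by
    intro x w
    induction w with
    | zero => simp only [map_zero, tmul_zero]
    | add c d hc hd => simp only [map_add, tmul_add, hc, hd]
    | tmul a e =>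
      have h3 := HopfAlgebra.antipodeInv_mul_comm_comul (k := k) a
      rw [LinearMap.rTensor_tmul, LinearMap.rTensor_tmul, TensorProduct.lid_tmul, ← smul_tmul]
      have h4 : counit (R := k) a • x = X.act (algebraMap k A (counit (R := k) a)) x := by
        rw [AlgHom.commutes]; rfl
      rw [h4, ← h3]
      generalize comul (R := k) a = w
      induction w with
      | zero => simp only [map_zero, zero_tmul, LinearMap.zero_apply]
      | add c d hc hd => simp only [map_add, add_tmul, LinearMap.add_apply, hc, hd]
      | tmul b c =>
        change (X.act (S' c) (X.act b x)) ⊗ₜ[k] e = (X.act (S' c * b) x) ⊗ₜ[k] e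
        rw [map_mul]
        rfl
  have h3 : ∀ z, L' (lin (β X) z) = C z := by
    intro z
    induction z using tens_induction with
    | zero => simp only [map_zero]
    | add a b ha hb => simp only [map_add, ha, hb]
    | pure e x =>
      rw [h.apply_pure, h1, ← h.coassoc, h2, h.counit_coact, TensorProduct.lid_tmul, one_smul]
      rfl
  intro z z' hz
  apply C.injective
  rw [← h3, ← h3, hz]

theorem isIso (X : FDMod k A) : IsIso (β X) :=
  isIso_of_injective _ (h.injective X) (TensorProduct.comm k E X).finrank_eq

/-- The object of the Drinfeld center defined by a half-braiding. -/
def halfBraiding : HalfBraiding E where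
  β X := @asIso _ _ _ _ (β X) (h.isIso X)
  monoidal X Y := h.tens X Y
  naturality f := h.natural f

end IsHalfBraiding
end FDMod

variable {K : Type u} [Ring K] [Algebra k K] [ComoduleAlgebra k A K]

namespace HopfBimodule

variable (P : HopfBimodule k A K)

/-- The counit axiom of the coaction of `P`; it becomes the unit axiom of `σ`. -/
theorem structHom_unit (M : FDMod k K) :
    P.structHom FDMod.unit M ≫ (FDMod.tensUnit (P.tensor M)).hom =
      P.mapHom (FDMod.tensUnit M).hom := by
  refine P.ext_tens fun p r m => ?_
  rw [FDMod.lin_comp_apply, lin_structHom_pure_pure, lin_mapHom_pure]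
  let r' : k := r
  change _ = P.pure M p (r' • m)
  have e1 : ∀ w : A ⊗[k] P, FDMod.lin (FDMod.tensUnit (P.tensor M)).hom
      (P.structAt FDMod.unit M r m w) =
      P.pure M (TensorProduct.lid k P ((counit (R := k)).rTensor P w)) (r' • m) := by
    intro w
    induction w with
    | zero => simp only [map_zero, LinearMap.zero_apply]
    | add c d hc hd => simp only [map_add, LinearMap.add_apply, hc, hd]
    | tmul a p =>
      change (counit (R := k) a * r') • P.pure M p m = P.pure M (counit (R := k) a • p) (r' • m)
      rw [map_smul, map_smul, LinearMap.smul_apply, smul_smul, mul_comm]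
  rw [e1, P.counit_coact, TensorProduct.lid_tmul, one_smul]

/-- The map `a ⊗ p ↦ p ⊗ (S⁻¹(a) x ⊗ m)`. -/
def structInvAt (X : FDMod k A) (M : FDMod k K) (x : X) (m : M) :
    A ⊗[k] P →ₗ[k] P.tensor (FDMod.tens X M) :=
  TensorProduct.lift ((P.pure (FDMod.tens X M)).flip ∘ₗ (FDMod.pure X M).flip m ∘ₗ
    (X.act.toLinearMap ∘ₗ HopfAlgebra.antipodeInv k A).flip x)

theorem structInvAt_tmul (X : FDMod k A) (M : FDMod k K) (x : X) (m : M) (a : A) (p : P) :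
    P.structInvAt X M x m (a ⊗ₜ p) = P.pure (FDMod.tens X M) p
      (FDMod.pure X M (X.act (HopfAlgebra.antipodeInv k A a) x) m) := rfl

/-- The map `structInvAt` as a bilinear map. -/
def structInvMap (X : FDMod k A) (M : FDMod k K) :
    X →ₗ[k] M →ₗ[k] A ⊗[k] P →ₗ[k] P.tensor (FDMod.tens X M) :=
  LinearMap.mk₂ k (P.structInvAt X M)
    (fun x y m => TensorProduct.ext' fun a p => by
      simp only [LinearMap.add_apply, structInvAt_tmul, map_add])
    (fun r x m => TensorProduct.ext' fun a p => by
      simp only [LinearMap.smul_apply, structInvAt_tmul, map_smul])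
    (fun x m n => TensorProduct.ext' fun a p => by
      simp only [LinearMap.add_apply, structInvAt_tmul, map_add])
    (fun r x m => TensorProduct.ext' fun a p => by
      simp only [LinearMap.smul_apply, structInvAt_tmul, map_smul])

/-- This makes the inverse well defined on `P ⊗_K M`. Replacing `p` by `p y` contributes `S⁻¹(y₋₁)`
on `x` and `y₀` on `p₀`; moved across the tensor product over `K`, the latter acts on `x` and `m` by
its own coaction, and `a₂ S⁻¹(a₁) = ε(a)` cancels the factors on `x`. -/
theorem structInvAt_coact_right (X : FDMod k A) (M : FDMod k K) (y : K) (p : P) (x : X) (m : M) :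
    P.structInvAt X M x m (P.coact (P.right (MulOpposite.op y) p)) =
      P.structInvAt X M x (M.act y m) (P.coact p) := by
  let S' : A →ₗ[k] A := HopfAlgebra.antipodeInv k A
  let Θ (x : X) : A ⊗[k] (A ⊗[k] K) →ₗ[k] FDMod.tens X M :=
    TensorProduct.lift ((tensorAct X.act M.act).toLinearMap.flip ∘ₗ
      (TensorProduct.mk k X M).flip m ∘ₗ (X.act.toLinearMap ∘ₗ S').flip x)
  have h1 : ∀ (x : X) (v : A ⊗[k] K),
      Θ x (TensorProduct.assoc k A A K ((comul (R := k)).rTensor K v)) =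
        FDMod.pure X M x (M.act (TensorProduct.lid k K ((counit (R := k)).rTensor K v)) m) := by
    intro x v
    induction v with
    | zero => simp only [map_zero, LinearMap.zero_apply]
    | add c d hc hd => simp only [map_add, LinearMap.add_apply, hc, hd]
    | tmul a z =>
      have h3 := HopfAlgebra.mul_antipodeInv_comm_comul (k := k) a
      rw [LinearMap.rTensor_tmul, LinearMap.rTensor_tmul, TensorProduct.lid_tmul, map_smul,
        LinearMap.smul_apply, map_smul, ← LinearMap.smul_apply, ← map_smul]
      have h4 : counit (R := k) a • x = X.act (algebraMap k A (counit (R := k) a)) x := by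
        rw [AlgHom.commutes]; rfl
      rw [h4, ← h3]
      generalize comul (R := k) a = w
      induction w with
      | zero => simp only [map_zero, zero_tmul, LinearMap.zero_apply]
      | add c d hc hd => simp only [map_add, add_tmul, LinearMap.add_apply, hc, hd]
      | tmul b c =>
        change (X.act c (X.act (S' b) x)) ⊗ₜ[k] M.act z m = (X.act (c * S' b) x) ⊗ₜ[k] M.act z m
        rw [map_mul]
        rfl
  have h2 : ∀ (v : A ⊗[k] K) (c : A) (q : P), P.structInvAt X M x m
      (tensorAct (Algebra.lsmul k k A : Aᵐᵒᵖ →ₐ[k] Module.End k A) P.right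
      (TensorProduct.map (MulOpposite.opLinearEquiv k).toLinearMap
        (MulOpposite.opLinearEquiv k).toLinearMap v) (c ⊗ₜ q)) =
      P.pure (FDMod.tens X M) q (Θ (X.act (S' c) x)
        ((ComoduleAlgebra.coact (A := A) (K := K)).toLinearMap.lTensor A v)) := by
    intro v c q
    induction v with
    | zero => simp only [map_zero, LinearMap.zero_apply]
    | add c d hc hd => simp only [map_add, LinearMap.add_apply, hc, hd]
    | tmul a z =>
      change P.pure (FDMod.tens X M) (P.right (MulOpposite.op z) q)
        (FDMod.pure X M (X.act (S' (c * a)) x) m) = P.pure (FDMod.tens X M) q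
          ((FDMod.tens X M).act z (FDMod.pure X M (X.act (S' a) (X.act (S' c) x)) m))
      rw [HopfAlgebra.antipodeInv_mul, map_mul, pure_right]
      rfl
  rw [P.coact_right]
  generalize P.coact p = w
  induction w with
  | zero => simp only [map_zero]
  | add c d hc hd => simp only [map_add, hc, hd]
  | tmul c q =>
    rw [h2, ← ComoduleAlgebra.coassoc, h1, ComoduleAlgebra.counit_coact, TensorProduct.lid_tmul,
      one_smul]
    rfl

/-- The map `x ⊗ (p ⊗ m) ↦ p₀ ⊗ (S⁻¹(p₋₁) x ⊗ m)`. -/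
def structInv (X : FDMod k A) (M : FDMod k K) :
    FDMod.tens X (P.tensor M) →ₗ[k] P.tensor (FDMod.tens X M) :=
  TensorProduct.lift
    { toFun := fun x => P.lift ((P.structInvMap X M x).flip ∘ₗ P.coact)
        fun y p m => P.structInvAt_coact_right X M y p x m
      map_add' := fun x y => P.lin_ext fun p m =>
        LinearMap.congr_fun (LinearMap.congr_fun (map_add (P.structInvMap X M) x y) m) (P.coact p)
      map_smul' := fun r x => P.lin_ext fun p m =>
        LinearMap.congr_fun (LinearMap.congr_fun (map_smul (P.structInvMap X M) r x) m)
          (P.coact p) }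

/-- The composite sends `p ⊗ x ⊗ m` to `p₀ ⊗ S⁻¹(p₋₁) p₋₂ x ⊗ m`, which collapses by coassociativity
and the counit. -/
theorem structInv_structHom (X : FDMod k A) (M : FDMod k K) :
    P.structInv X M ∘ₗ FDMod.lin (P.structHom X M) = LinearMap.id := by
  refine P.lin_ext fun p w => ?_
  induction w using FDMod.tens_induction with
  | zero => simp only [map_zero]
  | add a b ha hb => simp only [map_add, ha, hb]
  | pure x m =>
  let Θ : A ⊗[k] (A ⊗[k] P) →ₗ[k] P.tensor (FDMod.tens X M) :=
    TensorProduct.lift ((P.structInvMap X M).flip m ∘ₗ X.act.toLinearMap.flip x)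
  have h1 : ∀ w : A ⊗[k] P, P.structInv X M (P.structAt X M x m w) = Θ (P.coact.lTensor A w) := by
    intro w
    induction w with
    | zero => simp only [map_zero]
    | add c d hc hd => simp only [map_add, hc, hd]
    | tmul a q => rfl
  have h2 : ∀ w : A ⊗[k] P, Θ (TensorProduct.assoc k A A P ((comul (R := k)).rTensor P w)) =
      P.pure (FDMod.tens X M) (TensorProduct.lid k P ((counit (R := k)).rTensor P w))
        (FDMod.pure X M x m) := by
    intro w
    induction w with
    | zero => simp only [map_zero, LinearMap.zero_apply]
    | add c d hc hd => simp only [map_add, LinearMap.add_apply, hc, hd]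
    | tmul a q =>
      have h3 := HopfAlgebra.antipodeInv_mul_comm_comul (k := k) a
      rw [LinearMap.rTensor_tmul, LinearMap.rTensor_tmul, TensorProduct.lid_tmul, map_smul,
        LinearMap.smul_apply, ← map_smul, ← LinearMap.smul_apply, ← map_smul]
      have h4 : counit (R := k) a • x = X.act (algebraMap k A (counit (R := k) a)) x := by
        rw [AlgHom.commutes]; rfl
      rw [h4, ← h3]
      generalize comul (R := k) a = w
      induction w with
      | zero => simp only [map_zero, zero_tmul, LinearMap.zero_apply]
      | add c d hc hd => simp only [map_add, add_tmul, LinearMap.add_apply, hc, hd]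
      | tmul b c =>
        change P.pure (FDMod.tens X M) q (FDMod.pure X M
          (X.act (HopfAlgebra.antipodeInv k A c) (X.act b x)) m) = P.pure (FDMod.tens X M) q
            (FDMod.pure X M (X.act (HopfAlgebra.antipodeInv k A c * b) x) m)
        rw [map_mul]
        rfl
  rw [LinearMap.comp_apply, lin_structHom_pure_pure, h1, ← P.coassoc, h2, P.counit_coact,
    TensorProduct.lid_tmul, one_smul]
  rfl

/-- A left inverse that is merely linear is enough to cancel `c_X`, which is what the universal
property of `E ⊗ X` requires. -/
instance (X : FDMod k A) (M : FDMod k K) : Mono (P.structHom X M) where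
  right_cancellation f g h := FDMod.hom_ext (LinearMap.ext fun z => by
    have h1 := congrArg (fun f => P.structInv X M (FDMod.lin f z)) h
    simp only [FDMod.lin_comp_apply] at h1
    have h2 := fun w => LinearMap.congr_fun (P.structInv_structHom X M) w
    simp only [LinearMap.comp_apply, LinearMap.id_apply] at h2
    rwa [h2, h2] at h1)

end HopfBimodule
end HalfBraidingIso

/-! ### The object of the center carried by a relative end. -/

section CenterObject

variable {k : Type u} [Field k] {T : Type u} [Ring T] [HopfAlgebra k T] [Module.Finite k T]
  {R : RMatrix k T} {H : Type u} [Ring H] [Algebra k H] [Coalgebra k H] [Module.Finite k H]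
  [Module T H] [IsScalarTower k T H] {hH : BraidedHopf R H}
  {K : Type u} [Ring K] [Algebra k K] [ComoduleAlgebra k (Boson hH) K]

open FDMod

namespace HopfBimodule

open VFunctor

variable {P : HopfBimodule k (Boson hH) K} {X Y : FDMod k (Boson hH)}

theorem lin_smul_pure {M N : FDMod k K} (f : FDMod.tens X M ⟶ N) (r : k) (x : X) (m : M) :
    lin f (FDMod.pure X M (r • x) m) = r • lin f (FDMod.pure X M x m) :=
  (congrArg (lin f) (LinearMap.congr_fun (map_smul (FDMod.pure X M) r x) m)).trans
    (map_smul (lin f) r (FDMod.pure X M x m))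

theorem lin_pure_smul {M N : FDMod k K} (f : FDMod.tens X M ⟶ N) (r : k) (x : X) (m : M) :
    lin f (FDMod.pure X M x (r • m)) = r • lin f (FDMod.pure X M x m) :=
  (congrArg (lin f) (map_smul (FDMod.pure X M x) r m)).trans (map_smul (lin f) r _)

/-- Tested against the counit of `E`, the claim is `structHom_unit` combined with naturality of the
counit along `k ⊗ M → M`. -/
theorem sigma_unit (E : P.functor.RelEnd) :
    sigma E FDMod.unit ≫ (tensUnit E.obj).hom = (tensRightUnit E.obj).hom := by
  refine E.hom_ext fun M => ?_
  refine tens_ext fun w m => ?_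
  induction w using tens_induction with
  | zero => simp only [map_zero, LinearMap.zero_apply]
  | add a b ha hb => simp only [map_add, LinearMap.add_apply, ha, hb]
  | pure e r =>
  have h1 := congrArg (lin (tensUnit (P.tensor M)).hom)
    (sigma_spec_apply E FDMod.unit M (FDMod.pure E.obj FDMod.unit e r) m)
  rw [← lin_comp_apply, structHom_unit, lin_tensAssoc_hom_pure, ← lin_comp_apply, ev_natural,
    lin_comp_apply, lin_tensHom_pure] at h1
  have h2 : ∀ w, lin (tensUnit (P.tensor M)).hom (lin (tensHom (𝟙 FDMod.unit) (ev E M))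
      (lin (tensAssoc FDMod.unit E.obj M).hom (FDMod.pure (FDMod.tens FDMod.unit E.obj) M w m))) =
      lin (ev E M) (FDMod.pure E.obj M (lin (tensUnit E.obj).hom w) m) := by
    intro w
    induction w using tens_induction with
    | zero => simp only [map_zero, LinearMap.zero_apply]
    | add a b ha hb => simp only [map_add, LinearMap.add_apply, ha, hb]
    | pure r e =>
      let r' : k := r
      rw [lin_tensAssoc_hom_pure, lin_tensHom_pure]
      change r' • lin (ev E M) (FDMod.pure E.obj M e m) =
        lin (ev E M) (FDMod.pure E.obj M (r' • e) m)
      exact (LinearMap.congr_fun (congrArg (fun f => lin (ev E M) ∘ₗ f)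
        (map_smul (FDMod.pure E.obj M) r' e)) m).symm ▸ (map_smul _ r' _).symm
  rw [h2] at h1
  simp only [lin_comp_apply, lin_tensHom_pure, lin_id_apply]
  refine h1.symm.trans ?_
  let r' : k := r
  change lin (ev E M) (FDMod.pure E.obj M e (r' • m)) =
    lin (ev E M) (FDMod.pure E.obj M (r' • e) m)
  rw [lin_smul_pure, lin_pure_smul]

theorem isHalfBraiding_sigma (E : P.functor.RelEnd) : IsHalfBraiding E.obj (sigma E) where
  natural f := sigma_natural E f
  tens X Y := sigma_tens E X Y
  unit := sigma_unit E

/-- Composed with `c_X`, a transformation to `F ◁ X` becomes one to `X ▷ F` and factors through `X ⊗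
E`. Inverting `σ_X` brings the factorization back to `E ⊗ X`, and `c_X` is cancelled as a
monomorphism. -/
theorem rightAct_universal (E : P.functor.RelEnd) {γ : ∀ M, tens Y M ⟶ P.tensor (tens X M)}
    (h : (P.functor.rightAct X).IsModuleTrans Y γ) :
    ∃! g : Y ⟶ tens E.obj X, ∀ M, γ M = tensHom g (𝟙 M) ≫ rightTrans X (ev E) M := by
  have := (isHalfBraiding_sigma E).isIso X
  obtain ⟨g, hg, hg'⟩ := E.leftAct_universal (isModuleTrans_structHom h)
  refine ⟨g ≫ inv (sigma E X), fun M => ?_, fun f hf => ?_⟩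
  · rw [← cancel_mono (P.structHom X M), Category.assoc, sigma_spec, ← Category.assoc,
      ← tensHom_comp_id, Category.assoc, IsIso.inv_hom_id, Category.comp_id]
    exact hg M
  · rw [IsIso.eq_comp_inv]
    refine hg' _ fun M => ?_
    rw [tensHom_comp_id, Category.assoc]
    exact (congrArg (· ≫ P.structHom X M) (hf M)).trans
      ((Category.assoc _ _ _).trans (congrArg (tensHom f (𝟙 M) ≫ ·) (sigma_spec E X M)))

/-- The relative end `E ⊗ X` of `F ◁ X`, for `F = P ⊗_K -`. -/
def endRight (E : P.functor.RelEnd) (X : FDMod k (Boson hH)) : (P.functor.rightAct X).RelEnd :=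
  RelEnd.ofCounit (tens E.obj X) (rightTrans X (ev E)) (E.isModuleTrans.rightAct X)
    fun _ _ h => rightAct_universal E h

theorem ucoev_comp_uHomMap (X : FDMod k (Boson hH)) {M N : FDMod k K} (f : tens X M ⟶ N) :
    ucoev X M ≫ uHomMap (𝟙 M) f = psi f :=
  phi_injective (by rw [phi_comp_uHomMap_id, ucoev, phi_psi, phi_psi, Category.id_comp])

/-- The object of the center carried by a relative end. -/
def centerObj (E : P.functor.RelEnd) : P.CenterObj E where
  endRight := endRight E
  endLeft := E.leftAct
  right X := Iso.refl _
  left X := Iso.refl _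
  right_spec X M := (Category.id_comp _).trans (ucoev_comp_uHomMap _ _).symm
  left_spec X M := (Category.id_comp _).trans (ucoev_comp_uHomMap _ _).symm
  -- The relative ends of `F ◁ X` and `X ▷ F` are chosen as `E ⊗ X` and `X ⊗ E` themselves, so
  -- `right` and `left` are identities and `ρ̄(c_X)` is `σ_X`.
  constr X := sigma E X
  constr_spec X M := by
    have e1 : sigma E X ≫ psi (leftTrans X (ev E) M) =
        psi (rightTrans X (ev E) M) ≫ uHomMap (𝟙 M) (P.structHom X M) := by
      apply phi_injective
      rw [phi_comp_left, phi_comp_uHomMap_id, phi_psi, phi_psi, sigma_spec]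
    exact e1
  half := (isHalfBraiding_sigma E).halfBraiding
  half_spec X := ((Category.id_comp _).trans (Category.comp_id _)).symm

/-- Whatever relative ends and isomorphisms are chosen, the conditions on `right`, `left` and
`constr` make the half-braiding satisfy the equation that characterizes `σ_X`. Results about `σ`
therefore hold for every `Z`. -/
theorem CenterObj.half_eq_sigma {E : P.functor.RelEnd} (Z : P.CenterObj E)
    (X : FDMod k (Boson hH)) : (Z.half.β X).hom = sigma E X := by
  refine eq_sigma fun M => ?_
  have h1 : (Z.right X).inv ≫ (Z.endRight X).π M = psi (rightTrans X (ev E) M) :=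
    (Z.right_spec X M).trans (ucoev_comp_uHomMap _ _)
  have h2 : (Z.left X).inv ≫ (Z.endLeft X).π M = psi (leftTrans X (ev E) M) :=
    (Z.left_spec X M).trans (ucoev_comp_uHomMap _ _)
  have h3 : (Z.half.β X).hom ≫ (Z.left X).inv = (Z.right X).inv ≫ Z.constr X := by
    rw [Z.half_spec]; simp
  have h4 : (Z.half.β X).hom ≫ psi (leftTrans X (ev E) M) =
      psi (rightTrans X (ev E) M) ≫ uHomMap (𝟙 M) (P.structHom X M) :=
    (congrArg ((Z.half.β X).hom ≫ ·) h2.symm).trans ((Category.assoc _ _ _).symm.trans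
      ((congrArg (· ≫ (Z.endLeft X).π M) h3).trans ((Category.assoc _ _ _).trans
        ((congrArg ((Z.right X).inv ≫ ·) (Z.constr_spec X M)).trans
          ((Category.assoc _ _ _).symm.trans
            (congrArg (· ≫ uHomMap (𝟙 M) (P.structHom X M)) h1))))))
  have h5 := congrArg phi h4
  refine Eq.trans ?_ (h5.symm.trans ?_)
  · rw [phi_comp_uHomMap_id, phi_psi]
  · exact (phi_comp_left _ _).trans (congrArg (tensHom _ _ ≫ ·) (phi_psi _))

end HopfBimodule
end CenterObject

/-! ### The canonical isomorphism and the coaction on `S^T(H, K, P)`. -/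

section Canonical

variable {k : Type u} [Field k] {T : Type u} [Ring T] [HopfAlgebra k T] [Module.Finite k T]
  {R : RMatrix k T} {H : Type u} [Ring H] [Algebra k H] [Coalgebra k H] [Module.Finite k H]
  [Module T H] [IsScalarTower k T H] {hH : BraidedHopf R H}
  {K : Type u} [Ring K] [Algebra k K] [ComoduleAlgebra k (Boson hH) K]

open FDMod

namespace HopfBimodule

open VFunctor

variable {P : HopfBimodule k (Boson hH) K} {X Y : FDMod k (Boson hH)}

/-- A morphism compatible with the counits is compatible with `σ`, by uniqueness. Properties
computed on `S^T` thereby transfer to an arbitrary relative end. -/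
theorem sigma_comp {E E' : P.functor.RelEnd} (f : E.obj ⟶ E'.obj)
    (hf : ∀ M, tensHom f (𝟙 M) ≫ ev E' M = ev E M) (X : FDMod k (Boson hH)) :
    tensHom f (𝟙 X) ≫ sigma E' X = sigma E X ≫ tensHom (𝟙 X) f := by
  refine tens_hom_ext E' fun M => ?_
  rw [tensHom_comp_id, tensHom_comp_id, Category.assoc, Category.assoc, ← sigma_spec]
  have e : tensHom (tensHom (𝟙 X) f) (𝟙 M) ≫ leftTrans X (ev E') M = leftTrans X (ev E) M := by
    rw [leftTrans, leftTrans, ← Category.assoc, tensAssoc_hom_natural_middle, Category.assoc,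
      ← tensHom_id_comp, hf]
  rw [e, ← sigma_spec, rightTrans, rightTrans, ← Category.assoc, ← Category.assoc,
    tensAssoc_hom_natural_left, Category.assoc (tensAssoc _ _ _).hom, hf]

theorem coactOf_sigma_comp {E E' : P.functor.RelEnd} (f : E.obj ⟶ E'.obj)
    (hf : ∀ M, tensHom f (𝟙 M) ≫ ev E' M = ev E M) (e : E.obj) :
    coactOf (sigma E') (lin f e) = (lin f).lTensor (Boson hH) (coactOf (sigma E) e) :=
  congrArg (fun g => lin g (FDMod.pure E.obj (reg k (Boson hH)) e (regMk 1)))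
    (sigma_comp f hf (reg k (Boson hH)))

theorem CenterObj.coaction_eq {E : P.functor.RelEnd} (Z : P.CenterObj E) :
    Z.coaction = coactOf (sigma E) := by
  rw [CenterObj.coaction, Z.half_eq_sigma]
  rfl

variable [Module.Finite k K]

theorem ev_sRelEnd (M : FDMod k K) : ev P.sRelEnd M = P.sCounit M :=
  RelEnd.counit_ofCounit _ _ _ _ _

/-- The canonical morphism from `S^T(H, K, P)` to a relative end. -/
def canon (E : P.functor.RelEnd) : P.sT ⟶ E.obj :=
  (E.existsUnique_hom P.isModuleTrans_sCounit).choose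

theorem canon_spec (E : P.functor.RelEnd) (M : FDMod k K) :
    tensHom (canon E) (𝟙 M) ≫ ev E M = P.sCounit M :=
  ((E.existsUnique_hom P.isModuleTrans_sCounit).choose_spec.1 M).symm

theorem sLift_spec {γ : ∀ M, tens Y M ⟶ P.tensor M} (h : P.functor.IsModuleTrans Y γ)
    (M : FDMod k K) : tensHom (sLift h) (𝟙 M) ≫ P.sCounit M = γ M := by
  refine tens_ext fun y m => ?_
  rw [lin_comp_apply, lin_tensHom_pure, lin_sCounit_pure, lin_eq_pure_atOne h, sEval_sLift,
    map_one]
  rfl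

theorem isModuleTrans_ev (E : P.functor.RelEnd) : P.functor.IsModuleTrans E.obj (ev E) :=
  E.isModuleTrans

/-- The isomorphism between `S^T(H, K, P)` and a relative end. -/
def canonIso (E : P.functor.RelEnd) : P.sT ≅ E.obj where
  hom := canon E
  inv := sLift (isModuleTrans_ev E)
  hom_inv_id := (sT_universal P.isModuleTrans_sCounit).unique
    (fun M => by
      rw [tensHom_comp_id, Category.assoc, sLift_spec]
      exact (canon_spec E M).symm)
    (fun M => by rw [tensHom_id_id, Category.id_comp])
  inv_hom_id := E.hom_ext fun M => by
    rw [tensHom_comp_id, Category.assoc, tensHom_id_id, Category.id_comp]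
    exact (congrArg (tensHom (sLift (isModuleTrans_ev E)) (𝟙 M) ≫ ·) (canon_spec E M)).trans
      (sLift_spec (isModuleTrans_ev E) M)

theorem isCanonical_canon (E : P.functor.RelEnd) : P.IsCanonical (canon E) := by
  intro M α h m
  rw [uEval_eq_phi, phi_comp_left]
  refine (congrArg (fun f => lin f (FDMod.pure P.sT M (P.sT.act h α) m)) (canon_spec E M)).trans ?_
  rw [lin_sCounit_pure, sEval_act, one_mul]

variable (P) in
/-- The coaction on `S^T(H, K, P)`. -/
def sCoact : P.sT →ₗ[k] Boson hH ⊗[k] P.sT := coactOf (sigma P.sRelEnd)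

/-- The defining equation of `σ` for the regular `A`-module and `M = K`, at `α ⊗ 1 ⊗ 1`: evaluation
at `1 ⊗ 1` intertwines the coaction on `S^T` with that of `P`. -/
theorem sEval_one_coact (α : P.sT) :
    (P.sEval 1 1).lTensor (Boson hH) (P.sCoact α) = P.coact (P.sEval 1 1 α) := by
  have h1 := sigma_spec_apply P.sRelEnd (reg k (Boson hH)) (reg k K)
    (FDMod.pure P.sRelEnd.obj (reg k (Boson hH)) α (regMk 1)) (regMk 1)
  simp only [ev_sRelEnd] at h1
  let θ : tens (reg k (Boson hH)) (P.tensor (reg k K)) →ₗ[k] Boson hH ⊗[k] P :=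
    (lin P.rightUnit).lTensor (Boson hH)
  have h2 : ∀ w, θ (P.structAt (reg k (Boson hH)) (reg k K) (regMk 1) (regMk 1) w) = w := by
    intro w
    induction w with
    | zero => simp only [map_zero]
    | add c d hc hd => simp only [map_add, hc, hd]
    | tmul a p =>
      change (a * 1) ⊗ₜ[k] lin P.rightUnit (P.pure (reg k K) p (regMk 1)) = _
      rw [lin_rightUnit_pure_one, mul_one]
      rfl
  let θ' : tens (reg k (Boson hH)) P.sT →ₗ[k] Boson hH ⊗[k] P := (P.sEval 1 1).lTensor (Boson hH)
  have h3 : ∀ w, θ (lin (tensHom (𝟙 (reg k (Boson hH))) (P.sCounit (reg k K)))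
      (lin (tensAssoc (reg k (Boson hH)) P.sT (reg k K)).hom
        (FDMod.pure (tens (reg k (Boson hH)) P.sT) (reg k K) w (regMk 1)))) = θ' w := by
    intro w
    induction w using tens_induction with
    | zero => simp only [map_zero, LinearMap.zero_apply]
    | add c d hc hd => simp only [map_add, LinearMap.add_apply, hc, hd]
    | pure a β =>
      let a' : Boson hH := a
      change a' ⊗ₜ[k] lin P.rightUnit (P.pure (reg k K) (P.sEval 1 1 β) (regMk 1)) = _
      rw [lin_rightUnit_pure_one]
      rfl
  refine (h3 _).symm.trans ((congrArg θ h1).symm.trans ?_)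
  refine Eq.trans ?_ (h2 _)
  rfl

theorem sEval_eq (x : Boson hH) : P.sEval x 1 = P.sEval 1 1 ∘ₗ P.sT.act x :=
  LinearMap.ext fun α => by rw [LinearMap.comp_apply, sEval_act, one_mul]

/-- Evaluating `act_coact` at `1 ⊗ 1` gives `x₁ α₋₁ ⊗ α₀(x₂ ⊗ 1) = α(x₁ ⊗ 1)₋₁ x₂ ⊗ α(x₁ ⊗ 1)₀`.
Multiplication by `S` of one more leg of `x` on the left solves this for `α₋₁ ⊗ α₀(x ⊗ 1)`. -/
theorem sEval_coact (x : Boson hH) {n : ℕ} (a b c : Fin n → Boson hH)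
    (habc : (comul (R := k)).lTensor (Boson hH) (comul (R := k) x) =
      ∑ i, a i ⊗ₜ[k] (b i ⊗ₜ[k] c i)) (α : P.sT) :
    (P.sEval x 1).lTensor (Boson hH) (P.sCoact α) =
      ∑ i, (LinearMap.mulLeftRight k (HopfAlgebra.antipode k (a i), c i)).rTensor P
        (P.coact (P.sEval (b i) 1 α)) := by
  let L : Boson hH →ₗ[k] Module.End k (Boson hH ⊗[k] P) :=
    LinearMap.rTensorHom P ∘ₗ LinearMap.mul k (Boson hH)
  let Q : Boson hH →ₗ[k] Module.End k (Boson hH ⊗[k] P) :=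
    LinearMap.rTensorHom P ∘ₗ (LinearMap.mul k (Boson hH)).flip
  let S : Boson hH →ₗ[k] Boson hH := HopfAlgebra.antipode k
  let G : Boson hH ⊗[k] Boson hH →ₗ[k] Boson hH ⊗[k] P :=
    (P.sEval 1 1).lTensor (Boson hH) ∘ₗ
      (tensorAct (Algebra.lmul k (Boson hH)) P.sT.act).toLinearMap.flip (P.sCoact α)
  let G' : Boson hH ⊗[k] Boson hH →ₗ[k] Boson hH ⊗[k] P :=
    TensorProduct.lift (Q.flip ∘ₗ P.coact ∘ₗ P.sEval 1 1 ∘ₗ P.sT.act.toLinearMap.flip α)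
  let Ψ (F : Boson hH ⊗[k] Boson hH →ₗ[k] Boson hH ⊗[k] P) :
      Boson hH ⊗[k] (Boson hH ⊗[k] Boson hH) →ₗ[k] Boson hH ⊗[k] P :=
    TensorProduct.lift ((LinearMap.lcomp k (Boson hH ⊗[k] P) F) ∘ₗ L ∘ₗ S)
  -- `G` and `G'` are the two sides of `act_coact` for `α`, evaluated at `1 ⊗ 1`; on the second side
  -- `sEval_one_coact` replaces the coaction of `S^T` by that of `P`.
  have hG : G ∘ₗ comul = G' ∘ₗ comul := by
    ext a
    obtain ⟨n, b, c, ha⟩ := TensorProduct.exists_sum_fin (comul (R := k) a)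
    have h0 : ∑ i, TensorProduct.map (LinearMap.mulLeft k (b i)) (P.sT.act (c i)) (P.sCoact α) =
        ∑ i, (LinearMap.mulRight k (c i)).rTensor P.sT (P.sCoact (P.sT.act (b i) α)) :=
      (isHalfBraiding_sigma P.sRelEnd).act_coact ha α
    have h1 := congrArg ((P.sEval 1 1).lTensor (Boson hH)) h0
    change G (comul a) = G' (comul a)
    rw [ha, map_sum, map_sum]
    rw [map_sum, map_sum] at h1
    refine h1.trans (Finset.sum_congr rfl fun i _ => ?_)
    change _ = Q (c i) (P.coact (P.sEval 1 1 (P.sT.act (b i) α)))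
    rw [← sEval_one_coact]
    generalize P.sCoact (P.sT.act (b i) α) = w
    induction w with
    | zero => simp only [map_zero]
    | add c d hc hd => simp only [map_add, hc, hd]
    | tmul a p => rfl
  have hΨ : ∀ w : Boson hH ⊗[k] Boson hH, Ψ G ((comul (R := k)).lTensor (Boson hH) w) =
      Ψ G' ((comul (R := k)).lTensor (Boson hH) w) := by
    intro w
    induction w with
    | zero => simp only [map_zero]
    | add c d hc hd => simp only [map_add, hc, hd]
    | tmul x y => exact congrArg (L (S x)) (LinearMap.congr_fun hG y)
  -- With the first two legs bracketed together, `S(x₁) x₂` stands in front of `α₋₁` and collapses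
  -- to a counit.
  have hb : ∀ y (w : Boson hH ⊗[k] Boson hH),
      Ψ G (TensorProduct.assoc k _ _ _ (w ⊗ₜ y)) =
        L (LinearMap.mul' k _ (S.rTensor _ w)) ((P.sEval y 1).lTensor (Boson hH) (P.sCoact α)) := by
    intro y w
    induction w with
    | zero => simp only [map_zero, zero_tmul, LinearMap.zero_apply]
    | add c d hc hd => simp only [map_add, add_tmul, LinearMap.add_apply, hc, hd]
    | tmul b c =>
      change L (S b) ((P.sEval 1 1).lTensor (Boson hH)
        (tensorAct (Algebra.lmul k (Boson hH)) P.sT.act (c ⊗ₜ y) (P.sCoact α))) =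
          L (S b * c) ((P.sEval y 1).lTensor (Boson hH) (P.sCoact α))
      rw [sEval_eq y]
      generalize P.sCoact α = v
      induction v with
      | zero => simp only [map_zero]
      | add c d hc hd => simp only [map_add, hc, hd]
      | tmul p q => exact congrArg (· ⊗ₜ[k] _) (mul_assoc (S b) c p).symm
  have h2 : ∀ w : Boson hH ⊗[k] Boson hH,
      Ψ G (TensorProduct.assoc k _ _ _ ((comul (R := k)).rTensor (Boson hH) w)) =
        (P.sEval (TensorProduct.lid k _ ((counit (R := k)).rTensor (Boson hH) w)) 1).lTensor
          (Boson hH) (P.sCoact α) := by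
    intro w
    rw [sEval_eq]
    induction w with
    | zero => simp only [map_zero, LinearMap.comp_zero, LinearMap.lTensor_zero,
        LinearMap.zero_apply]
    | add c d hc hd => simp only [map_add, LinearMap.comp_add, LinearMap.lTensor_add,
        LinearMap.add_apply, hc, hd]
    | tmul x y =>
      rw [LinearMap.rTensor_tmul, hb, LinearMap.rTensor_tmul,
        HopfAlgebra.mul_antipode_rTensor_comul_apply,
        TensorProduct.lid_tmul, map_smul, LinearMap.comp_smul, LinearMap.lTensor_smul,
        LinearMap.smul_apply,
        Algebra.algebraMap_eq_smul_one, map_smul, LinearMap.smul_apply, ← sEval_eq]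
      congr 1
      generalize (P.sEval y 1).lTensor (Boson hH) (P.sCoact α) = v
      induction v with
      | zero => simp only [map_zero]
      | add c d hc hd => simp only [map_add, hc, hd]
      | tmul p q => exact congrArg (· ⊗ₜ[k] q) (one_mul p)
  have h3 := h2 (comul (R := k) x)
  rw [rTensor_counit_comul, TensorProduct.lid_tmul, one_smul, coassoc_apply, hΨ, habc] at h3
  rw [← h3, map_sum]
  refine Finset.sum_congr rfl fun i _ => ?_
  change L (S (a i)) (Q (c i) (P.coact (P.sEval 1 1 (P.sT.act (b i) α)))) = _
  rw [sEval_act, one_mul]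
  generalize P.coact (P.sEval (b i) 1 α) = v
  induction v with
  | zero => simp only [map_zero]
  | add c d hc hd => simp only [map_add, hc, hd]
  | tmul p q => exact congrArg (· ⊗ₜ[k] q) (mul_assoc _ p _).symm

theorem isCoaction_sCoact : P.IsCoaction P.sCoact := by
  intro x n a b c habc y α
  have h1 : P.sEval x y = P.right (MulOpposite.op y) ∘ₗ P.sEval x 1 :=
    LinearMap.ext fun α => P.sEval_right x y α
  rw [h1, LinearMap.lTensor_comp, LinearMap.comp_apply, sEval_coact x a b c habc, map_sum]
  refine Finset.sum_congr rfl fun i _ => ?_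
  generalize P.coact (P.sEval (b i) 1 α) = w
  induction w with
  | zero => simp only [map_zero]
  | add c d hc hd => simp only [map_add, hc, hd]
  | tmul a p => rfl

variable (P) in
-- The coaction on `S^T` is that of its own half-braiding as a relative end. The canonical
-- isomorphism carries it to the half-braiding of `E`, which is the same for every `Z` by
-- `CenterObj.half_eq_sigma`.
theorem exists_iso (E : P.functor.RelEnd) : ∃ f : P.sT ≅ E.obj, P.IsCanonical f.hom ∧
    ∃ δ : P.sT →ₗ[k] Boson hH ⊗[k] P.sT, P.IsCoaction δ ∧ IsYetterDrinfeld P.sT δ ∧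
      ∀ Z : P.CenterObj E, IsYetterDrinfeld E.obj Z.coaction ∧
        (∀ α : P.sT, Z.coaction (FDMod.lin f.hom α) =
          (FDMod.lin f.hom).lTensor (Boson hH) (δ α)) ∧
        ∀ (X : FDMod k (Boson hH)) (α : P.sT) (x : X),
          FDMod.lin (Z.half.β X).hom (FDMod.pure E.obj X (FDMod.lin f.hom α) x) =
            TensorProduct.map (X.act.toLinearMap.flip x) (FDMod.lin f.hom) (δ α) := by
  have hc : ∀ α : P.sT, coactOf (sigma E) (lin (canon E) α) =
      (lin (canon E)).lTensor (Boson hH) (P.sCoact α) :=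
    coactOf_sigma_comp (E := P.sRelEnd) (canon E) fun M => (canon_spec E M).trans (ev_sRelEnd M).symm
  refine ⟨canonIso E, isCanonical_canon E, P.sCoact, isCoaction_sCoact,
    (isHalfBraiding_sigma P.sRelEnd).isYetterDrinfeld, fun Z => ?_⟩
  rw [Z.coaction_eq]
  refine ⟨(isHalfBraiding_sigma E).isYetterDrinfeld, hc, fun X α x => ?_⟩
  rw [Z.half_eq_sigma]
  refine ((isHalfBraiding_sigma E).apply_pure X _ x).trans ?_
  refine (congrArg (actAt E.obj X x) (hc α)).trans ?_
  change _ = TensorProduct.map (X.act.toLinearMap.flip x) (lin (canon E)) (P.sCoact α)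
  generalize P.sCoact α = w
  induction w with
  | zero => simp only [map_zero]; rfl
  | add c d hc hd => simp only [map_add, hc, hd]; rfl
  | tmul a p => rfl

end HopfBimodule
end Canonical

/-! ### The functor `K ⊗_K -` and the identity. -/

section RegularUnit

variable {k : Type u} [Field k] {A : Type u} [Ring A] [Bialgebra k A]
  {K : Type u} [Ring K] [Algebra k K] [ComoduleAlgebra k A K] [Module.Finite k K]

open FDMod

namespace HopfBimodule

/-- An element of `K` as an element of the bimodule `K`. -/
def regElt : K →ₗ[k] regular k A K := LinearMap.id

theorem regElt_surjective : Function.Surjective (regElt (k := k) (A := A) (K := K)) :=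
  fun p => ⟨p, rfl⟩

theorem lin_regularUnit_pure (M : FDMod k K) (p : K) (m : M) :
    lin (regularUnit (A := A) M) ((regular k A K).pure M (regElt p) m) = M.act p m := rfl

theorem regular_pure (M : FDMod k K) (p : K) (m : M) :
    (regular k A K).pure M (regElt p) m = (regular k A K).pure M (regElt 1) (M.act p m) :=
  (congrArg (fun q : K => (regular k A K).pure M (regElt q) m) (one_mul p)).symm.trans
    ((regular k A K).pure_right M p (regElt 1) m)

/-- The isomorphism `M → K ⊗_K M`. -/
def regularInv (M : FDMod k K) : M ⟶ (regular k A K).tensor M :=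
  ofLin ((regular k A K).pure M (regElt 1)) fun x m => by
    rw [← regular_pure, act_pure]
    exact congrArg (fun q : K => (regular k A K).pure M (regElt q) m) (mul_one x).symm

theorem lin_regularInv (M : FDMod k K) (m : M) :
    lin (regularInv (A := A) M) m = (regular k A K).pure M (regElt 1) m := rfl

theorem regularInv_regularUnit (M : FDMod k K) :
    regularInv (A := A) M ≫ regularUnit M = 𝟙 M :=
  hom_ext (LinearMap.ext fun m => by
    rw [lin_comp_apply, lin_regularInv, lin_regularUnit_pure, map_one]
    rfl)

theorem regularUnit_regularInv (M : FDMod k K) :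
    regularUnit (A := A) M ≫ regularInv M = 𝟙 _ :=
  (regular k A K).ext fun p m => by
    obtain ⟨p, rfl⟩ := regElt_surjective p
    rw [lin_comp_apply, lin_regularUnit_pure, lin_regularInv, ← regular_pure]
    rfl

theorem regularInv_natural {M N : FDMod k K} (f : M ⟶ N) :
    regularInv (A := A) M ≫ (regular k A K).mapHom f = f ≫ regularInv N := rfl

theorem regularUnit_natural {M N : FDMod k K} (f : M ⟶ N) :
    (regular k A K).mapHom f ≫ regularUnit N = regularUnit (A := A) M ≫ f := by
  rw [← Category.comp_id (regularUnit M ≫ f), ← regularInv_regularUnit (A := A) N, Category.assoc,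
    ← Category.assoc f, ← regularInv_natural, ← Category.assoc, ← Category.assoc, 
    regularUnit_regularInv, Category.id_comp]

/-- Since `1` is coinvariant in `K`, the identification of `M` with `K ⊗_K M` carries the trivial
module structure of the identity functor to that of `K ⊗_K -`. -/
theorem regularInv_structHom (X : FDMod k A) (M : FDMod k K) :
    regularInv (tens X M) ≫ (regular k A K).structHom X M = tensHom (𝟙 X) (regularInv M) := by
  refine tens_ext fun x m => ?_
  rw [lin_comp_apply, lin_regularInv, lin_structHom_pure_pure, lin_tensHom_pure, lin_regularInv]
  refine (congrArg _ (map_one (ComoduleAlgebra.coact (k := k) (A := A) (K := K)))).trans ?_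
  refine (structAt_tmul (regular k A K) X M x m 1 (regElt 1)).trans ?_
  rw [map_one]
  rfl

end HopfBimodule
end RegularUnit

/-! ### The product for `P = K`. -/

section Product

variable {k : Type u} [Field k] {T : Type u} [Ring T] [HopfAlgebra k T] [Module.Finite k T]
  {R : RMatrix k T} {H : Type u} [Ring H] [Algebra k H] [Coalgebra k H] [Module.Finite k H]
  [Module T H] [IsScalarTower k T H] {hH : BraidedHopf R H}
  {K : Type u} [Ring K] [Algebra k K] [Module.Finite k K] [ComoduleAlgebra k (Boson hH) K]

open FDMod

namespace HopfBimodule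

open VFunctor

variable {X Y : FDMod k (Boson hH)} {γ : ∀ M : FDMod k K, tens Y M ⟶ M}

/-- A natural transformation `Y ⊗ - → id` of module functors over `Rep(T)`. -/
structure IsIdTrans (γ : ∀ M : FDMod k K, tens Y M ⟶ M) : Prop where
  natural : ∀ {M N : FDMod k K} (f : M ⟶ N), γ M ≫ f = tensHom (𝟙 Y) f ≫ γ N
  swap : ∀ (V : FDMod k T) (M : FDMod k K),
    γ (tens (infl hH V) M) = swap Y V M ≫ tensHom (𝟙 (infl hH V)) (γ M)

/-- The transformation to `K ⊗_K -` defined by a transformation to the identity. -/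
def regTrans (γ : ∀ M : FDMod k K, tens Y M ⟶ M) (M : FDMod k K) :
    tens Y M ⟶ (regular k (Boson hH) K).tensor M := γ M ≫ regularInv M

theorem IsIdTrans.isModuleTrans (h : IsIdTrans γ) :
    (regular k (Boson hH) K).functor.IsModuleTrans Y (regTrans γ) := by
  refine isModuleTrans_iff_swap.2 ⟨fun {M N} f => ?_, fun V M => ?_⟩
  · rw [regTrans, regTrans, Category.assoc, regularInv_natural, ← Category.assoc, h.natural,
      Category.assoc]
  · rw [regTrans, regTrans, Category.assoc, regularInv_structHom, h.swap, Category.assoc,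
      ← tensHom_id_comp]

variable {E E' : (regular k (Boson hH) K).functor.RelEnd}

/-- The morphism `E ⊗ M → M` of a relative end of the identity functor. -/
def idEv (E : (regular k (Boson hH) K).functor.RelEnd) (M : FDMod k K) : tens E.obj M ⟶ M :=
  ev E M ≫ regularUnit M

theorem idEv_regularInv (E : (regular k (Boson hH) K).functor.RelEnd) (M : FDMod k K) :
    idEv E M ≫ regularInv M = ev E M := by
  rw [idEv, Category.assoc, regularUnit_regularInv, Category.comp_id]

theorem isIdTrans_idEv (E : (regular k (Boson hH) K).functor.RelEnd) : IsIdTrans (idEv E) where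
  natural f := by
    rw [idEv, Category.assoc, ← regularUnit_natural, ← Category.assoc, ev_natural, Category.assoc,
      idEv]
  swap V M := by
    have h := (isModuleTrans_iff_swap.1 (isModuleTrans_ev E)).2 V M
    have h1 : regularInv (tens (infl hH V) M) ≫ (regular k (Boson hH) K).structHom (infl hH V) M ≫
        tensHom (𝟙 (infl hH V)) (regularUnit M) = 𝟙 _ := by
      rw [← Category.assoc, regularInv_structHom, ← tensHom_id_comp, regularInv_regularUnit,
        tensHom_id_id]
    have h2 := congrArg (· ≫ tensHom (𝟙 (infl hH V)) (regularUnit M)) h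
    simp only [Category.assoc] at h2
    rw [← tensHom_id_comp, ← idEv_regularInv, Category.assoc, h1, Category.comp_id] at h2
    exact h2

theorem idEv_hom_ext {g g' : Y ⟶ E.obj}
    (h : ∀ M, tensHom g (𝟙 M) ≫ idEv E M = tensHom g' (𝟙 M) ≫ idEv E M) : g = g' :=
  E.hom_ext fun M => by
    have h1 : tensHom g (𝟙 M) ≫ ev E M = tensHom g' (𝟙 M) ≫ ev E M := by
      rw [← idEv_regularInv, ← Category.assoc, h, Category.assoc]
    exact h1

/-- The morphism to a relative end defined by a transformation to the identity. -/
def idLift (E : (regular k (Boson hH) K).functor.RelEnd) (h : IsIdTrans γ) : Y ⟶ E.obj :=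
  (E.existsUnique_hom h.isModuleTrans).choose

theorem idLift_spec (E : (regular k (Boson hH) K).functor.RelEnd) (h : IsIdTrans γ)
    (M : FDMod k K) : tensHom (idLift E h) (𝟙 M) ≫ idEv E M = γ M := by
  have h1 : γ M ≫ regularInv M = tensHom (idLift E h) (𝟙 M) ≫ ev E M :=
    (E.existsUnique_hom h.isModuleTrans).choose_spec.1 M
  rw [idEv, ← Category.assoc, ← h1, Category.assoc, regularInv_regularUnit, Category.comp_id]

/-- The product of transformations to the identity. -/
def mulTrans {X Y : FDMod k (Boson hH)} (γ : ∀ M : FDMod k K, tens X M ⟶ M)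
    (γ' : ∀ M : FDMod k K, tens Y M ⟶ M) (M : FDMod k K) : tens (tens X Y) M ⟶ M :=
  (tensAssoc X Y M).hom ≫ tensHom (𝟙 X) (γ' M) ≫ γ M

/-- Composing two module transformations to the identity gives another one, with the hexagon for `X
⊗ Y`. The universal property turns this composition into the product of the relative end. -/
theorem IsIdTrans.mulTrans {γ : ∀ M : FDMod k K, tens X M ⟶ M}
    {γ' : ∀ M : FDMod k K, tens Y M ⟶ M} (h : IsIdTrans γ) (h' : IsIdTrans γ') :
    IsIdTrans (mulTrans γ γ') where
  natural f := by
    simp only [HopfBimodule.mulTrans, Category.assoc]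
    rw [h.natural, ← Category.assoc (tensHom _ _), ← tensHom_id_comp, h'.natural, tensHom_id_comp,
      ← Category.assoc (tensHom (𝟙 (tens X Y)) f), tensAssoc_hom_natural_right]
    simp only [Category.assoc]
  swap V M := by
    simp only [HopfBimodule.mulTrans]
    rw [tensHom_id_comp (infl hH V), ← Category.assoc (FDMod.swap _ _ _), swap_tens, h.swap, h'.swap,
      tensHom_id_comp X, tensHom_id_comp (infl hH V)]
    simp only [Category.assoc]
    rw [← Category.assoc (tensHom (𝟙 X) (tensHom _ _)), swap_natural_right]
    simp only [Category.assoc]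

/-- The unit isomorphisms `k ⊗ M → M`. -/
def unitTrans (M : FDMod k K) : tens (FDMod.unit : FDMod k (Boson hH)) M ⟶ M := (tensUnit M).hom

theorem isIdTrans_unitTrans : IsIdTrans (unitTrans (hH := hH) (K := K)) where
  natural f := (tensUnit_hom_natural f).symm
  swap V M := (swap_unit V M).symm

/-- The product of a relative end of the identity functor. -/
def endMul (E : (regular k (Boson hH) K).functor.RelEnd) : tens E.obj E.obj ⟶ E.obj :=
  idLift E ((isIdTrans_idEv E).mulTrans (isIdTrans_idEv E))

/-- The unit of a relative end of the identity functor. -/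
def endOne (E : (regular k (Boson hH) K).functor.RelEnd) : FDMod.unit ⟶ E.obj :=
  idLift E isIdTrans_unitTrans

theorem endMul_spec (E : (regular k (Boson hH) K).functor.RelEnd) (e e' : E.obj) (M : FDMod k K)
    (m : M) : lin (idEv E M) (FDMod.pure E.obj M (lin (endMul E) (FDMod.pure E.obj E.obj e e')) m) =
      lin (idEv E M) (FDMod.pure E.obj M e (lin (idEv E M) (FDMod.pure E.obj M e' m))) :=
  congrArg (fun f => lin f (FDMod.pure (tens E.obj E.obj) M (FDMod.pure E.obj E.obj e e') m))
    (idLift_spec E ((isIdTrans_idEv E).mulTrans (isIdTrans_idEv E)) M)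

theorem act_endMul (E : (regular k (Boson hH) K).functor.RelEnd) {x : Boson hH} {n : ℕ}
    {a b : Fin n → Boson hH} (hx : comul (R := k) x = ∑ i, a i ⊗ₜ[k] b i) (e e' : E.obj) :
    E.obj.act x (lin (endMul E) (FDMod.pure E.obj E.obj e e')) =
      ∑ i, lin (endMul E) (FDMod.pure E.obj E.obj (E.obj.act (a i) e) (E.obj.act (b i) e')) := by
  rw [← lin_act, tens_act_pure _ _ hx, map_sum]

theorem endOne_spec (E : (regular k (Boson hH) K).functor.RelEnd) (r : k) (M : FDMod k K)
    (m : M) : lin (idEv E M) (FDMod.pure E.obj M (lin (endOne E) r) m) = r • m :=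
  congrArg (fun f => lin f (FDMod.pure FDMod.unit M r m)) (idLift_spec E isIdTrans_unitTrans M)

/-- A relative end of the identity functor is an algebra. -/
def endMonObj (E : (regular k (Boson hH) K).functor.RelEnd) : MonObj E.obj where
  one := endOne E
  mul := endMul E
  -- The three axioms are equalities of morphisms into `E`. Tested against `idEv`, the product
  -- becomes composition of the families `E ⊗ M → M` and the unit becomes scalar multiplication, for
  -- which the axioms are immediate.
  one_mul := by
    change tensHom (endOne E) (𝟙 E.obj) ≫ endMul E = (tensUnit E.obj).hom
    refine idEv_hom_ext fun M => tens_ext_threefold fun r e m => ?_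
    let r' : k := r
    simp only [lin_comp_apply, lin_tensHom_pure, lin_id_apply, endMul_spec]
    refine (endOne_spec E r' M _).trans ?_
    exact (lin_smul_pure (idEv E M) r' e m).symm
  mul_one := by
    change tensHom (𝟙 E.obj) (endOne E) ≫ endMul E = (tensRightUnit E.obj).hom
    refine idEv_hom_ext fun M => tens_ext_threefold fun e r m => ?_
    let r' : k := r
    simp only [lin_comp_apply, lin_tensHom_pure, lin_id_apply, endMul_spec]
    refine (congrArg (fun n => lin (idEv E M) (FDMod.pure E.obj M e n))
      (endOne_spec E r' M m)).trans ?_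
    exact (lin_pure_smul (idEv E M) r' e m).trans (lin_smul_pure (idEv E M) r' e m).symm
  mul_assoc := by
    change tensHom (endMul E) (𝟙 E.obj) ≫ endMul E = (tensAssoc E.obj E.obj E.obj).hom ≫
      tensHom (𝟙 E.obj) (endMul E) ≫ endMul E
    refine idEv_hom_ext fun M => tens_ext fun w m => ?_
    induction w using tens_induction with
    | zero => simp only [map_zero, LinearMap.zero_apply]
    | add a b ha hb => simp only [map_add, LinearMap.add_apply, ha, hb]
    | pure w e'' =>
    induction w using tens_induction with
    | zero => simp only [map_zero, LinearMap.zero_apply]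
    | add a b ha hb => simp only [map_add, LinearMap.add_apply, ha, hb]
    | pure e e' =>
    simp only [lin_comp_apply, lin_tensHom_pure, lin_id_apply, lin_tensAssoc_hom_pure, endMul_spec]

/-- The product and the unit are determined by how elements act on all `M`, so a morphism that
preserves these actions preserves both. -/
theorem isMonHom_of_idEv (f : E.obj ⟶ E'.obj)
    (hf : ∀ M, tensHom f (𝟙 M) ≫ idEv E' M = idEv E M) :
    @IsMonHom _ _ _ _ _ (endMonObj E) (endMonObj E') f := by
  have hf' : ∀ M e m, lin (idEv E' M) (FDMod.pure E'.obj M (lin f e) m) =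
      lin (idEv E M) (FDMod.pure E.obj M e m) := fun M e m =>
    congrArg (fun g => lin g (FDMod.pure E.obj M e m)) (hf M)
  refine @IsMonHom.mk _ _ _ _ _ (endMonObj E) (endMonObj E') f ?_ ?_
  · change endOne E ≫ f = endOne E'
    refine idEv_hom_ext fun M => tens_ext fun r m => ?_
    let r' : k := r
    simp only [lin_comp_apply, lin_tensHom_pure, lin_id_apply, hf']
    exact (endOne_spec E r' M m).trans (endOne_spec E' r' M m).symm
  · change endMul E ≫ f = tensHom f f ≫ endMul E'
    refine idEv_hom_ext fun M => tens_ext_threefold fun e e' m => ?_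
    simp only [lin_comp_apply, lin_tensHom_pure, lin_id_apply, hf', endMul_spec]

theorem phi_endProj (E : (regular k (Boson hH) K).functor.RelEnd) (M : FDMod k K) :
    phi (endProj E M) = idEv E M := phi_comp_uHomMap_id _ _

/-- Under the adjunction, composition of internal Homs is iterated evaluation, which is the equation
that defines `endMul`. -/
theorem isEndMul_endMonObj (E : (regular k (Boson hH) K).functor.RelEnd) :
    IsEndMul (endMonObj E) where
  mul M := by
    change endMul E ≫ endProj E M = _
    apply phi_injective
    rw [phi_comp_left, phi_endProj, phi_comp_left, ucomp, phi_psi]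
    have h : ∀ e (m : M), lin (uev (A := Boson hH) M M)
        (FDMod.pure (uHom (A := Boson hH) M M) M (lin (endProj E M) e) m) =
          lin (idEv E M) (FDMod.pure E.obj M e m) := by
      intro e m
      rw [← phi_endProj]
      rfl
    refine tens_ext_threefold fun e e' m => ?_
    simp only [lin_comp_apply, lin_tensHom_pure, lin_id_apply, endMul_spec, lin_tensAssoc_hom_pure, h]
  one M := by
    change endOne E ≫ endProj E M = _
    apply phi_injective
    rw [phi_comp_left, phi_endProj, ucoev_comp_uHomMap, phi_psi]
    exact idLift_spec E isIdTrans_unitTrans M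

/-- The map `α ↦ α(1 ⊗ 1)`. -/
def sAtOne : (regular k (Boson hH) K).sRelEnd.obj →ₗ[k] K := (regular k (Boson hH) K).sEval 1 1

/-- `α(x ⊗ y) = (x α)(1 ⊗ 1) y`: the formula for the product of `S^T` need only be proved at `1 ⊗
1`, the rest being linearity of the product. -/
theorem sEval_eq_sAtOne (x : Boson hH) (y : K) (α : (regular k (Boson hH) K).sRelEnd.obj) :
    (regular k (Boson hH) K).sEval x y α =
      (sAtOne ((regular k (Boson hH) K).sRelEnd.obj.act x α) * y : K) := by
  refine ((regular k (Boson hH) K).sEval_right x y α).trans ?_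
  refine congrArg ((regular k (Boson hH) K).right (MulOpposite.op y)) ?_
  exact congrArg (fun z => (regular k (Boson hH) K).sEval z 1 α) (one_mul x).symm

theorem lin_idEv_sRelEnd (α : (regular k (Boson hH) K).sRelEnd.obj) (M : FDMod k K) (m : M) :
    lin (idEv (regular k (Boson hH) K).sRelEnd M) (FDMod.pure _ M α m) = M.act (sAtOne α) m := by
  rw [idEv, ev_sRelEnd]
  rfl

/-- An element `α` acts on the regular module `K` as left multiplication by `α(1 ⊗ 1)`, so
composition of actions multiplies these values. -/
theorem sAtOne_endMul (α β : (regular k (Boson hH) K).sRelEnd.obj) :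
    sAtOne (lin (endMul (regular k (Boson hH) K).sRelEnd) (FDMod.pure _ _ α β)) =
      sAtOne α * sAtOne β := by
  have h := endMul_spec (regular k (Boson hH) K).sRelEnd α β (reg k K) (regMk 1)
  rw [lin_idEv_sRelEnd, lin_idEv_sRelEnd, lin_idEv_sRelEnd] at h
  exact (mul_one _).symm.trans (h.trans (congrArg (sAtOne α * ·) (mul_one _)))

theorem sAtOne_endOne (r : k) :
    sAtOne (lin (endOne (regular k (Boson hH) K).sRelEnd) r) = r • (1 : K) := by
  have h := endOne_spec (regular k (Boson hH) K).sRelEnd r (reg k K) (regMk 1)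
  rw [lin_idEv_sRelEnd] at h
  exact (mul_one _).symm.trans h

/-- Linearity of the product gives `(x (α β))(1 ⊗ 1) = (x₁ α)(1 ⊗ 1) (x₂ β)(1 ⊗ 1)`, and
multiplication by `y` on the right turns this into `α(x₁ ⊗ β(x₂ ⊗ y))`. -/
theorem isSMul_endMonObj :
    IsSMul (hH := hH) (K := K) (endMonObj (regular k (Boson hH) K).sRelEnd) where
  mul x n a b hx y α β := by
    refine (sEval_eq_sAtOne x y _).trans ?_
    have h := act_endMul (regular k (Boson hH) K).sRelEnd hx α β
    refine (congrArg (fun z => sAtOne z * y) h).trans ?_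
    rw [map_sum, Finset.sum_mul]
    refine Finset.sum_congr rfl fun i _ => ?_
    rw [sAtOne_endMul, mul_assoc]
    refine Eq.trans ?_ (sEval_eq_sAtOne (a i) _ α).symm
    exact congrArg (sAtOne _ * ·) (sEval_eq_sAtOne (b i) y β).symm
  one x y r := by
    refine (sEval_eq_sAtOne x y _).trans ?_
    have h : (regular k (Boson hH) K).sRelEnd.obj.act x
        (lin (endOne (regular k (Boson hH) K).sRelEnd) r) =
          lin (endOne (regular k (Boson hH) K).sRelEnd) (counit (R := k) x * r : k) :=
      (lin_act (endOne (regular k (Boson hH) K).sRelEnd) x r).symm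
    refine (congrArg (fun z => sAtOne z * y) h).trans ?_
    rw [sAtOne_endOne, smul_mul_assoc, one_mul, mul_comm, mul_smul]

theorem exists_algebra_iso (E : (regular k (Boson hH) K).functor.RelEnd) :
    ∃ f : (regular k (Boson hH) K).sT ≅ E.obj, (regular k (Boson hH) K).IsCanonical f.hom ∧
      ∃ (mS : MonObj (regular k (Boson hH) K).sT) (mE : MonObj E.obj),
        IsSMul mS ∧ IsEndMul mE ∧ IsMonHom f.hom :=
  ⟨canonIso E, isCanonical_canon E, endMonObj (regular k (Boson hH) K).sRelEnd, endMonObj E,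
    isSMul_endMonObj, isEndMul_endMonObj E,
    isMonHom_of_idEv (E := (regular k (Boson hH) K).sRelEnd) (canon E) fun M => by
      rw [idEv, idEv, ev_sRelEnd]
      exact (Category.assoc _ _ _).symm.trans (congrArg (· ≫ regularUnit M) (canon_spec E M))⟩

end HopfBimodule
end Product

/-! ### The abelian category of finite-dimensional modules. -/

section AbelianCategory

variable {k : Type u} [Field k] {B : Type u} [Ring B] [Algebra k B]

namespace FDMod

theorem lin_lin_eq_zero {M N L : FDMod k B} {f : M ⟶ N} {g : N ⟶ L} (w : f ≫ g = 0) (m : M) :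
    lin g (lin f m) = 0 :=
  LinearMap.congr_fun (congrArg lin w) m

/-- The submodule given by an invariant subspace. -/
def sub (M : FDMod k B) (S : Submodule k M) (hS : ∀ (b : B), ∀ m ∈ S, M.act b m ∈ S) :
    FDMod k B where
  carrier := S
  act := AlgHom.ofLinearMap
    { toFun := fun b => (M.act b).restrict (hS b)
      map_add' := fun a b => LinearMap.ext fun m => Subtype.ext (by
        simp only [map_add, LinearMap.restrict_apply, LinearMap.add_apply]; rfl)
      map_smul' := fun a b => LinearMap.ext fun m => Subtype.ext (by
        simp only [map_smul, LinearMap.restrict_apply, LinearMap.smul_apply]; rfl) }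
    (LinearMap.ext fun m => Subtype.ext (by
      change M.act 1 (m : M) = m
      rw [map_one]; rfl))
    (fun a b => LinearMap.ext fun m => Subtype.ext (by
      change M.act (a * b) (m : M) = M.act a (M.act b m)
      rw [map_mul]; rfl))

/-- The inclusion of an invariant subspace. -/
def subHom (M : FDMod k B) (S : Submodule k M) (hS : ∀ (b : B), ∀ m ∈ S, M.act b m ∈ S) :
    sub M S hS ⟶ M :=
  ofLin S.subtype fun _ _ => rfl

/-- The quotient by an invariant subspace. -/
def quot (M : FDMod k B) (S : Submodule k M) (hS : ∀ (b : B), ∀ m ∈ S, M.act b m ∈ S) :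
    FDMod k B where
  carrier := M ⧸ S
  act := AlgHom.ofLinearMap
    { toFun := fun b => S.mapQ S (M.act b) (hS b)
      map_add' := fun a b => Submodule.linearMap_qext _ (LinearMap.ext fun m => by
        simp only [map_add, LinearMap.comp_apply, LinearMap.add_apply, Submodule.mkQ_apply,
          Submodule.mapQ_apply, Submodule.Quotient.mk_add])
      map_smul' := fun a b => Submodule.linearMap_qext _ (LinearMap.ext fun m => by
        simp only [map_smul, LinearMap.comp_apply, LinearMap.smul_apply, Submodule.mkQ_apply,
          Submodule.mapQ_apply, Submodule.Quotient.mk_smul, RingHom.id_apply]) }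
    (Submodule.linearMap_qext _ (LinearMap.ext fun m => by
      change S.mkQ (M.act 1 m) = S.mkQ m
      rw [map_one]; rfl))
    (fun a b => Submodule.linearMap_qext _ (LinearMap.ext fun m => by
      change S.mkQ (M.act (a * b) m) = S.mkQ (M.act a (M.act b m))
      rw [map_mul]; rfl))

/-- The projection to the quotient by an invariant subspace. -/
def quotHom (M : FDMod k B) (S : Submodule k M) (hS : ∀ (b : B), ∀ m ∈ S, M.act b m ∈ S) :
    M ⟶ quot M S hS :=
  ofLin S.mkQ fun _ _ => rfl

theorem act_mem_ker {M N : FDMod k B} (f : M ⟶ N) (b : B) (m : M)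
    (hm : m ∈ LinearMap.ker (lin f)) : M.act b m ∈ LinearMap.ker (lin f) := by
  rw [LinearMap.mem_ker] at hm ⊢
  rw [lin_act, hm, map_zero]

theorem act_mem_range {M N : FDMod k B} (f : M ⟶ N) (b : B) (n : N)
    (hn : n ∈ LinearMap.range (lin f)) : N.act b n ∈ LinearMap.range (lin f) := by
  obtain ⟨m, rfl⟩ := hn
  exact ⟨M.act b m, lin_act f b m⟩

/-- The kernel of a morphism. -/
abbrev kerHom {M N : FDMod k B} (f : M ⟶ N) :
    sub M (LinearMap.ker (lin f)) (act_mem_ker f) ⟶ M :=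
  subHom M _ (act_mem_ker f)

/-- The cokernel of a morphism. -/
abbrev cokerHom {M N : FDMod k B} (f : M ⟶ N) :
    N ⟶ quot N (LinearMap.range (lin f)) (act_mem_range f) :=
  quotHom N _ (act_mem_range f)

theorem kerHom_comp {M N : FDMod k B} (f : M ⟶ N) : kerHom f ≫ f = 0 :=
  hom_ext (LinearMap.ext fun m => m.2)

theorem comp_cokerHom {M N : FDMod k B} (f : M ⟶ N) : f ≫ cokerHom f = 0 :=
  hom_ext (LinearMap.ext fun m => (Submodule.Quotient.mk_eq_zero _).2 ⟨m, rfl⟩)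

theorem kerHom_injective {M N : FDMod k B} (f : M ⟶ N) : Function.Injective (lin (kerHom f)) :=
  Subtype.val_injective

theorem cokerHom_surjective {M N : FDMod k B} (f : M ⟶ N) :
    Function.Surjective (lin (cokerHom f)) :=
  Submodule.mkQ_surjective _

theorem kerHom_exact {M N : FDMod k B} (f : M ⟶ N) :
    Function.Exact (lin (kerHom f)) (lin f) :=
  fun m => ⟨fun h => ⟨⟨m, h⟩, rfl⟩, by rintro ⟨x, rfl⟩; exact x.2⟩

theorem exact_cokerHom {M N : FDMod k B} (f : M ⟶ N) :
    Function.Exact (lin f) (lin (cokerHom f)) :=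
  fun _ => Submodule.Quotient.mk_eq_zero _

/-- An injective morphism whose range is the kernel of `g` is a kernel of `g`. -/
def isLimitOfExact {X Y Z : FDMod k B} {f : X ⟶ Y} {g : Y ⟶ Z} (w : f ≫ g = 0)
    (hf : Function.Injective (lin f)) (hfg : Function.Exact (lin f) (lin g)) :
    Limits.IsLimit (Limits.KernelFork.ofι f w) :=
  -- Over a field the injection `f` has a linear retraction. It need not commute with the action,
  -- but its composite with a morphism `h` that `g` kills does, since `f` is injective and carries
  -- that composite back to `h`.
  have hr :=
    (LinearMap.exists_leftInverse_of_injective (lin f) (LinearMap.ker_eq_bot.2 hf)).choose_spec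
  have key : ∀ {W : FDMod k B} (h : W ⟶ Y) (_ : h ≫ g = 0) (x : W), lin f
      ((LinearMap.exists_leftInverse_of_injective (lin f) (LinearMap.ker_eq_bot.2 hf)).choose
        (lin h x)) = lin h x := fun h hw x => by
    obtain ⟨y, hy⟩ := (hfg (lin h x)).1 (lin_lin_eq_zero hw x)
    rw [← hy]
    exact congrArg (lin f) (LinearMap.congr_fun hr y)
  Limits.KernelFork.IsLimit.ofι f w
    (fun h hw => ofLin
      ((LinearMap.exists_leftInverse_of_injective (lin f) (LinearMap.ker_eq_bot.2 hf)).choose ∘ₗ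
        lin h) fun b x => hf (by
          rw [LinearMap.comp_apply, LinearMap.comp_apply, key h hw, lin_act, lin_act, key h hw]))
    (fun h hw => hom_ext (LinearMap.ext fun x => key h hw x))
    (fun h hw m hm => hom_ext (LinearMap.ext fun x => hf
      ((LinearMap.congr_fun (congrArg lin hm) x).trans (key h hw x).symm)))

/-- A surjective morphism whose kernel is the range of `f` is a cokernel of `f`. -/
def isColimitOfExact {X Y Z : FDMod k B} {f : X ⟶ Y} {g : Y ⟶ Z} (w : f ≫ g = 0)
    (hg : Function.Surjective (lin g)) (hfg : Function.Exact (lin f) (lin g)) :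
    Limits.IsColimit (Limits.CokernelCofork.ofπ g w) :=
  -- Dually, a linear section of `g` followed by a morphism `h` that kills `f` does not depend on
  -- the choice of preimages, hence commutes with the action.
  have hs :=
    (LinearMap.exists_rightInverse_of_surjective (lin g) (LinearMap.range_eq_top.2 hg)).choose_spec
  have key : ∀ {W : FDMod k B} (h : Y ⟶ W) (_ : f ≫ h = 0) (y : Y), lin h
      ((LinearMap.exists_rightInverse_of_surjective (lin g) (LinearMap.range_eq_top.2 hg)).choose
        (lin g y)) = lin h y := fun h hw y => by
    rw [← sub_eq_zero, ← map_sub]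
    obtain ⟨x, hx⟩ := (hfg _).1 ((map_sub (lin g) _ y).trans
      (sub_eq_zero.2 (LinearMap.congr_fun hs (lin g y))))
    rw [← hx, lin_lin_eq_zero hw]
  Limits.CokernelCofork.IsColimit.ofπ g w
    (fun h hw => ofLin (lin h ∘ₗ
      (LinearMap.exists_rightInverse_of_surjective (lin g) (LinearMap.range_eq_top.2 hg)).choose)
        fun b z => by
          obtain ⟨y, rfl⟩ := hg z
          rw [LinearMap.comp_apply, LinearMap.comp_apply, ← lin_act, key h hw, key h hw, lin_act])
    (fun h hw => hom_ext (LinearMap.ext fun y => key h hw y))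
    (fun h hw m hm => hom_ext (LinearMap.ext fun z => by
      obtain ⟨y, rfl⟩ := hg z
      exact (LinearMap.congr_fun (congrArg lin hm) y).trans (key h hw y).symm))

theorem injective_of_mono {M N : FDMod k B} (f : M ⟶ N) [Mono f] : Function.Injective (lin f) := by
  have h : kerHom f = 0 := Limits.zero_of_comp_mono f (kerHom_comp f)
  refine LinearMap.ker_eq_bot.1 ((Submodule.eq_bot_iff _).2 fun m hm => ?_)
  exact LinearMap.congr_fun (congrArg lin h) ⟨m, hm⟩

theorem surjective_of_epi {M N : FDMod k B} (f : M ⟶ N) [Epi f] :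
    Function.Surjective (lin f) := fun n =>
  (exact_cokerHom f n).1
    (LinearMap.congr_fun (congrArg lin (Limits.zero_of_epi_comp f (comp_cokerHom f))) n)

instance : Limits.HasKernels (FDMod k B) where
  has_limit f := ⟨⟨⟨_, isLimitOfExact (kerHom_comp f) (kerHom_injective f) (kerHom_exact f)⟩⟩⟩

instance : Limits.HasCokernels (FDMod k B) where
  has_colimit f :=
    ⟨⟨⟨_, isColimitOfExact (comp_cokerHom f) (cokerHom_surjective f) (exact_cokerHom f)⟩⟩⟩

instance : IsNormalMonoCategory (FDMod k B) where
  normalMonoOfMono f _ := ⟨⟨_, cokerHom f, comp_cokerHom f,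
    isLimitOfExact (comp_cokerHom f) (injective_of_mono f) (exact_cokerHom f)⟩⟩

instance : IsNormalEpiCategory (FDMod k B) where
  normalEpiOfEpi f _ := ⟨⟨_, kerHom f, kerHom_comp f,
    isColimitOfExact (kerHom_comp f) (surjective_of_epi f) (kerHom_exact f)⟩⟩

/-- The zero module. -/
def zeroObj (k B : Type u) [Field k] [Ring B] [Algebra k B] : FDMod k B where
  carrier := PUnit
  act := AlgHom.ofLinearMap 0 (LinearMap.ext fun _ => rfl) (fun _ _ => rfl)

instance : Limits.HasZeroObject (FDMod k B) :=
  ⟨zeroObj k B, (Limits.IsZero.iff_id_eq_zero _).2 (hom_ext (LinearMap.ext fun _ => rfl))⟩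

/-- The direct sum of two modules. -/
def prod (M N : FDMod k B) : FDMod k B where
  carrier := M × N
  act := AlgHom.ofLinearMap
    { toFun := fun b => (M.act b).prodMap (N.act b)
      map_add' := fun a b => by simp only [map_add]; rfl
      map_smul' := fun a b => by simp only [map_smul]; rfl }
    (LinearMap.ext fun m => by
      change (M.act 1 m.1, N.act 1 m.2) = m
      rw [map_one, map_one]; rfl)
    (fun a b => LinearMap.ext fun m => by
      change (M.act (a * b) m.1, N.act (a * b) m.2) = (M.act a (M.act b m.1), N.act a (N.act b m.2))
      rw [map_mul, map_mul]; rfl)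

instance : Limits.HasFiniteProducts (FDMod k B) :=
  have : ∀ M N : FDMod k B, Limits.HasLimit (Limits.pair M N) := fun M N =>
    ⟨⟨⟨Limits.BinaryFan.mk (P := prod M N) (ofLin (LinearMap.fst k M N) fun _ _ => rfl)
      (ofLin (LinearMap.snd k M N) fun _ _ => rfl),
      Limits.BinaryFan.isLimitMk
        (fun s => ofLin ((lin s.fst).prod (lin s.snd)) fun b x =>
          Prod.ext (lin_act s.fst b x) (lin_act s.snd b x))
        (fun _ => rfl) (fun _ => rfl)
        (fun s m h₁ h₂ => hom_ext (LinearMap.ext fun x =>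
          Prod.ext (LinearMap.congr_fun (congrArg lin h₁) x)
            (LinearMap.congr_fun (congrArg lin h₂) x)))⟩⟩⟩
  have := Limits.hasBinaryProducts_of_hasLimit_pair (FDMod k B)
  hasFiniteProducts_of_has_binary_and_terminal

/-- The category of finite-dimensional modules is abelian. -/
def abelian (k B : Type u) [Field k] [Ring B] [Algebra k B] : Abelian (FDMod k B) where

variable {B' : Type u} [Ring B'] [Algebra k B']

/-- An additive functor that preserves kernels preserves finite limits. Kernels can be tested on the
concrete kernel of a morphism, where exactness on underlying spaces decides. -/
theorem preservesFiniteLimits_of_exact (F : FDMod k B ⥤ FDMod k B') [F.Additive]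
    (hF : ∀ {X Y Z : FDMod k B} (f : X ⟶ Y) (g : Y ⟶ Z), Function.Injective (lin f) →
      Function.Exact (lin f) (lin g) →
      Function.Injective (lin (F.map f)) ∧ Function.Exact (lin (F.map f)) (lin (F.map g))) :
    Limits.PreservesFiniteLimits F := by
  have : Limits.HasBinaryBiproducts (FDMod k B) := Limits.HasBinaryBiproducts.of_hasBinaryProducts
  have : Limits.HasEqualizers (FDMod k B) := Preadditive.hasEqualizers_of_hasKernels
  have : ∀ {X Y : FDMod k B} (f : X ⟶ Y), Limits.PreservesLimit (Limits.parallelPair f 0) F :=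
    fun f => Limits.preservesLimit_of_preserves_limit_cone
      (isLimitOfExact (kerHom_comp f) (kerHom_injective f) (kerHom_exact f))
      ((Limits.KernelFork.isLimitMapConeEquiv _ F).symm
        (isLimitOfExact (f := F.map (kerHom f)) (g := F.map f)
          ((F.map_comp _ _).symm.trans (by rw [kerHom_comp, F.map_zero])) (hF _ f (kerHom_injective f) (kerHom_exact f)).1
          (hF _ f (kerHom_injective f) (kerHom_exact f)).2))
  exact Functor.preservesFiniteLimits_of_preservesKernels F

theorem preservesFiniteColimits_of_exact (F : FDMod k B ⥤ FDMod k B') [F.Additive]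
    (hF : ∀ {X Y Z : FDMod k B} (f : X ⟶ Y) (g : Y ⟶ Z), Function.Surjective (lin g) →
      Function.Exact (lin f) (lin g) →
      Function.Surjective (lin (F.map g)) ∧ Function.Exact (lin (F.map f)) (lin (F.map g))) :
    Limits.PreservesFiniteColimits F := by
  have : Limits.HasFiniteBiproducts (FDMod k B) := Limits.HasFiniteBiproducts.of_hasFiniteProducts
  have : Limits.HasBinaryBiproducts (FDMod k B) := Limits.HasBinaryBiproducts.of_hasBinaryProducts
  have : Limits.HasCoequalizers (FDMod k B) := Preadditive.hasCoequalizers_of_hasCokernels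
  have : ∀ {X Y : FDMod k B} (f : X ⟶ Y), Limits.PreservesColimit (Limits.parallelPair f 0) F :=
    fun f => Limits.preservesColimit_of_preserves_colimit_cocone
      (isColimitOfExact (comp_cokerHom f) (cokerHom_surjective f) (exact_cokerHom f))
      ((Limits.CokernelCofork.isColimitMapCoconeEquiv _ F).symm
        (isColimitOfExact (f := F.map f) (g := F.map (cokerHom f))
          ((F.map_comp _ _).symm.trans (by rw [comp_cokerHom, F.map_zero])) (hF f _ (cokerHom_surjective f) (exact_cokerHom f)).1
          (hF f _ (cokerHom_surjective f) (exact_cokerHom f)).2))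
  exact Functor.preservesFiniteColimits_of_preservesCokernels F

end FDMod

end AbelianCategory

/-! ### The action of `Rep(A)` and its exactness. -/

section ModuleCategory

variable {k : Type u} [Field k] {A : Type u} [Ring A] [Bialgebra k A]
  {K : Type u} [Ring K] [Algebra k K] [ComoduleAlgebra k A K]

namespace FDMod

/-- The action of `Rep(A)` on the category of `K`-modules. -/
def action (k A K : Type u) [Field k] [Ring A] [Bialgebra k A] [Ring K] [Algebra k K]
    [ComoduleAlgebra k A K] : MonoidalCategory.MonoidalLeftAction (FDMod k A) (FDMod k K) where
  __ := instActionStruct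
  actionHom_def _ _ := hom_ext (TensorProduct.ext' fun _ _ => rfl)
  actionHomRight_id _ _ := hom_ext (TensorProduct.ext' fun _ _ => rfl)
  id_actionHomLeft _ _ := hom_ext (TensorProduct.ext' fun _ _ => rfl)
  actionHom_comp _ _ _ _ := hom_ext (TensorProduct.ext' fun _ _ => rfl)
  actionAssocIso_hom_naturality _ _ _ := hom_ext (TensorProduct.ext_threefold fun _ _ _ => rfl)
  actionUnitIso_hom_naturality f := hom_ext (TensorProduct.ext' fun (r : k) x =>
    map_smul (lin f) r x)
  whiskerLeft_actionHomLeft _ _ _ _ _ := hom_ext (TensorProduct.ext_threefold fun _ _ _ => rfl)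
  whiskerRight_actionHomLeft _ _ _ := hom_ext (TensorProduct.ext_threefold fun _ _ _ => rfl)
  associator_actionHom _ _ _ _ := hom_ext (TensorProduct.ext_fourfold fun _ _ _ _ => rfl)
  leftUnitor_actionHom _ _ := hom_ext (TensorProduct.ext_threefold fun _ _ _ => rfl)
  rightUnitor_actionHom _ _ := hom_ext (TensorProduct.ext_threefold fun x (r : k) y =>
    TensorProduct.smul_tmul r x y)

variable (K) in
instance (X : FDMod k A) : (tensLeft K X).Additive where
  map_add := hom_ext (TensorProduct.map_add_right _ _ _)

variable (K) in
instance (X : FDMod k A) : (tensLeft K X).Linear k where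
  map_smul _ _ := hom_ext (TensorProduct.map_smul_right _ _ _)

variable (A) in
instance (M : FDMod k K) : (tensRight A M).Additive where
  map_add := hom_ext (TensorProduct.map_add_left _ _ _)

variable (A) in
instance (M : FDMod k K) : (tensRight A M).Linear k where
  map_smul _ _ := hom_ext (TensorProduct.map_smul_left _ _ _)

variable (K) in
-- Exactness is a matter of underlying spaces, where every module over a field is flat. The same
-- holds for the three statements that follow.
theorem preservesFiniteLimits_tensLeft (X : FDMod k A) :
    Limits.PreservesFiniteLimits (tensLeft K X) :=
  preservesFiniteLimits_of_exact _ fun f _ hf hfg =>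
    ⟨Module.Flat.lTensor_preserves_injective_linearMap (M := X) (lin f) hf,
      Module.Flat.lTensor_exact X hfg⟩

variable (K) in
theorem preservesFiniteColimits_tensLeft (X : FDMod k A) :
    Limits.PreservesFiniteColimits (tensLeft K X) :=
  preservesFiniteColimits_of_exact _ fun _ _ hg hfg =>
    ⟨LinearMap.lTensor_surjective X hg, Module.Flat.lTensor_exact X hfg⟩

variable (A) in
theorem preservesFiniteLimits_tensRight (M : FDMod k K) :
    Limits.PreservesFiniteLimits (tensRight A M) :=
  preservesFiniteLimits_of_exact _ fun f _ hf hfg =>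
    ⟨Module.Flat.rTensor_preserves_injective_linearMap (M := M) (lin f) hf,
      Module.Flat.rTensor_exact M hfg⟩

variable (A) in
theorem preservesFiniteColimits_tensRight (M : FDMod k K) :
    Limits.PreservesFiniteColimits (tensRight A M) :=
  preservesFiniteColimits_of_exact _ fun _ _ hg hfg =>
    ⟨LinearMap.rTensor_surjective M hg, Module.Flat.rTensor_exact M hfg⟩

end FDMod

end ModuleCategory

end

/-- Let `(T, R)` be a finite-dimensional quasitriangular Hopf algebra, `H` a finite-dimensional
braided Hopf algebra in `Rep(T)`, `K` a finite-dimensional left `H # T`-comodule algebra and `P` a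
finite-dimensional `K`-bimodule with a compatible coaction of `H # T`. -/
theorem mainTheorem6 {k : Type u} [Field k]
    {T : Type u} [Ring T] [HopfAlgebra k T] [Module.Finite k T] {R : RMatrix k T}
    {H : Type u} [Ring H] [Algebra k H] [Coalgebra k H] [Module.Finite k H]
    [Module T H] [IsScalarTower k T H] (hH : BraidedHopf R H)
    {K : Type u} [Ring K] [Algebra k K] [Module.Finite k K] [ComoduleAlgebra k (Boson hH) K]
    (P : HopfBimodule k (Boson hH) K) :
    -- the category of `K`-modules is a module category over `Rep(H # T)`
    ((∃ ab : Abelian (FDMod k K), ab.toPreadditive = FDMod.instPreadditive) ∧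
      (∃ act : MonoidalCategory.MonoidalLeftAction (FDMod k (Boson hH)) (FDMod k K),
        act.toMonoidalLeftActionStruct = FDMod.instActionStruct) ∧
      (∀ X : FDMod k (Boson hH), (FDMod.tensLeft K X).Additive ∧ (FDMod.tensLeft K X).Linear k ∧
        Limits.PreservesFiniteLimits (FDMod.tensLeft K X) ∧
        Limits.PreservesFiniteColimits (FDMod.tensLeft K X)) ∧
      ∀ M : FDMod k K, (FDMod.tensRight (Boson hH) M).Additive ∧
        (FDMod.tensRight (Boson hH) M).Linear k ∧
        Limits.PreservesFiniteLimits (FDMod.tensRight (Boson hH) M) ∧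
        Limits.PreservesFiniteColimits (FDMod.tensRight (Boson hH) M)) ∧
    -- the relative end exists, and so does the object `Z(ρ̄)(P)` of the center that it carries
    (Nonempty P.functor.RelEnd ∧ ∀ E : P.functor.RelEnd, Nonempty (P.CenterObj E)) ∧
    -- the isomorphism of `H # T`-modules, which is also one of Yetter-Drinfeld modules
    (∀ E : P.functor.RelEnd, ∃ f : P.sT ≅ E.obj, P.IsCanonical f.hom ∧
      ∃ δ : P.sT →ₗ[k] Boson hH ⊗[k] P.sT, P.IsCoaction δ ∧ IsYetterDrinfeld P.sT δ ∧
        ∀ Z : P.CenterObj E, IsYetterDrinfeld E.obj Z.coaction ∧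
          (∀ α : P.sT, Z.coaction (FDMod.lin f.hom α) =
            (FDMod.lin f.hom).lTensor (Boson hH) (δ α)) ∧
          ∀ (X : FDMod k (Boson hH)) (α : P.sT) (x : X),
            FDMod.lin (Z.half.β X).hom (FDMod.pure E.obj X (FDMod.lin f.hom α) x) =
              TensorProduct.map (X.act.toLinearMap.flip x) (FDMod.lin f.hom) (δ α)) ∧
    -- for `P = K` it is an isomorphism of algebras
    (∀ E : (HopfBimodule.regular k (Boson hH) K).functor.RelEnd,
      ∃ f : (HopfBimodule.regular k (Boson hH) K).sT ≅ E.obj,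
        (HopfBimodule.regular k (Boson hH) K).IsCanonical f.hom ∧
        ∃ (mS : MonObj (HopfBimodule.regular k (Boson hH) K).sT) (mE : MonObj E.obj),
          HopfBimodule.IsSMul mS ∧ HopfBimodule.IsEndMul mE ∧ IsMonHom f.hom) := by
  exact ⟨⟨⟨FDMod.abelian k K, rfl⟩, ⟨FDMod.action k (Boson hH) K, rfl⟩,
      fun X => ⟨inferInstance, inferInstance, FDMod.preservesFiniteLimits_tensLeft K X,
        FDMod.preservesFiniteColimits_tensLeft K X⟩,
      fun M => ⟨inferInstance, inferInstance, FDMod.preservesFiniteLimits_tensRight (Boson hH) M,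
        FDMod.preservesFiniteColimits_tensRight (Boson hH) M⟩⟩,
    ⟨⟨P.sRelEnd⟩, fun E => ⟨HopfBimodule.centerObj E⟩⟩,
    fun E => HopfBimodule.exists_iso P E, fun E => HopfBimodule.exists_algebra_iso E⟩
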